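/- **Arrangements.** Let $C$ be a convex curve in the plane that is either closed with a topmost point $c_0$, or unbounded in both directions and the graph of a convex function. Let $\mathcal L$ be a finite set of lines in general position: no line is vertical, no two are parallel, no three are concurrent, no line is tangent to $C$, no two lines meet $C$ in the same point, and, if $C$ is closed, no line passes through $c_0$. Assume that every line meets $C$, and that the intersection graph of the family $\mathcal L'$ of segments (or rays) $a\cap\operatorname{conv}(C)$, $a\in\mathcal L$, is connected. Endpoints of segments on $C$ are ordered from left to right if $C$ is unbounded, and counterclockwise starting from $c_0$ if $C$ is closed (we again say "from left to right"); $L_a$ and $R_a$ denote the first and the last endpoint of a segment $a$. The negative side of $a\in\mathcal L'$ is its lower side if $C$ is unbounded, and the side not facing $c_0$ if $C$ is closed. Walk along the boundaries of the cells of the arrangement inside $\operatorname{conv}(C)$ that touch $C$, cell after cell in the order in which they touch $C$, from the first to the last endpoint on $C$, going around each cell clockwise from the beginning to the end of its arc of $C$. The *lower inner-zone sequence* $S$ lists the segments whose pieces are visited on the negative side, in the order of the visits. **Hart–Sharir sequences.** In the following sequences some contiguous blocks are designated as special, and written in parentheses. If $A$ has $k$ special blocks of length $m$ and $B$ has $\ell$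 special blocks of length $k$, the shuffle $A\bullet B$ is obtained as follows: replace the $i$-th special block $(a_1\cdots a_k)$ of $B$, for each $i$, by a copy of $A$ with fresh symbols, in which, for each $j$, $a_j$ is appended to the $j$-th special block and the former last symbol of that block is repeated immediately after the block, and put another $a_k$ immediately after this copy. Set $S_1(m)=(1\,2\cdots m)\,(m-1)\cdots 2\,1\,2\cdots m$. For $k\ge2$, let $S_k(1)$ be $S_{k-1}(2)$ with each special block of length $2$ split into two of length $1$, and for $m\ge2$ let $S_k(m)=S_k(m-1)\bullet S_{k-1}(N)$, where $N$ is the number of special blocks of $S_k(m-1)$. A sequence contains another one as a subsequence if it does so up to an injective renaming of symbols. **The configuration $X$.** For endpoint sequences with special blocks of left endpoints, the endpoint shuffle $A\circ B$ is defined like $A\bullet B$ but without any repetition of symbols: the $i$-th special block $(L_1\cdots L_k)$ of $B$ is replaced by a fresh copy of $A$ in which $L_j$ is appended to the $j$-th special block. Let $$F_m=(L_1\cdots L_m)\,R_1\cdots R_m,$$ $$Z_m=L_aL_b\,(L_1\cdots L_m)\,R_1\cdots R_m\,L_cR_a\,(L_{m+1}\cdots L_{2m})\,R_{m+1}\cdots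 R_{2m}\,R_bR_c,$$ $$Y=L_dL_e\,()\,()\,L_fR_d\,()\,()\,R_eR_f\,(),$$ $$T_4=(((Z_1\circ Z_2)\circ Z_4)\circ Z_8)\circ F_{16},\qquad X=Y\circ T_4 .$$ A group of numeric segments of $X$ consists of the five segments whose left endpoints form one special block of $T_4$, in this order. Segments $a_1,\dots,a_m$ with endpoints in the order $L_{a_1}\cdots L_{a_m}R_{a_1}\cdots R_{a_m}$ *intersect concavely* if the points $a_m\cap a_{m-1},\dots,a_3\cap a_2,a_2\cap a_1$ appear in this order from left to right, that is, if for $1<j<m$ the point $a_{j+1}\cap a_j$ precedes $a_j\cap a_{j-1}$ on $a_j$ in the direction from $L_{a_j}$ to $R_{a_j}$. **Theorem.** There exists $m\ge1$ such that the following hold. 1. The Hart–Sharir sequence $S_7(m)$ forces a copy of $X$ with concave intersections: $S_7(m)$ contains no alternation $a\cdots b\cdots a\cdots b\cdots a$ with $a\ne b$, and for all $C$ and $\mathcal L$ as above, if the lower inner-zone sequence contains $S_7(m)$ as a subsequence, then $\mathcal L'$ contains a subfamily of segments whose endpoints appear along $C$ in the order given by $X$, in which the segments $a,b,c$ of each copy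 of each $Z_i$, the segments $d,e,f$ of each copy of $Y$, and the five segments of each group of numeric segments intersect concavely. 2. Consequently, if $C$ is the parabola $y=x^2$, then the lower inner-zone sequence of $C$ in an arrangement of lines $\mathcal L$ as above never contains $S_7(m)$ as a subsequence. The same holds, with the same $m$, if $C$ is any circle. -/

import Mathlib

/-! ## Sequences with special blocks -/

/-- Symbols. In a shuffle of `A` and `B`, `loc i a` is the symbol `a` of the `i`-th copy of `A`,
and `glob b` is the symbol `b` of `B`; in this way fresh symbols are always available. -/
inductive Symb : Type
  | atom (n : ℕ) : Symb
  | loc (i : ℕ) (a : Symb) : Symb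
  | glob (b : Symb) : Symb

/-- A sequence with special blocks is a list of pieces; a piece is either a special block
(a list of symbols) or a single entry outside all the special blocks. -/
inductive Piece (β : Type) : Type
  | block (l : List Symb) : Piece β
  | plain (b : β) : Piece β

/-- The list of the special blocks. -/
def specialBlocks {β : Type} : List (Piece β) → List (List Symb)
  | [] => []
  | Piece.block l :: A => l :: specialBlocks A
  | Piece.plain _ :: A => specialBlocks A

/-- Rename the symbols in the special blocks by `f` and the other entries by `g`. -/
def renamePieces {β : Type} (f : Symb → Symb) (g : β → β) : List (Piece β) → List (Piece β)
  | [] => []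
  | Piece.block l :: A => Piece.block (l.map f) :: renamePieces f g A
  | Piece.plain b :: A => Piece.plain (g b) :: renamePieces f g A

/-! ## The Hart--Sharir sequences -/

/-- The underlying sequence of symbols (the block structure is forgotten). -/
def word : List (Piece Symb) → List Symb
  | [] => []
  | Piece.block l :: A => l ++ word A
  | Piece.plain b :: A => b :: word A

/-- Insert the `j`-th symbol of the second list at the end of the `j`-th special block, and duplicate
the (former) last symbol of that block immediately after the block. -/
def insertGlobals : List (Piece Symb) → List Symb → List (Piece Symb)
  | [], _ => []
  | Piece.plain b :: A, gs => Piece.plain b :: insertGlobals A gs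
  | Piece.block l :: A, [] => Piece.block l :: insertGlobals A []
  | Piece.block l :: A, g :: gs =>
      Piece.block (l ++ [g]) :: (l.getLast?.toList.map Piece.plain ++ insertGlobals A gs)

/-- Replace the special blocks of the second sequence, numbered from `i` on, by enlarged copies of
`A`, each one followed by another copy of the last symbol of the replaced block. -/
def shuffleFrom (A : List (Piece Symb)) : ℕ → List (Piece Symb) → List (Piece Symb)
  | _, [] => []
  | i, Piece.plain b :: B => Piece.plain (Symb.glob b) :: shuffleFrom A i B
  | i, Piece.block l :: B =>
      insertGlobals (renamePieces (Symb.loc i) (Symb.loc i) A) (l.map Symb.glob)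
        ++ (l.map Symb.glob).getLast?.toList.map Piece.plain
        ++ shuffleFrom A (i + 1) B

/-- The shuffle `A • B`. -/
def shuffle (A B : List (Piece Symb)) : List (Piece Symb) := shuffleFrom A 0 B

/-- Split every special block into special blocks of length `1`. -/
def splitBlocks : List (Piece Symb) → List (Piece Symb)
  | [] => []
  | Piece.block l :: A => l.map (fun a => Piece.block [a]) ++ splitBlocks A
  | Piece.plain b :: A => Piece.plain b :: splitBlocks A

/-- `S_1(m) = (1 2 ⋯ m) (m-1) ⋯ 2 1 2 ⋯ m`. -/
def hartSharirOne (m : ℕ) : List (Piece Symb) :=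
  Piece.block ((List.range' 1 m).map Symb.atom) ::
    ((List.range' 1 (m - 1)).reverse ++ List.range' 2 (m - 1)).map
      (fun j => Piece.plain (Symb.atom j))

/-- The sequences `S_k(·)` for `k ≥ 2`, built from `prev = S_{k-1}(·)`. The value at `m = 0` is
irrelevant. -/
def hartSharirNext (prev : ℕ → List (Piece Symb)) : ℕ → List (Piece Symb)
  | 0 => []
  | 1 => splitBlocks (prev 2)
  | m + 2 =>
      shuffle (hartSharirNext prev (m + 1))
        (prev (specialBlocks (hartSharirNext prev (m + 1))).length)

/-- The Hart--Sharir sequence `S_k(m)`, for `k, m ≥ 1`, with its special blocks. -/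
def hartSharir : ℕ → ℕ → List (Piece Symb)
  | 0 => fun _ => []
  | 1 => hartSharirOne
  | k + 2 => hartSharirNext (hartSharir (k + 1))

/-- There is no alternation `a ⋯ b ⋯ a ⋯ b ⋯ a`. -/
def AbabaFree {α : Type} (u : List α) : Prop :=
  ∀ a b : α, a ≠ b → ¬ List.Sublist [a, b, a, b, a] u

/-- `S` contains, up to an injective renaming of symbols, the sequence `u` as a
(not necessarily contiguous) subsequence. -/
def ContainsPattern {α β : Type} (S : List α) (u : List β) : Prop :=
  ∃ f : β → α, Set.InjOn f {x | x ∈ u} ∧ List.Sublist (u.map f) S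

/-! ## Endpoint sequences and the configuration `X` -/

/-- The left and the right endpoint of the segment with a given name. -/
inductive Endpt : Type
  | left (a : Symb) : Endpt
  | right (a : Symb) : Endpt

/-- Rename the segment of an endpoint. -/
def Endpt.rename (f : Symb → Symb) : Endpt → Endpt
  | Endpt.left a => Endpt.left (f a)
  | Endpt.right a => Endpt.right (f a)

/-- A segment configuration: an endpoint sequence, in which a special block `l` stands for the left
endpoints of the segments listed in `l`, together with a list of tuples of segments that
are required to intersect concavely. -/
structure SegConfig where
  pieces : List (Piece Endpt)
  concave : List (List Symb)

/-- The underlying sequence of endpoints. -/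
def endpointWord : List (Piece Endpt) → List Endpt
  | [] => []
  | Piece.block l :: A => l.map Endpt.left ++ endpointWord A
  | Piece.plain e :: A => e :: endpointWord A

/-- Insert the `j`-th symbol of the second list at the end of the `j`-th special block. -/
def insertLefts : List (Piece Endpt) → List Symb → List (Piece Endpt)
  | [], _ => []
  | Piece.plain e :: A, gs => Piece.plain e :: insertLefts A gs
  | Piece.block l :: A, [] => Piece.block l :: insertLefts A []
  | Piece.block l :: A, g :: gs => Piece.block (l ++ [g]) :: insertLefts A gs

/-- Replace the special blocks of the second sequence, numbered from `i` on, by enlarged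
copies of `A`. -/
def endpointShuffleFrom (A : List (Piece Endpt)) : ℕ → List (Piece Endpt) → List (Piece Endpt)
  | _, [] => []
  | i, Piece.plain e :: B => Piece.plain (e.rename Symb.glob) :: endpointShuffleFrom A i B
  | i, Piece.block l :: B =>
      insertLefts (renamePieces (Symb.loc i) (Endpt.rename (Symb.loc i)) A) (l.map Symb.glob)
        ++ endpointShuffleFrom A (i + 1) B

/-- The endpoint shuffle `A ∘ B`; the concavity requirements of all the copies of `A` and
of `B` are kept. -/
def SegConfig.shuffle (A B : SegConfig) : SegConfig where
  pieces := endpointShuffleFrom A.pieces 0 B.pieces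
  concave :=
    (List.range (specialBlocks B.pieces).length).flatMap
        (fun i => A.concave.map (List.map (Symb.loc i)))
      ++ B.concave.map (List.map Symb.glob)

/-- `F_m = (L_1 ⋯ L_m) R_1 ⋯ R_m`. -/
def configF (m : ℕ) : SegConfig where
  pieces :=
    Piece.block ((List.range' 1 m).map Symb.atom) ::
      (List.range' 1 m).map (fun j => Piece.plain (Endpt.right (Symb.atom j)))
  concave := []

/-- `Z_m = L_a L_b (L_1 ⋯ L_m) R_1 ⋯ R_m L_c R_a (L_{m+1} ⋯ L_{2m}) R_{m+1} ⋯ R_{2m} R_b R_c`,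
where `a, b, c` must intersect concavely. Here `a, b, c` are the atoms `0, 1, 2` and the
numeric segment `j` is the atom `j + 2`. -/
def configZ (m : ℕ) : SegConfig where
  pieces :=
    [Piece.plain (Endpt.left (Symb.atom 0)), Piece.plain (Endpt.left (Symb.atom 1)),
      Piece.block ((List.range' 1 m).map (fun j => Symb.atom (j + 2)))]
    ++ (List.range' 1 m).map (fun j => Piece.plain (Endpt.right (Symb.atom (j + 2))))
    ++ [Piece.plain (Endpt.left (Symb.atom 2)), Piece.plain (Endpt.right (Symb.atom 0)),
      Piece.block ((List.range' (m + 1) m).map (fun j => Symb.atom (j + 2)))]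
    ++ (List.range' (m + 1) m).map (fun j => Piece.plain (Endpt.right (Symb.atom (j + 2))))
    ++ [Piece.plain (Endpt.right (Symb.atom 1)), Piece.plain (Endpt.right (Symb.atom 2))]
  concave := [[Symb.atom 0, Symb.atom 1, Symb.atom 2]]

/-- `Y = L_d L_e () () L_f R_d () () R_e R_f ()`, where `d, e, f` (the atoms `0, 1, 2`) must
intersect concavely. -/
def configY : SegConfig where
  pieces :=
    [Piece.plain (Endpt.left (Symb.atom 0)), Piece.plain (Endpt.left (Symb.atom 1)),
      Piece.block [], Piece.block [],
      Piece.plain (Endpt.left (Symb.atom 2)), Piece.plain (Endpt.right (Symb.atom 0)),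
      Piece.block [], Piece.block [],
      Piece.plain (Endpt.right (Symb.atom 1)), Piece.plain (Endpt.right (Symb.atom 2)),
      Piece.block []]
  concave := [[Symb.atom 0, Symb.atom 1, Symb.atom 2]]

/-- `T_4 = (((Z_1 ∘ Z_2) ∘ Z_4) ∘ Z_8) ∘ F_16`. -/
def configT4 : SegConfig :=
  ((((configZ 1).shuffle (configZ 2)).shuffle (configZ 4)).shuffle (configZ 8)).shuffle (configF 16)

/-- `X = Y ∘ T_4`, where the segments `a, b, c` of each whisker, the segments `d, e, f` of each copy
of `Y`, and the five numeric segments of each group (that is, of each special block of `T_4`) must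
intersect concavely. -/
def configX : SegConfig where
  pieces := (configY.shuffle configT4).pieces
  concave := (configY.shuffle configT4).concave
    ++ (specialBlocks configT4.pieces).map (List.map Symb.glob)

/-! ## Lines, convex curves and the lower inner-zone sequence -/

/-- The non-vertical line `y = slope * x + icept`. -/
structure PlaneLine where
  slope : ℝ
  icept : ℝ

/-- The signed vertical distance from the line to the point `p`. -/
def PlaneLine.height (a : PlaneLine) (p : ℝ × ℝ) : ℝ := p.2 - (a.slope * p.1 + a.icept)

/-- The point `p` lies on the line `a`. -/
def PlaneLine.Has (a : PlaneLine) (p : ℝ × ℝ) : Prop := a.height p = 0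

/-- The cross product of two planar vectors. -/
def planeCross (v w : ℝ × ℝ) : ℝ := v.1 * w.2 - v.2 * w.1

/-- `C` is a convex curve, either unbounded in both directions and the graph of a convex function
(then `c₀ = none`), or closed with topmost point `c` (then `c₀ = some c`). The map `γ` traverses `C`,
in the closed case without `c`, in counterclockwise direction; so in the closed case it
starts and ends at `c`, and in the unbounded case it goes from left to right. -/
structure IsConvexCurve (C : Set (ℝ × ℝ)) (c₀ : Option (ℝ × ℝ)) (γ : ℝ → ℝ × ℝ) : Prop where
  frontier_hull : frontier (convexHull ℝ C) = C
  interior_hull : (interior (convexHull ℝ C)).Nonempty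
  continuous_param : Continuous γ
  injective_param : Function.Injective γ
  counterclockwise : ∀ s t u : ℝ, s < t → t < u → 0 ≤ planeCross (γ t - γ s) (γ u - γ s)
  unbounded_case : c₀ = none →
    Set.range γ = C ∧ StrictMono (fun t => (γ t).1) ∧
      ∀ p ∈ convexHull ℝ C, ∀ y : ℝ, p.2 ≤ y → (p.1, y) ∈ convexHull ℝ C
  closed_case : ∀ c : ℝ × ℝ, c₀ = some c →
    Set.range γ = C \ {c} ∧ IsCompact C ∧ c ∈ C ∧ ∀ p ∈ C, p.2 ≤ c.2

section Arrangement

variable {ι : Type} (C : Set (ℝ × ℝ)) (c₀ : Option (ℝ × ℝ)) (γ : ℝ → ℝ × ℝ) (ℓ : ι → PlaneLine)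

/-- The part of a line inside the convex hull of `C`: a segment or a ray. -/
def chord (a : PlaneLine) : Set (ℝ × ℝ) := {p | p ∈ convexHull ℝ C ∧ a.Has p}

/-- The intersection graph of the segments cut out by the convex hull of `C`. -/
def intersectionGraph : SimpleGraph ι where
  Adj i j := i ≠ j ∧ (chord C (ℓ i) ∩ chord C (ℓ j)).Nonempty
  symm := ⟨fun _ _ h => ⟨h.1.symm, by rw [Set.inter_comm]; exact h.2⟩⟩
  loopless := ⟨fun _ h => h.1 rfl⟩

/-- The standing assumptions on the lines: general position (no vertical line being built into
`PlaneLine`), every line crosses `C`, and the intersection graph is connected. -/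
structure IsGeneralArrangement : Prop where
  not_parallel : ∀ i j, i ≠ j → (ℓ i).slope ≠ (ℓ j).slope
  not_concurrent : ∀ i j k, i ≠ j → j ≠ k → i ≠ k →
    ¬ ∃ p : ℝ × ℝ, (ℓ i).Has p ∧ (ℓ j).Has p ∧ (ℓ k).Has p
  meets_curve : ∀ i, ∃ p ∈ C, (ℓ i).Has p
  not_tangent : ∀ i, ∃ p ∈ interior (convexHull ℝ C), (ℓ i).Has p
  no_common_endpoint : ∀ i j, i ≠ j → ∀ p ∈ C, ¬ ((ℓ i).Has p ∧ (ℓ j).Has p)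
  avoids_top : ∀ c : ℝ × ℝ, c₀ = some c → ∀ i, ¬ (ℓ i).Has c
  connected : (intersectionGraph C ℓ).Preconnected

/-- A quantity that is positive on the positive side of the line `a`, and negative on its negative
side. The positive side is the upper one if `C` is unbounded, and the one facing the topmost point
`c` if `C` is closed. -/
def sideValue : Option (ℝ × ℝ) → PlaneLine → ℝ × ℝ → ℝ
  | none, a, p => a.height p
  | some c, a, p => a.height c * a.height p

/-- The parameters of the endpoints on `C`. -/
def endTimes : Set ℝ := {t | ∃ i, (ℓ i).Has (γ t)}

/-- The parameters of the open arc of `C` from the endpoint with parameter `s` to the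
next endpoint. -/
def arcAfter (s : ℝ) : Set ℝ := {u | s < u ∧ ∀ t ∈ endTimes γ ℓ, s < t → u < t}

/-- The (relatively open) edge, contained in the line `ℓ i`, of the cell of the inner zone that is
bounded by the arc of `C` following the endpoint with parameter `s`: its points lie on `ℓ i`, inside
`C`, and with respect to any other line they lie on the same side as the arc. It is empty if
the cell has no edge on `ℓ i`. -/
def cellEdge (s : ℝ) (i : ι) : Set (ℝ × ℝ) :=
  {p | p ∈ interior (convexHull ℝ C) ∧ (ℓ i).Has p ∧
    ∀ j, j ≠ i → ∀ u ∈ arcAfter γ ℓ s, 0 < (ℓ j).height p * (ℓ j).height (γ u)}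

/-- The tour of the inner zone, from the first to the last endpoint on `C`, visits a sub-segment of
`ℓ v.2` on its negative side while it walks around the cell of the arc following the
endpoint with parameter `v.1`. -/
def IsVisited (v : ℝ × ι) : Prop :=
  v.1 ∈ endTimes γ ℓ ∧ (∃ t ∈ endTimes γ ℓ, v.1 < t) ∧
    (∀ u ∈ arcAfter γ ℓ v.1, sideValue c₀ (ℓ v.2) (γ u) < 0) ∧ (cellEdge C γ ℓ v.1 v.2).Nonempty

/-- The order of the visits: the cells are visited in the order of their arcs along `C`, and the
boundary of each (convex) cell is traversed clockwise from the start to the end of its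
arc, that is, in clockwise order as seen from a point of the arc. -/
def VisitedBefore (v w : ℝ × ι) : Prop :=
  v.1 < w.1 ∨ (v.1 = w.1 ∧ ∀ u ∈ arcAfter γ ℓ v.1,
    ∀ p ∈ cellEdge C γ ℓ v.1 v.2, ∀ q ∈ cellEdge C γ ℓ w.1 w.2,
      planeCross (p - γ u) (q - γ u) < 0)

/-- `S` is the lower inner-zone sequence: the list of the lines of all the visited sub-segments on
negative sides, in the order of the visits. -/
def IsLowerInnerZoneSeq (S : List ι) : Prop :=
  ∃ V : List (ℝ × ι), V.Pairwise (VisitedBefore C γ ℓ) ∧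
    (∀ v, v ∈ V ↔ IsVisited C c₀ γ ℓ v) ∧ S = V.map Prod.snd

end Arrangement

/-! ## Forcing a configuration -/

/-- The line `a` meets the curve exactly at the parameters `l < r`, its left and its
right endpoint. -/
def HasEndTimes (γ : ℝ → ℝ × ℝ) (a : PlaneLine) (l r : ℝ) : Prop :=
  l < r ∧ ∀ t, a.Has (γ t) ↔ t = l ∨ t = r

/-- The segments `a_1, …, a_m` listed in `g` have endpoints in the order
`L_{a_1} ⋯ L_{a_m} R_{a_1} ⋯ R_{a_m}` and intersect concavely: the intersection points
`a_m ∩ a_{m-1}, …, a_2 ∩ a_1` appear in this order from left to right. Two successive ones lie on a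
common segment `b`, and "from left to right" means in the direction from `L_b` to `R_b`. -/
def IntersectConcavely (C : Set (ℝ × ℝ)) (γ : ℝ → ℝ × ℝ) (seg : Symb → PlaneLine) (l r : Symb → ℝ)
    (g : List Symb) : Prop :=
  (g.map l ++ g.map r).Pairwise (· < ·) ∧
    ∀ a b c : Symb, List.IsInfix [a, b, c] g →
      ∃ p ∈ chord C (seg c) ∩ chord C (seg b), ∃ q ∈ chord C (seg b) ∩ chord C (seg a),
        0 < (q.1 - p.1) * ((γ (r b)).1 - (γ (l b)).1)

/-- The parameter of an endpoint. -/
def Endpt.time (l r : Symb → ℝ) : Endpt → ℝ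
  | Endpt.left a => l a
  | Endpt.right a => r a

/-- The segments `seg a`, where `a` ranges over the symbols of `T`, have their endpoints on the curve
in the order prescribed by `T`, and the prescribed tuples intersect concavely. -/
def Realizes (C : Set (ℝ × ℝ)) (γ : ℝ → ℝ × ℝ) (seg : Symb → PlaneLine) (T : SegConfig) : Prop :=
  ∃ l r : Symb → ℝ,
    (∀ a : Symb, Endpt.left a ∈ endpointWord T.pieces → HasEndTimes γ (seg a) (l a) (r a)) ∧
    ((endpointWord T.pieces).map (Endpt.time l r)).Pairwise (· < ·) ∧
    ∀ g ∈ T.concave, IntersectConcavely C γ seg l r g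

/-- The `ababa`-free sequence `u` forces the segment configuration `T`: whenever the lower inner-zone
sequence of a convex curve in an arrangement of lines contains `u`, the family of segments
contains a copy of `T`. -/
def Forces (u : List Symb) (T : SegConfig) : Prop :=
  AbabaFree u ∧
    ∀ (C : Set (ℝ × ℝ)) (c₀ : Option (ℝ × ℝ)) (γ : ℝ → ℝ × ℝ), IsConvexCurve C c₀ γ →
      ∀ (n : ℕ) (ℓ : Fin n → PlaneLine), IsGeneralArrangement C c₀ ℓ →
        ∀ S : List (Fin n), IsLowerInnerZoneSeq C c₀ γ ℓ S → ContainsPattern S u →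
          ∃ φ : Symb → Fin n, Realizes C γ (fun a => ℓ (φ a)) T

/-- The lower inner-zone sequence of the convex curve `C` in an arrangement of lines never contains
`u` as a subsequence. -/
def NeverContains (C : Set (ℝ × ℝ)) (u : List Symb) : Prop :=
  ∀ (c₀ : Option (ℝ × ℝ)) (γ : ℝ → ℝ × ℝ), IsConvexCurve C c₀ γ →
    ∀ (n : ℕ) (ℓ : Fin n → PlaneLine), IsGeneralArrangement C c₀ ℓ →
      ∀ S : List (Fin n), IsLowerInnerZoneSeq C c₀ γ ℓ S → ¬ ContainsPattern S u

/-- The parabola `y = x²`. -/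
def parabola : Set (ℝ × ℝ) := {p | p.2 = p.1 ^ 2}

/-- The circle with center `z` and radius `ρ`. -/
def planeCircle (z : ℝ × ℝ) (ρ : ℝ) : Set (ℝ × ℝ) :=
  {p | (p.1 - z.1) ^ 2 + (p.2 - z.2) ^ 2 = ρ ^ 2}

/-! ## Words of shuffles -/

section PieceLists

variable {β : Type}

/-! From visits to endpoints. Each visit of the tour gets a time, a parameter on the arc of the
visited cell, so that times increase along the lower inner-zone sequence. A line is visited only
while the arc is on its negative side, hence only between its left and right endpoints. The
geometric core is `turn_neg_of_visitedBefore`: if `a` is visited before `b`, and both lines are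
negative at both visits, then the sign of `turn` for (`a`, `b`) is negative. As `turn` is
antisymmetric, the opposite order cannot occur as well. So visits `a b a b` at times `t₁ < t₂ < t₃ <
t₄` force `t₁ < L_b` and `R_a < t₄` (`GoodTimes`), and visits `a b c b a b c` force concave
crossings (`ZigZag`, `exists_meets`). From there on, forcing is a question about timed copies of
`S_k(m)`.

Combinatorics of `S_k(m)`. After a special block `x₁ ⋯ x_m` the word contains `x_{m-1} ⋯ x₁ x₂ ⋯
x_m` (`BlockGood`); this makes the segments of a block overlap, start and end in order, and zigzag.
Repeated symbols in a shuffle give two timed versions of each factor, an early and a late one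
(`Decomposition`). Number the symbols of a block from 0. Number `i ≥ 1` was appended by the shuffle
that produced `S_k(i+1)` from `S_k(i)`: its segment reaches beyond all blocks of the enlarged copy
of `S_k(i)` to which it was appended (`last_lt_right`), whereas the symbols numbered at most `n` in
the last block of a copy of `S_k(n+1)` end before the next block (`right_lt_next`). With these two
estimates long and short segments can be placed at will, which yields `F`, `Y` and `Z`
(`exists_three_blocks`, `hasConfig_configY`, `hasConfig_configZ`). `HasConfig.shuffle` turns the
shuffle of words into the endpoint shuffle of configurations, and `exists_configX` assembles `X`
inside `S_7(m)`.

No copy of `X` on a conic. In coordinates where `C` is a parabola, parametrized by its abscissa,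
concavity of three segments is an inequality between products of endpoint differences
(`ConcaveRatio`). A circle is a parabola after projection from its top point. For a whisker `a, b,
c` the inequality makes one of the two halves short (`whisker_gaps`). Choosing the short half on all
four levels leads to a leaf of `X` at which the distances from `L_1` to `R_1, …, R_5` more than
double at each step. Concavity of the five numeric segments then makes the gaps between their left
endpoints shrink so fast that `L_5 - L_2 < L_2 - L_1` and `L_5 - L_4 < L_4 - L_3`. The segments `d,
e, f` of `Y` straddle exactly these gaps, and `whisker_gaps` applied to them is violated
(`leaf_contradiction`). -/

@[simp] theorem specialBlocks_append (A B : List (Piece β)) :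
    specialBlocks (A ++ B) = specialBlocks A ++ specialBlocks B := by
  induction A with
  | nil => rfl
  | cons p A ih => cases p <;> simp [specialBlocks, ih]

@[simp] theorem specialBlocks_renamePieces (f : Symb → Symb) (g : β → β) (A : List (Piece β)) :
    specialBlocks (renamePieces f g A) = (specialBlocks A).map (List.map f) := by
  induction A with
  | nil => rfl
  | cons p A ih => cases p <;> simp [specialBlocks, renamePieces, ih]

end PieceLists

@[simp] theorem word_append (A B : List (Piece Symb)) : word (A ++ B) = word A ++ word B := by
  induction A with
  | nil => rfl
  | cons p A ih => cases p <;> simp [word, ih]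

@[simp] theorem word_renamePieces (f : Symb → Symb) (A : List (Piece Symb)) :
    word (renamePieces f f A) = (word A).map f := by
  induction A with
  | nil => rfl
  | cons p A ih => cases p <;> simp [word, renamePieces, ih]

@[simp] theorem word_map_plain (l : List Symb) : word (l.map Piece.plain) = l := by
  induction l with
  | nil => rfl
  | cons p A ih => simp [word, ih]

@[simp] theorem specialBlocks_map_plain {β : Type} (l : List β) :
    specialBlocks (l.map Piece.plain) = [] := by
  induction l with
  | nil => rfl
  | cons p A ih => simp [specialBlocks, ih]

theorem specialBlocks_insertGlobals : ∀ (A : List (Piece Symb)) (gs : List Symb),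
    (specialBlocks A).length = gs.length →
    specialBlocks (insertGlobals A gs) =
      List.zipWith (fun l g => l ++ [g]) (specialBlocks A) gs
  | [], gs, h => by simp [insertGlobals, specialBlocks]
  | Piece.plain b :: A, gs, h => by
      simpa [insertGlobals, specialBlocks] using specialBlocks_insertGlobals A gs h
  | Piece.block l :: A, [], h => by simp [specialBlocks] at h
  | Piece.block l :: A, g :: gs, h => by
      simp only [specialBlocks, List.length_cons, Nat.add_right_cancel_iff] at h
      simp [insertGlobals, specialBlocks, specialBlocks_insertGlobals A gs h]

theorem length_specialBlocks_insertGlobals : ∀ (A : List (Piece Symb)) (gs : List Symb),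
    (specialBlocks (insertGlobals A gs)).length = (specialBlocks A).length
  | [], gs => by simp [insertGlobals, specialBlocks]
  | Piece.plain b :: A, gs => by
      simpa [insertGlobals, specialBlocks] using length_specialBlocks_insertGlobals A gs
  | Piece.block l :: A, [] => by
      simpa [insertGlobals, specialBlocks] using length_specialBlocks_insertGlobals A []
  | Piece.block l :: A, g :: gs => by
      simpa [insertGlobals, specialBlocks] using length_specialBlocks_insertGlobals A gs

theorem length_specialBlocks_shuffleFrom (A : List (Piece Symb)) :
    ∀ (B : List (Piece Symb)) (i : ℕ),
    (specialBlocks (shuffleFrom A i B)).length =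
      (specialBlocks B).length * (specialBlocks A).length
  | [], i => by simp [shuffleFrom, specialBlocks]
  | Piece.plain b :: B, i => by
      simpa [shuffleFrom, specialBlocks] using length_specialBlocks_shuffleFrom A B i
  | Piece.block l :: B, i => by
      simp [shuffleFrom, specialBlocks, length_specialBlocks_shuffleFrom A B (i + 1),
        length_specialBlocks_insertGlobals]
      ring

theorem shuffleFrom_append (A : List (Piece Symb)) :
    ∀ (B B' : List (Piece Symb)) (i : ℕ),
    shuffleFrom A i (B ++ B') =
      shuffleFrom A i B ++ shuffleFrom A (i + (specialBlocks B).length) B'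
  | [], B', i => by simp [shuffleFrom, specialBlocks]
  | Piece.plain b :: B, B', i => by
      simp [shuffleFrom, specialBlocks, shuffleFrom_append A B B' i]
  | Piece.block l :: B, B', i => by
      simp [shuffleFrom, specialBlocks, shuffleFrom_append A B B' (i + 1), Nat.add_assoc,
        Nat.add_comm 1]

theorem map_word_sublist_insertGlobals (f : Symb → Symb) : ∀ (A : List (Piece Symb)) (gs : List Symb),
    ((word A).map f).Sublist (word (insertGlobals (renamePieces f f A) gs))
  | [], gs => by simp [word]
  | Piece.plain b :: A, gs => by
      simpa [insertGlobals, renamePieces, word] using map_word_sublist_insertGlobals f A gs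
  | Piece.block l :: A, [] => by
      simpa [insertGlobals, renamePieces, word] using map_word_sublist_insertGlobals f A []
  | Piece.block l :: A, g :: gs => by
      simp only [insertGlobals, renamePieces, word, word_append, word_map_plain, List.map_append,
        List.append_assoc]
      refine List.Sublist.append (List.Sublist.refl _) ?_
      exact (map_word_sublist_insertGlobals f A gs).trans
        ((List.sublist_append_right _ _).trans (List.sublist_append_right _ _))

theorem sublist_word_insertGlobals : ∀ (A : List (Piece Symb)) (gs : List Symb),
    gs.length ≤ (specialBlocks A).length → gs.Sublist (word (insertGlobals A gs))
  | [], gs, h => by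
      have : gs = [] := by simpa [specialBlocks] using h
      simp [this]
  | Piece.plain b :: A, gs, h => by
      have := sublist_word_insertGlobals A gs (by simpa [specialBlocks] using h)
      simpa [insertGlobals, word] using this.cons b
  | Piece.block l :: A, [], h => by simp
  | Piece.block l :: A, g :: gs, h => by
      have := sublist_word_insertGlobals A gs (by simpa [specialBlocks] using h)
      simp only [insertGlobals, word, word_append, word_map_plain, List.append_assoc,
        List.singleton_append]
      refine List.Sublist.trans ?_ (List.sublist_append_right _ _)
      exact (this.trans (List.sublist_append_right _ _)).cons_cons g

theorem mem_word_insertGlobals : ∀ (A : List (Piece Symb)) (gs : List Symb) (x : Symb),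
    x ∈ word (insertGlobals A gs) → x ∈ word A ∨ x ∈ gs
  | [], gs, x, h => by simp [insertGlobals, word] at h
  | Piece.plain b :: A, gs, x, h => by
      simp only [insertGlobals, word, List.mem_cons] at h ⊢
      rcases h with h | h
      · exact Or.inl (Or.inl h)
      · rcases mem_word_insertGlobals A gs x h with h | h <;> tauto
  | Piece.block l :: A, [], x, h => by
      simp only [insertGlobals, word, List.mem_append] at h ⊢
      rcases h with h | h
      · tauto
      · rcases mem_word_insertGlobals A [] x h with h | h <;> tauto
  | Piece.block l :: A, g :: gs, x, h => by
      simp only [insertGlobals, word, word_append, word_map_plain, List.mem_append,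
        List.mem_cons, Option.mem_toList] at h ⊢
      rcases h with (h | h | h) | h | h
      · tauto
      · tauto
      · simp at h
      · exact Or.inl (Or.inl (List.mem_of_getLast? h))
      · rcases mem_word_insertGlobals A gs x h with h | h <;> tauto

theorem map_word_sublist_shuffleFrom (A : List (Piece Symb)) : ∀ (B : List (Piece Symb)) (i : ℕ),
    (∀ l ∈ specialBlocks B, l.length = (specialBlocks A).length) →
    ((word B).map Symb.glob).Sublist (word (shuffleFrom A i B))
  | [], i, h => by simp [word]
  | Piece.plain b :: B, i, h => by
      simpa [shuffleFrom, word] using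
        map_word_sublist_shuffleFrom A B i (by simpa [specialBlocks] using h)
  | Piece.block l :: B, i, h => by
      simp only [specialBlocks, List.mem_cons, forall_eq_or_imp] at h
      simp only [shuffleFrom, word, word_append, List.map_append, List.append_assoc]
      refine List.Sublist.append ?_ ?_
      · exact sublist_word_insertGlobals _ _ (by simp [h.1])
      · exact (map_word_sublist_shuffleFrom A B (i + 1) h.2).trans
          (List.sublist_append_right _ _)

/-- The index of a local symbol counts the special blocks of `B` before its copy. Hence all
occurrences of a local symbol lie in a single copy. -/
theorem mem_word_shuffleFrom (A : List (Piece Symb)) : ∀ (B : List (Piece Symb)) (i : ℕ) (x : Symb),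
    x ∈ word (shuffleFrom A i B) →
      (∃ j y, x = Symb.loc j y ∧ ∃ B₁ l B₂, B = B₁ ++ Piece.block l :: B₂ ∧
        j = i + (specialBlocks B₁).length) ∨ ∃ g, x = Symb.glob g ∧ g ∈ word B
  | [], i, x, h => by simp [shuffleFrom, word] at h
  | Piece.plain b :: B, i, x, h => by
      simp only [shuffleFrom, word, List.mem_cons] at h
      rcases h with h | h
      · exact Or.inr ⟨b, h, by simp [word]⟩
      · rcases mem_word_shuffleFrom A B i x h with ⟨j, y, hx, B₁, l, B₂, hB, hj⟩ | ⟨g, hx, hg⟩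
        · exact Or.inl ⟨j, y, hx, Piece.plain b :: B₁, l, B₂, by simp [hB],
            by simpa [specialBlocks] using hj⟩
        · exact Or.inr ⟨g, hx, by simp [word, hg]⟩
  | Piece.block l :: B, i, x, h => by
      simp only [shuffleFrom, word_append, word_map_plain, List.mem_append, Option.mem_toList] at h
      rcases h with (h | h) | h
      · rcases mem_word_insertGlobals _ _ _ h with h | h
        · rw [word_renamePieces] at h
          obtain ⟨y, -, rfl⟩ := List.mem_map.1 h
          exact Or.inl ⟨i, y, rfl, [], l, B, rfl, by simp [specialBlocks]⟩
        · obtain ⟨g, hg, rfl⟩ := List.mem_map.1 h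
          exact Or.inr ⟨g, rfl, by simp [word, hg]⟩
      · obtain ⟨g, hg, rfl⟩ := List.mem_map.1 (List.mem_of_getLast? h)
        exact Or.inr ⟨g, rfl, by simp [word, hg]⟩
      · rcases mem_word_shuffleFrom A B (i + 1) x h with ⟨j, y, hx, B₁, l', B₂, hB, hj⟩ | ⟨g, hx, hg⟩
        · exact Or.inl ⟨j, y, hx, Piece.block l :: B₁, l', B₂, by simp [hB],
            by simp [specialBlocks]; omega⟩
        · exact Or.inr ⟨g, hx, by simp [word, hg]⟩

/-! ## First occurrences -/

/-- Every symbol of a special block occurs there for the first time, given the symbols `P` that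
have occurred earlier. -/
def FirstOcc : List Symb → List (Piece Symb) → Prop
  | _, [] => True
  | P, Piece.block l :: A => l.Nodup ∧ (∀ x ∈ l, x ∉ P) ∧ FirstOcc (P ++ l) A
  | P, Piece.plain b :: A => FirstOcc (P ++ [b]) A

theorem firstOcc_append : ∀ (A B : List (Piece Symb)) (P : List Symb),
    FirstOcc P (A ++ B) ↔ FirstOcc P A ∧ FirstOcc (P ++ word A) B
  | [], B, P => by simp [FirstOcc, word]
  | Piece.plain b :: A, B, P => by
      simp [FirstOcc, word, firstOcc_append A B]
  | Piece.block l :: A, B, P => by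
      simp [FirstOcc, word, firstOcc_append A B, and_assoc]

theorem firstOcc_map_plain : ∀ (l : List Symb) (P : List Symb), FirstOcc P (l.map Piece.plain)
  | [], P => by simp [FirstOcc]
  | b :: l, P => by simpa [FirstOcc] using firstOcc_map_plain l _

/-- Two histories are tracked: `P` inside `A`, and `P'` inside the shuffle. They only need to agree
on the local symbols with index `i`. -/
theorem firstOcc_insertGlobals (i : ℕ) : ∀ (A : List (Piece Symb)) (gs P P' : List Symb),
    FirstOcc P A → (∀ x, Symb.loc i x ∈ P' → x ∈ P) → (∀ g ∈ gs, Symb.glob g ∉ P') → gs.Nodup →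
    FirstOcc P' (insertGlobals (renamePieces (Symb.loc i) (Symb.loc i) A) (gs.map Symb.glob))
  | [], gs, P, P', h, h1, h2, h3 => by simp [renamePieces, insertGlobals, FirstOcc]
  | Piece.plain b :: A, gs, P, P', h, h1, h2, h3 => by
      simp only [renamePieces, insertGlobals, FirstOcc] at h ⊢
      refine firstOcc_insertGlobals i A gs _ _ h ?_ ?_ h3
      · intro x hx
        simp only [List.mem_append, List.mem_singleton, Symb.loc.injEq, true_and] at hx ⊢
        exact hx.imp_left (h1 x)
      · intro g hg
        simpa using h2 g hg
  | Piece.block l :: A, [], P, P', h, h1, h2, h3 => by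
      simp only [renamePieces, insertGlobals, FirstOcc, List.map_nil] at h ⊢
      refine ⟨h.1.map (fun a b hab => by simpa using hab), ?_, ?_⟩
      · intro x hx hx'
        obtain ⟨y, hy, rfl⟩ := List.mem_map.1 hx
        exact h.2.1 y hy (h1 y hx')
      · refine firstOcc_insertGlobals i A [] _ _ h.2.2 ?_ (by simp) (by simp)
        intro x hx
        simp only [List.mem_append, List.mem_map, Symb.loc.injEq, true_and, exists_eq_right] at hx ⊢
        exact hx.imp_left (h1 x)
  | Piece.block l :: A, g :: gs, P, P', h, h1, h2, h3 => by
      simp only [renamePieces, insertGlobals, FirstOcc, List.map_cons] at h ⊢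
      simp only [List.nodup_cons] at h3
      simp only [List.mem_cons, forall_eq_or_imp] at h2
      refine ⟨?_, ?_, ?_⟩
      · refine List.Nodup.append (h.1.map (fun a b hab => by simpa using hab)) (by simp) ?_
        intro x hx hx'
        simp at hx hx'
        obtain ⟨y, hy, rfl⟩ := hx
        simp at hx'
      · intro x hx hx'
        simp only [List.mem_append, List.mem_map, List.mem_singleton] at hx
        rcases hx with ⟨y, hy, rfl⟩ | rfl
        · exact h.2.1 y hy (h1 y hx')
        · exact h2.1 hx'
      · rw [firstOcc_append]
        refine ⟨firstOcc_map_plain _ _, ?_⟩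
        refine firstOcc_insertGlobals i A gs _ _ h.2.2 ?_ ?_ h3.2
        · intro x hx
          simp only [word_map_plain, List.mem_append, List.mem_map, List.mem_singleton,
            Option.mem_toList, Symb.loc.injEq, true_and, exists_eq_right, reduceCtorEq,
            or_false] at hx ⊢
          rcases hx with (hx | hx) | hx
          · exact Or.inl (h1 x hx)
          · exact Or.inr hx
          · have := List.mem_of_getLast? hx
            simp at this
            exact Or.inr this
        · intro g' hg' hx
          simp only [word_map_plain, List.mem_append, List.mem_map, List.mem_singleton,
            Option.mem_toList, Symb.glob.injEq, reduceCtorEq, and_false, exists_false,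
            false_or] at hx
          rcases hx with (hx | hx) | hx
          · exact h2.2 g' hg' hx
          · exact h3.1 (hx ▸ hg')
          · have := List.mem_of_getLast? hx
            simp at this

theorem firstOcc_shuffleFrom (A : List (Piece Symb)) (hA : FirstOcc [] A) :
    ∀ (B : List (Piece Symb)) (i : ℕ) (P P' : List Symb),
    FirstOcc P B → (∀ x, Symb.glob x ∈ P' → x ∈ P) → (∀ j ≥ i, ∀ x, Symb.loc j x ∉ P') →
    FirstOcc P' (shuffleFrom A i B)
  | [], i, P, P', h, h1, h2 => by simp [shuffleFrom, FirstOcc]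
  | Piece.plain b :: B, i, P, P', h, h1, h2 => by
      simp only [shuffleFrom, FirstOcc] at h ⊢
      refine firstOcc_shuffleFrom A hA B i _ _ h ?_ ?_
      · intro x hx
        simp only [List.mem_append, List.mem_singleton, Symb.glob.injEq] at hx ⊢
        exact hx.imp_left (h1 x)
      · intro j hj x
        simpa using h2 j hj x
  | Piece.block l :: B, i, P, P', h, h1, h2 => by
      simp only [shuffleFrom, FirstOcc] at h ⊢
      rw [firstOcc_append, firstOcc_append]
      refine ⟨⟨?_, firstOcc_map_plain _ _⟩, ?_⟩
      · exact firstOcc_insertGlobals i A l [] P' hA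
          (fun x hx => absurd hx (h2 i le_rfl x)) (fun g hg hx => h.2.1 g hg (h1 g hx)) h.1
      · refine firstOcc_shuffleFrom A hA B (i + 1) _ _ h.2.2 ?_ ?_
        · intro x hx
          simp only [word_append, word_map_plain, List.mem_append, Option.mem_toList] at hx ⊢
          rcases hx with hx | hx | hx
          · exact Or.inl (h1 x hx)
          · rcases mem_word_insertGlobals _ _ _ hx with hx | hx
            · simp at hx
            · simp at hx; exact Or.inr hx
          · have := List.mem_of_getLast? hx
            simp at this; exact Or.inr this
        · intro j hj x hx
          simp only [word_append, word_map_plain, List.mem_append, Option.mem_toList] at hx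
          rcases hx with hx | hx | hx
          · exact h2 j (by omega) x hx
          · rcases mem_word_insertGlobals _ _ _ hx with hx | hx
            · simp at hx; omega
            · simp at hx
          · have := List.mem_of_getLast? hx
            simp at this

theorem firstOcc_splitBlocks : ∀ (A : List (Piece Symb)) (P : List Symb),
    FirstOcc P A → FirstOcc P (splitBlocks A)
  | [], P, h => by simp [splitBlocks, FirstOcc]
  | Piece.plain b :: A, P, h => by
      simpa [splitBlocks, FirstOcc] using firstOcc_splitBlocks A _ h
  | Piece.block l :: A, P, h => by
      simp only [splitBlocks, FirstOcc] at h ⊢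
      have key : ∀ (l P : List Symb), l.Nodup → (∀ x ∈ l, x ∉ P) →
          FirstOcc P (l.map (fun a => Piece.block [a])) ∧
            word (l.map (fun a => Piece.block [a])) = l := by
        intro l
        induction l with
        | nil => intro P _ _; simp [FirstOcc, word]
        | cons a l ih =>
          intro P h1 h2
          simp only [List.nodup_cons] at h1
          have := ih (P ++ [a]) h1.2 (by
            intro x hx hx'
            simp only [List.mem_append, List.mem_singleton] at hx'
            rcases hx' with hx' | rfl
            · exact h2 x (by simp [hx]) hx'
            · exact h1.1 hx)
          simp only [List.map_cons, FirstOcc, word]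
          refine ⟨⟨by simp, by simpa using h2 a (by simp), this.1⟩, by simp [this.2]⟩
      obtain ⟨k1, k2⟩ := key l P h.1 h.2.1
      rw [firstOcc_append, k2]
      exact ⟨k1, firstOcc_splitBlocks A _ h.2.2⟩

theorem word_splitBlocks (A : List (Piece Symb)) : word (splitBlocks A) = word A := by
  induction A with
  | nil => rfl
  | cons p A ih =>
    cases p with
    | plain b => simp [splitBlocks, word, ih]
    | block l =>
      simp only [splitBlocks, word, word_append, ih, List.append_cancel_right_eq]
      induction l with
      | nil => rfl
      | cons a l ih => simp [word, ih]


/-! ## Alternations in shuffles -/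

/-- Every sublist of `u'` without equal neighbours is a sublist of `u`. -/
def StutterOf {α : Type} (u' u : List α) : Prop :=
  ∀ v : List α, v.IsChain (· ≠ ·) → v.Sublist u' → v.Sublist u

theorem StutterOf.refl {α : Type} (u : List α) : StutterOf u u := fun _ _ h => h

theorem StutterOf.append {α : Type} {a' a b' b : List α} (h1 : StutterOf a' a)
    (h2 : StutterOf b' b) : StutterOf (a' ++ b') (a ++ b) := by
  intro v hv h
  obtain ⟨v1, v2, rfl, hs1, hs2⟩ := List.sublist_append_iff.1 h
  exact (h1 v1 hv.left_of_append hs1).append (h2 v2 hv.right_of_append hs2)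

/-- A subsequence that uses both copies of the last symbol has two equal neighbours; otherwise one
copy can stand in for the other. -/
theorem stutterOf_append_getLast {α : Type} (l : List α) :
    StutterOf (l ++ l.getLast?.toList) l := by
  rcases List.eq_nil_or_concat l with rfl | ⟨l, a, rfl⟩
  · exact fun v _ h => by simpa using h
  · intro v hv h
    simp only [List.concat_eq_append, List.getLast?_append, List.getLast?_singleton,
      Option.some_or, Option.toList_some] at h ⊢
    obtain ⟨v1, v2, rfl, hs1, hs2⟩ := List.sublist_append_iff.1 h
    rcases List.sublist_singleton.1 hs2 with rfl | rfl
    · simpa using hs1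
    · obtain ⟨w1, w2, rfl, ht1, ht2⟩ := List.sublist_append_iff.1 hs1
      rcases List.sublist_singleton.1 ht2 with rfl | rfl
      · simpa using ht1.append hs2
      · exfalso
        rw [List.append_assoc] at hv
        have := hv.right_of_append
        simp at this

/-- The symbol of the `i`-th copy, if it is one. -/
def unloc (i : ℕ) : Symb → Option Symb
  | Symb.loc j a => if j = i then some a else none
  | _ => none

/-- The global symbol, if it is one. -/
def unglob : Symb → Option Symb
  | Symb.glob a => some a
  | _ => none

theorem filterMap_unloc_map_loc (i : ℕ) (l : List Symb) :
    (l.map (Symb.loc i)).filterMap (unloc i) = l := by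
  induction l with
  | nil => rfl
  | cons a l ih => simp [unloc, ih]

theorem filterMap_unglob_map_glob (l : List Symb) :
    (l.map Symb.glob).filterMap unglob = l := by
  induction l with
  | nil => rfl
  | cons a l ih => simp [unglob, ih]

theorem filterMap_unglob_map_loc (i : ℕ) (l : List Symb) :
    (l.map (Symb.loc i)).filterMap unglob = [] := by
  induction l with
  | nil => rfl
  | cons a l ih => simp [unglob]

theorem getLast?_map_toList {α β : Type} (f : α → β) (l : List α) :
    (l.map f).getLast?.toList = l.getLast?.toList.map f := by
  rw [List.getLast?_map]; cases l.getLast? <;> rfl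

/-- Once the inserted globals are erased, each repeated symbol stands next to its original. So
repetitions create no new alternation of local symbols. -/
theorem stutterOf_copy (i : ℕ) : ∀ (A : List (Piece Symb)) (gs : List Symb),
    StutterOf ((word (insertGlobals (renamePieces (Symb.loc i) (Symb.loc i) A)
      (gs.map Symb.glob))).filterMap (unloc i)) (word A)
  | [], gs => by simpa [renamePieces, insertGlobals, word] using StutterOf.refl _
  | Piece.plain b :: A, gs => by
      simpa [renamePieces, insertGlobals, word, unloc] using
        (StutterOf.refl [b]).append (stutterOf_copy i A gs)
  | Piece.block l :: A, [] => by
      simp only [renamePieces, insertGlobals, word, List.map_nil, List.filterMap_append,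
        filterMap_unloc_map_loc]
      exact (StutterOf.refl l).append (stutterOf_copy i A [])
  | Piece.block l :: A, g :: gs => by
      simp only [renamePieces, insertGlobals, word, word_append, word_map_plain, List.map_cons,
        List.filterMap_append, filterMap_unloc_map_loc, getLast?_map_toList]
      have : List.filterMap (unloc i) [Symb.glob g] = [] := rfl
      rw [this, List.append_nil, ← List.append_assoc]
      exact (stutterOf_append_getLast l).append (stutterOf_copy i A gs)

/-- Each global is inserted into a copy only once, and in the given order; the repeated symbols are
local. -/
theorem filterMap_unglob_copy (i : ℕ) : ∀ (A : List (Piece Symb)) (gs : List Symb),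
    ((word (insertGlobals (renamePieces (Symb.loc i) (Symb.loc i) A)
      (gs.map Symb.glob))).filterMap unglob).Sublist gs
  | [], gs => by simp [renamePieces, insertGlobals, word]
  | Piece.plain b :: A, gs => by
      simpa [renamePieces, insertGlobals, word, unglob, List.filterMap_cons] using
        filterMap_unglob_copy i A gs
  | Piece.block l :: A, [] => by
      simp only [renamePieces, insertGlobals, word, List.map_nil, List.filterMap_append,
        filterMap_unglob_map_loc]
      exact filterMap_unglob_copy i A []
  | Piece.block l :: A, g :: gs => by
      simp only [renamePieces, insertGlobals, word, word_append, word_map_plain, List.map_cons,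
        List.filterMap_append, filterMap_unglob_map_loc, getLast?_map_toList, List.nil_append]
      have : List.filterMap unglob [Symb.glob g] = [g] := rfl
      rw [this]
      exact (filterMap_unglob_copy i A gs).cons_cons g

/-- With the local symbols erased, a special block of `B` reappears in its order, followed at most
by a second copy of its last symbol. -/
theorem stutterOf_globals (A : List (Piece Symb)) : ∀ (B : List (Piece Symb)) (i : ℕ),
    StutterOf ((word (shuffleFrom A i B)).filterMap unglob) (word B)
  | [], i => by simpa [shuffleFrom, word] using StutterOf.refl _
  | Piece.plain b :: B, i => by
      simpa [shuffleFrom, word, unglob] using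
        (StutterOf.refl [b]).append (stutterOf_globals A B i)
  | Piece.block l :: B, i => by
      simp only [shuffleFrom, word, word_append, word_map_plain, List.filterMap_append,
        getLast?_map_toList, filterMap_unglob_map_glob]
      refine StutterOf.append ?_ (stutterOf_globals A B (i + 1))
      intro v hv h
      exact stutterOf_append_getLast l v hv
        (h.trans ((filterMap_unglob_copy i A l).append_right _))

theorem eq_middle_of_alternation {α : Type} {a b : α} {p q r : List α}
    (h : [a, b, a, b, a].Sublist (p ++ q ++ r)) (hp : a ∉ p) (hr : a ∉ r) :
    [a, b, a, b, a].Sublist q := by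
  obtain ⟨v, v3, hv, hs, hs3⟩ := List.sublist_append_iff.1 h
  obtain ⟨v1, v2, rfl, hs1, hs2⟩ := List.sublist_append_iff.1 hs
  have h1 : v1 = [] := by
    rcases v1 with _ | ⟨c, v1⟩
    · rfl
    · simp only [List.cons_append, List.cons.injEq] at hv
      exact absurd (hs1.subset (by simp [hv.1])) hp
  have h3 : v3 = [] := by
    rcases List.eq_nil_or_concat v3 with rfl | ⟨v3, c, rfl⟩
    · rfl
    · have := congrArg List.getLast? hv
      simp at this
      exact absurd (hs3.subset (by simp [this])) hr
  subst h1 h3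
  simp only [List.nil_append, List.append_nil] at hv
  exact hv ▸ hs2

/-- Both occurrences of `a` are confined to `q`, hence so is the middle `b`; only the place of the
first `b` is open. -/
theorem twice_or_mem_of_alternation {α : Type} {a b : α} {p q r : List α}
    (hab : a ≠ b) (h : [b, a, b, a, b].Sublist (p ++ q ++ r)) (hp : a ∉ p) (hr : a ∉ r) :
    [b, b].Sublist q ∨ (b ∈ p ∧ b ∈ q) := by
  obtain ⟨v, v3, hv, hs, hs3⟩ := List.sublist_append_iff.1 h
  obtain ⟨v1, v2, rfl, hs1, hs2⟩ := List.sublist_append_iff.1 hs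
  have h1 : v1 = [] ∨ v1 = [b] := by
    rcases v1 with _ | ⟨c, _ | ⟨d, v1⟩⟩
    · exact Or.inl rfl
    · simp only [List.cons_append, List.cons.injEq] at hv
      exact Or.inr (by simp [hv.1])
    · simp only [List.cons_append, List.cons.injEq] at hv
      exact absurd (hs1.subset (by simp [hv.2.1])) hp
  have h3 : v3 = [] ∨ v3 = [b] := by
    rcases List.eq_nil_or_concat v3 with rfl | ⟨v3, c, rfl⟩
    · exact Or.inl rfl
    rcases List.eq_nil_or_concat v3 with rfl | ⟨v3, d, rfl⟩
    · have := congrArg List.getLast? hv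
      simp at this
      exact Or.inr (by simp [this])
    · have := congrArg (fun l => l.dropLast.getLast?) hv
      simp only [List.concat_eq_append, ← List.append_assoc, List.dropLast_concat] at this
      simp at this
      exact absurd (hs3.subset (by simp [this])) hr
  have hb2 : [a, b, a].Sublist v2 := by
    rcases h1 with rfl | rfl <;> rcases h3 with rfl | rfl <;> simp at hv
    · rw [← hv]; exact ((List.sublist_append_left [a, b, a] [b]).cons b)
    · have : [b, a, b, a] = v2 := by
        apply List.append_cancel_right (bs := [b]); simpa using hv
      rw [← this]; exact (List.Sublist.refl _).cons b
    · rw [← hv]; exact (List.sublist_append_left [a, b, a] [b])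
    · have : [a, b, a] = v2 := by
        apply List.append_cancel_right (bs := [b]); simpa using hv
      rw [← this]
  rcases h1 with rfl | rfl
  · left
    rcases v2 with _ | ⟨c, v2⟩
    · simp at hb2
    · simp only [List.nil_append, List.cons_append, List.cons.injEq] at hv
      obtain ⟨rfl, hv⟩ := hv
      refine List.Sublist.trans (List.Sublist.cons_cons b ?_) hs2
      have : [a, b, a].Sublist v2 := by
        cases hb2 with
        | cons _ h => exact h
        | cons_cons _ h => exact absurd rfl hab
      exact List.singleton_sublist.2 (this.subset (by simp))
  · right
    exact ⟨hs1.subset (by simp), hs2.subset (hb2.subset (by simp))⟩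

/-- Two locals that alternate lie in the same copy and alternate in `A`; two globals alternate in
`B`. A mixed alternation would need a global twice inside one copy, or inside a copy after an
occurrence before that copy. The first is impossible because a global is inserted only once, the
second because special blocks of `B` consist of first occurrences. -/
theorem ababaFree_shuffle {A B : List (Piece Symb)} (hA : AbabaFree (word A))
    (hB : AbabaFree (word B)) (hfB : FirstOcc [] B) : AbabaFree (word (shuffle A B)) := by
  intro a b hab h
  have hchain : ∀ x y : Symb, x ≠ y → [x, y, x, y, x].IsChain (· ≠ ·) := by
    intro x y hxy; simp [hxy, hxy.symm]
  -- the position of a copy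
  have split : ∀ B₁ l B₂, B = B₁ ++ Piece.block l :: B₂ →
      ∃ p r, word (shuffle A B) = p ++ word (insertGlobals (renamePieces
          (Symb.loc (specialBlocks B₁).length) (Symb.loc (specialBlocks B₁).length) A)
          (l.map Symb.glob)) ++ r ∧ (∀ x, Symb.loc (specialBlocks B₁).length x ∉ p) ∧
        (∀ x, Symb.loc (specialBlocks B₁).length x ∉ r) ∧
        (∀ g, Symb.glob g ∈ p → g ∈ word B₁) := by
    intro B₁ l B₂ hBeq
    refine ⟨word (shuffleFrom A 0 B₁),
      word ((l.map Symb.glob).getLast?.toList.map Piece.plain) ++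
        word (shuffleFrom A ((specialBlocks B₁).length + 1) B₂), ?_, ?_, ?_, ?_⟩
    · rw [shuffle, hBeq, shuffleFrom_append]
      simp only [shuffleFrom, word_append, List.append_assoc, Nat.zero_add]
    · intro x hx
      rcases mem_word_shuffleFrom _ _ _ _ hx with ⟨j, y, hy, C₁, l', C₂, hC, hj⟩ | ⟨g, hg, -⟩
      · simp only [Symb.loc.injEq] at hy
        have := congrArg (fun z => (specialBlocks z).length) hC
        simp [specialBlocks] at this
        omega
      · simp at hg
    · intro x hx
      simp only [word_map_plain, List.mem_append, Option.mem_toList] at hx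
      rcases hx with hx | hx
      · have := List.mem_of_getLast? hx
        simp at this
      · rcases mem_word_shuffleFrom _ _ _ _ hx with ⟨j, y, hy, C₁, l', C₂, hC, hj⟩ | ⟨g, hg, -⟩
        · simp only [Symb.loc.injEq] at hy
          omega
        · simp at hg
    · intro g hg
      rcases mem_word_shuffleFrom _ _ _ _ hg with ⟨j, y, hy, -⟩ | ⟨g', hg, hg'⟩
      · simp at hy
      · simp only [Symb.glob.injEq] at hg
        exact hg ▸ hg'
  have ha := mem_word_shuffleFrom _ _ _ _ (h.subset (show a ∈ [a, b, a, b, a] by simp))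
  have hb := mem_word_shuffleFrom _ _ _ _ (h.subset (show b ∈ [a, b, a, b, a] by simp))
  rcases ha with ⟨j, x, rfl, B₁, l, B₂, hBeq, hj⟩ | ⟨x, rfl, hx⟩
  · obtain ⟨p, r, hu, hp, hr, -⟩ := split B₁ l B₂ hBeq
    rw [Nat.zero_add] at hj
    subst hj
    rw [hu] at h
    have h' := eq_middle_of_alternation h (hp x) (hr x)
    have hb' := h'.subset (show b ∈ [_, b, _, b, _] by simp)
    rcases mem_word_insertGlobals _ _ _ hb' with hb' | hb'
    · rw [word_renamePieces] at hb'
      obtain ⟨y, -, rfl⟩ := List.mem_map.1 hb'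
      have h2 := h'.filterMap (unloc (specialBlocks B₁).length)
      simp only [unloc, if_true, List.filterMap_cons, List.filterMap_nil] at h2
      exact hA x y (by simpa using hab) (stutterOf_copy _ A l _ (hchain x y (by simpa using hab)) h2)
    · obtain ⟨g, hg, rfl⟩ := List.mem_map.1 hb'
      have h2 := h'.filterMap unglob
      simp only [unglob, List.filterMap_cons, List.filterMap_nil] at h2
      have h3 := h2.trans (filterMap_unglob_copy _ A l)
      rw [hBeq, firstOcc_append] at hfB
      exact (List.nodup_iff_sublist.1 hfB.2.1) g h3
  · rcases hb with ⟨j, y, rfl, B₁, l, B₂, hBeq, hj⟩ | ⟨y, rfl, hy⟩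
    · obtain ⟨p, r, hu, hp, hr, hpB⟩ := split B₁ l B₂ hBeq
      rw [Nat.zero_add] at hj
      subst hj
      rw [hu] at h
      rw [hBeq, firstOcc_append] at hfB
      rcases twice_or_mem_of_alternation hab.symm h (hp y) (hr y) with h2 | ⟨h2, h3⟩
      · have h2 := h2.filterMap unglob
        simp only [unglob, List.filterMap_cons, List.filterMap_nil] at h2
        have h3 := h2.trans (filterMap_unglob_copy _ A l)
        exact (List.nodup_iff_sublist.1 hfB.2.1) x h3
      · have h4 : x ∈ l := by
          rcases mem_word_insertGlobals _ _ _ h3 with h3 | h3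
          · rw [word_renamePieces] at h3
            simp at h3
          · simpa using h3
        -- The global `x` is inserted into the copy, so it belongs to the special block `l`,
        -- although it has already occurred in `B₁`.
        exact hfB.2.2.1 x h4 (by simpa using hpB x h2)
    · have h2 := h.filterMap unglob
      simp only [unglob, List.filterMap_cons, List.filterMap_nil] at h2
      exact hB x y (by simpa using hab)
        (stutterOf_globals A B 0 _ (hchain x y (by simpa using hab)) h2)

/-- A monotone run contains at most two consecutive letters of an alternation. Five letters in three
runs would therefore need `ab` or `ba` in two adjacent runs of opposite direction, in a
contradictory way. -/
theorem ababaFree_zigzag {u v w : List ℕ} (hu : u.Pairwise (· < ·)) (hv : v.Pairwise (· > ·))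
    (hw : w.Pairwise (· < ·)) : AbabaFree (u ++ (v ++ w)) := by
  intro a b hab h
  obtain ⟨x, y, hxy, hx, hy⟩ := List.sublist_append_iff.1 h
  obtain ⟨y, z, rfl, hy, hz⟩ := List.sublist_append_iff.1 hy
  have hx' := hu.sublist hx
  have hy' := hv.sublist hy
  have hz' := hw.sublist hz
  have len := congrArg List.length hxy
  clear hx hy hz hu hv hw h
  rcases x with _ | ⟨x1, _ | ⟨x2, _ | ⟨x3, x⟩⟩⟩ <;>
  rcases y with _ | ⟨y1, _ | ⟨y2, _ | ⟨y3, y⟩⟩⟩ <;>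
  rcases z with _ | ⟨z1, _ | ⟨z2, _ | ⟨z3, z⟩⟩⟩ <;>
  simp at hxy hx' hy' hz' <;> omega

theorem hartSharirOne_word (m : ℕ) : word (hartSharirOne m) =
    (List.range' 1 m ++ ((List.range' 1 (m - 1)).reverse ++ List.range' 2 (m - 1))).map
      Symb.atom := by
  have : ∀ l : List ℕ, l.map (fun j => Piece.plain (Symb.atom j)) =
      (l.map Symb.atom).map Piece.plain := fun l => by simp [Function.comp_def]
  rw [hartSharirOne, word, this, word_map_plain, ← List.map_append]

theorem ababaFree_map {u : List ℕ} (h : AbabaFree u) : AbabaFree (u.map Symb.atom) := by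
  intro a b hab hs
  have ha := hs.subset (show a ∈ [a, b, a, b, a] by simp)
  have hb := hs.subset (show b ∈ [a, b, a, b, a] by simp)
  obtain ⟨x, -, rfl⟩ := List.mem_map.1 ha
  obtain ⟨y, -, rfl⟩ := List.mem_map.1 hb
  have h2 := hs.filterMap (fun s => match s with | Symb.atom n => some n | _ => none)
  simp only [List.filterMap_cons, List.filterMap_nil, List.filterMap_map] at h2
  have h3 : (fun s : Symb => match s with | Symb.atom n => some n | _ => none) ∘ Symb.atom
      = some := rfl
  rw [h3, List.filterMap_some] at h2
  exact h x y (by simpa using hab) h2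

/-- The two properties are carried along together, since `ababaFree_shuffle` needs first occurrences
in its second factor. The induction is lexicographic in `(k, m)`. -/
theorem hartSharir_firstOcc_ababaFree : ∀ k m : ℕ,
    FirstOcc [] (hartSharir k m) ∧ AbabaFree (word (hartSharir k m))
  | 0, m => ⟨by simp [hartSharir, FirstOcc], fun a b _ h => by simp [hartSharir, word] at h⟩
  | 1, m => by
      refine ⟨?_, ?_⟩
      · have : ∀ l : List ℕ, l.map (fun j => Piece.plain (Symb.atom j)) =
            (l.map Symb.atom).map Piece.plain := fun l => by simp [Function.comp_def]
        rw [hartSharir, hartSharirOne, this]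
        refine ⟨List.Nodup.map (fun a b hab => by simpa using hab) List.nodup_range', by simp,
          firstOcc_map_plain _ _⟩
      · rw [hartSharir, hartSharirOne_word]
        refine ababaFree_map (ababaFree_zigzag List.pairwise_lt_range' ?_ List.pairwise_lt_range')
        rw [List.pairwise_reverse]
        exact List.pairwise_lt_range'
  | k + 2, 0 => ⟨by simp [hartSharir, hartSharirNext, FirstOcc],
      fun a b _ h => by simp [hartSharir, hartSharirNext, word] at h⟩
  | k + 2, 1 => by
      obtain ⟨h1, h2⟩ := hartSharir_firstOcc_ababaFree (k + 1) 2
      simp only [hartSharir, hartSharirNext, word_splitBlocks]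
      exact ⟨firstOcc_splitBlocks _ _ h1, h2⟩
  | k + 2, m + 2 => by
      obtain ⟨h1, h2⟩ := hartSharir_firstOcc_ababaFree (k + 2) (m + 1)
      obtain ⟨h3, h4⟩ := hartSharir_firstOcc_ababaFree (k + 1)
        (specialBlocks (hartSharir (k + 2) (m + 1))).length
      refine ⟨firstOcc_shuffleFrom _ h1 _ _ _ _ h3 (by simp) (by simp),
        ababaFree_shuffle h2 h4 h3⟩
termination_by k m => (k, m)


/-! ## The word after a special block -/

/-- After every special block `x₁ ⋯ x_m`, the rest of the word, continued by `R`, contains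
`x_{m-1} ⋯ x₁ x₂ ⋯ x_m`. -/
def BlockGood (R : List Symb) : List (Piece Symb) → Prop
  | [] => True
  | Piece.block l :: A => (l.dropLast.reverse ++ l.tail).Sublist (word A ++ R) ∧ BlockGood R A
  | Piece.plain _ :: A => BlockGood R A

theorem BlockGood.append {R : List Symb} : ∀ {A B : List (Piece Symb)},
    BlockGood (word B ++ R) A → BlockGood R B → BlockGood R (A ++ B)
  | [], B, _, h2 => h2
  | Piece.plain b :: A, B, h1, h2 => by
      simp only [BlockGood, List.cons_append] at h1 ⊢
      exact BlockGood.append h1 h2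
  | Piece.block l :: A, B, h1, h2 => by
      simp only [BlockGood, List.cons_append, word_append, List.append_assoc] at h1 ⊢
      exact ⟨h1.1, BlockGood.append h1.2 h2⟩

theorem blockGood_map_plain (R : List Symb) : ∀ l : List Symb, BlockGood R (l.map Piece.plain)
  | [] => trivial
  | _ :: l => blockGood_map_plain R l

/-- For an enlarged block `l' x g`, the leading `x` of the required sequence is the repetition right
after the block, the middle part is the old sequence of `l' x` inside the copy, and the final `g`
comes from `R`, after the copy. -/
theorem blockGood_insertGlobals (f : Symb → Symb) (R : List Symb) :
    ∀ (A : List (Piece Symb)) (gs : List Symb), (∀ l ∈ specialBlocks A, l ≠ []) →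
    BlockGood [] A → (∀ g ∈ gs, g ∈ R) → (specialBlocks A).length ≤ gs.length →
    BlockGood R (insertGlobals (renamePieces f f A) gs)
  | [], gs, _, _, _, _ => trivial
  | Piece.plain b :: A, gs, h0, h1, h2, h3 => by
      simp only [renamePieces, insertGlobals, BlockGood] at h1 ⊢
      exact blockGood_insertGlobals f R A gs h0 h1 h2 h3
  | Piece.block l :: A, [], h0, h1, h2, h3 => by simp [specialBlocks] at h3
  | Piece.block l :: A, g :: gs, h0, h1, h2, h3 => by
      simp only [specialBlocks, List.mem_cons, forall_eq_or_imp, List.length_cons] at h0 h2 h3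
      simp only [renamePieces, insertGlobals, BlockGood] at h1 ⊢
      refine ⟨?_, BlockGood.append (blockGood_map_plain _ _)
        (blockGood_insertGlobals f R A gs h0.2 h1.2 h2.2 (by omega))⟩
      rcases List.eq_nil_or_concat l with rfl | ⟨l', x, rfl⟩
      · exact absurd rfl h0.1
      · have h4 := (h1.1.map f).trans
          ((map_word_sublist_insertGlobals f A gs).trans (List.Sublist.refl _) |> fun h => by
            simpa using h)
        have h5 : (List.map f l' ++ [f x, g]).tail = (List.map f (l' ++ [x]).tail) ++ [g] := by
          cases l' <;> simp
        have h6 : (List.map f l' ++ [f x, g]).dropLast = List.map f l' ++ [f x] := by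
          simp
        simp only [List.concat_eq_append, List.map_append, List.map_cons, List.map_nil,
          List.dropLast_concat, List.getLast?_append, List.getLast?_singleton, Option.some_or,
          Option.toList_some, word, List.nil_append, List.cons_append,
          List.append_assoc] at h4 ⊢
        rw [h5, h6, List.reverse_concat, List.cons_append, ← List.append_assoc,
          ← List.map_reverse]
        exact List.Sublist.cons_cons _ (h4.append (List.singleton_sublist.2 h2.1))

theorem blockGood_shuffleFrom {A : List (Piece Symb)} (h0 : ∀ l ∈ specialBlocks A, l ≠ [])
    (hA : BlockGood [] A) : ∀ (B : List (Piece Symb)) (i : ℕ), BlockGood [] B →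
    (∀ l ∈ specialBlocks B, l.length = (specialBlocks A).length) →
    BlockGood [] (shuffleFrom A i B)
  | [], i, _, _ => trivial
  | Piece.plain b :: B, i, h1, h2 => by
      simp only [shuffleFrom, BlockGood] at h1 ⊢
      exact blockGood_shuffleFrom h0 hA B i h1 h2
  | Piece.block l :: B, i, h1, h2 => by
      simp only [specialBlocks, List.mem_cons, forall_eq_or_imp] at h2
      simp only [shuffleFrom, BlockGood] at h1 ⊢
      refine BlockGood.append (BlockGood.append ?_ (blockGood_map_plain _ _))
        (blockGood_shuffleFrom h0 hA B (i + 1) h1.2 h2.2)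
      refine blockGood_insertGlobals _ _ A _ h0 hA ?_ (by simp [h2.1])
      intro g hg
      obtain ⟨y, hy, rfl⟩ := List.mem_map.1 hg
      -- A global that is not last in its block recurs after the copy by the property of `B`; the
      -- last one recurs because of its extra occurrence right after the copy.
      rcases List.eq_nil_or_concat l with rfl | ⟨l', x, rfl⟩
      · simp at hy
      · simp only [List.concat_eq_append, List.mem_append, List.mem_singleton] at hy
        rcases hy with hy | rfl
        · have h3 : y ∈ word B := by
            have := h1.1.subset (a := y) (by simp [hy])
            simpa using this
          have h4 := (map_word_sublist_shuffleFrom A B (i + 1) h2.2).subset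
            (List.mem_map_of_mem (f := Symb.glob) h3)
          simp [h4]
        · simp [word]

theorem blockGood_splitBlocks : ∀ (A : List (Piece Symb)), BlockGood [] (splitBlocks A)
  | [] => trivial
  | Piece.plain b :: A => by
      simp only [splitBlocks, BlockGood]
      exact blockGood_splitBlocks A
  | Piece.block l :: A => by
      simp only [splitBlocks]
      have key : ∀ (R : List Symb) (l : List Symb),
          BlockGood R (l.map (fun a => Piece.block [a])) := by
        intro R l
        induction l with
        | nil => trivial
        | cons a l ih => exact ⟨by simp, ih⟩
      exact BlockGood.append (key _ _) (blockGood_splitBlocks A)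

theorem length_splitBlocks {n : ℕ} : ∀ (A : List (Piece Symb)),
    (∀ l ∈ specialBlocks A, l.length = n) →
    (∀ l ∈ specialBlocks (splitBlocks A), l.length = 1) ∧
      (specialBlocks (splitBlocks A)).length = n * (specialBlocks A).length
  | [], _ => by simp [splitBlocks, specialBlocks]
  | Piece.plain b :: A, h => by
      simpa [splitBlocks, specialBlocks] using length_splitBlocks A h
  | Piece.block l :: A, h => by
      simp only [specialBlocks, List.mem_cons, forall_eq_or_imp] at h
      obtain ⟨h1, h2⟩ := length_splitBlocks A h.2
      have key : ∀ l : List Symb, specialBlocks (l.map (fun a => Piece.block [a]) :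
          List (Piece Symb)) = l.map (fun a => [a]) := by
        intro l
        induction l with
        | nil => rfl
        | cons a l ih => simp [specialBlocks, ih]
      simp only [splitBlocks, specialBlocks, specialBlocks_append, key, List.mem_append,
        List.mem_map, List.length_append, List.length_map, List.length_cons]
      refine ⟨?_, by rw [h.1, h2]; ring⟩
      rintro l' (⟨a, -, rfl⟩ | h')
      · rfl
      · exact h1 l' h'

theorem length_mem_insertGlobals {m : ℕ} (A : List (Piece Symb)) (gs : List Symb)
    (h : ∀ l ∈ specialBlocks A, l.length = m) (hl : (specialBlocks A).length = gs.length) :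
    ∀ l ∈ specialBlocks (insertGlobals A gs), l.length = m + 1 := by
  rw [specialBlocks_insertGlobals A gs hl]
  intro l hl
  obtain ⟨i, hi, rfl⟩ := List.getElem_of_mem hl
  simp [h _ (List.getElem_mem _)]

theorem length_mem_shuffleFrom {m : ℕ} (A : List (Piece Symb))
    (h : ∀ l ∈ specialBlocks A, l.length = m) : ∀ (B : List (Piece Symb)) (i : ℕ),
    (∀ l ∈ specialBlocks B, l.length = (specialBlocks A).length) →
    ∀ l ∈ specialBlocks (shuffleFrom A i B), l.length = m + 1
  | [], i, _ => by simp [shuffleFrom, specialBlocks]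
  | Piece.plain b :: B, i, hB => by
      simpa [shuffleFrom, specialBlocks] using length_mem_shuffleFrom A h B i hB
  | Piece.block l :: B, i, hB => by
      simp only [specialBlocks, List.mem_cons, forall_eq_or_imp] at hB
      simp only [shuffleFrom, specialBlocks_append, specialBlocks_map_plain, List.append_nil,
        List.mem_append]
      rintro l' (hl | hl)
      · refine length_mem_insertGlobals _ _ ?_ (by simp [hB.1]) l' hl
        intro l'' hl''
        simp only [specialBlocks_renamePieces, List.mem_map] at hl''
        obtain ⟨l3, h3, rfl⟩ := hl''
        simp [h l3 h3]
      · exact length_mem_shuffleFrom A h B (i + 1) hB.2 l' hl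

/-- The number of special blocks of `S_k(m)`. -/
def blockCount (k m : ℕ) : ℕ := (specialBlocks (hartSharir k m)).length

theorem hartSharir_step (k m : ℕ) (hm : 1 ≤ m) : hartSharir (k + 2) (m + 1) =
    shuffle (hartSharir (k + 2) m) (hartSharir (k + 1) (blockCount (k + 2) m)) := by
  obtain ⟨m, rfl⟩ := Nat.exists_eq_add_of_le' hm
  rfl

/-- The uniform block length makes the lengths match in every shuffle: the blocks of `S_{k-1}(N)`
have as many symbols as the first factor has blocks. -/
theorem hartSharir_blocks : ∀ k m : ℕ, 1 ≤ k → 1 ≤ m →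
    (∀ l ∈ specialBlocks (hartSharir k m), l.length = m) ∧ 1 ≤ blockCount k m ∧
      BlockGood [] (hartSharir k m)
  | 0, _, h, _ => by omega
  | _, 0, _, h => by omega
  | 1, m + 1, _, _ => by
      have h1 : ∀ l : List ℕ, l.map (fun j => Piece.plain (Symb.atom j)) =
            (l.map Symb.atom).map Piece.plain := fun l => by simp [Function.comp_def]
      simp only [blockCount, hartSharir, hartSharirOne, h1, specialBlocks,
        specialBlocks_map_plain, BlockGood, word_map_plain]
      refine ⟨by simp, by simp, ?_, blockGood_map_plain _ _⟩
      have h2 : List.range' 1 (m + 1) = List.range' 1 m ++ [m + 1] := by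
        rw [List.range'_concat]; simp [Nat.add_comm]
      have h3 : (List.range' 1 (m + 1)).tail = List.range' 2 m := by
        rw [List.range'_succ]; rfl
      rw [List.append_nil, ← List.map_tail, h3, h2]
      simp
  | k + 2, 1, _, _ => by
      obtain ⟨h1, h2, h3⟩ := hartSharir_blocks (k + 1) 2 (by omega) (by omega)
      obtain ⟨h4, h5⟩ := length_splitBlocks _ h1
      refine ⟨h4, ?_, blockGood_splitBlocks _⟩
      simp only [blockCount] at h2 ⊢
      simp only [hartSharir, hartSharirNext] at h2 h5 ⊢
      omega
  | k + 2, m + 2, _, _ => by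
      obtain ⟨h1, h2, h3⟩ := hartSharir_blocks (k + 2) (m + 1) (by omega) (by omega)
      obtain ⟨h4, h5, h6⟩ := hartSharir_blocks (k + 1) (blockCount (k + 2) (m + 1)) (by omega) h2
      rw [blockCount, hartSharir_step k (m + 1) (by omega)]
      refine ⟨length_mem_shuffleFrom _ h1 _ _ h4, ?_, ?_⟩
      · rw [shuffle, length_specialBlocks_shuffleFrom]
        exact Nat.mul_pos h5 h2
      · refine blockGood_shuffleFrom ?_ h3 _ _ h6 h4
        intro l hl h
        have := h1 l hl
        simp [h] at this
termination_by k m => (k, m)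

/-! ### Growth and divisibility of the block counts -/

theorem blockCount_step (k m : ℕ) (hm : 1 ≤ m) : blockCount (k + 2) (m + 1) =
    blockCount (k + 1) (blockCount (k + 2) m) * blockCount (k + 2) m := by
  rw [blockCount, hartSharir_step k m hm, shuffle, length_specialBlocks_shuffleFrom]
  rfl

theorem blockCount_pos {k m : ℕ} (hk : 1 ≤ k) (hm : 1 ≤ m) : 1 ≤ blockCount k m :=
  (hartSharir_blocks k m hk hm).2.1

theorem two_le_blockCount {k m : ℕ} (hk : 2 ≤ k) (hm : 1 ≤ m) : 2 ≤ blockCount k m := by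
  obtain ⟨k, rfl⟩ := Nat.exists_eq_add_of_le' hk
  induction m, hm using Nat.le_induction with
  | base =>
    obtain ⟨h1, h2, h3⟩ := hartSharir_blocks (k + 1) 2 (by omega) (by omega)
    obtain ⟨h4, h5⟩ := length_splitBlocks _ h1
    simp only [blockCount] at h2 ⊢
    simp only [hartSharir, hartSharirNext] at h2 h5 ⊢
    omega
  | succ m hm ih =>
    rw [blockCount_step k m hm]
    have := blockCount_pos (k := k + 1) (m := blockCount (k + 2) m) (by omega) (by omega)
    nlinarith

theorem two_mul_blockCount_le {k m : ℕ} (hk : 3 ≤ k) (hm : 1 ≤ m) :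
    2 * blockCount k m ≤ blockCount k (m + 1) := by
  obtain ⟨k, rfl⟩ := Nat.exists_eq_add_of_le' hk
  rw [show k + 3 = (k + 1) + 2 from rfl, blockCount_step (k + 1) m hm]
  have := two_le_blockCount (k := k + 1 + 1) (m := blockCount (k + 1 + 2) m) (by omega)
    (blockCount_pos (by omega) hm)
  exact Nat.mul_le_mul_right _ this

theorem blockCount_strictMono {k m n : ℕ} (hk : 3 ≤ k) (hm : 1 ≤ m) (hmn : m < n) :
    blockCount k m < blockCount k n := by
  induction n, hmn using Nat.le_induction with
  | base =>
    have := two_mul_blockCount_le hk hm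
    have := blockCount_pos (k := k) (by omega) hm
    show blockCount k m < blockCount k (m + 1)
    omega
  | succ n hn ih =>
    have := two_mul_blockCount_le (k := k) (m := n) hk (by omega)
    omega

theorem blockCount_mono {k m n : ℕ} (hk : 3 ≤ k) (hm : 1 ≤ m) (hmn : m ≤ n) :
    blockCount k m ≤ blockCount k n := by
  rcases hmn.eq_or_lt with rfl | h
  · exact le_rfl
  · exact (blockCount_strictMono hk hm h).le

/-- By divisibility, the copies of `S_k(m)` nested in `S_k(n)` occupy runs of consecutive blocks
that start at the multiples of `blockCount k m`. -/
theorem blockCount_dvd {k m n : ℕ} (hk : 2 ≤ k) (hm : 1 ≤ m) (hmn : m ≤ n) :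
    blockCount k m ∣ blockCount k n := by
  obtain ⟨k, rfl⟩ := Nat.exists_eq_add_of_le' hk
  induction n, hmn using Nat.le_induction with
  | base => exact dvd_rfl
  | succ n hn ih =>
    rw [blockCount_step k n (by omega)]
    exact ih.mul_left _

theorem le_blockCount {k m : ℕ} (hk : 3 ≤ k) (hm : 1 ≤ m) : m + 1 ≤ blockCount k m := by
  induction m, hm using Nat.le_induction with
  | base => exact two_le_blockCount (by omega) le_rfl
  | succ m hm ih =>
    have := two_mul_blockCount_le hk hm
    omega


/-! ## Timed words -/

/-- A word with special blocks, in which every entry carries a time. -/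
abbrev TimedWord := List (List (Symb × ℝ) ⊕ (Symb × ℝ))

namespace TimedWord

/-- Forget the times. -/
def shape : TimedWord → List (Piece Symb)
  | [] => []
  | Sum.inl l :: W => Piece.block (l.map Prod.fst) :: shape W
  | Sum.inr x :: W => Piece.plain x.1 :: shape W

/-- The list of all the entries. -/
def entries : TimedWord → List (Symb × ℝ)
  | [] => []
  | Sum.inl l :: W => l ++ entries W
  | Sum.inr x :: W => x :: entries W

/-- The list of the special blocks. -/
def blocks : TimedWord → List (List (Symb × ℝ))
  | [] => []
  | Sum.inl l :: W => l :: blocks W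
  | Sum.inr _ :: W => blocks W

/-- The times increase. -/
def Sorted (W : TimedWord) : Prop := (entries W).Pairwise (fun x y => x.2 < y.2)

theorem entries_append (W W' : TimedWord) : entries (W ++ W') = entries W ++ entries W' := by
  induction W with
  | nil => rfl
  | cons p W ih => cases p <;> simp [entries, ih]

theorem blocks_append (W W' : TimedWord) : blocks (W ++ W') = blocks W ++ blocks W' := by
  induction W with
  | nil => rfl
  | cons p W ih => cases p <;> simp [blocks, ih]

theorem map_entries (W : TimedWord) : (entries W).map Prod.fst = word (shape W) := by
  induction W with
  | nil => rfl
  | cons p W ih => cases p <;> simp [entries, shape, word, ih]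

theorem map_blocks (W : TimedWord) :
    (blocks W).map (List.map Prod.fst) = specialBlocks (shape W) := by
  induction W with
  | nil => rfl
  | cons p W ih => cases p <;> simp [blocks, shape, specialBlocks, ih]

theorem flatten_blocks_sublist (W : TimedWord) : (blocks W).flatten.Sublist (entries W) := by
  induction W with
  | nil => simp [blocks]
  | cons p W ih =>
    cases p with
    | inl l => simpa [blocks, entries] using ih
    | inr x => simpa [blocks, entries] using ih.cons x

theorem length_blocks (W : TimedWord) : (blocks W).length = (specialBlocks (shape W)).length := by
  rw [← map_blocks, List.length_map]

theorem shape_eq_append : ∀ {W : TimedWord} {A B : List (Piece Symb)}, shape W = A ++ B →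
    ∃ W₁ W₂, W = W₁ ++ W₂ ∧ shape W₁ = A ∧ shape W₂ = B
  | W, [], B, h => ⟨[], W, rfl, rfl, h⟩
  | [], p :: A, B, h => by simp [shape] at h
  | Sum.inl l :: W, p :: A, B, h => by
      simp only [shape, List.cons_append, List.cons.injEq] at h
      obtain ⟨W₁, W₂, rfl, h1, h2⟩ := shape_eq_append h.2
      exact ⟨Sum.inl l :: W₁, W₂, rfl, by simp [shape, h.1, h1], h2⟩
  | Sum.inr l :: W, p :: A, B, h => by
      simp only [shape, List.cons_append, List.cons.injEq] at h
      obtain ⟨W₁, W₂, rfl, h1, h2⟩ := shape_eq_append h.2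
      exact ⟨Sum.inr l :: W₁, W₂, rfl, by simp [shape, h.1, h1], h2⟩

/-- Rename the symbol of an entry. -/
def ren (f : Symb → Symb) (x : Symb × ℝ) : Symb × ℝ := (f x.1, x.2)

theorem ren_eq (f : Symb → Symb) (x : Symb) (t : ℝ) : ren f (x, t) = (f x, t) := rfl

/-- `u'` arises from `u` by delaying the last entry from a time before `g` to a time after `g`. -/
def Delayed (u u' : List (Symb × ℝ)) (g : ℝ) : Prop :=
  ∃ v x t t', u = v ++ [(x, t)] ∧ u' = v ++ [(x, t')] ∧ t < g ∧ g < t'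

/-- The last local entry of each block occurs twice, just before and just after the inserted global.
`U` takes the first occurrence and `U'` the second; all other entries of `U` and `U'` are the same.
-/
theorem exists_of_shape_eq_insertGlobals (i : ℕ) : ∀ (A : List (Piece Symb)) (gs : List Symb)
    (W : TimedWord), shape W = insertGlobals (renamePieces (Symb.loc i) (Symb.loc i) A)
      (gs.map Symb.glob) → (∀ l ∈ specialBlocks A, l ≠ []) →
    (specialBlocks A).length = gs.length → Sorted W →
    ∃ (U U' : TimedWord) (G : List (Symb × ℝ)), shape U = A ∧ shape U' = A ∧ G.map Prod.fst = gs ∧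
      ((entries U).map (ren (Symb.loc i))).Sublist (entries W) ∧
      ((entries U').map (ren (Symb.loc i))).Sublist (entries W) ∧
      (G.map (ren Symb.glob)).Sublist (entries W) ∧
      ∀ j < gs.length,
        (blocks W).getD j [] = ((blocks U).getD j []).map (ren (Symb.loc i)) ++
          [ren Symb.glob (G.getD j (Symb.atom 0, 0))] ∧
        Delayed ((blocks U).getD j []) ((blocks U').getD j []) (G.getD j (Symb.atom 0, 0)).2
  | [], gs, W, h, h0, hl, hs => by
      have : gs = [] := by simpa [specialBlocks] using hl.symm
      subst this
      exact ⟨[], [], [], rfl, rfl, rfl, by simp [entries], by simp [entries], by simp, by simp⟩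
  | Piece.plain b :: A, gs, W, h, h0, hl, hs => by
      rcases W with _ | ⟨l | x, W⟩
      · simp [shape, renamePieces, insertGlobals] at h
      · simp [shape, renamePieces, insertGlobals] at h
      · simp only [shape, renamePieces, insertGlobals, List.cons.injEq, Piece.plain.injEq] at h
        obtain ⟨U, U', G, h1, h2, h3, h4, h5, h6, h7⟩ :=
          exists_of_shape_eq_insertGlobals i A gs W h.2 h0 hl (List.Pairwise.of_cons hs)
        have hx : x = ren (Symb.loc i) (b, x.2) := by rw [ren_eq, ← h.1]
        refine ⟨Sum.inr (b, x.2) :: U, Sum.inr (b, x.2) :: U', G, by simp [shape, h1],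
          by simp [shape, h2], h3, ?_, ?_, h6.cons x, h7⟩
        · simp only [entries, List.map_cons, ← hx]; exact h4.cons_cons x
        · simp only [entries, List.map_cons, ← hx]; exact h5.cons_cons x
  | Piece.block l :: A, [], W, h, h0, hl, hs => by simp [specialBlocks] at hl
  | Piece.block l :: A, g :: gs, W, h, h0, hl, hs => by
      simp only [specialBlocks, List.mem_cons, forall_eq_or_imp, List.length_cons,
        Nat.add_right_cancel_iff] at h0 hl
      rcases List.eq_nil_or_concat l with rfl | ⟨l', y, rfl⟩
      · exact absurd rfl h0.1
      rcases W with _ | ⟨w | x, W⟩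
      · simp [shape, renamePieces, insertGlobals] at h
      swap
      · simp [shape, renamePieces, insertGlobals] at h
      simp only [shape, renamePieces, insertGlobals, List.cons.injEq, Piece.block.injEq,
        List.map_cons, List.concat_eq_append, List.map_append, List.map_nil,
        List.getLast?_append, List.getLast?_singleton, Option.some_or, Option.toList_some,
        List.singleton_append] at h
      obtain ⟨hw, h⟩ := h
      rcases W with _ | ⟨w' | x, W⟩
      · simp [shape] at h
      · simp [shape] at h
      simp only [shape, List.cons.injEq, Piece.plain.injEq] at h
      obtain ⟨hx, h⟩ := h
      simp only [Sorted, entries] at hs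
      obtain ⟨U, U', G, h1, h2, h3, h4, h5, h6, h7⟩ :=
        exists_of_shape_eq_insertGlobals i A gs W h h0.2 hl
          (hs.sublist ((List.sublist_cons_self _ _).trans (List.sublist_append_right _ _)))
      obtain ⟨w1, w2, rfl, hw1, hw2⟩ := List.map_eq_append_iff.1 hw
      obtain ⟨w0, wy, rfl, hw0, hwy⟩ := List.map_eq_append_iff.1 hw1
      obtain ⟨⟨gx, tg⟩, rfl⟩ : ∃ e, w2 = [e] := List.length_eq_one_iff.1 (by
        simpa using congrArg List.length hw2)
      obtain ⟨⟨yx, ty⟩, rfl⟩ : ∃ e, wy = [e] := List.length_eq_one_iff.1 (by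
        simpa using congrArg List.length hwy)
      obtain ⟨xx, tx⟩ := x
      simp only [List.map_cons, List.map_nil, List.cons.injEq, and_true] at hw2 hwy hx
      subst hw2 hwy hx
      -- The renaming is undone entry by entry, with the times kept.
      obtain ⟨v, hv, hvl⟩ : ∃ v : List (Symb × ℝ), v.map (ren (Symb.loc i)) = w0 ∧
          v.map Prod.fst = l' := by
        refine ⟨List.zipWith (fun a e => (a, e.2)) l' w0, ?_, ?_⟩
        · have hlen : l'.length = w0.length := by simpa using (congrArg List.length hw0).symm
          apply List.ext_getElem
          · simp [hlen]
          · intro n hn1 hn2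
            have hn3 : n < l'.length := by simp at hn1; omega
            have : (w0.map Prod.fst)[n]'(by simpa using hn2) =
                (l'.map (Symb.loc i))[n]'(by simpa using hn3) := by simp only [hw0]
            simp at this
            simp only [List.getElem_map, List.getElem_zipWith, ren]
            rw [← this]
        · have hlen : l'.length = w0.length := by simpa using (congrArg List.length hw0).symm
          apply List.ext_getElem <;> simp [hlen]
      subst hv
      refine ⟨Sum.inl (v ++ [(y, ty)]) :: U, Sum.inl (v ++ [(y, tx)]) :: U', (g, tg) :: G,
        by simp [shape, h1, hvl], by simp [shape, h2, hvl], by simp [h3], ?_, ?_, ?_, ?_⟩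
      · simp only [entries, List.map_append, List.map_cons, List.map_nil, ren_eq]
        exact (List.sublist_append_left _ _).append (h4.cons _)
      · simp only [entries, List.map_append, List.map_cons, ren_eq, List.append_assoc,
          List.singleton_append]
        exact (List.Sublist.refl _).append (((h5.cons_cons _).cons _).cons _)
      · simp only [entries, List.map_cons, ren_eq, List.append_assoc, List.singleton_append]
        exact ((((h6.cons _).cons_cons _).cons _).trans (List.sublist_append_right _ _))
      · intro j hj
        rcases j with _ | j
        · simp only [blocks, List.getD_cons_zero, List.map_append, List.map_cons, List.map_nil,
            ren_eq, true_and]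
          refine ⟨v, y, ty, tx, rfl, rfl, ?_, ?_⟩
          · rw [List.append_assoc, List.append_assoc] at hs
            have := (List.pairwise_append.1 hs).2.1
            simp only [List.singleton_append, List.pairwise_cons] at this
            exact this.1 (Symb.glob g, tg) (by simp)
          · rw [List.append_assoc, List.append_assoc] at hs
            have := (List.pairwise_append.1 hs).2.1
            simp only [List.singleton_append, List.pairwise_cons] at this
            exact this.2.1 (Symb.loc i y, tx) (by simp)
        · simpa [blocks] using h7 j (by simpa using hj)

/-- For the globals the repeated entry is the one placed after the copy: `V` takes the globals where
they were inserted, `V'` moves the last one of each block to its repetition at time `D`. This `D`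
separates the `p`-th copy from all later ones. -/
theorem exists_of_shape_eq_shuffleFrom (A : List (Piece Symb))
    (h0 : ∀ l ∈ specialBlocks A, l ≠ []) (hA : specialBlocks A ≠ []) :
    ∀ (B : List (Piece Symb)) (i : ℕ) (W : TimedWord), shape W = shuffleFrom A i B →
    (∀ l ∈ specialBlocks B, l.length = (specialBlocks A).length) → Sorted W →
    ∃ (V V' : TimedWord) (U U' : ℕ → TimedWord), shape V = B ∧ shape V' = B ∧
      ((entries V).map (ren Symb.glob)).Sublist (entries W) ∧
      ((entries V').map (ren Symb.glob)).Sublist (entries W) ∧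
      ∀ p < (specialBlocks B).length, shape (U p) = A ∧ shape (U' p) = A ∧
        ((entries (U p)).map (ren (Symb.loc (i + p)))).Sublist (entries W) ∧
        ((entries (U' p)).map (ren (Symb.loc (i + p)))).Sublist (entries W) ∧
        (∀ j < (specialBlocks A).length,
          (blocks W).getD (p * (specialBlocks A).length + j) [] =
            ((blocks (U p)).getD j []).map (ren (Symb.loc (i + p))) ++
              [ren Symb.glob (((blocks V).getD p []).getD j (Symb.atom 0, 0))] ∧
          Delayed ((blocks (U p)).getD j []) ((blocks (U' p)).getD j [])
            (((blocks V).getD p []).getD j (Symb.atom 0, 0)).2) ∧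
        ∃ v x t D, (blocks V).getD p [] = v ++ [(x, t)] ∧ (blocks V').getD p [] = v ++ [(x, D)] ∧
          t < D ∧ (∀ e ∈ entries (U p), e.2 < D) ∧ (∀ e ∈ entries (U' p), e.2 < D) ∧
          ∀ p' < (specialBlocks B).length, p < p' → ∀ e ∈ entries (U p'), D < e.2
  | [], i, W, h, hB, hs =>
      ⟨[], [], fun _ => [], fun _ => [], rfl, rfl, by simp [entries], by simp [entries],
        by simp [specialBlocks]⟩
  | Piece.plain b :: B, i, W, h, hB, hs => by
      rcases W with _ | ⟨l | x, W⟩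
      · simp [shape, shuffleFrom] at h
      · simp [shape, shuffleFrom] at h
      · simp only [shape, shuffleFrom, List.cons.injEq, Piece.plain.injEq] at h
        obtain ⟨V, V', U, U', h1, h2, h3, h4, h5⟩ :=
          exists_of_shape_eq_shuffleFrom A h0 hA B i W h.2 hB (List.Pairwise.of_cons hs)
        have hx : x = ren Symb.glob (b, x.2) := by rw [ren_eq, ← h.1]
        refine ⟨Sum.inr (b, x.2) :: V, Sum.inr (b, x.2) :: V', U, U', by simp [shape, h1],
          by simp [shape, h2], ?_, ?_, ?_⟩
        · simp only [entries, List.map_cons, ← hx]; exact h3.cons_cons x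
        · simp only [entries, List.map_cons, ← hx]; exact h4.cons_cons x
        · intro p hp
          obtain ⟨k1, k2, k3, k4, k5, k6⟩ := h5 p hp
          exact ⟨k1, k2, k3.cons x, k4.cons x, k5, k6⟩
  | Piece.block l :: B, i, W, h, hB, hs => by
      simp only [specialBlocks, List.mem_cons, forall_eq_or_imp] at hB
      simp only [shuffleFrom] at h
      obtain ⟨W12, W3, rfl, h12, h3⟩ := shape_eq_append h
      obtain ⟨W1, W2, rfl, h1, h2⟩ := shape_eq_append h12
      have hs3 := hs
      simp only [Sorted, entries_append] at hs3
      have hs3' := List.pairwise_append.1 hs3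
      have hs12 := List.pairwise_append.1 hs3'.1
      obtain ⟨Uf, Uf', G, a1, a2, a3, a4, a5, a6, a7⟩ :=
        exists_of_shape_eq_insertGlobals i A l W1 h1 h0 hB.1.symm hs12.1
      obtain ⟨V, V', U, U', b1, b2, b3, b4, b5⟩ :=
        exists_of_shape_eq_shuffleFrom A h0 hA B (i + 1) W3 h3 hB.2 hs3'.2.1
      rcases List.eq_nil_or_concat l with rfl | ⟨l', y, rfl⟩
      · exact absurd (List.length_eq_zero_iff.1 hB.1.symm) hA
      have hG : ∃ G0 t, G = G0 ++ [(y, t)] ∧ G0.map Prod.fst = l' := by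
        simp only [List.concat_eq_append] at a3
        obtain ⟨G0, G1, rfl, c1, c2⟩ := List.map_eq_append_iff.1 a3
        obtain ⟨⟨gx, tg⟩, rfl⟩ : ∃ e, G1 = [e] := List.length_eq_one_iff.1 (by
          simpa using congrArg List.length c2)
        simp at c2
        subst c2
        exact ⟨G0, tg, rfl, c1⟩
      obtain ⟨G0, t, rfl, hG0⟩ := hG
      have hW2 : ∃ D, W2 = [Sum.inr (Symb.glob y, D)] := by
        simp at h2
        rcases W2 with _ | ⟨w | ⟨x, D⟩, W2⟩
        · simp [shape] at h2
        · simp [shape] at h2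
        · simp only [shape, List.cons.injEq, Piece.plain.injEq] at h2
          rcases W2 with _ | ⟨w | x, W2⟩
          · exact ⟨D, by rw [h2.1]⟩
          · simp [shape] at h2
          · simp [shape] at h2
      obtain ⟨D, rfl⟩ := hW2
      have hlt1 : ∀ e ∈ entries W1, e.2 < D := fun e he =>
        hs12.2.2 e he (Symb.glob y, D) (by simp [entries])
      have hlt3 : ∀ e ∈ entries W3, D < e.2 := fun e he =>
        hs3'.2.2 (Symb.glob y, D) (by simp [entries]) e he
      have hb1 : (blocks W1).length = (specialBlocks A).length := by
        rw [length_blocks, h1, length_specialBlocks_insertGlobals, specialBlocks_renamePieces,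
          List.length_map]
      refine ⟨Sum.inl (G0 ++ [(y, t)]) :: V, Sum.inl (G0 ++ [(y, D)]) :: V',
        fun p => if p = 0 then Uf else U (p - 1), fun p => if p = 0 then Uf' else U' (p - 1),
        by simp [shape, b1, hG0], by simp [shape, b2, hG0], ?_, ?_, ?_⟩
      · simp only [entries, entries_append, List.map_append]
        simp only [List.map_append] at a6
        exact List.Sublist.append (a6.trans (List.sublist_append_left _ _)) b3
      · simp only [entries, entries_append, List.map_append] at a6 ⊢
        refine List.Sublist.append (List.Sublist.append
          ((List.sublist_append_left _ _).trans a6) (by simp [ren])) b4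
      · intro p hp
        rcases p with _ | p
        · simp only [if_true]
          refine ⟨a1, a2, ?_, ?_, ?_, G0, y, t, D, rfl, rfl, ?_, ?_, ?_, ?_⟩
          · simp only [entries_append, List.append_assoc]
            exact a4.trans (List.sublist_append_left _ _)
          · simp only [entries_append, List.append_assoc]
            exact a5.trans (List.sublist_append_left _ _)
          · intro j hj
            obtain ⟨c1, c2⟩ := a7 j (by rw [← hB.1] at hj; exact hj)
            simp only [blocks_append, List.append_assoc, Nat.zero_mul, Nat.zero_add]
            rw [List.getD_append _ _ _ _ (by rw [hb1]; exact hj)]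
            exact ⟨c1, c2⟩
          · exact hlt1 _ (a6.subset (by simp [ren]) : (Symb.glob y, t) ∈ entries W1)
          · intro e he
            exact hlt1 (ren _ e) (a4.subset (List.mem_map_of_mem he))
          · intro e he
            exact hlt1 (ren _ e) (a5.subset (List.mem_map_of_mem he))
          · intro p' hp' hpp e he
            rcases p' with _ | p'
            · omega
            · simp only [Nat.add_eq_zero_iff, one_ne_zero, and_false, if_false,
                Nat.add_sub_cancel] at he
              have := (b5 p' (by simpa [specialBlocks] using hp')).2.2.1
              exact hlt3 (ren _ e) (this.subset (List.mem_map_of_mem he))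
        · obtain ⟨k1, k2, k3, k4, k5, k6⟩ := b5 p (by simpa [specialBlocks] using hp)
          have hi : i + (p + 1) = i + 1 + p := by ring
          simp only [Nat.add_eq_zero_iff, one_ne_zero, and_false, if_false,
                Nat.add_sub_cancel, hi]
          refine ⟨k1, k2, ?_, ?_, ?_, ?_⟩
          · simp only [entries_append]
            exact k3.trans (List.sublist_append_right _ _)
          · simp only [entries_append]
            exact k4.trans (List.sublist_append_right _ _)
          · intro j hj
            obtain ⟨c1, c2⟩ := k5 j hj
            simp only [blocks_append, blocks, List.append_nil, List.getD_cons_succ]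
            rw [List.getD_append_right _ _ _ _ (by rw [hb1]; nlinarith), hb1,
              show (p + 1) * (specialBlocks A).length + j - (specialBlocks A).length =
                p * (specialBlocks A).length + j by
                  rw [Nat.add_mul, Nat.one_mul]; omega]
            exact ⟨c1, c2⟩
          · obtain ⟨v, x, t', D', d1, d2, d3, d4, d5, d6⟩ := k6
            refine ⟨v, x, t', D', d1, d2, d3, d4, d5, ?_⟩
            intro p' hp' hpp e he
            rcases p' with _ | p'
            · omega
            · simp only [Nat.add_eq_zero_iff, one_ne_zero, and_false, if_false,
                Nat.add_sub_cancel] at he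
              exact d6 p' (by simpa [specialBlocks] using hp') (by omega) e he

end TimedWord


open TimedWord

/-! ## Times and endpoints -/

/-- `E` is a set of pairs (segment, time of a visit), and `l` and `r` are the times of the
left and right endpoints; these are the order relations forced by the visits. -/
structure GoodTimes (l r : Symb → ℝ) (E : Set (Symb × ℝ)) : Prop where
  mem : ∀ a t, (a, t) ∈ E → l a < t ∧ t < r a
  alt : ∀ a b t₁ t₂ t₃ t₄, a ≠ b → (a, t₁) ∈ E → (b, t₂) ∈ E → (a, t₃) ∈ E → (b, t₄) ∈ E →
    t₁ < t₂ → t₂ < t₃ → t₃ < t₄ → t₁ < l b ∧ r a < t₄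

theorem GoodTimes.comp {l r : Symb → ℝ} {E E' : Set (Symb × ℝ)} (h : GoodTimes l r E)
    (f : Symb → Symb) (hf : Function.Injective f) (hE : ∀ e ∈ E', ren f e ∈ E) :
    GoodTimes (l ∘ f) (r ∘ f) E' where
  mem _ _ ha := h.mem _ _ (hE _ ha)
  alt _ _ _ _ _ _ hab h1 h2 h3 h4 :=
    h.alt _ _ _ _ _ _ (hf.ne hab) (hE _ h1) (hE _ h2) (hE _ h3) (hE _ h4)

/-- The visits contain the pattern `a b c b a b c`. -/
def ZigZag (E : Set (Symb × ℝ)) (a b c : Symb) : Prop :=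
  ∃ Q : List (Symb × ℝ), (∀ e ∈ Q, e ∈ E) ∧ Q.map Prod.fst = [a, b, c, b, a, b, c] ∧
    Q.Pairwise (fun x y => x.2 < y.2)

theorem ZigZag.map {E E' : Set (Symb × ℝ)} {a b c : Symb} (h : ZigZag E' a b c) (f : Symb → Symb)
    (hE : ∀ e ∈ E', ren f e ∈ E) : ZigZag E (f a) (f b) (f c) := by
  obtain ⟨Q, h1, h2, h3⟩ := h
  refine ⟨Q.map (ren f), ?_, ?_, ?_⟩
  · intro e he
    obtain ⟨e', he', rfl⟩ := List.mem_map.1 he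
    exact hE _ (h1 _ he')
  · rw [List.map_map, show Prod.fst ∘ ren f = f ∘ Prod.fst from rfl, ← List.map_map, h2]
    rfl
  · rw [List.pairwise_map]; exact h3

/-- The `i`-th symbol of the `q`-th special block of `S_k(m)`. -/
def hsSymb (k m q i : ℕ) : Symb :=
  ((specialBlocks (hartSharir k m)).getD q []).getD i (Symb.atom 0)

/-- The time of the `i`-th entry of the `q`-th special block. -/
def TimedWord.tm (W : TimedWord) (q i : ℕ) : ℝ :=
  (((blocks W).getD q []).getD i (Symb.atom 0, 0)).2

/-- `W` is a timed version of `S_k(m)`, compatible with the endpoints `l` and `r`. -/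
structure IsTimed (k m : ℕ) (l r : Symb → ℝ) (W : TimedWord) : Prop where
  shape_eq : shape W = hartSharir k m
  sorted : Sorted W
  good : GoodTimes l r {e | e ∈ entries W}

/-! ### Subsequences of the zigzag that follows a special block -/

section ListLemmas

variable {α : Type} {d : α}

theorem pair_sublist {l : List α} {i j : ℕ} (hij : i < j) (hj : j < l.length) :
    [l.getD i d, l.getD j d].Sublist l := by
  rw [← List.take_append_drop (i + 1) l]
  refine List.Sublist.append (l₁ := [_]) (r₁ := [_]) ?_ ?_
  · rw [List.singleton_sublist, List.take_append_drop, List.getD_eq_getElem _ _ (by omega)]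
    exact List.mem_take_iff_getElem.2 ⟨i, by omega, rfl⟩
  · rw [List.singleton_sublist, List.take_append_drop, List.getD_eq_getElem _ _ (by omega)]
    exact List.mem_drop_iff_getElem.2 ⟨j - (i + 1), by omega, by congr 1; omega⟩

theorem getD_mem {l : List α} {i : ℕ} (hi : i < l.length) : l.getD i d ∈ l := by
  rw [List.getD_eq_getElem _ _ hi]; exact List.getElem_mem _

theorem getD_dropLast {l : List α} {i : ℕ} (hi : i + 1 < l.length) :
    l.dropLast.getD i d = l.getD i d := by
  rw [List.getD_eq_getElem _ _ (by simp; omega), List.getD_eq_getElem _ _ (by omega)]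
  simp

theorem getD_tail {l : List α} {i : ℕ} (hi : i + 1 < l.length) :
    l.tail.getD i d = l.getD (i + 1) d := by
  rw [List.getD_eq_getElem _ _ (by simp; omega), List.getD_eq_getElem _ _ (by omega)]
  simp

theorem zigzag_one {l : List α} {i : ℕ} (hi : i < l.length) (h2 : 2 ≤ l.length) :
    [l.getD i d].Sublist (l.dropLast.reverse ++ l.tail) := by
  rw [List.singleton_sublist, List.mem_append]
  by_cases h : i + 1 < l.length
  · left
    rw [List.mem_reverse, ← getD_dropLast h]
    exact getD_mem (by simp; omega)
  · right
    obtain ⟨j, rfl⟩ : ∃ j, i = j + 1 := ⟨i - 1, by omega⟩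
    rw [← getD_tail hi]
    exact getD_mem (by simp; omega)

theorem zigzag_two {l : List α} {i j : ℕ} (hij : i < j) (hj : j < l.length) :
    [l.getD i d, l.getD j d].Sublist (l.dropLast.reverse ++ l.tail) := by
  refine List.Sublist.append (l₁ := [_]) (r₁ := [_]) ?_ ?_
  · rw [List.singleton_sublist, List.mem_reverse, ← getD_dropLast (by omega)]
    exact getD_mem (by simp; omega)
  · obtain ⟨j, rfl⟩ : ∃ j', j = j' + 1 := ⟨j - 1, by omega⟩
    rw [List.singleton_sublist, ← getD_tail hj]
    exact getD_mem (by simp; omega)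

theorem zigzag_four {l : List α} {i j k : ℕ} (hij : i < j) (hjk : j < k) (hk : k < l.length) :
    [l.getD j d, l.getD i d, l.getD j d, l.getD k d].Sublist (l.dropLast.reverse ++ l.tail) := by
  refine List.Sublist.append (l₁ := [_, _]) (r₁ := [_, _]) ?_ ?_
  · have := (pair_sublist (d := d) (l := l.dropLast) hij (by simp; omega)).reverse
    rwa [getD_dropLast (by omega), getD_dropLast (by omega)] at this
  · obtain ⟨j, rfl⟩ : ∃ j', j = j' + 1 := ⟨j - 1, by omega⟩
    obtain ⟨k, rfl⟩ : ∃ j', k = j' + 1 := ⟨k - 1, by omega⟩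
    have := pair_sublist (d := d) (l := l.tail) (i := j) (j := k) (by omega) (by simp; omega)
    rwa [getD_tail (by omega), getD_tail (by omega)] at this

end ListLemmas

theorem FirstOcc.nodup_of_mem : ∀ {A : List (Piece Symb)} {P : List Symb}, FirstOcc P A →
    ∀ l ∈ specialBlocks A, l.Nodup
  | [], P, h => by simp [specialBlocks]
  | Piece.plain b :: A, P, h => by
      simpa [specialBlocks] using FirstOcc.nodup_of_mem (A := A) h
  | Piece.block l :: A, P, h => by
      simp only [specialBlocks, List.mem_cons, forall_eq_or_imp]
      exact ⟨h.1, FirstOcc.nodup_of_mem (A := A) h.2.2⟩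

theorem length_hartSharir_block {k m q : ℕ} (hk : 1 ≤ k) (hm : 1 ≤ m) (hq : q < blockCount k m) :
    ((specialBlocks (hartSharir k m)).getD q []).length = m :=
  (hartSharir_blocks k m hk hm).1 _ (getD_mem hq)

theorem hsSymb_ne {k m q i j : ℕ} (hk : 1 ≤ k) (hq : q < blockCount k m)
    (hij : i < j) (hj : j < m) : hsSymb k m q i ≠ hsSymb k m q j := by
  have h1 := length_hartSharir_block hk (by omega) hq
  have h2 := (hartSharir_firstOcc_ababaFree k m).1.nodup_of_mem _ (getD_mem (d := []) hq)
  have hi : i < ((specialBlocks (hartSharir k m)).getD q []).length := by omega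
  have hj' : j < ((specialBlocks (hartSharir k m)).getD q []).length := by omega
  rw [hsSymb, hsSymb, List.getD_eq_getElem _ _ hi, List.getD_eq_getElem _ _ hj']
  intro h
  have := (List.Nodup.getElem_inj_iff h2).1 h
  omega

/-- The timed form of `BlockGood`: the zigzag is realized by actual entries, all later than the
block. -/
theorem TimedWord.exists_after : ∀ (W : TimedWord) (q : ℕ), q < (blocks W).length →
    BlockGood [] (shape W) → Sorted W →
    ∃ Q : List (Symb × ℝ), Q.Sublist (entries W) ∧
      Q.map Prod.fst = (((blocks W).getD q []).map Prod.fst).dropLast.reverse ++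
        (((blocks W).getD q []).map Prod.fst).tail ∧
      ∀ b ∈ (blocks W).getD q [], ∀ e ∈ Q, b.2 < e.2
  | [], q, h, _, _ => by simp [blocks] at h
  | Sum.inr x :: W, q, h, h1, h2 => by
      obtain ⟨Q, h3, h4, h5⟩ := TimedWord.exists_after W q h h1 (List.Pairwise.of_cons h2)
      exact ⟨Q, h3.cons x, h4, h5⟩
  | Sum.inl l :: W, 0, h, h1, h2 => by
      simp only [shape, BlockGood, List.append_nil] at h1
      rw [← map_entries] at h1
      obtain ⟨Q, hQ, hQ'⟩ := List.sublist_map_iff.1 h1.1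
      refine ⟨Q, ?_, hQ'.symm, ?_⟩
      · simp only [entries]; exact hQ.trans (List.sublist_append_right _ _)
      · simp only [Sorted, entries] at h2
        intro b hb e he
        exact (List.pairwise_append.1 h2).2.2 b (by simpa [blocks] using hb) e (hQ.subset he)
  | Sum.inl l :: W, q + 1, h, h1, h2 => by
      simp only [Sorted, entries] at h2
      obtain ⟨Q, h3, h4, h5⟩ := TimedWord.exists_after W q (by simpa [blocks] using h) h1.2
        (List.pairwise_append.1 h2).2.1
      refine ⟨Q, ?_, by simpa [blocks] using h4, by simpa [blocks] using h5⟩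
      simp only [entries]; exact h3.trans (List.sublist_append_right _ _)

namespace IsTimed

variable {k m : ℕ} {l r : Symb → ℝ} {W : TimedWord}

theorem length_blocks (h : IsTimed k m l r W) : (blocks W).length = blockCount k m := by
  rw [TimedWord.length_blocks, h.shape_eq]; rfl

theorem map_block (h : IsTimed k m l r W) (q : ℕ) :
    ((blocks W).getD q []).map Prod.fst = (specialBlocks (hartSharir k m)).getD q [] := by
  rw [← h.shape_eq, ← map_blocks]
  exact (List.getD_map _ _ (List.map Prod.fst)).symm

theorem length_block (h : IsTimed k m l r W) (hk : 1 ≤ k) (hm : 1 ≤ m) {q : ℕ}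
    (hq : q < blockCount k m) : ((blocks W).getD q []).length = m := by
  rw [← length_hartSharir_block hk hm hq, ← h.map_block q, List.length_map]

theorem entry_eq (h : IsTimed k m l r W) (q i : ℕ) :
    ((blocks W).getD q []).getD i (Symb.atom 0, 0) = (hsSymb k m q i, tm W q i) := by
  refine Prod.ext ?_ rfl
  rw [hsSymb, ← h.map_block q, show Symb.atom 0 = Prod.fst (Symb.atom 0, (0 : ℝ)) from rfl,
    List.getD_map]

theorem mem_entries (h : IsTimed k m l r W) (hk : 1 ≤ k) {q i : ℕ}
    (hq : q < blockCount k m) (hi : i < m) : (hsSymb k m q i, tm W q i) ∈ entries W := by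
  rw [← h.entry_eq]
  refine (flatten_blocks_sublist W).subset (List.mem_flatten.2 ⟨(blocks W).getD q [], ?_, ?_⟩)
  · exact getD_mem (by rw [h.length_blocks]; exact hq)
  · exact getD_mem (by rw [h.length_block hk (by omega) hq]; exact hi)

theorem tm_lt_same (h : IsTimed k m l r W) (hk : 1 ≤ k) {q i j : ℕ}
    (hq : q < blockCount k m) (hij : i < j) (hj : j < m) : tm W q i < tm W q j := by
  have h1 := (List.pairwise_flatten.1 (h.sorted.sublist (flatten_blocks_sublist W))).1
    ((blocks W).getD q []) (getD_mem (by rw [h.length_blocks]; exact hq))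
  have h2 := h.length_block hk (by omega) hq
  have hi : i < ((blocks W).getD q []).length := by omega
  have hj' : j < ((blocks W).getD q []).length := by omega
  rw [tm, tm, List.getD_eq_getElem _ _ hi, List.getD_eq_getElem _ _ hj']
  exact List.pairwise_iff_getElem.1 h1 i j hi hj' hij

theorem tm_le_same (h : IsTimed k m l r W) (hk : 1 ≤ k) {q i j : ℕ}
    (hq : q < blockCount k m) (hij : i ≤ j) (hj : j < m) : tm W q i ≤ tm W q j := by
  rcases hij.eq_or_lt with rfl | h'
  · exact le_rfl
  · exact (h.tm_lt_same hk hq h' hj).le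

theorem tm_lt (h : IsTimed k m l r W) (hk : 1 ≤ k) {q q' i i' : ℕ}
    (hqq : q < q') (hq : q' < blockCount k m) (hi : i < m) (hi' : i' < m) :
    tm W q i < tm W q' i' := by
  have h1 := (List.pairwise_flatten.1 (h.sorted.sublist (flatten_blocks_sublist W))).2
  have h3 := h.length_blocks
  have h2 := List.pairwise_iff_getElem.1 h1 q q' (by omega) (by omega) hqq
  have h4 := h.length_block hk (by omega) (lt_trans hqq hq)
  have h5 := h.length_block hk (by omega) hq
  have h6 := h2 (((blocks W).getD q []).getD i (Symb.atom 0, 0)) (by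
      rw [← List.getD_eq_getElem _ []]; exact getD_mem (by omega))
    (((blocks W).getD q' []).getD i' (Symb.atom 0, 0)) (by
      rw [← List.getD_eq_getElem _ []]; exact getD_mem (by omega))
  exact h6

theorem after (h : IsTimed k m l r W) (hk : 1 ≤ k) (hm : 1 ≤ m) {q : ℕ} (hq : q < blockCount k m)
    {L : List Symb} (hL : L.Sublist (((specialBlocks (hartSharir k m)).getD q []).dropLast.reverse ++
      ((specialBlocks (hartSharir k m)).getD q []).tail)) :
    ∃ Q : List (Symb × ℝ), Q.Sublist (entries W) ∧ Q.map Prod.fst = L ∧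
      ∀ e ∈ Q, tm W q (m - 1) < e.2 := by
  obtain ⟨Q, h1, h2, h3⟩ := exists_after W q (by rw [h.length_blocks]; exact hq)
    (by rw [h.shape_eq]; exact (hartSharir_blocks k m hk hm).2.2) h.sorted
  rw [h.map_block q] at h2
  rw [← h2] at hL
  obtain ⟨Q', h4, h5⟩ := List.sublist_map_iff.1 hL
  refine ⟨Q', h4.trans h1, h5.symm, fun e he => ?_⟩
  have := h.length_block hk hm hq
  exact h3 (((blocks W).getD q []).getD (m - 1) (Symb.atom 0, 0)) (getD_mem (by omega)) e
    (h4.subset he)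

theorem left_lt (h : IsTimed k m l r W) (hk : 1 ≤ k) {q i : ℕ}
    (hq : q < blockCount k m) (hi : i < m) : l (hsSymb k m q i) < tm W q i :=
  (h.good.mem _ _ (h.mem_entries hk hq hi)).1

/-- Every symbol of a block occurs in the zigzag after it; for blocks of length 1 the zigzag is
empty, whence `2 ≤ m`. -/
theorem exists_later (h : IsTimed k m l r W) (hk : 1 ≤ k) (hm : 2 ≤ m) {q i : ℕ}
    (hq : q < blockCount k m) (hi : i < m) :
    ∃ t, (hsSymb k m q i, t) ∈ entries W ∧ tm W q (m - 1) < t := by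
  have hlen := length_hartSharir_block hk (by omega : 1 ≤ m) hq
  obtain ⟨Q, h1, h2, h3⟩ := h.after hk (by omega) hq (zigzag_one (d := Symb.atom 0)
    (by rw [hlen]; exact hi) (by rw [hlen]; exact hm))
  obtain ⟨⟨x, t⟩, rfl⟩ : ∃ e, Q = [e] := List.length_eq_one_iff.1 (by
    simpa using congrArg List.length h2)
  simp only [List.map_cons, List.map_nil, List.cons.injEq, and_true] at h2
  refine ⟨t, ?_, h3 (x, t) (by simp)⟩
  rw [hsSymb, ← h2]
  exact h1.subset (by simp)

theorem lt_right (h : IsTimed k m l r W) (hk : 1 ≤ k) (hm : 2 ≤ m) {q i : ℕ}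
    (hq : q < blockCount k m) (hi : i < m) : tm W q (m - 1) < r (hsSymb k m q i) := by
  obtain ⟨t, h1, h2⟩ := h.exists_later hk hm hq hi
  exact h2.trans (h.good.mem _ _ h1).2

/-- The block contains `x_i x_j` and the zigzag after it contains `x_i x_j` again; the rule for `a b
a b` in `GoodTimes` applies. -/
theorem block_lt (h : IsTimed k m l r W) (hk : 1 ≤ k) {q i j : ℕ}
    (hq : q < blockCount k m) (hij : i < j) (hj : j < m) :
    tm W q i < l (hsSymb k m q j) ∧ r (hsSymb k m q i) < r (hsSymb k m q j) := by
  have hlen := length_hartSharir_block hk (by omega : 1 ≤ m) hq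
  obtain ⟨Q, h1, h2, h3⟩ := h.after hk (by omega) hq (zigzag_two (d := Symb.atom 0)
    hij (by rw [hlen]; exact hj))
  obtain ⟨⟨x, t⟩, ⟨y, t'⟩, rfl⟩ : ∃ e e', Q = [e, e'] := List.length_eq_two.1 (by
    simpa using congrArg List.length h2)
  simp only [List.map_cons, List.map_nil, List.cons.injEq, and_true] at h2
  rw [show List.getD _ i _ = hsSymb k m q i from rfl, show List.getD _ j _ = hsSymb k m q j from rfl]
    at h2
  obtain ⟨rfl, rfl⟩ := h2
  have hs := h.sorted.sublist h1
  have := h.good.alt _ _ (tm W q i) (tm W q j) t t' (hsSymb_ne hk hq hij hj)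
    (h.mem_entries hk hq (by omega)) (h.mem_entries hk hq hj)
    (h1.subset (List.mem_cons_self ..))
    (h1.subset (List.mem_cons_of_mem _ (List.mem_cons_self ..))) (h.tm_lt_same hk hq hij hj)
    ((h.tm_le_same hk hq (by omega) (by omega)).trans_lt (h3 (_, t) (List.mem_cons_self ..)))
    (by simpa using hs)
  exact ⟨this.1, this.2.trans (h.good.mem _ t' (h1.subset
    (List.mem_cons_of_mem _ (List.mem_cons_self ..)))).2⟩

/-- `a b c` is read off the block itself and `b a b c` off the zigzag after it. -/
theorem zigZag (h : IsTimed k m l r W) (hk : 1 ≤ k) {q i j j' : ℕ}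
    (hq : q < blockCount k m) (hij : i < j) (hjj : j < j') (hj : j' < m) :
    ZigZag {e | e ∈ entries W} (hsSymb k m q i) (hsSymb k m q j) (hsSymb k m q j') := by
  have hlen := length_hartSharir_block hk (by omega : 1 ≤ m) hq
  obtain ⟨Q, h1, h2, h3⟩ := h.after hk (by omega) hq (zigzag_four (d := Symb.atom 0)
    hij hjj (by rw [hlen]; exact hj))
  refine ⟨[(hsSymb k m q i, tm W q i), (hsSymb k m q j, tm W q j), (hsSymb k m q j', tm W q j')] ++ Q,
    ?_, ?_, ?_⟩
  · simp only [List.mem_append, List.mem_cons, List.not_mem_nil, or_false, Set.mem_ofPred_eq]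
    rintro e ((rfl | rfl | rfl) | he)
    · exact h.mem_entries hk hq (by omega)
    · exact h.mem_entries hk hq (by omega)
    · exact h.mem_entries hk hq (by omega)
    · exact h1.subset he
  · simp only [List.map_append, h2]; rfl
  · refine List.pairwise_append.2 ⟨?_, h.sorted.sublist h1, ?_⟩
    · have e1 := h.tm_lt_same hk hq hij (by omega)
      have e2 := h.tm_lt_same hk hq hjj (by omega)
      simp [e1, e2, e1.trans e2]
    · simp only [List.mem_cons, List.not_mem_nil, or_false]
      rintro e (rfl | rfl | rfl) e' he'
      all_goals exact (h.tm_le_same hk hq (by omega) (by omega)).trans_lt (h3 e' he')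

end IsTimed



/-! ## The decomposition of timed words along a shuffle -/

theorem getD_map_append_of_lt {α β : Type} (f : α → β) (u : List α) (v : List β) (a : α) (b : β) {i : ℕ}
    (hi : i < u.length) : (u.map f ++ v).getD i b = f (u.getD i a) := by
  rw [List.getD_append _ _ _ _ (by rw [List.length_map]; exact hi),
    List.getD_eq_getElem (u.map f) _ (by rw [List.length_map]; exact hi), List.getElem_map,
    List.getD_eq_getElem u _ hi]

theorem getD_map_append_of_eq {α β : Type} (f : α → β) (u : List α) (x b : β) {i : ℕ}
    (hi : u.length = i) : (u.map f ++ [x]).getD i b = x := by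
  subst hi
  rw [List.getD_append_right _ _ _ _ (by rw [List.length_map]), List.length_map, Nat.sub_self,
    List.getD_cons_zero]

theorem specialBlocks_shuffleFrom_getD (A : List (Piece Symb)) : ∀ (B : List (Piece Symb)) (i p j : ℕ),
    (∀ l ∈ specialBlocks B, l.length = (specialBlocks A).length) →
    p < (specialBlocks B).length → j < (specialBlocks A).length →
    (specialBlocks (shuffleFrom A i B)).getD (p * (specialBlocks A).length + j) [] =
      ((specialBlocks A).getD j []).map (Symb.loc (i + p)) ++
        [Symb.glob (((specialBlocks B).getD p []).getD j (Symb.atom 0))]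
  | [], i, p, j, _, hp, _ => by simp [specialBlocks] at hp
  | Piece.plain b :: B, i, p, j, h, hp, hj => by
      simp only [shuffleFrom, specialBlocks] at h hp ⊢
      exact specialBlocks_shuffleFrom_getD A B i p j h hp hj
  | Piece.block l :: B, i, p, j, h, hp, hj => by
      simp only [specialBlocks, List.mem_cons, forall_eq_or_imp] at h
      simp only [shuffleFrom, specialBlocks, specialBlocks_append, specialBlocks_map_plain,
        List.append_nil]
      have hl : (specialBlocks (insertGlobals (renamePieces (Symb.loc i) (Symb.loc i) A)
          (l.map Symb.glob))).length = (specialBlocks A).length := by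
        rw [length_specialBlocks_insertGlobals, specialBlocks_renamePieces, List.length_map]
      rcases p with _ | p
      · rw [List.getD_append _ _ _ _ (by omega),
          specialBlocks_insertGlobals _ _ (by simp [h.1]), specialBlocks_renamePieces]
        have hj' : j < l.length := by rw [h.1]; exact hj
        rw [List.getD_eq_getElem _ _ (by simp; omega)]
        simp [List.getElem?_eq_getElem hj, List.getElem?_eq_getElem hj']
      · have e : (p + 1) * (specialBlocks A).length + j =
            (specialBlocks A).length + (p * (specialBlocks A).length + j) := by ring
        rw [List.getD_append_right _ _ _ _ (by rw [hl, e]; omega), hl, e, Nat.add_sub_cancel_left,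
          specialBlocks_shuffleFrom_getD A B (i + 1) p j h.2 (by simpa [specialBlocks] using hp) hj]
        simp [show i + 1 + p = i + (p + 1) by ring]

/-- The address formula behind all later computations: blocks are numbered `p * N + j`, and the
appended symbol ties block `j` of copy `p` to symbol number `j` of block `p` of the second factor.
-/
theorem hsSymb_block (k m p j : ℕ) (hm : 1 ≤ m)
    (hp : p < blockCount (k + 1) (blockCount (k + 2) m)) (hj : j < blockCount (k + 2) m) :
    (∀ i < m, hsSymb (k + 2) (m + 1) (p * blockCount (k + 2) m + j) i =
      Symb.loc p (hsSymb (k + 2) m j i)) ∧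
    hsSymb (k + 2) (m + 1) (p * blockCount (k + 2) m + j) m =
      Symb.glob (hsSymb (k + 1) (blockCount (k + 2) m) p j) := by
  have hlen := length_hartSharir_block (k := k + 2) (by omega) hm hj
  have hN := blockCount_pos (k := k + 2) (by omega) hm
  have key := specialBlocks_shuffleFrom_getD (hartSharir (k + 2) m)
    (hartSharir (k + 1) (blockCount (k + 2) m)) 0 p j
    (hartSharir_blocks (k + 1) _ (by omega) hN).1 hp hj
  rw [Nat.zero_add] at key
  constructor
  · intro i hi
    rw [hsSymb, hartSharir_step k m hm, shuffle]
    erw [key]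
    exact getD_map_append_of_lt _ _ _ _ _ (by rw [hlen]; exact hi)
  · rw [hsSymb, hartSharir_step k m hm, shuffle]
    erw [key]
    exact getD_map_append_of_eq _ _ _ _ hlen

/-- The timed words of which a timed version `W` of `S_k(m+1)` is composed: the second
factor, and the copies of the first factor, both with the original and with the duplicated
entries. Here `N` and `M` are the numbers of special blocks of the two factors. -/
structure Decomposition (k m N M : ℕ) (l r : Symb → ℝ) (W V V' : TimedWord)
    (U U' : ℕ → TimedWord) : Prop where
  timed_V : IsTimed (k + 1) N (l ∘ Symb.glob) (r ∘ Symb.glob) V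
  timed_V' : IsTimed (k + 1) N (l ∘ Symb.glob) (r ∘ Symb.glob) V'
  mem_V : ∀ e ∈ entries V, ren Symb.glob e ∈ entries W
  mem_V' : ∀ e ∈ entries V', ren Symb.glob e ∈ entries W
  timed_U : ∀ p < M, IsTimed (k + 2) m (l ∘ Symb.loc p) (r ∘ Symb.loc p) (U p)
  timed_U' : ∀ p < M, IsTimed (k + 2) m (l ∘ Symb.loc p) (r ∘ Symb.loc p) (U' p)
  mem_U : ∀ p < M, ∀ e ∈ entries (U p), ren (Symb.loc p) e ∈ entries W
  mem_U' : ∀ p < M, ∀ e ∈ entries (U' p), ren (Symb.loc p) e ∈ entries W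
  tm_loc : ∀ p < M, ∀ j < N, ∀ i < m, tm W (p * N + j) i = tm (U p) j i
  tm_glob : ∀ p < M, ∀ j < N, tm W (p * N + j) m = tm V p j
  tm_U' : ∀ p < M, ∀ j < N, ∀ i, i + 1 < m → tm (U' p) j i = tm (U p) j i
  tm_U_lt : ∀ p < M, ∀ j < N, tm (U p) j (m - 1) < tm V p j
  lt_tm_U' : ∀ p < M, ∀ j < N, tm V p j < tm (U' p) j (m - 1)
  tm_V_lt : ∀ p < M, tm V p (N - 1) < tm V' p (N - 1)
  entries_U'_lt : ∀ p < M, ∀ e ∈ entries (U' p), e.2 < tm V' p (N - 1)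
  lt_entries_U : ∀ p < M, ∀ p' < M, p < p' → ∀ e ∈ entries (U p'), tm V' p (N - 1) < e.2

theorem IsTimed.decompose {k m : ℕ} {l r : Symb → ℝ} {W : TimedWord}
    (h : IsTimed (k + 2) (m + 1) l r W) (hm : 1 ≤ m) :
    ∃ V V' U U', Decomposition k m (blockCount (k + 2) m)
      (blockCount (k + 1) (blockCount (k + 2) m)) l r W V V' U U' := by
  have hN := blockCount_pos (k := k + 2) (by omega) hm
  have hA := hartSharir_blocks (k + 2) m (by omega) hm
  have hB := hartSharir_blocks (k + 1) (blockCount (k + 2) m) (by omega) hN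
  obtain ⟨V, V', U, U', h1, h2, h3, h4, h5⟩ := exists_of_shape_eq_shuffleFrom (hartSharir (k + 2) m)
    (by intro l hl h0; have := hA.1 l hl; simp [h0] at this; omega)
    (by intro h0; simp [blockCount, h0] at hN)
    (hartSharir (k + 1) (blockCount (k + 2) m)) 0 W
    (by rw [h.shape_eq, hartSharir_step k m hm]; rfl) hB.1 h.sorted
  have sub : ∀ {f : Symb → Symb} {X : TimedWord}, ((entries X).map (ren f)).Sublist (entries W) →
      ∀ e ∈ entries X, ren f e ∈ entries W := fun hX e he => hX.subset (List.mem_map_of_mem he)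
  have srt : ∀ {f : Symb → Symb} {X : TimedWord}, ((entries X).map (ren f)).Sublist (entries W) →
      Sorted X := fun hX => by
    have := h.sorted.sublist hX
    rw [List.pairwise_map] at this
    exact this
  have hloc : ∀ p, Function.Injective (Symb.loc p) := fun p a b hab => by simpa using hab
  have hglob : Function.Injective Symb.glob := fun a b hab => by simpa using hab
  have hVt : IsTimed (k + 1) (blockCount (k + 2) m) (l ∘ Symb.glob) (r ∘ Symb.glob) V :=
    ⟨h1, srt h3, h.good.comp _ hglob (sub h3)⟩
  have hVt' : IsTimed (k + 1) (blockCount (k + 2) m) (l ∘ Symb.glob) (r ∘ Symb.glob) V' :=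
    ⟨h2, srt h4, h.good.comp _ hglob (sub h4)⟩
  have hU : ∀ p < blockCount (k + 1) (blockCount (k + 2) m),
      IsTimed (k + 2) m (l ∘ Symb.loc p) (r ∘ Symb.loc p) (U p) ∧
      IsTimed (k + 2) m (l ∘ Symb.loc p) (r ∘ Symb.loc p) (U' p) := by
    intro p hp
    obtain ⟨a1, a2, a3, a4, -⟩ := h5 p hp
    rw [Nat.zero_add] at a3 a4
    exact ⟨⟨a1, srt a3, h.good.comp _ (hloc p) (sub a3)⟩,
      ⟨a2, srt a4, h.good.comp _ (hloc p) (sub a4)⟩⟩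
  have last : ∀ (v : List (Symb × ℝ)) (e d : Symb × ℝ) (n : ℕ), (v ++ [e]).length = n →
      (v ++ [e]).getD (n - 1) d = e := by
    intro v e d n hn
    subst hn
    simp
  have init : ∀ (v : List (Symb × ℝ)) (e e' d : Symb × ℝ) (n i : ℕ), (v ++ [e]).length = n →
      i + 1 < n → (v ++ [e]).getD i d = (v ++ [e']).getD i d := by
    intro v e e' d n i hn hi
    subst hn
    simp at hi
    rw [List.getD_append _ _ _ _ hi, List.getD_append _ _ _ _ hi]
  refine ⟨V, V', U, U', hVt, hVt', sub h3, sub h4, fun p hp => (hU p hp).1, fun p hp => (hU p hp).2,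
    ?_, ?_, ?_, ?_, ?_, ?_, ?_, ?_, ?_, ?_⟩
  · intro p hp
    obtain ⟨a1, a2, a3, a4, -⟩ := h5 p hp
    rw [Nat.zero_add] at a3
    exact sub a3
  · intro p hp
    obtain ⟨a1, a2, a3, a4, -⟩ := h5 p hp
    rw [Nat.zero_add] at a4
    exact sub a4
  · intro p hp j hj i hi
    obtain ⟨-, -, -, -, a5, -⟩ := h5 p hp
    have hlen := (hU p hp).1.length_block (by omega) hm hj
    have a6 := (a5 j hj).1
    rw [← blockCount] at a6
    rw [tm, a6, getD_map_append_of_lt _ _ _ (Symb.atom 0, 0) _ (by rw [hlen]; exact hi)]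
    rfl
  · intro p hp j hj
    obtain ⟨-, -, -, -, a5, -⟩ := h5 p hp
    have hlen := (hU p hp).1.length_block (by omega) hm hj
    have a6 := (a5 j hj).1
    rw [← blockCount] at a6
    rw [tm, a6, getD_map_append_of_eq _ _ _ _ hlen]
    rfl
  · intro p hp j hj i hi
    obtain ⟨-, -, -, -, a5, -⟩ := h5 p hp
    obtain ⟨v, x, t, t', b1, b2, b3, b4⟩ := (a5 j hj).2
    have hlen := (hU p hp).1.length_block (by omega) hm hj
    have hlen' := (hU p hp).2.length_block (by omega) hm hj
    rw [b1] at hlen; rw [b2] at hlen'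
    rw [tm, tm, b1, b2, init v (x, t') (x, t) _ m i hlen' hi]
  · intro p hp j hj
    obtain ⟨-, -, -, -, a5, -⟩ := h5 p hp
    obtain ⟨v, x, t, t', b1, b2, b3, b4⟩ := (a5 j hj).2
    have hlen := (hU p hp).1.length_block (by omega) hm hj
    rw [b1] at hlen
    rw [tm, b1, last v (x, t) _ m hlen]
    exact b3
  · intro p hp j hj
    obtain ⟨-, -, -, -, a5, -⟩ := h5 p hp
    obtain ⟨v, x, t, t', b1, b2, b3, b4⟩ := (a5 j hj).2
    have hlen := (hU p hp).2.length_block (by omega) hm hj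
    rw [b2] at hlen
    rw [tm, tm, b2, last v (x, t') _ m hlen]
    exact b4
  all_goals
    intro p hp
    obtain ⟨-, -, -, -, -, v, x, t, D, b1, b2, b3, b4, b5, b6⟩ := h5 p hp
    have hlen := hVt.length_block (by omega) hN hp
    have hlen' := hVt'.length_block (by omega) hN hp
    rw [b1] at hlen; rw [b2] at hlen'
    have e1 : tm V' p (blockCount (k + 2) m - 1) = D := by rw [tm, b2, last _ _ _ _ hlen']
    have e2 : tm V p (blockCount (k + 2) m - 1) = t := by rw [tm, b1, last _ _ _ _ hlen]
    simp only [e1, e2]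
    assumption

namespace Decomposition

variable {k m N M : ℕ} {l r : Symb → ℝ} {W V V' : TimedWord} {U U' : ℕ → TimedWord}

/-- Let `x` be a local symbol of the last block of copy `p`, and `g` the global appended to that
block. The word contains `x` in the block, then `g`, then `x` again later in the copy, then `g`
right after the copy; so `x` ends before that last entry. -/
theorem right_lt (h : Decomposition k m N M l r W V V' U U') (hW : GoodTimes l r {e | e ∈ entries W})
    (hm : 2 ≤ m) (hN : N = blockCount (k + 2) m) (hM : M = blockCount (k + 1) N) {p i : ℕ}
    (hp : p < M) (hi : i < m) :
    r (Symb.loc p (hsSymb (k + 2) m (N - 1) i)) < tm V' p (N - 1) := by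
  have hN1 : 1 ≤ N := hN ▸ blockCount_pos (by omega) (by omega)
  have hU := h.timed_U p hp
  have hU' := h.timed_U' p hp
  have hq : N - 1 < blockCount (k + 2) m := by omega
  have hp' : p < blockCount (k + 1) N := hM ▸ hp
  obtain ⟨t, h1, h2⟩ := hU'.exists_later (by omega) hm hq hi
  refine (hW.alt (Symb.loc p (hsSymb (k + 2) m (N - 1) i))
    (Symb.glob (hsSymb (k + 1) N p (N - 1))) (tm (U p) (N - 1) i) (tm V p (N - 1)) t
    (tm V' p (N - 1)) (by simp) (h.mem_U p hp _ (hU.mem_entries (by omega) hq hi))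
    (h.mem_V _ (h.timed_V.mem_entries (by omega) hp' (by omega)))
    (h.mem_U' p hp _ h1) (h.mem_V' _ (h.timed_V'.mem_entries (by omega) hp' (by omega)))
    ?_ ?_ ?_).2
  · exact (hU.tm_le_same (by omega) hq (by omega) (by omega)).trans_lt
      (h.tm_U_lt p hp (N - 1) (by omega))
  · exact (h.lt_tm_U' p hp (N - 1) (by omega)).trans h2
  · exact h.entries_U'_lt p hp _ h1

end Decomposition



/-! ## Order relations forced by the iterated shuffles -/

theorem exists_eq_mul_add {q M N : ℕ} (h : q < M * N) : ∃ p < M, ∃ j < N, q = p * N + j := by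
  have hN : 0 < N := Nat.pos_of_ne_zero (by rintro rfl; simp at h)
  refine ⟨q / N, ?_, q % N, Nat.mod_lt _ hN, ?_⟩
  · exact Nat.div_lt_of_lt_mul (by rwa [Nat.mul_comm])
  · rw [Nat.mul_comm]; exact (Nat.div_add_mod q N).symm

theorem mul_add_lt_mul {p j M N : ℕ} (hp : p < M) (hj : j < N) : p * N + j < M * N := by
  have : (p + 1) * N ≤ M * N := Nat.mul_le_mul_right _ hp
  linarith [add_mul p 1 N]

namespace IsTimed

/-- The block before a multiple of `blockCount (k + 3) (n + 1)` is the last one of a copy of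
`S(n+1)`, and the symbols numbered at most `n` are local to this copy. `right_lt` bounds them by an
entry after the copy that precedes the next block. -/
theorem right_lt_next {k n : ℕ} (hn : 1 ≤ n) (M : ℕ) (hM : n + 2 ≤ M) : ∀ {l r : Symb → ℝ}
    {W : TimedWord}, IsTimed (k + 3) M l r W → ∀ c i : ℕ, 1 ≤ c →
    c * blockCount (k + 3) (n + 1) < blockCount (k + 3) M → i ≤ n →
    r (hsSymb (k + 3) M (c * blockCount (k + 3) (n + 1) - 1) i) <
      tm W (c * blockCount (k + 3) (n + 1)) 0 := by
  induction M, hM using Nat.le_induction with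
  | base =>
    intro l r W h c i hc hlt hi
    obtain ⟨V, V', U, U', d⟩ := h.decompose (by omega)
    rw [show blockCount (k + 3) (n + 2) = _ from blockCount_step (k + 1) (n + 1) (by omega)] at hlt
    have hN : 1 ≤ blockCount (k + 3) (n + 1) := blockCount_pos (by omega) (by omega)
    have hc' : c < blockCount (k + 1 + 1) (blockCount (k + 1 + 2) (n + 1)) :=
      Nat.lt_of_mul_lt_mul_right hlt
    obtain ⟨p, rfl⟩ : ∃ p, c = p + 1 := ⟨c - 1, by omega⟩
    have e : (p + 1) * blockCount (k + 3) (n + 1) - 1 =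
        p * blockCount (k + 3) (n + 1) + (blockCount (k + 3) (n + 1) - 1) := by
      rw [add_mul, one_mul]; exact Nat.add_sub_assoc hN _
    rw [e, (hsSymb_block (k + 1) (n + 1) p _ (by omega) (by omega) (Nat.sub_lt hN one_pos)).1 i
      (by omega)]
    refine (d.right_lt h.good (by omega) rfl rfl (by omega) (by omega)).trans ?_
    rw [← Nat.add_zero ((p + 1) * _), d.tm_loc (p + 1) hc' 0 hN 0 (by omega)]
    have := d.lt_entries_U p (by omega) (p + 1) hc' (by omega) _
      ((d.timed_U _ hc').mem_entries (i := 0) (by omega) hN (by omega))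
    exact this
  | succ M hM ih =>
    intro l r W h c i hc hlt hi
    obtain ⟨V, V', U, U', d⟩ := h.decompose (by omega)
    have hN : 1 ≤ blockCount (k + 3) (n + 1) := blockCount_pos (by omega) (by omega)
    have hN' : 1 ≤ blockCount (k + 3) M := blockCount_pos (by omega) (by omega)
    obtain ⟨e, he⟩ := blockCount_dvd (k := k + 3) (m := n + 1) (n := M) (by omega) (by omega)
      (by omega)
    rw [show blockCount (k + 3) (M + 1) = _ from blockCount_step (k + 1) M (by omega)] at hlt
    obtain ⟨p, hp, j, hj, hpj⟩ := exists_eq_mul_add hlt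
    have hdj : ∃ c', j = c' * blockCount (k + 3) (n + 1) := by
      rw [show blockCount (k + 1 + 2) M = blockCount (k + 3) M from rfl, he] at hpj
      refine ⟨c - p * e, ?_⟩
      rw [Nat.sub_mul, hpj]
      rw [show p * e * blockCount (k + 3) (n + 1) = p * (blockCount (k + 3) (n + 1) * e) by ring]
      omega
    obtain ⟨c', rfl⟩ := hdj
    rw [show c * blockCount (k + 3) (n + 1) = p * blockCount (k + 3) M +
      c' * blockCount (k + 3) (n + 1) from hpj]
    -- The multiple is either the border between two consecutive copies of `S(M)`, where `right_lt`
    -- applies directly, or interior to one copy, where the induction hypothesis applies.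
    rcases Nat.eq_zero_or_pos c' with rfl | hc'
    · rw [Nat.zero_mul, Nat.add_zero] at hpj
      simp only [Nat.zero_mul, Nat.add_zero]
      obtain ⟨p, rfl⟩ : ∃ p', p = p' + 1 := ⟨p - 1, by
        rcases p with _ | p
        · rw [Nat.zero_mul] at hpj
          have := Nat.mul_pos hc hN
          omega
        · rfl⟩
      have e : (p + 1) * blockCount (k + 3) M - 1 =
          p * blockCount (k + 3) M + (blockCount (k + 3) M - 1) := by
        rw [add_mul, one_mul]; exact Nat.add_sub_assoc hN' _
      rw [e, (hsSymb_block (k + 1) M p _ (by omega) (by omega) (Nat.sub_lt hN' one_pos)).1 i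
        (by omega)]
      refine (d.right_lt h.good (by omega) rfl rfl (by omega) (by omega)).trans ?_
      rw [← Nat.add_zero ((p + 1) * _), d.tm_loc (p + 1) hp 0 hN' 0 (by omega)]
      have := d.lt_entries_U p (by omega) (p + 1) hp (by omega) _
        ((d.timed_U _ hp).mem_entries (i := 0) (by omega) hN' (by omega))
      exact this
    · have hpos : 0 < c' * blockCount (k + 3) (n + 1) := Nat.mul_pos hc' hN
      have h1 := ih (d.timed_U p hp) c' i hc' hj hi
      rw [Nat.add_sub_assoc hpos, d.tm_loc p hp _ hj 0 (by omega),
        (hsSymb_block (k + 1) M p _ (by omega) hp (by omega)).1 i (by omega)]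
      exact h1

/-- Equal quotients mean that both blocks lie in the same enlarged copy of `S(i)`. Symbol number `i`
is a global there, and in the late version `V'` all globals of its block still recur after the entry
that follows the copy. -/
theorem last_lt_right {k i : ℕ} (hi : 1 ≤ i) (M : ℕ) (hM : i + 1 ≤ M) : ∀ {l r : Symb → ℝ}
    {W : TimedWord}, IsTimed (k + 2) M l r W → ∀ q q' : ℕ, q < blockCount (k + 2) M →
    q' < blockCount (k + 2) M → q / blockCount (k + 2) i = q' / blockCount (k + 2) i →
    tm W q' (M - 1) < r (hsSymb (k + 2) M q i) := by
  induction M, hM using Nat.le_induction with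
  | base =>
    intro l r W h q q' hq hq' e
    obtain ⟨V, V', U, U', d⟩ := h.decompose (by omega)
    have hN : 2 ≤ blockCount (k + 2) i := two_le_blockCount (by omega) (by omega)
    rw [blockCount_step _ _ (by omega)] at hq hq'
    obtain ⟨p, hp, j, hj, rfl⟩ := exists_eq_mul_add hq
    obtain ⟨p', hp', j', hj', rfl⟩ := exists_eq_mul_add hq'
    rw [Nat.add_comm, Nat.add_mul_div_right _ _ (by omega), Nat.add_comm (p' * _),
      Nat.add_mul_div_right _ _ (by omega), Nat.div_eq_of_lt hj, Nat.div_eq_of_lt hj',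
      Nat.zero_add, Nat.zero_add] at e
    subst e
    rw [(hsSymb_block k i p j hi hp hj).2, Nat.add_sub_cancel, d.tm_glob p hp j' hj']
    refine ((d.timed_V.tm_le_same (by omega) hp (by omega : j' ≤ blockCount (k + 2) i - 1)
      (by omega)).trans_lt (d.tm_V_lt p hp)).trans ?_
    exact d.timed_V'.lt_right (by omega) hN hp hj
  | succ M hM ih =>
    intro l r W h q q' hq hq' e
    obtain ⟨V, V', U, U', d⟩ := h.decompose (by omega)
    obtain ⟨f, hf⟩ := blockCount_dvd (k := k + 2) (m := i) (n := M) (by omega) (by omega)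
      (by omega)
    have hN : 1 ≤ blockCount (k + 2) i := blockCount_pos (by omega) (by omega)
    have hN' : 1 ≤ blockCount (k + 2) M := blockCount_pos (by omega) (by omega)
    rw [blockCount_step _ _ (by omega)] at hq hq'
    obtain ⟨p, hp, j, hj, rfl⟩ := exists_eq_mul_add hq
    obtain ⟨p', hp', j', hj', rfl⟩ := exists_eq_mul_add hq'
    have e' := congrArg (· / f) e
    simp only [Nat.div_div_eq_div_mul, ← hf] at e'
    rw [Nat.add_comm, Nat.add_mul_div_right _ _ (by omega), Nat.add_comm (p' * _),
      Nat.add_mul_div_right _ _ (by omega), Nat.div_eq_of_lt hj, Nat.div_eq_of_lt hj',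
      Nat.zero_add, Nat.zero_add] at e'
    subst e'
    have e2 : j / blockCount (k + 2) i = j' / blockCount (k + 2) i := by
      rw [hf, show p * (blockCount (k + 2) i * f) = p * f * blockCount (k + 2) i by ring,
        Nat.add_comm, Nat.add_mul_div_right _ _ (by omega), Nat.add_comm (p * f * _),
        Nat.add_mul_div_right _ _ (by omega)] at e
      omega
    rw [(hsSymb_block k M p j (by omega) hp hj).1 i (by omega), Nat.add_sub_cancel,
      d.tm_glob p hp j' hj']
    -- The block has grown by one entry, which is later than the last entry of `U` but earlier than
    -- that of `U'`; hence the late version.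
    exact (d.lt_tm_U' p hp j' hj').trans (ih (d.timed_U' p hp) j j' hj hj' e2)

/-- Passage to a copy of the first factor. -/
theorem copy {k m : ℕ} {l r : Symb → ℝ} {W : TimedWord} (h : IsTimed (k + 2) (m + 1) l r W)
    (hm : 1 ≤ m) : ∃ U U', IsTimed (k + 2) m (l ∘ Symb.loc 0) (r ∘ Symb.loc 0) U ∧
      IsTimed (k + 2) m (l ∘ Symb.loc 0) (r ∘ Symb.loc 0) U' ∧
      (∀ e ∈ entries U, ren (Symb.loc 0) e ∈ entries W) ∧
      ∀ q < blockCount (k + 2) m, (∀ i < m, tm W q i = tm U q i) ∧ tm W q m < tm U' q (m - 1) ∧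
        (∀ i, i + 1 < m → tm U' q i = tm W q i) ∧
        ∀ i < m, hsSymb (k + 2) (m + 1) q i = Symb.loc 0 (hsSymb (k + 2) m q i) := by
  obtain ⟨V, V', U, U', d⟩ := h.decompose hm
  have hM : 0 < blockCount (k + 1) (blockCount (k + 2) m) :=
    blockCount_pos (by omega) (blockCount_pos (by omega) hm)
  refine ⟨U 0, U' 0, d.timed_U 0 hM, d.timed_U' 0 hM, d.mem_U 0 hM, fun q hq => ?_⟩
  have h1 := d.tm_loc 0 hM q hq
  have h2 := d.tm_glob 0 hM q hq
  have h3 := hsSymb_block k m 0 q hm hM hq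
  simp only [Nat.zero_mul, Nat.zero_add] at h1 h2 h3
  refine ⟨h1, h2 ▸ d.lt_tm_U' 0 hM q hq, fun i hi => ?_, h3.1⟩
  rw [h1 i (by omega), d.tm_U' 0 hM q hq i hi]

end IsTimed

/-- Three segments of one special block, whose right endpoints lie before, after, and before two
later special blocks. -/
theorem exists_three_blocks (k n : ℕ) (hn : 4 ≤ n) : ∃ p₀ p₁ p₂ : ℕ, 1 ≤ p₀ ∧ p₀ < p₁ ∧ p₁ < p₂ ∧
    p₂ < blockCount (k + 4) (n + 1) ∧ ∀ M, n + 1 ≤ M → ∀ (l r : Symb → ℝ) (W : TimedWord),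
      IsTimed (k + 4) M l r W → r (hsSymb (k + 4) M p₀ 1) < tm W p₁ 0 ∧
        tm W p₁ (M - 1) < r (hsSymb (k + 4) M p₀ 3) ∧ r (hsSymb (k + 4) M p₀ n) < tm W p₂ 0 := by
  have a1 : 2 ≤ blockCount (k + 4) 2 := two_le_blockCount (by omega) (by omega)
  have a2 : blockCount (k + 4) 2 < blockCount (k + 4) 3 :=
    blockCount_strictMono (by omega) (by omega) (by omega)
  have a3 : blockCount (k + 4) 3 < blockCount (k + 4) n :=
    blockCount_strictMono (by omega) (by omega) (by omega)
  obtain ⟨N, hN⟩ : ∃ N, N = blockCount (k + 4) n := ⟨_, rfl⟩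
  -- Block `j` ends the first copy of `S(2)`, so symbol 1 stops before block `j + 1`, while both
  -- blocks share a copy of `S(3)`, so symbol 3 goes on. In the second factor, `i` is chosen in the
  -- same way to be the end of the first copy of `S(j + 1)`; so global number `j` of its block `i`,
  -- which is symbol `n` of the block `i * N + j`, stops before block `i + 1`.
  obtain ⟨j, hj⟩ : ∃ j, j + 1 = blockCount (k + 4) 2 := ⟨blockCount (k + 4) 2 - 1, by omega⟩
  have a4 : 1 ≤ blockCount (k + 3) (j + 1) := blockCount_pos (by omega) (by omega)
  obtain ⟨i, hi⟩ : ∃ i, i + 1 = blockCount (k + 3) (j + 1) := ⟨_ - 1, Nat.sub_add_cancel a4⟩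
  have a5 : blockCount (k + 3) (j + 1) < blockCount (k + 3) N :=
    blockCount_strictMono (by omega) (by omega) (by omega)
  have a6 : i + 1 < blockCount (k + 3) N := by omega
  have hs : blockCount (k + 4) (n + 1) = blockCount (k + 3) N * N := by
    rw [hN]; exact blockCount_step (k + 2) n (by omega)
  have b0 : i * N + j < blockCount (k + 4) (n + 1) := by
    rw [hs]; exact mul_add_lt_mul (by omega) (by omega)
  have b1 : i * N + (j + 1) < blockCount (k + 4) (n + 1) := by
    rw [hs]; exact mul_add_lt_mul (by omega) (by omega)
  have b2 : (i + 1) * N + 1 < blockCount (k + 4) (n + 1) := by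
    rw [hs]; exact mul_add_lt_mul (by omega) (by omega)
  refine ⟨i * N + j, i * N + (j + 1), (i + 1) * N + 1, by omega, by omega, ?_, b2, ?_⟩
  · rw [add_mul]; omega
  intro M hM
  induction M, hM using Nat.le_induction with
  | base =>
    intro l r W h
    obtain ⟨V, V', U, U', d⟩ := IsTimed.decompose (k := k + 2) h (by omega)
    have hN2 : blockCount (k + 2 + 2) n = N := hN.symm
    have hN1 : blockCount (k + 2 + 1) N = blockCount (k + 3) N := rfl
    have c0 := hsSymb_block (k + 2) n i j (by omega) (by rw [hN2]; omega) (by omega)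
    rw [hN2, hN1] at d
    rw [hN2] at c0
    refine ⟨?_, ?_, ?_⟩
    · have := (d.timed_U i (by omega)).right_lt_next (k := k + 1) (n := 1) le_rfl n (by omega) 1 1
        le_rfl (by rw [Nat.one_mul]; exact a2.trans a3) le_rfl
      rw [show k + 1 + 3 = k + 4 from rfl] at this
      rw [Nat.one_mul, ← hj, Nat.add_sub_cancel] at this
      rw [c0.1 1 (by omega), d.tm_loc i (by omega) (j + 1) (by omega) 0 (by omega)]
      exact this
    · obtain ⟨f, hf⟩ := blockCount_dvd (k := k + 4) (m := 3) (n := n) (by omega) (by omega)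
        (by omega)
      refine h.last_lt_right (k := k + 2) (i := 3) (by omega) (n + 1) (by omega) _ _ b0 b1 ?_
      rw [show N = blockCount (k + 2 + 2) 3 * f from hN.trans hf,
        show k + 2 + 2 = k + 4 from rfl,
        show i * (blockCount (k + 4) 3 * f) = i * f * blockCount (k + 4) 3 by ring,
        Nat.add_comm, Nat.add_mul_div_right _ _ (by omega), Nat.add_comm (i * f * _),
        Nat.add_mul_div_right _ _ (by omega), Nat.div_eq_of_lt (by omega),
        Nat.div_eq_of_lt (by omega)]
    · have := d.timed_V.right_lt_next (k := k) (n := j) (by omega) N (by omega) 1 j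
        le_rfl (by rw [Nat.one_mul]; exact a5) le_rfl
      rw [Nat.one_mul, ← hi, Nat.add_sub_cancel] at this
      rw [c0.2]
      refine this.trans ?_
      rw [← d.tm_glob (i + 1) a6 0 (by omega), Nat.add_zero]
      exact h.tm_lt (by omega) (by omega) b2 (by omega) (by omega)
  | succ M hM ih =>
    intro l r W h
    -- The outer inequalities concern first entries of blocks and follow from `U`; the middle one
    -- concerns the new last entry and needs `U'`.
    obtain ⟨U, U', hU, hU', -, hq⟩ := IsTimed.copy (k := k + 2) h (by omega)
    have hmono : blockCount (k + 4) (n + 1) ≤ blockCount (k + 2 + 2) M :=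
      blockCount_mono (by omega) (by omega) hM
    have hlt : i * N + j < (i + 1) * N + 1 := by rw [add_mul]; omega
    have hlt' : i * N + (j + 1) < (i + 1) * N + 1 := by rw [add_mul]; omega
    obtain ⟨-, -, -, c0⟩ := hq (i * N + j) (by omega)
    obtain ⟨c1, c1', -, -⟩ := hq (i * N + (j + 1)) (by omega)
    obtain ⟨c2, -, -, -⟩ := hq ((i + 1) * N + 1) (by omega)
    have d1 := ih _ _ _ hU
    have d2 := ih _ _ _ hU'
    rw [show k + 4 = k + 2 + 2 from rfl, c0 1 (by omega), c0 3 (by omega), c0 n (by omega),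
      c1 0 (by omega), c2 0 (by omega), Nat.add_sub_cancel]
    exact ⟨d1.1, c1'.trans d2.2.1, d1.2.2⟩



/-! ## Chains of inequalities between endpoints -/

/-- The endpoints of `T` appear in this order between the times `x` and `y`, and the `i`-th special
block lies inside the `i`-th one of the given time intervals. -/
def Chain (l r : Symb → ℝ) : ℝ → List (Piece Endpt) → List (ℝ × ℝ) → ℝ → Prop
  | x, [], [], y => x < y
  | _, [], _ :: _, _ => False
  | x, Piece.plain e :: T, I, y => x < e.time l r ∧ Chain l r (e.time l r) T I y
  | _, Piece.block _ :: _, [], _ => False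
  | x, Piece.block L :: T, (s, t) :: I, y =>
      x < s ∧ s < t ∧ (s :: L.map l).Pairwise (· < ·) ∧ (∀ a ∈ L, l a < t) ∧ Chain l r t T I y

namespace Chain

variable {l r : Symb → ℝ}

theorem mono_left : ∀ {x x' y : ℝ} {T : List (Piece Endpt)} {I : List (ℝ × ℝ)},
    Chain l r x T I y → x' ≤ x → Chain l r x' T I y
  | _, _, _, [], [], h, hx => hx.trans_lt h
  | _, _, _, [], _ :: _, h, _ => h.elim
  | _, _, _, Piece.plain _ :: _, _, h, hx => ⟨hx.trans_lt h.1, h.2⟩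
  | _, _, _, Piece.block _ :: _, [], h, _ => h.elim
  | _, _, _, Piece.block _ :: _, _ :: _, h, hx => ⟨hx.trans_lt h.1, h.2⟩

theorem mono_right : ∀ {x y y' : ℝ} {T : List (Piece Endpt)} {I : List (ℝ × ℝ)},
    Chain l r x T I y → y ≤ y' → Chain l r x T I y'
  | _, _, _, [], [], h, hx => h.trans_le hx
  | _, _, _, [], _ :: _, h, _ => h.elim
  | _, _, _, Piece.plain _ :: _, _, h, hx => ⟨h.1, mono_right h.2 hx⟩
  | _, _, _, Piece.block _ :: _, [], h, _ => h.elim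
  | _, _, _, Piece.block _ :: _, _ :: _, h, hx =>
      ⟨h.1, h.2.1, h.2.2.1, h.2.2.2.1, mono_right h.2.2.2.2 hx⟩

theorem lt : ∀ {x y : ℝ} {T : List (Piece Endpt)} {I : List (ℝ × ℝ)},
    Chain l r x T I y → x < y
  | _, _, [], [], h => h
  | _, _, [], _ :: _, h => h.elim
  | _, _, Piece.plain _ :: _, _, h => h.1.trans (lt h.2)
  | _, _, Piece.block _ :: _, [], h => h.elim
  | _, _, Piece.block _ :: _, _ :: _, h => h.1.trans (h.2.1.trans (lt h.2.2.2.2))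

theorem append : ∀ {x y z : ℝ} {T T' : List (Piece Endpt)} {I I' : List (ℝ × ℝ)},
    Chain l r x T I y → Chain l r y T' I' z → Chain l r x (T ++ T') (I ++ I') z
  | _, _, _, [], _, [], _, h, h' => h'.mono_left (le_of_lt h)
  | _, _, _, [], _, _ :: _, _, h, _ => h.elim
  | _, _, _, Piece.plain _ :: _, _, _, _, h, h' => ⟨h.1, append h.2 h'⟩
  | _, _, _, Piece.block _ :: _, _, [], _, h, _ => h.elim
  | _, _, _, Piece.block _ :: _, _, _ :: _, _, h, h' =>
      ⟨h.1, h.2.1, h.2.2.1, h.2.2.2.1, append h.2.2.2.2 h'⟩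

theorem pairwise : ∀ {x y : ℝ} {T : List (Piece Endpt)} {I : List (ℝ × ℝ)},
    Chain l r x T I y → (x :: (endpointWord T).map (Endpt.time l r)).Pairwise (· < ·)
  | _, _, [], [], _ => by simp [endpointWord]
  | _, _, [], _ :: _, h => h.elim
  | x, _, Piece.plain e :: T, _, h => by
      have h1 := pairwise h.2
      simp only [endpointWord, List.map_cons]
      refine List.pairwise_cons.2 ⟨?_, h1⟩
      simp only [List.mem_cons, forall_eq_or_imp]
      exact ⟨h.1, fun a ha => h.1.trans ((List.pairwise_cons.1 h1).1 a ha)⟩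
  | _, _, Piece.block _ :: _, [], h => h.elim
  | x, _, Piece.block L :: T, (s, t) :: I, h => by
      obtain ⟨h1, h2, h3, h4, h5⟩ := h
      have h6 := List.pairwise_cons.1 (pairwise h5)
      have h7 := List.pairwise_cons.1 h3
      have e : L.map (Endpt.time l r ∘ Endpt.left) = L.map l := rfl
      simp only [endpointWord, List.map_append, List.map_map, e]
      refine List.pairwise_cons.2 ⟨?_, List.pairwise_append.2 ⟨h7.2, h6.2, ?_⟩⟩
      · intro a ha
        rcases List.mem_append.1 ha with ha | ha
        · exact h1.trans (h7.1 a ha)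
        · exact (h1.trans h2).trans (h6.1 a ha)
      · intro a ha b hb
        obtain ⟨c, hc, rfl⟩ := List.mem_map.1 ha
        exact (h4 c hc).trans (h6.1 b hb)

theorem time_rename (f : Symb → Symb) (e : Endpt) :
    (e.rename f).time l r = e.time (l ∘ f) (r ∘ f) := by cases e <;> rfl

theorem rename_iff (f : Symb → Symb) : ∀ {x y : ℝ} {T : List (Piece Endpt)} {I : List (ℝ × ℝ)},
    Chain l r x (renamePieces f (Endpt.rename f) T) I y ↔ Chain (l ∘ f) (r ∘ f) x T I y
  | _, _, [], [] => Iff.rfl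
  | _, _, [], _ :: _ => Iff.rfl
  | _, _, Piece.plain e :: T, I => by
      simp only [renamePieces, Chain, time_rename, rename_iff f]
  | _, _, Piece.block _ :: _, [] => Iff.rfl
  | _, _, Piece.block L :: T, (s, t) :: I => by
      simp only [renamePieces, Chain, rename_iff f, List.map_map, List.forall_mem_map,
        Function.comp_apply]

/-- The early chain keeps the endpoints of a special block before `t`, and the late chain keeps
whatever follows after `t'`; so any right end between the two is possible. -/
theorem extend {s t t' v : ℕ → ℝ} : ∀ {x x' y y' : ℝ} {T : List (Piece Endpt)} {qs : List ℕ},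
    Chain l r x T (qs.map fun q => (s q, t q)) y → Chain l r x' T (qs.map fun q => (s q, t' q)) y' →
    (∀ q ∈ qs, t q ≤ v q ∧ v q ≤ t' q) → Chain l r x' T (qs.map fun q => (s q, v q)) y'
  | _, _, _, _, [], [], _, h', _ => h'
  | _, _, _, _, [], _ :: _, _, h', _ => h'.elim
  | _, _, _, _, Piece.plain e :: T, _, h, h', hv => ⟨h'.1, extend h.2 h'.2 hv⟩
  | _, _, _, _, Piece.block _ :: _, [], h, _, _ => h.elim
  | _, _, _, _, Piece.block L :: T, q :: qs, h, h', hv => by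
      simp only [List.mem_cons, forall_eq_or_imp] at hv
      exact ⟨h'.1, h.2.1.trans_le hv.1.1, h.2.2.1, fun a ha => (h.2.2.2.1 a ha).trans_le hv.1.1,
        (extend h.2.2.2.2 h'.2.2.2.2 hv.2).mono_left hv.1.2⟩

/-- The old endpoints of the block lie before `t q`, the new one between `t q` and `v q`, so it can
be appended at the end. -/
theorem insertLefts {s t v : ℕ → ℝ} : ∀ {x x' y y' : ℝ} {T : List (Piece Endpt)} {qs : List ℕ}
    {gs : List Symb}, Chain l r x T (qs.map fun q => (s q, t q)) y →
    Chain l r x' T (qs.map fun q => (s q, v q)) y' →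
    List.Forall₂ (fun q g => t q < l g ∧ l g < v q) qs gs →
    Chain l r x' (insertLefts T gs) (qs.map fun q => (s q, v q)) y'
  | _, _, _, _, [], [], _, _, h', _ => h'
  | _, _, _, _, [], _ :: _, _, _, h', _ => h'.elim
  | _, _, _, _, Piece.plain e :: T, _, _, h, h', hv => ⟨h'.1, insertLefts h.2 h'.2 hv⟩
  | _, _, _, _, Piece.block _ :: _, [], _, h, _, _ => h.elim
  | _, _, _, _, Piece.block L :: T, q :: qs, g :: gs, h, h', .cons hg hv => by
      refine ⟨h'.1, h'.2.1, ?_, ?_, insertLefts h.2.2.2.2 h'.2.2.2.2 hv⟩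
      · rw [List.map_append, ← List.cons_append]
        refine List.pairwise_append.2 ⟨h.2.2.1, by simp, ?_⟩
        intro a ha b hb
        obtain rfl : b = l g := by simpa using hb
        rcases List.mem_cons.1 ha with rfl | ha
        · exact h.2.1.trans hg.1
        · obtain ⟨c, hc, rfl⟩ := List.mem_map.1 ha
          exact (h.2.2.2.1 c hc).trans hg.1
      · intro a ha
        rcases List.mem_append.1 ha with ha | ha
        · exact h'.2.2.2.1 a ha
        · obtain rfl : a = g := by simpa using ha
          exact hg.2

/-- The time interval reserved for a special block of `B` is the place in which the enlarged copy of
`A` is laid out. -/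
theorem endpointShuffleFrom {A : List (Piece Endpt)} {s t : ℕ → ℝ} {J : ℕ → List (ℝ × ℝ)} :
    ∀ {x y : ℝ} {B : List (Piece Endpt)} {ps : List ℕ} {i : ℕ},
    Chain (l ∘ Symb.glob) (r ∘ Symb.glob) x B (ps.map fun p => (s p, t p)) y →
    (∀ n < ps.length, Chain l r (s (ps.getD n 0))
      (_root_.insertLefts (renamePieces (Symb.loc (i + n)) (Endpt.rename (Symb.loc (i + n))) A)
        (((specialBlocks B).getD n []).map Symb.glob)) (J (ps.getD n 0)) (t (ps.getD n 0))) →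
    Chain l r x (endpointShuffleFrom A i B) (ps.flatMap J) y
  | _, _, [], [], _, h, _ => h
  | _, _, [], _ :: _, _, h, _ => h.elim
  | _, _, Piece.plain e :: B, ps, i, h, hn =>
      ⟨by rw [time_rename]; exact h.1, by rw [time_rename]; exact endpointShuffleFrom h.2 hn⟩
  | _, _, Piece.block _ :: _, [], _, h, _ => h.elim
  | _, _, Piece.block L :: B, p :: ps, i, h, hn => by
      simp only [_root_.endpointShuffleFrom, List.flatMap_cons]
      refine ((hn 0 (by simp)).mono_left (le_of_lt h.1)).append (endpointShuffleFrom h.2.2.2.2 ?_)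
      intro n hn'
      have := hn (n + 1) (by simpa using hn')
      rw [show i + (n + 1) = i + 1 + n by ring] at this
      simpa [specialBlocks] using this

end Chain

/-! ## Configurations in timed words -/

/-- The segments `φ a`, where `a` ranges over the list `g`, have endpoints in the order
`L ⋯ L R ⋯ R`, and the visits of three successive ones zigzag. -/
def ConcaveTimes (l r : Symb → ℝ) (E : Set (Symb × ℝ)) (φ : Symb → Symb) (g : List Symb) : Prop :=
  (g.map (l ∘ φ) ++ g.map (r ∘ φ)).Pairwise (· < ·) ∧
    ∀ a b c : Symb, List.IsInfix [a, b, c] g → ZigZag E (φ a) (φ b) (φ c)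

theorem ConcaveTimes.map {l r : Symb → ℝ} {E E' : Set (Symb × ℝ)} {f ψ φ φ' : Symb → Symb}
    {g : List Symb} (h : ConcaveTimes (l ∘ f) (r ∘ f) E' φ g) (hE : ∀ e ∈ E', ren f e ∈ E)
    (hψ : ∀ a, φ' (ψ a) = f (φ a)) : ConcaveTimes l r E φ' (g.map ψ) := by
  have e1 : ∀ u : Symb → ℝ, (u ∘ φ') ∘ ψ = (u ∘ f) ∘ φ := fun u => by
    funext a; simp [hψ]
  refine ⟨by rw [List.map_map, List.map_map, e1, e1]; exact h.1, ?_⟩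
  rintro a b c ⟨P, Q, hPQ⟩
  obtain ⟨P', Q', rfl, h1, h2⟩ := List.map_eq_append_iff.1 hPQ.symm
  obtain ⟨P'', R, rfl, h3, h4⟩ := List.map_eq_append_iff.1 h1
  obtain ⟨a', b', c', rfl⟩ : ∃ a' b' c', R = [a', b', c'] :=
    List.length_eq_three.1 (by simpa using congrArg List.length h4)
  simp only [List.map_cons, List.map_nil, List.cons.injEq, and_true] at h4
  obtain ⟨rfl, rfl, rfl⟩ := h4
  rw [hψ, hψ, hψ]
  exact (h.2 a' b' c' ⟨P'', Q', rfl⟩).map f hE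

/-- Every timed version of `S_k(m)` contains the configuration `T`, in such a way that the `i`-th
special block of `T` consists of the symbols numbered `ys` of the `i`-th one of the blocks
numbered `qs`. -/
def HasConfig (k m : ℕ) (T : SegConfig) (ys qs : List ℕ) : Prop :=
  (qs.Pairwise (· < ·) ∧ ∀ q ∈ qs, 1 ≤ q ∧ q < blockCount k m) ∧
  ∃ (φ : Symb → Symb) (z : ℕ), z < blockCount k m ∧
    (specialBlocks T.pieces).map (List.map φ) = qs.map (fun q => ys.map (hsSymb k m q)) ∧
    ∀ (l r : Symb → ℝ) (W : TimedWord), IsTimed k m l r W →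
      Chain (l ∘ φ) (r ∘ φ) (tm W 0 (m - 1)) T.pieces
        (qs.map fun q => (tm W q 0, tm W q (m - 1))) (tm W z 0) ∧
      ∀ g ∈ T.concave, ConcaveTimes l r {e | e ∈ entries W} φ g

/-- `S_k(m+1)` begins with an enlarged copy of `S_k(m)`, whose blocks keep their numbers. Each block
interval grows by one entry, which lies between the right ends given by the early and the late
version of the copy, so `Chain.extend` applies. -/
theorem HasConfig.lift_succ {k m : ℕ} {T : SegConfig} {ys qs : List ℕ} (hm : 2 ≤ m)
    (h : HasConfig (k + 3) m T ys qs) (hys : ∀ y ∈ ys, y < m) : HasConfig (k + 3) (m + 1) T ys qs := by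
  obtain ⟨⟨h1, h2⟩, φ, z, hz, h3, h4⟩ := h
  have hlt := blockCount_strictMono (k := k + 3) (m := m) (n := m + 1) (by omega) (by omega)
    (by omega)
  refine ⟨⟨h1, fun q hq => ⟨(h2 q hq).1, (h2 q hq).2.trans hlt⟩⟩, Symb.loc 0 ∘ φ, z, hz.trans hlt,
    ?_, ?_⟩
  · rw [show List.map (Symb.loc 0 ∘ φ) = List.map (Symb.loc 0) ∘ List.map φ by simp,
      ← List.map_map, h3, List.map_map]
    refine List.map_congr_left fun q hq => ?_
    have hM : 0 < blockCount (k + 1 + 1) (blockCount (k + 1 + 2) m) :=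
      blockCount_pos (by omega) (blockCount_pos (by omega) (by omega))
    have h5 := (hsSymb_block (k + 1) m 0 q (by omega) hM (h2 q hq).2).1
    simp only [Nat.zero_mul, Nat.zero_add] at h5
    rw [Function.comp_apply, List.map_map]
    exact List.map_congr_left fun y hy => (h5 y (hys y hy)).symm
  · intro l r W hW
    obtain ⟨U, U', hU, hU', hE, hq⟩ := IsTimed.copy (k := k + 1) hW (by omega)
    obtain ⟨c1, c2⟩ := h4 _ _ _ hU
    obtain ⟨d1, -⟩ := h4 _ _ _ hU'
    have hz0 := hq z hz
    have h00 := hq 0 (Nat.zero_lt_of_lt hz)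
    refine ⟨?_, fun g hg => ?_⟩
    · have eI : ∀ X : TimedWord, (∀ q ∈ qs, tm X q 0 = tm W q 0) →
          qs.map (fun q => (tm X q 0, tm X q (m - 1))) =
            qs.map fun q => (tm W q 0, tm X q (m - 1)) := fun X hX =>
        List.map_congr_left fun q hq => by rw [hX q hq]
      rw [eI U fun q hq' => ((hq q (h2 q hq').2).1 0 (by omega)).symm] at c1
      rw [eI U' fun q hq' => (hq q (h2 q hq').2).2.2.1 0 (by omega)] at d1
      have key := c1.extend d1 (v := fun q => tm W q m) fun q hq' => ⟨?_, (hq q (h2 q hq').2).2.1.le⟩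
      · rw [Nat.add_sub_cancel, ← hz0.2.2.1 0 (by omega)]
        exact key.mono_left h00.2.1.le
      · rw [← (hq q (h2 q hq').2).1 (m - 1) (by omega)]
        exact hW.tm_le_same (by omega) ((h2 q hq').2.trans hlt) (by omega) (by omega)
    · have := (c2 g hg).map (l := l) (r := r) (ψ := id) (φ' := Symb.loc 0 ∘ φ)
        (E := {e | e ∈ entries W}) hE (fun _ => rfl)
      simpa using this

theorem HasConfig.lift {k m n : ℕ} {T : SegConfig} {ys qs : List ℕ} (hm : 2 ≤ m)
    (h : HasConfig (k + 3) m T ys qs) (hys : ∀ y ∈ ys, y < m) (hn : m ≤ n) :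
    HasConfig (k + 3) n T ys qs := by
  induction n, hn using Nat.le_induction with
  | base => exact h
  | succ n hn ih => exact ih.lift_succ (by omega) fun y hy => (hys y hy).trans_le hn

theorem forall₂_of_map_eq {α β γ : Type} {f : α → γ} {g : β → γ} : ∀ {u : List α} {v : List β},
    u.map f = v.map g → List.Forall₂ (fun b a => f a = g b) v u
  | [], [], _ => .nil
  | [], _ :: _, h => by simp at h
  | _ :: _, [], h => by simp at h
  | a :: u, b :: v, h => by
      simp only [List.map_cons, List.cons.injEq] at h
      exact .cons h.1 (forall₂_of_map_eq h.2)

theorem specialBlocks_insertLefts : ∀ (T : List (Piece Endpt)) (gs : List Symb),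
    (specialBlocks T).length = gs.length →
    specialBlocks (insertLefts T gs) =
      List.zipWith (fun L g => L ++ [g]) (specialBlocks T) gs
  | [], _, _ => rfl
  | Piece.plain _ :: T, gs, h => specialBlocks_insertLefts T gs h
  | Piece.block L :: T, [], h => by simp [specialBlocks] at h
  | Piece.block L :: T, g :: gs, h => by
      simp only [insertLefts, specialBlocks, List.zipWith_cons_cons]
      rw [specialBlocks_insertLefts T gs (by simpa [specialBlocks] using h)]

theorem map_specialBlocks_endpointShuffleFrom (A : List (Piece Endpt)) {φ : Symb → Symb}
    {F : ℕ → List (List Symb)} : ∀ (B : List (Piece Endpt)) (ps : List ℕ) (i : ℕ),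
    (specialBlocks B).length = ps.length →
    (∀ n < ps.length, (specialBlocks (insertLefts
      (renamePieces (Symb.loc (i + n)) (Endpt.rename (Symb.loc (i + n))) A)
        (((specialBlocks B).getD n []).map Symb.glob))).map (List.map φ) = F (ps.getD n 0)) →
    (specialBlocks (endpointShuffleFrom A i B)).map (List.map φ) = ps.flatMap F
  | [], [], _, _, _ => rfl
  | [], _ :: _, _, h, _ => by simp [specialBlocks] at h
  | Piece.plain e :: B, ps, i, h, hn => map_specialBlocks_endpointShuffleFrom A B ps i h hn
  | Piece.block _ :: _, [], _, h, _ => by simp [specialBlocks] at h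
  | Piece.block L :: B, p :: ps, i, h, hn => by
      simp only [endpointShuffleFrom, List.flatMap_cons, specialBlocks_append, List.map_append]
      congr 1
      · exact hn 0 (by simp)
      · refine map_specialBlocks_endpointShuffleFrom A B ps (i + 1) (by simpa [specialBlocks] using h) ?_
        intro n hn'
        have := hn (n + 1) (by simpa using hn')
        rw [show i + (n + 1) = i + 1 + n by ring] at this
        simpa [specialBlocks] using this

/-- Block `q` of copy `p` receives symbol number `q` of block `p` of the second factor. If the
special blocks of `A` sit in the blocks `qs`, then the globals appended to them are those numbered
`qs` in block `p`, and these are the special blocks of `B` by hypothesis. So the shuffle of words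
performs the endpoint shuffle, and the appended symbol has number `m` in its new block. -/
theorem HasConfig.shuffle {k m : ℕ} {A B : SegConfig} {ys qs ps : List ℕ} (hm : 2 ≤ m)
    (hA : HasConfig (k + 3) m A ys qs) (hys : ∀ y ∈ ys, y < m)
    (hB : HasConfig (k + 2) (blockCount (k + 3) m) B qs ps) :
    HasConfig (k + 3) (m + 1) (A.shuffle B) (ys ++ [m])
      (ps.flatMap fun p => qs.map fun q => p * blockCount (k + 3) m + q) := by
  obtain ⟨⟨a1, a2⟩, φ, z, hz, a3, a4⟩ := hA
  obtain ⟨⟨b1, b2⟩, ψ, w, hw, b3, b4⟩ := hB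
  have hN : 2 ≤ blockCount (k + 3) m := two_le_blockCount (by omega) (by omega)
  have step : blockCount (k + 3) (m + 1) = _ := blockCount_step (k + 1) m (by omega)
  -- The `n`-th copy of `A` in the configuration is realized in the copy of the first factor with
  -- number `ps[n]`. The value at atoms is a mere default, as a shuffle contains none.
  let χ : Symb → Symb := fun a => match a with
    | Symb.atom _ => Symb.atom 0
    | Symb.loc i a => Symb.loc (ps.getD i 0) (φ a)
    | Symb.glob b => Symb.glob (ψ b)
  have hp : ∀ n < ps.length, ps.getD n 0 < blockCount (k + 2) (blockCount (k + 3) m) := fun n hn =>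
    (b2 _ (getD_mem hn)).2
  have lenA : (specialBlocks A.pieces).length = qs.length := by
    simpa using congrArg List.length a3
  have lenB : (specialBlocks B.pieces).length = ps.length := by
    simpa using congrArg List.length b3
  have hL : ∀ n < ps.length, ((specialBlocks B.pieces).getD n []).map ψ =
      qs.map (hsSymb (k + 2) (blockCount (k + 3) m) (ps.getD n 0)) := by
    intro n hn
    have := congrArg (fun u : List (List Symb) => u.getD n []) b3
    rw [List.getD_eq_getElem _ _ (by simpa [lenB] using hn),
      List.getD_eq_getElem _ _ (by simpa using hn), List.getElem_map, List.getElem_map] at this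
    rw [List.getD_eq_getElem _ _ (by rw [lenB]; exact hn), List.getD_eq_getElem _ _ hn]
    exact this
  refine ⟨⟨?_, ?_⟩, χ, w * blockCount (k + 3) m + 1, ?_, ?_, ?_⟩
  · rw [List.pairwise_flatMap]
    refine ⟨fun p hp => ?_, b1.imp_of_mem fun {p p'} hp hp' hpp => ?_⟩
    · rw [List.pairwise_map]
      exact a1.imp fun h => by omega
    · intro x hx y hy
      obtain ⟨q, hq, rfl⟩ := List.mem_map.1 hx
      obtain ⟨q', hq', rfl⟩ := List.mem_map.1 hy
      have h1 := (a2 q hq).2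
      have h2 : (p + 1) * blockCount (k + 3) m ≤ p' * blockCount (k + 3) m :=
        Nat.mul_le_mul_right _ hpp
      rw [add_mul] at h2
      omega
  · intro x hx
    obtain ⟨p, hp, hx⟩ := List.mem_flatMap.1 hx
    obtain ⟨q, hq, rfl⟩ := List.mem_map.1 hx
    refine ⟨by have := (a2 q hq).1; omega, ?_⟩
    rw [step]
    exact mul_add_lt_mul (b2 p hp).2 (a2 q hq).2
  · rw [step]
    exact mul_add_lt_mul hw (show 1 < blockCount (k + 3) m by omega)
  · rw [List.map_flatMap]
    refine map_specialBlocks_endpointShuffleFrom A.pieces B.pieces ps 0 lenB fun n hn => ?_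
    have lenL := congrArg List.length (hL n hn)
    rw [List.length_map, List.length_map] at lenL
    rw [specialBlocks_insertLefts _ _ (by
      rw [specialBlocks_renamePieces, List.length_map, List.length_map, lenA, lenL]), specialBlocks_renamePieces,
      List.map_zipWith, List.zipWith_map, Nat.zero_add]
    have e2 : ∀ (L : List Symb) (g : Symb), List.map χ (List.map (Symb.loc n) L ++ [Symb.glob g]) =
        (fun L' g' => List.map (Symb.loc (ps.getD n 0)) L' ++ [Symb.glob g']) (L.map φ) (ψ g) := by
      intro L g
      simp [χ]
    simp only [e2]
    rw [← List.zipWith_map (f := fun L' g' => List.map (Symb.loc (ps.getD n 0)) L' ++ [Symb.glob g']),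
      a3, hL n hn, List.zipWith_map, List.zipWith_self, List.map_map]
    refine List.map_congr_left fun q hq => ?_
    have e3 := hsSymb_block (k + 1) m (ps.getD n 0) q (by omega) (hp n hn) (a2 q hq).2
    simp only [List.map_map, Function.comp_apply, List.map_append, List.map_cons, List.map_nil]
    congr 1
    · exact List.map_congr_left fun y hy => (e3.1 y (hys y hy)).symm
    · exact congrArg (fun a => [a]) e3.2.symm
  · intro l r W hW
    obtain ⟨V, V', U, U', d⟩ := IsTimed.decompose (k := k + 1) hW (by omega)
    obtain ⟨c1, c2⟩ := b4 _ _ _ d.timed_V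
    have hM : 0 < blockCount (k + 2) (blockCount (k + 3) m) := by omega
    constructor
    · have hfst : tm W 0 m < tm V 0 (blockCount (k + 3) m - 1) := by
        have := d.tm_glob 0 hM 0 (show 0 < blockCount (k + 3) m by omega)
        rw [Nat.zero_mul, Nat.zero_add] at this
        rw [this]
        exact d.timed_V.tm_lt_same (by omega) hM (show 0 < blockCount (k + 3) m - 1 by omega)
          (show _ < blockCount (k + 3) m by omega)
      have hlst : tm V w 0 < tm W (w * blockCount (k + 3) m + 1) 0 := by
        rw [← d.tm_glob w hw 0 (show 0 < blockCount (k + 3) m by omega)]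
        refine hW.tm_lt (by omega) (Nat.lt_succ_self _) ?_ (by omega) (by omega)
        rw [step]
        exact mul_add_lt_mul hw (show 1 < blockCount (k + 3) m by omega)
      have c1 : Chain ((l ∘ χ) ∘ Symb.glob) ((r ∘ χ) ∘ Symb.glob) _ _ _ _ := c1
      have key := Chain.endpointShuffleFrom (A := A.pieces) (i := 0)
        (J := fun p => qs.map fun q => (tm W (p * blockCount (k + 3) m + q) 0,
          tm W (p * blockCount (k + 3) m + q) m)) c1 ?_
      · rw [List.map_flatMap]
        simp only [List.map_map]
        exact (key.mono_left hfst.le).mono_right hlst.le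
      intro n hn
      have hp := hp n hn
      rw [Nat.zero_add]
      generalize hpn : ps.getD n 0 = p at hp
      have hχ : χ ∘ Symb.loc n = Symb.loc p ∘ φ := by
        funext a; simp only [χ, Function.comp_apply, hpn]
      obtain ⟨u1, -⟩ := a4 _ _ _ (d.timed_U p hp)
      obtain ⟨v1, -⟩ := a4 _ _ _ (d.timed_U' p hp)
      have hU0 : ∀ q < blockCount (k + 3) m, tm (U p) q 0 = tm W (p * blockCount (k + 3) m + q) 0 :=
        fun q hq => (d.tm_loc p hp q hq 0 (by omega)).symm
      have hU0' : ∀ q < blockCount (k + 3) m, tm (U' p) q 0 = tm W (p * blockCount (k + 3) m + q) 0 :=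
        fun q hq => by rw [← hU0 q hq]; exact d.tm_U' p hp q hq 0 (by omega)
      have eI : ∀ X : TimedWord, (∀ q ∈ qs, tm X q 0 = tm W (p * blockCount (k + 3) m + q) 0) →
          qs.map (fun q => (tm X q 0, tm X q (m - 1))) =
            qs.map fun q => (tm W (p * blockCount (k + 3) m + q) 0, tm X q (m - 1)) := fun X hX =>
        List.map_congr_left fun q hq => by rw [hX q hq]
      rw [eI (U p) fun q hq => hU0 q (a2 q hq).2] at u1
      rw [eI (U' p) fun q hq => hU0' q (a2 q hq).2] at v1
      have hWq : ∀ q < blockCount (k + 3) m,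
          p * blockCount (k + 3) m + q < blockCount (k + 3) (m + 1) := fun q hq => by
        rw [step]; exact mul_add_lt_mul hp hq
      -- The left endpoint of the appended global lies between the last two entries of its block, by
      -- `block_lt` and `left_lt`, and its entry precedes the delayed one of `U'`. This is the room
      -- that `Chain.insertLefts` requires.
      have h1 : ∀ q < blockCount (k + 3) m, tm (U p) q (m - 1) <
          l (hsSymb (k + 3) (m + 1) (p * blockCount (k + 3) m + q) m) := fun q hq => by
        rw [← d.tm_loc p hp q hq (m - 1) (by omega)]
        exact (hW.block_lt (by omega) (hWq q hq) (by omega) (by omega)).1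
      have h2 : ∀ q < blockCount (k + 3) m,
          l (hsSymb (k + 3) (m + 1) (p * blockCount (k + 3) m + q) m) <
            tm W (p * blockCount (k + 3) m + q) m := fun q hq =>
        hW.left_lt (by omega) (hWq q hq) (by omega)
      have h3 : ∀ q < blockCount (k + 3) m, tm W (p * blockCount (k + 3) m + q) m <
          tm (U' p) q (m - 1) := fun q hq => by
        rw [d.tm_glob p hp q hq]; exact d.lt_tm_U' p hp q hq
      have key := u1.extend v1 (v := fun q => tm W (p * blockCount (k + 3) m + q) m) fun q hq =>
        ⟨((h1 q (a2 q hq).2).trans (h2 q (a2 q hq).2)).le, (h3 q (a2 q hq).2).le⟩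
      have eχ : ∀ u : Symb → ℝ, (u ∘ Symb.loc p) ∘ φ = (u ∘ χ) ∘ Symb.loc n := fun u => by
        rw [Function.comp_assoc, ← hχ]; rfl
      rw [eχ, eχ, ← Chain.rename_iff] at u1 key
      have key2 := u1.insertLefts key (gs := ((specialBlocks B.pieces).getD n []).map Symb.glob) ?_
      · refine (key2.mono_left ?_).mono_right ?_
        · rw [← d.tm_glob p hp 0 (show 0 < blockCount (k + 3) m by omega)]
          exact (h3 0 (by omega)).le
        · rw [hU0' z hz]
          refine (hW.tm_le_same (by omega) (hWq z hz) (Nat.zero_le m) (by omega)).trans ?_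
          rw [d.tm_glob p hp z hz]
          exact d.timed_V.tm_le_same (by omega) hp (show z ≤ blockCount (k + 3) m - 1 by omega)
            (show _ < blockCount (k + 3) m by omega)
      · rw [List.forall₂_map_right_iff]
        refine ((List.forall₂_and_left _ _).2 ⟨a2, forall₂_of_map_eq (hL n hn)⟩).imp ?_
        rintro q g ⟨hq, hg⟩
        have e := (hsSymb_block (k + 1) m p q (by omega) hp hq.2).2
        have e' : χ (Symb.glob g) = hsSymb (k + 3) (m + 1) (p * blockCount (k + 3) m + q) m := by
          rw [show hsSymb (k + 3) (m + 1) (p * blockCount (k + 3) m + q) m = _ from e, ← hpn]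
          exact congrArg Symb.glob hg
        rw [Function.comp_apply, e']
        exact ⟨h1 q hq.2, h2 q hq.2⟩
    · intro g hg
      simp only [SegConfig.shuffle, List.mem_append, List.mem_flatMap, List.mem_range,
        List.mem_map] at hg
      rcases hg with ⟨n, hn, g, hg, rfl⟩ | ⟨g, hg, rfl⟩
      · rw [lenB] at hn
        obtain ⟨-, u2⟩ := a4 _ _ _ (d.timed_U _ (hp n hn))
        exact (u2 g hg).map (d.mem_U _ (hp n hn)) fun a => rfl
      · exact (c2 g hg).map d.mem_V fun a => rfl



/-! ## The building blocks of the configuration -/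

namespace Chain

variable {l r : Symb → ℝ}

theorem lt_right_end : ∀ {x y : ℝ} {T : List (Piece Endpt)} {I : List (ℝ × ℝ)},
    Chain l r x T I y → ∀ e ∈ endpointWord T, e.time l r < y
  | _, _, [], _, _ => by simp [endpointWord]
  | x, _, Piece.plain e :: T, _, h => by
      simp only [endpointWord, List.mem_cons, forall_eq_or_imp]
      exact ⟨lt h.2, lt_right_end h.2⟩
  | _, _, Piece.block _ :: _, [], h => h.elim
  | x, _, Piece.block L :: T, (s, t) :: I, h => by
      obtain ⟨-, -, -, h4, h5⟩ := h
      simp only [endpointWord, List.mem_append, List.mem_map]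
      rintro e (⟨a, ha, rfl⟩ | he)
      · exact (h4 a ha).trans (lt h5)
      · exact lt_right_end h5 e he

theorem rights {f : ℕ → Symb} : ∀ {u : List ℕ} {x x' y : ℝ} {T : List (Piece Endpt)}
    {I : List (ℝ × ℝ)}, (x :: u.map fun j => r (f j)).Pairwise (· < ·) → x < x' →
    (∀ j ∈ u, r (f j) < x') → Chain l r x' T I y →
    Chain l r x ((u.map fun j => Piece.plain (Endpt.right (f j))) ++ T) I y
  | [], _, _, _, _, _, _, hx, _, h => h.mono_left hx.le
  | j :: u, _, _, _, _, _, hp, _, hj, h => by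
      simp only [List.mem_cons, forall_eq_or_imp] at hj
      rw [List.map_cons] at hp
      exact ⟨(List.pairwise_cons.1 hp).1 (r (f j)) (by simp), rights (List.pairwise_cons.1 hp).2 hj.1 hj.2 h⟩

/-- Segments of one block start in order inside the block and end in order after it, by `block_lt`
and `lt_right`. Entry 0 is left out (`1 ≤ y`): its time serves as a bound before all the left
endpoints. -/
theorem numerics {k m q : ℕ} {W : TimedWord} (hW : IsTimed k m l r W) (hk : 1 ≤ k) (hm : 2 ≤ m)
    (hq : q < blockCount k m) {φ : Symb → Symb} {u ys : List ℕ} {f : ℕ → Symb}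
    (he : u.map (fun j => φ (f j)) = ys.map (hsSymb k m q)) (hys : ys.Pairwise (· < ·))
    (hym : ∀ y ∈ ys, 1 ≤ y ∧ y < m) {x x' z : ℝ} {T : List (Piece Endpt)} {I : List (ℝ × ℝ)}
    (hx : x < tm W q 0) (hx' : tm W q (m - 1) < x') (hr : ∀ y ∈ ys, r (hsSymb k m q y) < x')
    (h : Chain (l ∘ φ) (r ∘ φ) x' T I z) :
    Chain (l ∘ φ) (r ∘ φ) x (Piece.block (u.map f) ::
      ((u.map fun j => Piece.plain (Endpt.right (f j))) ++ T))
      ((tm W q 0, tm W q (m - 1)) :: I) z := by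
  have e : ∀ g : Symb → ℝ, u.map (fun j => (g ∘ φ) (f j)) = ys.map (fun y => g (hsSymb k m q y)) := by
    intro g
    have := congrArg (List.map g) he
    rwa [List.map_map, List.map_map] at this
  have e' : ∀ P : Symb → Prop, (∀ y ∈ ys, P (hsSymb k m q y)) → ∀ j ∈ u, P (φ (f j)) := by
    intro P hP j hj
    have := List.mem_map_of_mem (f := fun j => φ (f j)) hj
    rw [he] at this
    obtain ⟨y, hy, hy'⟩ := List.mem_map.1 this
    exact hy' ▸ hP y hy
  refine ⟨hx, hW.tm_lt_same hk hq (by omega) (by omega), ?_, ?_, rights ?_ hx' (e' (fun a => r a < x') hr) h⟩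
  · rw [List.map_map]
    refine (congrArg (fun v => List.Pairwise (· < ·) (tm W q 0 :: v)) (e l)).mpr ?_
    refine List.pairwise_cons.2 ⟨?_, List.pairwise_map.2 (hys.imp_of_mem fun {y y'} hy hy' hyy => ?_)⟩
    · simp only [List.mem_map]
      rintro _ ⟨y, hy, rfl⟩
      exact (hW.block_lt hk hq (hym y hy).1 (hym y hy).2).1
    · exact (hW.left_lt hk hq (hym y hy).2).trans (hW.block_lt hk hq hyy (hym y' hy').2).1
  · intro a ha
    obtain ⟨j, hj, rfl⟩ := List.mem_map.1 ha
    refine e' (fun a => l a < tm W q (m - 1)) (fun y hy => ?_) j hj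
    exact (hW.left_lt hk hq (hym y hy).2).trans_le
      (hW.tm_le_same hk hq (by have := (hym y hy).2; omega) (by omega))
  · refine (congrArg (fun v => List.Pairwise (· < ·) (tm W q (m - 1) :: v)) (e r)).mpr ?_
    refine List.pairwise_cons.2 ⟨?_, List.pairwise_map.2 (hys.imp_of_mem fun {y y'} hy hy' hyy => ?_)⟩
    · simp only [List.mem_map]
      rintro _ ⟨y, hy, rfl⟩
      exact hW.lt_right hk hm hq (hym y hy).2
    · exact (hW.block_lt hk hq hyy (hym y' hy').2).2

end Chain

theorem specialBlocks_map_plain_comp {α β : Type} (f : α → β) (u : List α) :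
    specialBlocks (u.map fun j => Piece.plain (f j)) = [] := by
  induction u with
  | nil => rfl
  | cons a u ih => exact ih

/-- The last block of the first copy of `S(n+1)` will do: by `right_lt_next` its symbols numbered at
most `n` end before the following block. -/
theorem hasConfig_configF (k n : ℕ) (hn : 1 ≤ n) (ys : List ℕ) (hys : ys.Pairwise (· < ·))
    (hyn : ∀ y ∈ ys, 1 ≤ y ∧ y ≤ n) :
    ∃ q, HasConfig (k + 3) (n + 2) (configF ys.length) ys [q] := by
  have hP : 2 ≤ blockCount (k + 3) (n + 1) := two_le_blockCount (by omega) (by omega)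
  have h2P : 2 * blockCount (k + 3) (n + 1) ≤ blockCount (k + 3) (n + 2) :=
    two_mul_blockCount_le (by omega) (by omega)
  have hlt : blockCount (k + 3) (n + 1) < blockCount (k + 3) (n + 2) := by omega
  have hlt' : blockCount (k + 3) (n + 1) + 1 < blockCount (k + 3) (n + 2) := by omega
  let φ : Symb → Symb := fun a => match a with
    | Symb.atom j => hsSymb (k + 3) (n + 2) (blockCount (k + 3) (n + 1) - 1) (ys.getD (j - 1) 0)
    | _ => Symb.atom 0
  have he : (List.range' 1 ys.length).map (fun j => φ (Symb.atom j)) =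
      ys.map (hsSymb (k + 3) (n + 2) (blockCount (k + 3) (n + 1) - 1)) := by
    apply List.ext_getElem (by simp)
    intro i h1 h2
    have : i < ys.length := by simpa using h2
    simp [φ, List.getElem?_eq_getElem this]
  refine ⟨blockCount (k + 3) (n + 1) - 1, ⟨by simp, by simp; omega⟩, φ, blockCount (k + 3) (n + 1) + 1,
    hlt', ?_, ?_⟩
  · simp only [configF, specialBlocks, List.map_cons, List.map_map, List.map_nil]
    rw [specialBlocks_map_plain_comp, List.map_nil]
    exact congrArg (fun v => [v]) he
  · intro l r W hW
    refine ⟨?_, by simp [configF]⟩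
    simp only [configF, List.map_cons, List.map_nil]
    rw [← List.append_nil (List.map (fun j => Piece.plain (Endpt.right (Symb.atom j))) _)]
    have hr := fun y (hy : y ∈ ys) => hW.right_lt_next hn (n + 2) le_rfl 1 y le_rfl
      (by rw [Nat.one_mul]; exact hlt) (hyn y hy).2
    simp only [Nat.one_mul] at hr
    refine Chain.numerics hW (by omega) (by omega) (by omega) he hys
      (fun y hy => ⟨(hyn y hy).1, by have := (hyn y hy).2; omega⟩) ?_ ?_ hr ?_
    · exact hW.tm_lt (by omega) (by omega) (by omega) (by omega) (by omega)
    · exact hW.tm_lt (by omega) (by omega) hlt (by omega) (by omega)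
    · exact hW.tm_lt (by omega) (Nat.lt_succ_self _) hlt' (by omega) (by omega)

theorem concaveTimes_three {l r : Symb → ℝ} {E : Set (Symb × ℝ)} {φ : Symb → Symb} {a b c : Symb}
    (h : ([l (φ a), l (φ b), l (φ c), r (φ a), r (φ b), r (φ c)]).Pairwise (· < ·))
    (hz : ZigZag E (φ a) (φ b) (φ c)) : ConcaveTimes l r E φ [a, b, c] := by
  refine ⟨h, fun a' b' c' h' => ?_⟩
  have := h'.eq_of_length (by simp)
  simp only [List.cons.injEq, and_true] at this
  obtain ⟨rfl, rfl, rfl⟩ := this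
  exact hz

/-- The segments `d, e, f` are the globals numbered 1, 3, 15 in block `p₀` of the second factor. As
global number `j` is appended to block `j` of copy `p₀`, the blocks 4 and 14 of that copy lie
between `L_e` and `L_f`. By the choice of `p₁` and `p₂`, copy `p₁` lies between `R_d` and `R_e`, and
block 1 of copy `p₂` comes after `R_f`. The gaps of 10 between the block numbers leave room for the
later insertion of whiskers. -/
theorem hasConfig_configY (k : ℕ) : ∃ m y₁ y₂ y₃ y₄ y₅ : ℕ, 2 ≤ m ∧ 1 ≤ y₁ ∧ y₁ + 10 ≤ y₂ ∧
    y₂ + 10 ≤ y₃ ∧ y₃ + 10 ≤ y₄ ∧ y₄ + 10 ≤ y₅ ∧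
    HasConfig (k + 5) m configY [] [y₁, y₂, y₃, y₄, y₅] := by
  obtain ⟨p₀, p₁, p₂, h0, h1, h2, h3, hQ⟩ := exists_three_blocks k 15 (by omega)
  -- The value 40 only makes `N` large enough: the numbers up to 15 must be valid, and `S_{k+4}(16)`
  -- must fit into `S_{k+4}(N)`.
  have hN0 := le_blockCount (k := k + 5) (m := 40) (by omega) (by omega)
  have hs : blockCount (k + 5) 41 = _ := blockCount_step (k + 3) 40 (by omega)
  have eN : blockCount (k + 3 + 2) 40 = blockCount (k + 5) 40 := rfl
  rw [eN] at hs
  generalize hN : blockCount (k + 5) 40 = N at hN0 hs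
  have hmono : blockCount (k + 4) 16 ≤ blockCount (k + 3 + 1) N :=
    blockCount_mono (by omega) (by omega) (by omega)
  have hp₂ : p₂ < blockCount (k + 3 + 1) N := lt_of_lt_of_le h3 hmono
  have b0 : ∀ p j, p ≤ p₂ → j < N → p * N + j < blockCount (k + 5) 41 := fun p j hp hj => by
    rw [hs]; exact mul_add_lt_mul (by omega) hj
  have m0 : N ≤ p₀ * N := Nat.le_mul_of_pos_left _ h0
  have m1 : (p₀ + 1) * N ≤ p₁ * N := Nat.mul_le_mul_right _ h1
  have m2 : (p₁ + 1) * N ≤ p₂ * N := Nat.mul_le_mul_right _ h2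
  rw [add_mul] at m1 m2
  let φ : Symb → Symb := fun a => match a with
    | Symb.atom 0 => Symb.glob (hsSymb (k + 4) N p₀ 1)
    | Symb.atom 1 => Symb.glob (hsSymb (k + 4) N p₀ 3)
    | Symb.atom 2 => Symb.glob (hsSymb (k + 4) N p₀ 15)
    | _ => Symb.atom 0
  refine ⟨41, p₀ * N + 4, p₀ * N + 14, p₁ * N + 1, p₁ * N + 11, p₂ * N + 1, by omega, by omega,
    by omega, by omega, by omega, by omega, ⟨?_, ?_⟩, φ, p₂ * N + 2, b0 _ _ le_rfl (by omega), ?_, ?_⟩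
  · simp; omega
  · simp only [List.mem_cons, List.not_mem_nil, or_false]
    rintro q (rfl | rfl | rfl | rfl | rfl)
    all_goals exact ⟨by omega, b0 _ _ (by omega) (by omega)⟩
  · simp [configY, specialBlocks]
  · intro l r W hW
    obtain ⟨V, V', U, U', d⟩ := IsTimed.decompose (k := k + 3) hW (by omega)
    rw [eN, hN] at d
    have hV := d.timed_V
    obtain ⟨q1, q2, q3⟩ := hQ N (by omega) _ _ V hV
    have lt : ∀ {q q' i i' : ℕ}, q < q' → q' < blockCount (k + 5) 41 → i < 41 → i' < 41 →
        tm W q i < tm W q' i' := fun hq hq' hi hi' => hW.tm_lt (by omega) hq hq' hi hi'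
    have hg : ∀ p ≤ p₂, ∀ j < N, tm V p j = tm W (p * N + j) 40 := fun p hp j hj =>
      (d.tm_glob p (by omega) j hj).symm
    have x0 : tm V p₀ 0 < l (φ (Symb.atom 0)) :=
      (hV.block_lt (by omega) (by omega) (show 0 < 1 by omega) (by omega)).1
    have x1 : tm V p₀ 1 < l (φ (Symb.atom 1)) :=
      (hV.block_lt (by omega) (by omega) (show 1 < 3 by omega) (by omega)).1
    have x2 : tm V p₀ 14 < l (φ (Symb.atom 2)) :=
      (hV.block_lt (by omega) (by omega) (show 14 < 15 by omega) (by omega)).1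
    have w0 : l (φ (Symb.atom 0)) < tm V p₀ 1 := hV.left_lt (by omega) (by omega) (by omega)
    have w1 : l (φ (Symb.atom 1)) < tm V p₀ 3 := hV.left_lt (by omega) (by omega) (by omega)
    have w2 : l (φ (Symb.atom 2)) < tm V p₀ 15 := hV.left_lt (by omega) (by omega) (by omega)
    have w3 : tm V p₀ 15 ≤ tm V p₀ (N - 1) :=
      hV.tm_le_same (by omega) (by omega) (by omega) (by omega)
    have v0 : tm V p₀ (N - 1) < r (φ (Symb.atom 0)) :=
      hV.lt_right (by omega) (by omega) (by omega) (by omega)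
    have v1 : r (φ (Symb.atom 0)) < tm V p₁ 0 := q1
    have v2 : tm V p₁ (N - 1) < r (φ (Symb.atom 1)) := q2
    have v3 : r (φ (Symb.atom 1)) < r (φ (Symb.atom 2)) :=
      (hV.block_lt (by omega) (by omega) (show 3 < 15 by omega) (by omega)).2
    have v4 : r (φ (Symb.atom 2)) < tm V p₂ 0 := q3
    have v5 : tm V p₁ 11 ≤ tm V p₁ (N - 1) :=
      hV.tm_le_same (by omega) (by omega) (by omega) (by omega)
    have v6 : tm V p₀ 3 < tm V p₀ 14 := hV.tm_lt_same (by omega) (by omega) (by omega) (by omega)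
    have v7 : tm V p₁ 0 < tm V p₁ 11 := hV.tm_lt_same (by omega) (by omega) (by omega) (by omega)
    rw [hg p₀ (by omega) 0 (by omega)] at x0
    have x2' := x2
    rw [hg p₀ (by omega) 14 (by omega)] at x2'
    have w1' := w1
    rw [hg p₀ (by omega) 3 (by omega)] at w1'
    have v1' := v1
    rw [hg p₁ (by omega) 0 (by omega)] at v1'
    have v4' := v4
    rw [hg p₂ le_rfl 0 (by omega)] at v4'
    have v5' := v5
    rw [hg p₁ (by omega) 11 (by omega)] at v5'
    have key : tm W 0 40 < l (φ (Symb.atom 0)) :=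
      (lt (by omega) (b0 _ _ (by omega) (by omega)) (by omega) (by omega)).trans x0
    have bl : ∀ p j, p ≤ p₂ → j < N → tm W (p * N + j) 0 < tm W (p * N + j) 40 := fun p j hp hj =>
      hW.tm_lt_same (by omega) (b0 p j hp hj) (by omega) (by omega)
    constructor
    · simp only [configY, Chain, List.map_cons, List.map_nil, Endpt.time, Function.comp_apply]
      have s : ∀ x : ℝ, [x].Pairwise (· < ·) := fun x => by simp
      refine ⟨key, w0.trans x1, w1'.trans (lt (by omega) (b0 _ _ (by omega) (by omega)) (by omega)
        (by omega)), bl _ _ (by omega) (by omega), s _, by simp, lt (by omega)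
        (b0 _ _ (by omega) (by omega)) (by omega) (by omega), bl _ _ (by omega) (by omega), s _,
        by simp, x2', by linarith, v1'.trans (lt (by omega) (b0 _ _ (by omega) (by omega)) (by omega)
        (by omega)), bl _ _ (by omega) (by omega), s _, by simp, lt (by omega)
        (b0 _ _ (by omega) (by omega)) (by omega) (by omega), bl _ _ (by omega) (by omega), s _,
        by simp, by linarith, v3, v4'.trans (lt (by omega) (b0 _ _ le_rfl (by omega)) (by omega)
        (by omega)), bl _ _ le_rfl (by omega), s _, by simp, lt (by omega)
        (b0 _ _ le_rfl (by omega)) (by omega) (by omega)⟩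
    · simp only [configY, List.mem_singleton]
      rintro g rfl
      refine concaveTimes_three ?_ ?_
      · rw [← List.isChain_iff_pairwise]
        simp only [List.isChain_cons_cons, List.isChain_singleton, and_true]
        exact ⟨w0.trans x1, by linarith, by linarith, by linarith, v3⟩
      · exact (hV.zigZag (by omega) (by omega) (show 1 < 3 by omega) (show 3 < 15 by omega)
          (by omega)).map Symb.glob d.mem_V

/-- As for `Y`, the segments `a, b, c` are globals of block `p₀`, now numbered 1, 3 and `5 * P`. The
numeric segments come from block `5 * P - 1` of the copies `p₀` and `p₁`. This block ends a copy of
`S(n+1)`, so they are over when block `5 * P` starts. -/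
theorem hasConfig_configZ (k n : ℕ) (hn : 1 ≤ n) (ys : List ℕ) (hys : ys.Pairwise (· < ·))
    (hyn : ∀ y ∈ ys, 1 ≤ y ∧ y ≤ n) :
    ∃ q q' : ℕ, HasConfig (k + 5) (n + 5) (configZ ys.length) ys [q, q'] := by
  have hP : 2 ≤ blockCount (k + 5) (n + 1) := two_le_blockCount (by omega) (by omega)
  have hP2 : 2 * blockCount (k + 5) (n + 1) ≤ blockCount (k + 5) (n + 2) :=
    two_mul_blockCount_le (by omega) (by omega)
  have hP3 : 2 * blockCount (k + 5) (n + 2) ≤ blockCount (k + 5) (n + 3) :=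
    two_mul_blockCount_le (by omega) (by omega)
  have hP4 : 2 * blockCount (k + 5) (n + 3) ≤ blockCount (k + 5) (n + 4) :=
    two_mul_blockCount_le (by omega) (by omega)
  have hs : blockCount (k + 5) (n + 5) = _ := blockCount_step (k + 3) (n + 4) (by omega)
  have eN : blockCount (k + 3 + 2) (n + 4) = blockCount (k + 5) (n + 4) := rfl
  have hD : ∀ {l r : Symb → ℝ} {W : TimedWord}, IsTimed (k + 5) (n + 4) l r W → ∀ i ≤ n,
      r (hsSymb (k + 5) (n + 4) (5 * blockCount (k + 5) (n + 1) - 1) i) <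
        tm W (5 * blockCount (k + 5) (n + 1)) 0 := fun hW i hi =>
    hW.right_lt_next (k := k + 2) hn (n + 4) (by omega) 5 i (by omega)
      (show 5 * blockCount (k + 5) (n + 1) < blockCount (k + 5) (n + 4) by omega) hi
  have hB := fun p j => hsSymb_block (k + 3) (n + 4) p j (by omega)
  rw [eN] at hs hB
  generalize hPe : blockCount (k + 5) (n + 1) = P at *
  generalize hNe : blockCount (k + 5) (n + 4) = N at *
  -- A multiple of `P` is needed for `right_lt_next`, and `5 * P - 1 > 3` places the numeric block
  -- after `L_b`. Being number `5 * P`, the segment `c` starts only after the first entry of block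
  -- `5 * P`, when the numeric segments of the first half have ended.
  obtain ⟨p₀, p₁, p₂, h0, h1, h2, h3, hQ⟩ := exists_three_blocks k (5 * P) (by omega)
  have hmono : blockCount (k + 4) (5 * P + 1) ≤ blockCount (k + 3 + 1) N :=
    blockCount_mono (by omega) (by omega) (by omega)
  have hp₂ : p₂ < blockCount (k + 3 + 1) N := lt_of_lt_of_le h3 hmono
  have b0 : ∀ p j, p ≤ p₂ → j < N → p * N + j < blockCount (k + 5) (n + 5) := fun p j hp hj => by
    rw [hs]; exact mul_add_lt_mul (by omega) hj
  have m0 : N ≤ p₀ * N := Nat.le_mul_of_pos_left _ h0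
  have m1 : (p₀ + 1) * N ≤ p₁ * N := Nat.mul_le_mul_right _ h1
  have m2 : (p₁ + 1) * N ≤ p₂ * N := Nat.mul_le_mul_right _ h2
  rw [add_mul] at m1 m2
  let φ : Symb → Symb := fun a => match a with
    | Symb.atom 0 => Symb.glob (hsSymb (k + 4) N p₀ 1)
    | Symb.atom 1 => Symb.glob (hsSymb (k + 4) N p₀ 3)
    | Symb.atom 2 => Symb.glob (hsSymb (k + 4) N p₀ (5 * P))
    | Symb.atom (j + 3) => if j < ys.length
        then hsSymb (k + 5) (n + 5) (p₀ * N + (5 * P - 1)) (ys.getD j 0)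
        else hsSymb (k + 5) (n + 5) (p₁ * N + (5 * P - 1)) (ys.getD (j - ys.length) 0)
    | _ => Symb.atom 0
  have he : (List.range' 1 ys.length).map (fun j => φ (Symb.atom (j + 2))) =
      ys.map (hsSymb (k + 5) (n + 5) (p₀ * N + (5 * P - 1))) := by
    apply List.ext_getElem (by simp)
    intro i h1 h2
    have hi : i < ys.length := by simpa using h2
    rw [List.getElem_map, List.getElem_map, List.getElem_range',
      show 1 + 1 * i + 2 = i + 3 by ring]
    simp [φ, hi]
  have he' : (List.range' (ys.length + 1) ys.length).map (fun j => φ (Symb.atom (j + 2))) =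
      ys.map (hsSymb (k + 5) (n + 5) (p₁ * N + (5 * P - 1))) := by
    apply List.ext_getElem (by simp)
    intro i h1 h2
    have hi : i < ys.length := by simpa using h2
    rw [List.getElem_map, List.getElem_map, List.getElem_range',
      show ys.length + 1 + 1 * i + 2 = ys.length + i + 3 by ring]
    simp [φ, hi]
  refine ⟨p₀ * N + (5 * P - 1), p₁ * N + (5 * P - 1), ⟨?_, ?_⟩, φ, p₂ * N + 1,
    b0 _ _ le_rfl (by omega), ?_, ?_⟩
  · simp; omega
  · simp only [List.mem_cons, List.not_mem_nil, or_false]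
    rintro q (rfl | rfl)
    all_goals exact ⟨by omega, b0 _ _ (by omega) (by omega)⟩
  · simp only [configZ, specialBlocks, specialBlocks_append, specialBlocks_map_plain_comp,
      List.cons_append, List.nil_append, List.map_cons, List.map_nil, List.map_map]
    exact congrArg₂ (fun u v => [u, v]) he he'
  · intro l r W hW
    obtain ⟨V, V', U, U', d⟩ := IsTimed.decompose (k := k + 3) hW (by omega)
    rw [show blockCount (k + 3 + 2) (n + 4) = N from hNe] at d
    have hV := d.timed_V
    obtain ⟨q1, q2, q3⟩ := hQ N (by omega) _ _ V hV
    have lt : ∀ {q q' i i' : ℕ}, q < q' → q' < blockCount (k + 5) (n + 5) → i < n + 5 → i' < n + 5 →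
        tm W q i < tm W q' i' := fun hq hq' hi hi' => hW.tm_lt (by omega) hq hq' hi hi'
    have hg : ∀ p ≤ p₂, ∀ j < N, tm V p j = tm W (p * N + j) (n + 4) := fun p hp j hj =>
      (d.tm_glob p (by omega) j hj).symm
    have hnum : ∀ p ≤ p₂, ∀ y ∈ ys, r (hsSymb (k + 5) (n + 5) (p * N + (5 * P - 1)) y) <
        tm W (p * N + 5 * P) 0 := fun p hp y hy => by
      rw [(hB p (5 * P - 1) (by omega) (by omega)).1 y (by have := (hyn y hy).2; omega),
        d.tm_loc p (by omega) (5 * P) (by omega) 0 (by omega)]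
      exact hD (d.timed_U p (by omega)) y (hyn y hy).2
    have x0 : tm V p₀ 0 < l (φ (Symb.atom 0)) :=
      (hV.block_lt (by omega) (by omega) (show 0 < 1 by omega) (by omega)).1
    have x1 : tm V p₀ 1 < l (φ (Symb.atom 1)) :=
      (hV.block_lt (by omega) (by omega) (show 1 < 3 by omega) (by omega)).1
    have x2 : tm W (p₀ * N + 5 * P) 0 < l (φ (Symb.atom 2)) := by
      have := (hW.block_lt (by omega) (b0 p₀ (5 * P) (by omega) (by omega))
        (show 0 < n + 4 by omega) (by omega)).1
      rwa [(hB p₀ (5 * P) (by omega) (by omega)).2] at this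
    have w0 : l (φ (Symb.atom 0)) < tm V p₀ 1 := hV.left_lt (by omega) (by omega) (by omega)
    have w1 : l (φ (Symb.atom 1)) < tm V p₀ 3 := hV.left_lt (by omega) (by omega) (by omega)
    have w2 : l (φ (Symb.atom 2)) < tm V p₀ (5 * P) := hV.left_lt (by omega) (by omega) (by omega)
    have w3 : tm V p₀ (5 * P) ≤ tm V p₀ (N - 1) :=
      hV.tm_le_same (by omega) (by omega) (by omega) (by omega)
    have v0 : tm V p₀ (N - 1) < r (φ (Symb.atom 0)) :=
      hV.lt_right (by omega) (by omega) (by omega) (by omega)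
    have v1 : r (φ (Symb.atom 0)) < tm V p₁ 0 := q1
    have v2 : tm V p₁ (N - 1) < r (φ (Symb.atom 1)) := q2
    have v3 : r (φ (Symb.atom 1)) < r (φ (Symb.atom 2)) :=
      (hV.block_lt (by omega) (by omega) (show 3 < 5 * P by omega) (by omega)).2
    have v4 : r (φ (Symb.atom 2)) < tm V p₂ 0 := q3
    have v5 : tm V p₁ (5 * P) ≤ tm V p₁ (N - 1) :=
      hV.tm_le_same (by omega) (by omega) (by omega) (by omega)
    have v7 : tm V p₁ 0 < tm V p₁ (5 * P) :=
      hV.tm_lt_same (by omega) (by omega) (by omega) (by omega)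
    have w4 : tm V p₀ 3 < tm W (p₀ * N + (5 * P - 1)) 0 := by
      rw [hg p₀ (by omega) 3 (by omega)]
      exact lt (by omega) (b0 _ _ (by omega) (by omega)) (by omega) (by omega)
    have w5 : tm W (p₁ * N + 5 * P) 0 < tm V p₁ (5 * P) := by
      rw [hg p₁ (by omega) (5 * P) (by omega)]
      exact hW.tm_lt_same (by omega) (b0 _ _ (by omega) (by omega)) (by omega) (by omega)
    have w6 : tm V p₁ 0 < tm W (p₁ * N + (5 * P - 1)) 0 := by
      rw [hg p₁ (by omega) 0 (by omega)]
      exact lt (by omega) (b0 _ _ (by omega) (by omega)) (by omega) (by omega)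
    have w7 : tm V p₂ 0 < tm W (p₂ * N + 1) 0 := by
      rw [hg p₂ (by omega) 0 (by omega)]
      exact lt (by omega) (b0 _ _ (by omega) (by omega)) (by omega) (by omega)
    have w8 : tm W 0 (n + 4) < tm V p₀ 0 := by
      rw [hg p₀ (by omega) 0 (by omega)]
      exact lt (by omega) (b0 _ _ (by omega) (by omega)) (by omega) (by omega)
    have hnext : ∀ p ≤ p₂, tm W (p * N + (5 * P - 1)) (n + 5 - 1) < tm W (p * N + 5 * P) 0 :=
      fun p hp => lt (by omega) (b0 _ _ hp (by omega)) (by omega) (by omega)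
    have hy' : ∀ y ∈ ys, 1 ≤ y ∧ y < n + 5 := fun y hy =>
      ⟨(hyn y hy).1, by have := (hyn y hy).2; omega⟩
    constructor
    · simp only [configZ, List.cons_append, List.nil_append, List.append_assoc]
      refine ⟨w8.trans x0, w0.trans x1, Chain.numerics hW (by omega) (by omega)
        (b0 _ _ (by omega) (by omega)) he hys hy' (w1.trans w4) (hnext p₀ (by omega))
        (hnum p₀ (by omega)) ⟨x2, ?_, Chain.numerics hW (by omega) (by omega)
          (b0 _ _ (by omega) (by omega)) he' hys hy' (v1.trans w6) (hnext p₁ (by omega))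
          (hnum p₁ (by omega)) ⟨?_, v3, v4.trans w7⟩⟩⟩
      · show l (φ (Symb.atom 2)) < r (φ (Symb.atom 0)); linarith
      · show _ < r (φ (Symb.atom 1)); linarith
    · simp only [configZ, List.mem_singleton]
      rintro g rfl
      refine concaveTimes_three ?_ ?_
      · rw [← List.isChain_iff_pairwise]
        simp only [List.isChain_cons_cons, List.isChain_singleton, and_true]
        have w9 : tm V p₀ 3 < tm V p₀ (5 * P) :=
          hV.tm_lt_same (by omega) (by omega) (by omega) (by omega)
        have w10 : tm W (p₀ * N + (5 * P - 1)) 0 < tm W (p₀ * N + 5 * P) 0 :=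
          lt (by omega) (b0 _ _ (by omega) (by omega)) (by omega) (by omega)
        exact ⟨w0.trans x1, by linarith, by linarith, by linarith, v3⟩
      · exact (hV.zigZag (by omega) (by omega) (show 1 < 3 by omega) (show 3 < 5 * P by omega)
          (by omega)).map Symb.glob d.mem_V

/-! ## The configuration in a Hart--Sharir sequence -/

/-- The block numbers `qs` of `A` become the numbers of the numeric segments of `Z` in `S_5`. They
are below `blockCount 6 m₀`, and the four extra steps up to `m` provide the room `n + 5` that
`hasConfig_configZ` asks for. -/
theorem HasConfig.shuffle_configZ {A : SegConfig} {ys qs : List ℕ} {m₀ m : ℕ} (hm₀ : 2 ≤ m₀)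
    (hm : m₀ + 4 ≤ m) (hA : HasConfig 6 m₀ A ys qs) (hys : ∀ y ∈ ys, y < m₀) :
    ∃ qs', HasConfig 6 (m + 1) (A.shuffle (configZ qs.length)) (ys ++ [m]) qs' ∧
      qs'.length = 2 * qs.length := by
  have h2 : 2 ≤ blockCount 6 m₀ := two_le_blockCount (by omega) (by omega)
  have h3 : ∀ j, blockCount 6 m₀ + j ≤ blockCount 6 (m₀ + j) := fun j => by
    induction j with
    | zero => exact le_rfl
    | succ j ih =>
      have := blockCount_strictMono (k := 6) (m := m₀ + j) (n := m₀ + (j + 1)) (by omega) (by omega)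
        (by omega)
      omega
  have h4 : blockCount 6 (m₀ + 4) ≤ blockCount 6 m := blockCount_mono (by omega) (by omega) hm
  obtain ⟨q, q', hZ⟩ := hasConfig_configZ 0 (blockCount 6 m₀ - 1) (by omega) qs hA.1.1
    (fun q hq => ⟨(hA.1.2 q hq).1, by have := (hA.1.2 q hq).2; omega⟩)
  have := h3 4
  have hZ' := HasConfig.lift (k := 2) (by omega) hZ (fun q hq => by have := (hA.1.2 q hq).2; omega)
    (show blockCount 6 m₀ - 1 + 5 ≤ blockCount 6 m by omega)
  exact ⟨_, HasConfig.shuffle (k := 3) (by omega) (HasConfig.lift (k := 3) hm₀ hA hys (by omega))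
    (fun y hy => by have := hys y hy; omega) hZ', by simp [two_mul]⟩

theorem HasConfig.shuffle_configF {A : SegConfig} {ys qs : List ℕ} {m₀ m : ℕ} (hm₀ : 2 ≤ m₀)
    (hm : m₀ + 1 ≤ m) (hA : HasConfig 6 m₀ A ys qs) (hys : ∀ y ∈ ys, y < m₀) :
    ∃ qs', HasConfig 6 (m + 1) (A.shuffle (configF qs.length)) (ys ++ [m]) qs' := by
  have h2 : 2 ≤ blockCount 6 m₀ := two_le_blockCount (by omega) (by omega)
  have h3 : blockCount 6 m₀ < blockCount 6 m := blockCount_strictMono (by omega) (by omega) hm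
  obtain ⟨q, hF⟩ := hasConfig_configF 2 (blockCount 6 m₀ - 1) (by omega) qs hA.1.1
    (fun q hq => ⟨(hA.1.2 q hq).1, by have := (hA.1.2 q hq).2; omega⟩)
  have hF' := HasConfig.lift (k := 2) (by omega) hF (fun q hq => by have := (hA.1.2 q hq).2; omega)
    (show blockCount 6 m₀ - 1 + 2 ≤ blockCount 6 m by omega)
  exact ⟨_, HasConfig.shuffle (k := 3) (by omega) (HasConfig.lift (k := 3) hm₀ hA hys (by omega))
    (fun y hy => by have := hys y hy; omega) hF'⟩

theorem pairwise_of_infix {α : Type} {R : α → α → Prop} {u v : List α} (h : v.Pairwise R)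
    (huv : u.IsInfix v) : u.Pairwise R := h.sublist huv.sublist

/-- The special blocks intersect concavely, too. -/
theorem HasConfig.concave_blocks {k m : ℕ} {T : SegConfig} {ys qs : List ℕ} (hk : 1 ≤ k)
    (hm : 2 ≤ m) (h : HasConfig k m T ys qs) (hys : ys.Pairwise (· < ·)) (hym : ∀ y ∈ ys, y < m) :
    HasConfig k m ⟨T.pieces, T.concave ++ specialBlocks T.pieces⟩ ys qs := by
  obtain ⟨hq, φ, z, hz, h1, h2⟩ := h
  refine ⟨hq, φ, z, hz, h1, fun l r W hW => ⟨(h2 l r W hW).1, fun g hg => ?_⟩⟩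
  rcases List.mem_append.1 hg with hg | hg
  · exact (h2 l r W hW).2 g hg
  have hg' := List.mem_map_of_mem (f := List.map φ) hg
  rw [h1] at hg'
  obtain ⟨q, hq', hgq⟩ := List.mem_map.1 hg'
  have hqm := (hq.2 q hq').2
  refine ⟨?_, fun a b c habc => ?_⟩
  · rw [← List.map_map, ← List.map_map, ← hgq, List.map_map, List.map_map]
    refine List.pairwise_append.2 ⟨List.pairwise_map.2 (hys.imp_of_mem fun {y y'} hy hy' hyy => ?_),
      List.pairwise_map.2 (hys.imp_of_mem fun {y y'} hy hy' hyy => ?_), ?_⟩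
    · exact (hW.left_lt hk hqm (hym y hy)).trans (hW.block_lt hk hqm hyy (hym y' hy')).1
    · exact (hW.block_lt hk hqm hyy (hym y' hy')).2
    · intro x hx x' hx'
      obtain ⟨y, hy, rfl⟩ := List.mem_map.1 hx
      obtain ⟨y', hy', rfl⟩ := List.mem_map.1 hx'
      exact ((hW.left_lt hk hqm (hym y hy)).trans_le (hW.tm_le_same hk hqm
        (by have := hym y hy; omega) (by omega))).trans (hW.lt_right hk hm hqm (hym y' hy'))
  · have h3 := habc.map φ
    rw [← hgq] at h3
    obtain ⟨P, Q, hPQ⟩ := h3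
    obtain ⟨P', Q', rfl, e2, -⟩ := List.map_eq_append_iff.1 hPQ.symm
    obtain ⟨P'', R, rfl, -, e4⟩ := List.map_eq_append_iff.1 e2
    obtain ⟨y, y', y'', rfl⟩ : ∃ y y' y'', R = [y, y', y''] :=
      List.length_eq_three.1 (by simpa using congrArg List.length e4)
    have h4 := pairwise_of_infix hys ⟨P'', Q', rfl⟩
    simp only [List.pairwise_cons, List.mem_cons, List.not_mem_nil, or_false, forall_eq_or_imp,
      forall_eq] at h4
    simp only [List.map_cons, List.map_nil, List.cons.injEq, and_true] at e4
    rw [← e4.1, ← e4.2.1, ← e4.2.2]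
    exact hW.zigZag hk hqm h4.1.1 h4.2.1 (hym y'' (by simp))

/-- The block numbers `y₁, …, y₅` of the five special blocks of `Y` dictate the numbers that the
five numeric segments of a group must have in `S_6`. So the first whisker is built with number `y₁`,
and the four subsequent shuffles are performed exactly at `m = y₂, …, y₅`; the gaps between the `yᵢ`
make this possible. A last shuffle, with `Y` in `S_7`, gives `X`. -/
theorem exists_configX : ∃ (m : ℕ) (φ : Symb → Symb), 1 ≤ m ∧
    ∀ (l r : Symb → ℝ) (W : TimedWord), IsTimed 7 m l r W →
      ((endpointWord configX.pieces).map (Endpt.time (l ∘ φ) (r ∘ φ))).Pairwise (· < ·) ∧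
      (∃ e ∈ entries W, ∃ e' ∈ entries W, ∀ a ∈ endpointWord configX.pieces,
        e.2 < a.time (l ∘ φ) (r ∘ φ) ∧ a.time (l ∘ φ) (r ∘ φ) < e'.2) ∧
      ∀ g ∈ configX.concave, ConcaveTimes l r {e | e ∈ entries W} φ g := by
  obtain ⟨m, y₁, y₂, y₃, y₄, y₅, hm, h0, h1, h2, h3, h4, hY⟩ := hasConfig_configY 2
  obtain ⟨q, q', hZ⟩ := hasConfig_configZ 1 y₁ h0 [y₁] (by simp) (by simp; omega)
  obtain ⟨qs2, hT2, hl2⟩ := HasConfig.shuffle_configZ (m₀ := y₁ + 5) (m := y₂) (by omega) (by omega)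
    hZ (by simp)
  obtain ⟨qs3, hT3, hl3⟩ := HasConfig.shuffle_configZ (m₀ := y₂ + 1) (m := y₃) (by omega) (by omega)
    hT2 (by simp; omega)
  obtain ⟨qs4, hT4, hl4⟩ := HasConfig.shuffle_configZ (m₀ := y₃ + 1) (m := y₄) (by omega) (by omega)
    hT3 (by simp; omega)
  obtain ⟨qs5, hT5⟩ := HasConfig.shuffle_configF (m₀ := y₄ + 1) (m := y₅) (by omega) (by omega)
    hT4 (by simp; omega)
  simp only [List.length_cons, List.length_nil] at hl2
  simp only [hl2] at hl3
  simp only [hl3] at hl4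
  rw [hl4, hl3, hl2] at hT5
  have hT : HasConfig 6 (y₅ + 1) configT4 [y₁, y₂, y₃, y₄, y₅] qs5 := hT5
  have hT' := hT.concave_blocks (by omega) (by omega) (by simp; omega) (by simp; omega)
  have hy₅ : y₅ < blockCount 7 m := (hY.1.2 y₅ (by simp)).2
  have hX := HasConfig.shuffle (k := 4) hm hY (by simp)
    (HasConfig.lift (k := 3) (by omega) hT' (by simp; omega) (show y₅ + 1 ≤ blockCount 7 m by omega))
  obtain ⟨-, φ, z, hz, -, hφ⟩ := hX
  refine ⟨m + 1, φ, by omega, fun l r W hW => ?_⟩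
  obtain ⟨h5, h6⟩ := hφ l r W hW
  have h7 := List.pairwise_cons.1 h5.pairwise
  refine ⟨h7.2, ⟨_, hW.mem_entries (by omega) (Nat.zero_lt_of_lt hz)
    (show m + 1 - 1 < m + 1 by omega), _, hW.mem_entries (by omega) hz (show 0 < m + 1 by omega),
    fun a ha => ⟨h7.1 _ (List.mem_map_of_mem ha), h5.lt_right_end a ha⟩⟩, fun g hg => h6 g ?_⟩
  simp only [configX, SegConfig.shuffle, List.mem_append, List.map_append] at hg ⊢
  tauto


/-! ## Plane geometry of convex curves -/

/-- Twice the signed area of the triangle `p q w`. -/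
def orient (p q w : ℝ × ℝ) : ℝ := planeCross (q - p) (w - p)

theorem orient_eq (p q w : ℝ × ℝ) :
    orient p q w = (q.1 - p.1) * (w.2 - p.2) - (q.2 - p.2) * (w.1 - p.1) := rfl

theorem orient_rotate (p q w : ℝ × ℝ) : orient q w p = orient p q w := by
  simp only [orient_eq]; ring

theorem orient_combo (p q v w : ℝ × ℝ) (s t : ℝ) (h : s + t = 1) :
    orient p q (s • v + t • w) = s * orient p q v + t * orient p q w := by
  obtain rfl : t = 1 - s := by linarith
  simp only [orient_eq, Prod.fst_add, Prod.snd_add, Prod.smul_fst, Prod.smul_snd, smul_eq_mul]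
  ring

theorem PlaneLine.height_combo (a : PlaneLine) (v w : ℝ × ℝ) (s t : ℝ) (h : s + t = 1) :
    a.height (s • v + t • w) = s * a.height v + t * a.height w := by
  obtain rfl : t = 1 - s := by linarith
  simp only [PlaneLine.height, Prod.fst_add, Prod.snd_add, Prod.smul_fst, Prod.smul_snd, smul_eq_mul]
  ring

theorem PlaneLine.continuous_height (a : PlaneLine) : Continuous a.height := by
  unfold PlaneLine.height; fun_prop

theorem continuous_orient (p q : ℝ × ℝ) : Continuous (orient p q) := by
  rw [show orient p q = fun w => (q.1 - p.1) * (w.2 - p.2) - (q.2 - p.2) * (w.1 - p.1) from rfl]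
  fun_prop

/-- The affine dependence of four points. -/
theorem PlaneLine.height_orient (a : PlaneLine) (p q v w : ℝ × ℝ) :
    a.height p * orient q v w - a.height q * orient p v w + a.height v * orient p q w
      - a.height w * orient p q v = 0 := by
  simp only [orient_eq, PlaneLine.height]; ring

theorem exists_combo_of_orient_eq_zero {p q w : ℝ × ℝ} (hpq : p ≠ q) (h : orient p q w = 0) :
    ∃ s : ℝ, w = (1 - s) • p + s • q := by
  rw [orient_eq] at h
  by_cases h1 : q.1 - p.1 = 0
  · have h2 : q.2 - p.2 ≠ 0 := fun h2 => hpq (Prod.ext (by linarith) (by linarith))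
    refine ⟨(w.2 - p.2) / (q.2 - p.2), Prod.ext ?_ ?_⟩
    · have : w.1 - p.1 = 0 := by
        rw [h1, zero_mul, zero_sub, neg_eq_zero] at h
        exact (mul_eq_zero.1 h).resolve_left h2
      simp only [Prod.fst_add, Prod.smul_fst, smul_eq_mul]
      linear_combination this - (w.2 - p.2) / (q.2 - p.2) * h1
    · simp only [Prod.snd_add, Prod.smul_snd, smul_eq_mul]
      field_simp; ring
  · refine ⟨(w.1 - p.1) / (q.1 - p.1), Prod.ext ?_ ?_⟩
    · simp only [Prod.fst_add, Prod.smul_fst, smul_eq_mul]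
      field_simp; ring
    · simp only [Prod.snd_add, Prod.smul_snd, smul_eq_mul]
      field_simp
      linear_combination h

theorem IsPreconnected.exists_mem_frontier {X : Type*} [TopologicalSpace X] {s t : Set X} (ht : IsPreconnected t)
    {x y : X} (hx : x ∈ t) (hxs : x ∈ s) (hy : y ∈ t) (hys : y ∉ s) : ∃ z ∈ t, z ∈ frontier s := by
  by_contra! hcon
  have hsub : t ⊆ interior s ∪ (closure s)ᶜ := by
    intro z hz
    by_contra h
    simp only [Set.mem_union, Set.mem_compl_iff, not_or, not_not] at h
    exact hcon z hz ⟨h.2, h.1⟩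
  have hxi : x ∈ interior s := by
    rcases hsub hx with h | h
    · exact h
    · exact absurd (subset_closure hxs) h
  have := ht.subset_left_of_subset_union isOpen_interior isClosed_closure.isOpen_compl
    (Set.disjoint_compl_right_iff_subset.2 (interior_subset.trans subset_closure)) hsub ⟨x, hx, hxi⟩
  exact hys (interior_subset (this hy))

namespace IsConvexCurve

variable {C : Set (ℝ × ℝ)} {c₀ : Option (ℝ × ℝ)} {γ : ℝ → ℝ × ℝ}

theorem mem_curve (hC : IsConvexCurve C c₀ γ) (t : ℝ) : γ t ∈ C := by
  cases c₀ with
  | none => exact (hC.unbounded_case rfl).1 ▸ Set.mem_range_self t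
  | some c =>
    have : γ t ∈ C \ {c} := (hC.closed_case c rfl).1 ▸ Set.mem_range_self t
    exact this.1

theorem mem_hull (hC : IsConvexCurve C c₀ γ) (t : ℝ) : γ t ∈ convexHull ℝ C :=
  subset_convexHull ℝ C (hC.mem_curve t)

theorem notMem_interior (hC : IsConvexCurve C c₀ γ) {p : ℝ × ℝ} (hp : p ∈ C) :
    p ∉ interior (convexHull ℝ C) := by
  rw [← hC.frontier_hull] at hp
  exact hp.2

theorem orient_nonneg (hC : IsConvexCurve C c₀ γ) {s t u : ℝ} (hst : s < t) (htu : t < u) :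
    0 ≤ orient (γ s) (γ t) (γ u) := hC.counterclockwise s t u hst htu

/-- For `s ≤ 0` the point `p` would be a convex combination of the interior point `w`, with positive
weight, and `q`; then it would be interior. -/
theorem pos_of_interior (hC : IsConvexCurve C c₀ γ) {p q w : ℝ × ℝ} (hp : p ∈ C)
    (hq : q ∈ C) (hw : w ∈ interior (convexHull ℝ C)) {s : ℝ} (h : w = (1 - s) • p + s • q) :
    0 < s := by
  by_contra! hs
  refine hC.notMem_interior hp ?_
  have key := (convex_convexHull ℝ C).combo_interior_self_mem_interior hw
    (subset_convexHull ℝ C hq) (a := 1 / (1 - s)) (b := -s / (1 - s)) (by apply one_div_pos.2; linarith)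
    (div_nonneg (by linarith) (by linarith)) (by have : (1 - s) ≠ 0 := by linarith
                                                 field_simp; ring)
  have h1 : (1 - s) ≠ 0 := by linarith
  have h2 : 1 / (1 - s) * (1 - s) = 1 := by field_simp
  convert key using 1
  rw [h]
  refine Prod.ext ?_ ?_ <;>
  simp only [Prod.fst_add, Prod.snd_add, Prod.smul_fst, Prod.smul_snd, smul_eq_mul] <;> field_simp <;>
  ring

theorem mem_openSegment (hC : IsConvexCurve C c₀ γ) {p q w : ℝ × ℝ} (hp : p ∈ C)
    (hq : q ∈ C) (hpq : p ≠ q) (hw : w ∈ interior (convexHull ℝ C)) (h : orient p q w = 0) :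
    ∃ s : ℝ, 0 < s ∧ s < 1 ∧ w = (1 - s) • p + s • q := by
  obtain ⟨s, hs⟩ := exists_combo_of_orient_eq_zero hpq h
  refine ⟨s, hC.pos_of_interior hp hq hw hs, ?_, hs⟩
  have := hC.pos_of_interior hq hp hw (s := 1 - s) (by rw [hs, add_comm]; simp)
  linarith

/-- If `w` were beyond `p` or `q`, this end point would lie strictly between the interior point `o`
and a point of the hull. -/
theorem mem_segment (hC : IsConvexCurve C c₀ γ) {p q o w : ℝ × ℝ} (hp : p ∈ C)
    (hq : q ∈ C) (hpq : p ≠ q) (ho : o ∈ interior (convexHull ℝ C)) (h : orient p q o = 0)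
    (hw : w ∈ convexHull ℝ C) (h' : orient p q w = 0) :
    ∃ s : ℝ, 0 ≤ s ∧ s ≤ 1 ∧ w = (1 - s) • p + s • q := by
  obtain ⟨s, hs0, hs1, hs⟩ := hC.mem_openSegment hp hq hpq ho h
  obtain ⟨t, ht⟩ := exists_combo_of_orient_eq_zero hpq h'
  refine ⟨t, ?_, ?_, ht⟩
  · by_contra! h0
    have h1 : s - t ≠ 0 := by linarith
    refine hC.notMem_interior hp ?_
    have key := (convex_convexHull ℝ C).combo_interior_self_mem_interior ho hw (a := -t / (s - t))
      (b := s / (s - t)) (div_pos (by linarith) (by linarith)) (div_nonneg hs0.le (by linarith))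
      (by field_simp; ring)
    convert key using 1
    rw [hs, ht]
    refine Prod.ext ?_ ?_ <;>
    simp only [Prod.fst_add, Prod.snd_add, Prod.smul_fst, Prod.smul_snd, smul_eq_mul] <;>
    field_simp <;> ring
  · by_contra! h0
    have h1 : t - s ≠ 0 := by linarith
    refine hC.notMem_interior hq ?_
    have key := (convex_convexHull ℝ C).combo_interior_self_mem_interior ho hw (a := (t - 1) / (t - s))
      (b := (1 - s) / (t - s)) (div_pos (by linarith) (by linarith))
      (div_nonneg (by linarith) (by linarith)) (by field_simp; ring)
    convert key using 1
    rw [hs, ht]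
    refine Prod.ext ?_ ?_ <;>
    simp only [Prod.fst_add, Prod.snd_add, Prod.smul_fst, Prod.smul_snd, smul_eq_mul] <;>
    field_simp <;> ring

/-- Three points of the curve do not lie on a line that meets the interior. -/
theorem eq_or_eq_of_has (hC : IsConvexCurve C c₀ γ) {a : PlaneLine} {o p q w : ℝ × ℝ}
    (ho : o ∈ interior (convexHull ℝ C)) (hao : a.Has o) (hp : p ∈ C) (hap : a.Has p)
    (hq : q ∈ C) (haq : a.Has q) (hw : w ∈ C) (haw : a.Has w) (hpq : p ≠ q) : w = p ∨ w = q := by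
  simp only [PlaneLine.Has, PlaneLine.height] at hao hap haq haw
  have h1 : orient p q o = 0 := by
    rw [orient_eq]
    linear_combination (q.1 - p.1) * (hao - hap) - (o.1 - p.1) * (haq - hap)
  have h2 : orient p q w = 0 := by
    rw [orient_eq]
    linear_combination (q.1 - p.1) * (haw - hap) - (w.1 - p.1) * (haq - hap)
  obtain ⟨s, hs0, hs1, hs⟩ := hC.mem_openSegment hp hq hpq ho h1
  obtain ⟨t, ht0, ht1, ht⟩ := hC.mem_segment hp hq hpq ho h1 (subset_convexHull ℝ C hw) h2
  by_contra! hcon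
  have ht0' : 0 < t := lt_of_le_of_ne ht0 (by rintro rfl; exact hcon.1 (by rw [ht]; simp))
  have ht1' : t < 1 := lt_of_le_of_ne ht1 (by rintro rfl; exact hcon.2 (by rw [ht]; simp))
  refine hC.notMem_interior hw ?_
  rcases le_total t s with hts | hts
  · have key := (convex_convexHull ℝ C).combo_interior_self_mem_interior ho
      (subset_convexHull ℝ C hp) (a := t / s) (b := 1 - t / s) (by positivity)
      (by rw [sub_nonneg, div_le_one hs0]; exact hts) (by ring)
    convert key using 1
    rw [hs, ht]
    refine Prod.ext ?_ ?_ <;>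
    simp only [Prod.fst_add, Prod.snd_add, Prod.smul_fst, Prod.smul_snd, smul_eq_mul] <;>
    field_simp <;> ring
  · have h1 : (1 - s) ≠ 0 := by linarith
    have key := (convex_convexHull ℝ C).combo_interior_self_mem_interior ho
      (subset_convexHull ℝ C hq) (a := (1 - t) / (1 - s)) (b := 1 - (1 - t) / (1 - s))
      (div_pos (by linarith) (by linarith))
      (by rw [sub_nonneg, div_le_one (by linarith)]; linarith) (by ring)
    convert key using 1
    rw [hs, ht]
    refine Prod.ext ?_ ?_ <;>
    simp only [Prod.fst_add, Prod.snd_add, Prod.smul_fst, Prod.smul_snd, smul_eq_mul] <;>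
    field_simp <;> ring

/-- A small half circle around `c`, from the direction of an interior point to the opposite
direction, starts inside the hull and ends outside. It meets the frontier, which is `C`, at a point
near `c` and different from it. -/
theorem mem_closure_range (hC : IsConvexCurve C c₀ γ) {c : ℝ × ℝ} (hc : c₀ = some c) :
    c ∈ closure (Set.range γ) := by
  obtain ⟨hr, -, hcC, -⟩ := hC.closed_case c hc
  obtain ⟨o, ho⟩ := hC.interior_hull
  have hoc : o ≠ c := by rintro rfl; exact hC.notMem_interior hcC ho
  have hK := convex_convexHull ℝ C
  have hcK := subset_convexHull ℝ C hcC
  rw [Metric.mem_closure_iff]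
  intro ε hε
  obtain ⟨d, hd⟩ : ∃ d, d = c - o := ⟨_, rfl⟩
  have hd0 : 0 < d.1 ^ 2 + d.2 ^ 2 := by
    by_contra! h
    have h1 : d.1 = 0 := by nlinarith [sq_nonneg d.1, sq_nonneg d.2]
    have h2 : d.2 = 0 := by nlinarith [sq_nonneg d.1, sq_nonneg d.2]
    rw [hd] at h1 h2
    exact hoc (Prod.ext (by simp at h1; linarith) (by simp at h2; linarith))
  set M := |d.1| + |d.2| + 1 with hM
  have hM1 : |d.1| < M := by rw [hM]; linarith [abs_nonneg d.2]
  have hM2 : |d.2| < M := by rw [hM]; linarith [abs_nonneg d.1]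
  have hM0 : 0 < M := (abs_nonneg _).trans_lt hM1
  obtain ⟨η, hη0, hη⟩ : ∃ η : ℝ, 0 < η ∧ η < 1 ∧ η * M < ε := by
    refine ⟨min (1 / 2) (ε / (2 * M)), by positivity, (min_le_left _ _).trans_lt (by norm_num), ?_⟩
    calc _ ≤ ε / (2 * M) * M := mul_le_mul_of_nonneg_right (min_le_right _ _) hM0.le
      _ < ε := by field_simp; linarith
  let x : ℝ → ℝ × ℝ := fun θ => (c.1 + η * (-Real.cos θ * d.1 - Real.sin θ * d.2),
    c.2 + η * (-Real.cos θ * d.2 + Real.sin θ * d.1))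
  have hx : Continuous x := by fun_prop
  have hx0 : x 0 ∈ convexHull ℝ C := by
    refine interior_subset (?_ : _ ∈ interior (convexHull ℝ C))
    have key := hK.combo_interior_self_mem_interior ho hcK hη0 (b := 1 - η) (by linarith) (by ring)
    convert key using 1
    refine Prod.ext ?_ ?_ <;>
    simp only [x, hd, Real.cos_zero, Real.sin_zero, Prod.fst_add, Prod.snd_add, Prod.smul_fst,
      Prod.smul_snd, smul_eq_mul, Prod.fst_sub, Prod.snd_sub] <;> ring
  have hxπ : x Real.pi ∉ convexHull ℝ C := by
    intro h
    refine hC.notMem_interior hcC ?_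
    have key := hK.combo_interior_self_mem_interior ho h (a := η / (1 + η)) (b := 1 / (1 + η))
      (by positivity) (by positivity) (by field_simp; ring)
    convert key using 1
    refine Prod.ext ?_ ?_ <;>
    simp only [x, hd, Real.cos_pi, Real.sin_pi, Prod.fst_add, Prod.snd_add, Prod.smul_fst,
      Prod.smul_snd, smul_eq_mul, Prod.fst_sub, Prod.snd_sub] <;> field_simp <;> ring
  obtain ⟨z, ⟨θ, -, rfl⟩, hz⟩ := ((isPreconnected_Icc (a := (0 : ℝ)) (b := Real.pi)).image x
    hx.continuousOn).exists_mem_frontier ⟨0, ⟨le_rfl, Real.pi_pos.le⟩, rfl⟩ hx0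
    ⟨Real.pi, ⟨Real.pi_pos.le, le_rfl⟩, rfl⟩ hxπ
  rw [hC.frontier_hull] at hz
  refine ⟨x θ, ?_, ?_⟩
  · rw [hr]
    refine ⟨hz, fun h => ?_⟩
    have h1 : η * (-Real.cos θ * d.1 - Real.sin θ * d.2) = 0 := by
      have := congrArg Prod.fst h; simp only [x] at this; linarith
    have h2 : η * (-Real.cos θ * d.2 + Real.sin θ * d.1) = 0 := by
      have := congrArg Prod.snd h; simp only [x] at this; linarith
    have h3 := (mul_eq_zero.1 h1).resolve_left hη0.ne'
    have h4 := (mul_eq_zero.1 h2).resolve_left hη0.ne'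
    have h5 : (Real.sin θ ^ 2 + Real.cos θ ^ 2) * (d.1 ^ 2 + d.2 ^ 2) = 0 := by
      linear_combination (-Real.cos θ * d.1 - Real.sin θ * d.2) * h3 +
        (-Real.cos θ * d.2 + Real.sin θ * d.1) * h4
    rw [Real.sin_sq_add_cos_sq, one_mul] at h5
    exact hd0.ne' h5
  · have b1 : |-Real.cos θ * d.1 - Real.sin θ * d.2| ≤ M := by
      calc _ ≤ |-Real.cos θ * d.1| + |Real.sin θ * d.2| := abs_sub _ _
        _ ≤ 1 * |d.1| + 1 * |d.2| := by
          rw [abs_mul, abs_mul, abs_neg]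
          gcongr
          · exact Real.abs_cos_le_one θ
          · exact Real.abs_sin_le_one θ
        _ ≤ M := by rw [hM]; linarith
    have b2 : |-Real.cos θ * d.2 + Real.sin θ * d.1| ≤ M := by
      calc _ ≤ |-Real.cos θ * d.2| + |Real.sin θ * d.1| := abs_add_le _ _
        _ ≤ 1 * |d.2| + 1 * |d.1| := by
          rw [abs_mul, abs_mul, abs_neg]
          gcongr
          · exact Real.abs_cos_le_one θ
          · exact Real.abs_sin_le_one θ
        _ ≤ M := by rw [hM]; linarith
    rw [Prod.dist_eq]
    refine max_lt ?_ ?_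
    · rw [Real.dist_eq]
      calc _ = η * |-Real.cos θ * d.1 - Real.sin θ * d.2| := by
            simp only [x]; rw [← abs_neg, ← abs_of_pos hη0, ← abs_mul, abs_of_pos hη0]; ring_nf
        _ ≤ η * M := by gcongr
        _ < ε := hη.2
    · rw [Real.dist_eq]
      calc _ = η * |-Real.cos θ * d.2 + Real.sin θ * d.1| := by
            simp only [x]; rw [← abs_neg, ← abs_of_pos hη0, ← abs_mul, abs_of_pos hη0]; ring_nf
        _ ≤ η * M := by gcongr
        _ < ε := hη.2

/-- In the closed case, the topmost point comes after (and before) all the other ones. -/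
theorem orient_top_nonneg (hC : IsConvexCurve C c₀ γ) {c : ℝ × ℝ} (hc : c₀ = some c)
    {s t : ℝ} (hst : s < t) : 0 ≤ orient (γ s) (γ t) c := by
  have hr := (hC.closed_case c hc).1
  -- The compact arc over `[s, t]` misses `c`, so `c` is a limit of curve points outside it, for
  -- which the orientation is nonnegative.
  have h1 : c ∈ closure (γ '' (Set.Icc s t)ᶜ) := by
    have h2 := hC.mem_closure_range hc
    rw [← Set.image_univ, ← Set.union_compl_self (Set.Icc s t), Set.image_union, closure_union,
      ((isCompact_Icc.image hC.continuous_param).isClosed).closure_eq] at h2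
    refine h2.resolve_left ?_
    rintro ⟨τ, -, hτ⟩
    have : γ τ ∈ C \ {c} := hr ▸ Set.mem_range_self τ
    exact this.2 hτ
  have h2 : closure (γ '' (Set.Icc s t)ᶜ) ⊆ {w | 0 ≤ orient (γ s) (γ t) w} := by
    refine closure_minimal ?_ (isClosed_le continuous_const (continuous_orient _ _))
    rintro _ ⟨τ, hτ, rfl⟩
    rw [Set.mem_compl_iff, Set.mem_Icc, not_and_or, not_le, not_le] at hτ
    rcases hτ with hτ | hτ
    · show 0 ≤ orient (γ s) (γ t) (γ τ)
      rw [orient_rotate]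
      exact hC.orient_nonneg hτ hst
    · exact hC.orient_nonneg hst hτ
  exact h2 h1

/-- On a line, an injective curve does not cross a level twice. -/
theorem not_dip (hC : IsConvexCurve C c₀ γ) {a : PlaneLine} {κ v t₁ t₂ t₃ : ℝ} {p q : ℝ × ℝ}
    (hpq : p ≠ q) (h12 : t₁ < t₂) (h23 : t₂ < t₃)
    (hline : ∀ t ∈ Set.Icc t₁ t₃, κ * a.height (γ t) = v → orient p q (γ t) = 0)
    (h1 : κ * a.height (γ t₁) < v) (h2 : v < κ * a.height (γ t₂)) (h3 : κ * a.height (γ t₃) < v)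
    (hne : κ * a.height p ≠ κ * a.height q) : False := by
  have hcont : Continuous fun t => κ * a.height (γ t) :=
    continuous_const.mul (a.continuous_height.comp hC.continuous_param)
  obtain ⟨τ₁, ⟨ha1, hb1⟩, he1⟩ := intermediate_value_Icc h12.le hcont.continuousOn ⟨h1.le, h2.le⟩
  obtain ⟨τ₂, ⟨ha2, hb2⟩, he2⟩ := intermediate_value_Icc' h23.le hcont.continuousOn ⟨h3.le, h2.le⟩
  simp only at he1 he2
  obtain ⟨x, hx⟩ := exists_combo_of_orient_eq_zero hpq (hline τ₁ ⟨ha1, hb1.trans h23.le⟩ he1)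
  obtain ⟨y, hy⟩ := exists_combo_of_orient_eq_zero hpq (hline τ₂ ⟨h12.le.trans ha2, hb2⟩ he2)
  -- The height is injective on the line `p q`, so both passages through the level `v` are at the
  -- same point of it, hence at the same parameter.
  have hxy : x = y := by
    have e1 := he1.trans he2.symm
    rw [hx, hy, a.height_combo _ _ _ _ (by ring), a.height_combo _ _ _ _ (by ring)] at e1
    have : (x - y) * (κ * a.height q - κ * a.height p) = 0 := by linear_combination e1
    exact sub_eq_zero.1 ((mul_eq_zero.1 this).resolve_right (sub_ne_zero.2 hne.symm))
  have hττ : τ₁ = τ₂ := hC.injective_param (by rw [hx, hy, hxy])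
  subst hττ
  obtain rfl : τ₁ = t₂ := le_antisymm hb1 ha2
  linarith

end IsConvexCurve


/-! ## Negative sides -/

/-- The factor by which `sideValue` differs from the height. -/
def sideSign : Option (ℝ × ℝ) → PlaneLine → ℝ
  | none, _ => 1
  | some c, a => a.height c

theorem sideValue_eq (c₀ : Option (ℝ × ℝ)) (a : PlaneLine) (p : ℝ × ℝ) :
    sideValue c₀ a p = sideSign c₀ a * a.height p := by
  cases c₀ with
  | none => simp [sideValue, sideSign]
  | some c => rfl

theorem sideSign_ne_zero {c₀ : Option (ℝ × ℝ)} {a : PlaneLine}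
    (ha : ∀ c, c₀ = some c → ¬ a.Has c) : sideSign c₀ a ≠ 0 := by
  cases c₀ with
  | none => exact one_ne_zero
  | some c => exact ha c rfl

theorem sideValue_combo (c₀ : Option (ℝ × ℝ)) (a : PlaneLine) (v w : ℝ × ℝ) (s t : ℝ)
    (h : s + t = 1) :
    sideValue c₀ a (s • v + t • w) = s * sideValue c₀ a v + t * sideValue c₀ a w := by
  simp only [sideValue_eq, a.height_combo _ _ _ _ h]; ring

theorem sideValue_combo_three (c₀ : Option (ℝ × ℝ)) (a : PlaneLine) (p q w : ℝ × ℝ) (s t u : ℝ)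
    (h : s + t + u = 1) :
    sideValue c₀ a (s • p + t • q + u • w) =
      s * sideValue c₀ a p + t * sideValue c₀ a q + u * sideValue c₀ a w := by
  obtain rfl : u = 1 - s - t := by linarith
  simp only [sideValue_eq, PlaneLine.height, Prod.fst_add, Prod.snd_add, Prod.smul_fst,
    Prod.smul_snd, smul_eq_mul]
  ring

theorem sideValue_eq_zero {c₀ : Option (ℝ × ℝ)} {a : PlaneLine}
    (ha : ∀ c, c₀ = some c → ¬ a.Has c) {p : ℝ × ℝ} : sideValue c₀ a p = 0 ↔ a.Has p := by
  rw [sideValue_eq, mul_eq_zero, or_iff_right (sideSign_ne_zero ha)]; rfl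

theorem continuous_sideValue (c₀ : Option (ℝ × ℝ)) (a : PlaneLine) : Continuous (sideValue c₀ a) := by
  rw [show sideValue c₀ a = fun p => sideSign c₀ a * a.height p from funext (sideValue_eq c₀ a)]
  exact continuous_const.mul a.continuous_height

theorem sideValue_orient (c₀ : Option (ℝ × ℝ)) (a : PlaneLine) (p q v w : ℝ × ℝ) :
    sideValue c₀ a p * orient q v w - sideValue c₀ a q * orient p v w
      + sideValue c₀ a v * orient p q w - sideValue c₀ a w * orient p q v = 0 := by
  simp only [sideValue_eq]
  linear_combination sideSign c₀ a * a.height_orient p q v w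

theorem sideValue_top_pos {c : ℝ × ℝ} {a : PlaneLine} (ha : ¬ a.Has c) :
    0 < sideValue (some c) a c := mul_self_pos.2 ha

/-- Its sign tells on which side of its meeting point with `x` the line `y` is above `x`. -/
def turn (c₀ : Option (ℝ × ℝ)) (x y : PlaneLine) : ℝ :=
  sideSign c₀ x * sideSign c₀ y * (y.slope - x.slope)

theorem turn_neg (c₀ : Option (ℝ × ℝ)) (x y : PlaneLine) : turn c₀ y x = -turn c₀ x y := by
  simp only [turn]; ring

/-- The side values of `x` and `y` are affine functions on the plane, and `turn` is the determinant
of their linear parts; orientations are computed in these coordinates. -/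
theorem orient_mul_turn (c₀ : Option (ℝ × ℝ)) (x y : PlaneLine) (p q w : ℝ × ℝ) :
    orient p q w * turn c₀ x y =
      (sideValue c₀ x q - sideValue c₀ x p) * (sideValue c₀ y w - sideValue c₀ y p) -
      (sideValue c₀ y q - sideValue c₀ y p) * (sideValue c₀ x w - sideValue c₀ x p) := by
  simp only [sideValue_eq, turn, PlaneLine.height, orient_eq]; ring

theorem eq_of_sideValue_eq {c₀ : Option (ℝ × ℝ)} {x y : PlaneLine} (h : turn c₀ x y ≠ 0) {p q : ℝ × ℝ}
    (hx : sideValue c₀ x p = sideValue c₀ x q) (hy : sideValue c₀ y p = sideValue c₀ y q) :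
    p = q := by
  simp only [sideValue_eq, turn, PlaneLine.height] at *
  have h1 : turn c₀ x y * (p.1 - q.1) = 0 := by
    simp only [turn]
    linear_combination sideSign c₀ y * hx - sideSign c₀ x * hy
  have h2 : p.1 = q.1 := by
    have := (mul_eq_zero.1 h1).resolve_left h; linarith
  have h3 : sideSign c₀ x ≠ 0 := fun h0 => h (by rw [h0]; ring)
  refine Prod.ext h2 ?_
  have := mul_left_cancel₀ h3 hx
  rw [h2] at this
  linarith

/-- The common point of two lines. -/
noncomputable def PlaneLine.meet (a b : PlaneLine) : ℝ × ℝ :=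
  ((b.icept - a.icept) / (a.slope - b.slope),
    a.slope * ((b.icept - a.icept) / (a.slope - b.slope)) + a.icept)

theorem PlaneLine.has_meet_left (a b : PlaneLine) : a.Has (a.meet b) := by
  simp [PlaneLine.Has, PlaneLine.height, PlaneLine.meet]

theorem PlaneLine.has_meet_right {a b : PlaneLine} (h : a.slope ≠ b.slope) : b.Has (a.meet b) := by
  have : a.slope - b.slope ≠ 0 := sub_ne_zero.2 h
  simp only [PlaneLine.Has, PlaneLine.height, PlaneLine.meet]
  field_simp
  ring

theorem Convex.combo_three_mem_interior {K : Set (ℝ × ℝ)} (hK : Convex ℝ K) {p q w : ℝ × ℝ}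
    (hp : p ∈ interior K) (hq : q ∈ interior K) (hw : w ∈ K) {s t u : ℝ} (hs : 0 ≤ s) (ht : 0 ≤ t)
    (hu : 0 ≤ u) (hst : 0 < s + t) (h : s + t + u = 1) : s • p + t • q + u • w ∈ interior K := by
  have h1 := hK.interior hp hq (a := s / (s + t)) (b := t / (s + t)) (by positivity) (by positivity)
    (by field_simp)
  have h2 := hK.combo_interior_self_mem_interior h1 hw hst hu h
  convert h2 using 2
  rw [smul_add, smul_smul, smul_smul, mul_div_cancel₀ _ hst.ne', mul_div_cancel₀ _ hst.ne']

namespace IsConvexCurve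

variable {C : Set (ℝ × ℝ)} {c₀ : Option (ℝ × ℝ)} {γ : ℝ → ℝ × ℝ}

/-- The parameters of the points on the negative side of a line form an interval. -/
theorem sideValue_neg_of_between (hC : IsConvexCurve C c₀ γ) {a : PlaneLine}
    (ha : ∀ c, c₀ = some c → ¬ a.Has c) {t₁ t₂ t₃ : ℝ} (h12 : t₁ < t₂) (h23 : t₂ < t₃)
    (h1 : sideValue c₀ a (γ t₁) < 0) (h3 : sideValue c₀ a (γ t₃) < 0) :
    sideValue c₀ a (γ t₂) < 0 := by
  cases hc : c₀ with
  | none =>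
    subst hc
    simp only [sideValue, PlaneLine.height] at h1 h3 ⊢
    obtain ⟨-, hx, -⟩ := hC.unbounded_case rfl
    have e := hC.orient_nonneg h12 h23
    have x12 := hx h12
    have x23 := hx h23
    simp only at x12 x23
    rw [orient_eq] at e
    by_contra! h2
    nlinarith [mul_pos (sub_pos.2 x12) (neg_pos.2 h3), mul_pos (sub_pos.2 x23) (neg_pos.2 h1),
      mul_nonneg (sub_pos.2 (x12.trans x23)).le h2]
  | some c =>
    subst hc
    by_contra! h2
    have hcpos := sideValue_top_pos (ha c rfl)
    -- In the affine dependence of the three curve points and `c` all terms have the same sign under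
    -- these assumptions, so all of them vanish.
    have col : ∀ {s₁ s₂ s₃ : ℝ}, s₁ < s₂ → s₂ < s₃ → sideValue (some c) a (γ s₁) < 0 →
        0 ≤ sideValue (some c) a (γ s₂) → sideValue (some c) a (γ s₃) < 0 →
        orient (γ s₁) (γ s₂) c = 0 ∧ orient (γ s₂) (γ s₃) c = 0 := by
      intro s₁ s₂ s₃ l12 l23 g1 g2 g3
      have e := sideValue_orient (some c) a (γ s₁) (γ s₂) (γ s₃) c
      have o1 := hC.orient_top_nonneg rfl l12
      have o2 := hC.orient_top_nonneg rfl l23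
      have o3 := hC.orient_top_nonneg rfl (l12.trans l23)
      have o4 := hC.orient_nonneg l12 l23
      have m1 := mul_nonneg (neg_pos.2 g1).le o2
      have m2 := mul_nonneg g2 o3
      have m3 := mul_nonneg (neg_pos.2 g3).le o1
      have m4 := mul_nonneg hcpos.le o4
      have z1 : -sideValue (some c) a (γ s₁) * orient (γ s₂) (γ s₃) c = 0 := by linarith
      have z3 : -sideValue (some c) a (γ s₃) * orient (γ s₁) (γ s₂) c = 0 := by linarith
      exact ⟨(mul_eq_zero.1 z3).resolve_left (by linarith),
        (mul_eq_zero.1 z1).resolve_left (by linarith)⟩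
    have hne : γ t₂ ≠ c := by
      have : γ t₂ ∈ C \ {c} := (hC.closed_case c rfl).1 ▸ Set.mem_range_self t₂
      exact this.2
    -- The collinear case remains. The side value rises through the level `v < 0` and falls back
    -- again, always on the line through `γ t₂` and `c`, which `not_dip` excludes.
    obtain ⟨v, hv1, hv2⟩ := exists_between (max_lt h1 h3)
    have line : ∀ {t : ℝ}, orient (γ t) (γ t₂) c = 0 → orient (γ t₂) c (γ t) = 0 := fun h => by
      rw [orient_rotate]; exact h
    have line' : ∀ {t : ℝ}, orient (γ t₂) (γ t) c = 0 → orient (γ t₂) c (γ t) = 0 := fun {t} h => by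
      rw [orient_eq] at h ⊢; linarith
    simp only [sideValue_eq] at h1 h2 h3 hv1
    refine hC.not_dip (a := a) (κ := sideSign (some c) a) (v := v) (p := γ t₂) (q := c) hne h12 h23
      ?_ ((le_max_left _ _).trans_lt hv1) (hv2.trans_le h2) ((le_max_right _ _).trans_lt hv1) ?_
    · intro t ht hvt
      rcases lt_trichotomy t t₂ with htt | rfl | htt
      · exact line (col htt h23 (by rw [sideValue_eq, hvt]; exact hv2) (by rw [sideValue_eq]; exact h2)
          (by rw [sideValue_eq]; exact h3)).1
      · linarith
      · exact line' (col h12 htt (by rw [sideValue_eq]; exact h1) (by rw [sideValue_eq]; exact h2)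
          (by rw [sideValue_eq, hvt]; exact hv2)).2
    · intro heq
      obtain ⟨s, hs⟩ := exists_combo_of_orient_eq_zero hne (line (col h12 h23
        (by rw [sideValue_eq]; exact h1) (by rw [sideValue_eq]; exact h2)
        (by rw [sideValue_eq]; exact h3)).1)
      rw [hs, a.height_combo _ _ _ _ (by ring)] at h1
      have : sideSign (some c) a * ((1 - s) * a.height (γ t₂) + s * a.height c) =
        sideSign (some c) a * a.height (γ t₂) := by linear_combination -s * heq
      linarith

end IsConvexCurve

/-! ## Two visits -/

section Position

variable {K : Set (ℝ × ℝ)} {c₀ : Option (ℝ × ℝ)} {x y : PlaneLine}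

/-- The crossing is found in the triangle `p q c`: the weights are chosen to make both side values
vanish, and the points `p` and `q`, which are interior, get positive weight. -/
theorem meet_mem_interior (hK : Convex ℝ K) (hxy : x.slope ≠ y.slope)
    (ht : turn c₀ x y ≠ 0) {p q c : ℝ × ℝ} (hp : p ∈ interior K) (hq : q ∈ interior K) (hc : c ∈ K)
    (hxp : sideValue c₀ x p = 0) (hyp : sideValue c₀ y p < 0)
    (hyq : sideValue c₀ y q = 0) (hxq : sideValue c₀ x q < 0)
    (hxc : 0 < sideValue c₀ x c) (hyc : 0 < sideValue c₀ y c) : x.meet y ∈ interior K := by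
  have nyp := hyp.ne
  have nxq := hxq.ne
  obtain ⟨α, hα⟩ : ∃ α, α = sideValue c₀ y c / -sideValue c₀ y p := ⟨_, rfl⟩
  obtain ⟨β, hβ⟩ : ∃ β, β = sideValue c₀ x c / -sideValue c₀ x q := ⟨_, rfl⟩
  have hα0 : 0 < α := hα ▸ div_pos hyc (by linarith)
  have hβ0 : 0 < β := hβ ▸ div_pos hxc (by linarith)
  have key := hK.combo_three_mem_interior hp hq hc (s := α / (α + β + 1)) (t := β / (α + β + 1))
    (u := 1 / (α + β + 1)) (by positivity) (by positivity) (by positivity) (by positivity)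
    (by field_simp)
  convert key using 1
  have e1 : β * sideValue c₀ x q + sideValue c₀ x c = 0 := by rw [hβ]; field_simp; ring
  have e2 : α * sideValue c₀ y p + sideValue c₀ y c = 0 := by rw [hα]; field_simp; ring
  have hm : α + β + 1 ≠ 0 := by positivity
  refine eq_of_sideValue_eq ht ?_ ?_
  · rw [sideValue_combo_three _ _ _ _ _ _ _ _ (by field_simp), hxp, sideValue_eq,
      show x.height (x.meet y) = 0 from x.has_meet_left y]
    field_simp
    linarith
  · rw [sideValue_combo_three _ _ _ _ _ _ _ _ (by field_simp), hyq, sideValue_eq,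
      show y.height (x.meet y) = 0 from PlaneLine.has_meet_right hxy]
    field_simp
    linarith

/-- Here `w = z + β (p - z) + δ (q - z)`. With `β + δ ≤ 1` it would be a convex combination of `z`,
`p`, `q` with positive weight on an interior point. -/
theorem one_lt_add_of_notMem (hK : Convex ℝ K) (ht : turn c₀ x y ≠ 0) {z p q w : ℝ × ℝ}
    (hz : z ∈ interior K) (hp : p ∈ interior K) (hq : q ∈ K) (hw : w ∉ interior K)
    (hxz : sideValue c₀ x z = 0) (hyz : sideValue c₀ y z = 0) {β δ : ℝ} (hβ : 0 < β) (hδ : 0 ≤ δ)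
    (hx : sideValue c₀ x w = β * sideValue c₀ x p + δ * sideValue c₀ x q)
    (hy : sideValue c₀ y w = β * sideValue c₀ y p + δ * sideValue c₀ y q) : 1 < β + δ := by
  by_contra! h
  refine hw ?_
  have key := hK.combo_three_mem_interior hz hp hq (s := 1 - β - δ) (t := β) (u := δ) (by linarith)
    hβ.le hδ (by linarith) (by ring)
  convert key using 1
  refine eq_of_sideValue_eq ht ?_ ?_
  · rw [sideValue_combo_three _ _ _ _ _ _ _ _ (by ring), hx, hxz]; ring
  · rw [sideValue_combo_three _ _ _ _ _ _ _ _ (by ring), hy, hyz]; ring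

/-- As seen from the crossing `z`, the point `w` lies beyond the line `p q`, since its coordinates
`β, δ` with respect to `p, q` are positive with sum greater than 1. This fixes the orientation of `w
p q` up to the sign of `turn`. -/
theorem orient_mul_turn_pos (hK : Convex ℝ K) (ht : turn c₀ x y ≠ 0) {z p q w : ℝ × ℝ}
    (hz : z ∈ interior K) (hp : p ∈ interior K) (hq : q ∈ K) (hw : w ∉ interior K)
    (hxz : sideValue c₀ x z = 0) (hyz : sideValue c₀ y z = 0) (hxp : sideValue c₀ x p = 0)
    (hyp : sideValue c₀ y p < 0) (hyq : sideValue c₀ y q = 0) (hxq : sideValue c₀ x q < 0)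
    (hxw : sideValue c₀ x w < 0) (hyw : sideValue c₀ y w < 0) :
    0 < orient w p q * turn c₀ x y := by
  have nyp := hyp.ne
  have nxq := hxq.ne
  have := one_lt_add_of_notMem hK ht hz hp hq hw hxz hyz (β := sideValue c₀ y w / sideValue c₀ y p)
    (δ := sideValue c₀ x w / sideValue c₀ x q) (div_pos_of_neg_of_neg hyw hyp)
    (div_pos_of_neg_of_neg hxw hxq).le (by rw [hxp]; field_simp; ring) (by rw [hyq]; field_simp; ring)
  rw [orient_mul_turn, hxp, hyq]
  have h2 : 0 < sideValue c₀ y p * sideValue c₀ x q := mul_pos_of_neg_of_neg hyp hxq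
  have h3 := mul_lt_mul_of_pos_left this h2
  have h4 : sideValue c₀ y p * sideValue c₀ x q * (sideValue c₀ y w / sideValue c₀ y p +
      sideValue c₀ x w / sideValue c₀ x q) =
      sideValue c₀ x q * sideValue c₀ y w + sideValue c₀ y p * sideValue c₀ x w := by
    field_simp
  linarith

/-- If `w` and `w'` lie in the wrong order, then the segments `w p` and `w' q` cross; so no line
separates the end points of one of them from those of the other one. -/
theorem not_separated (hK : Convex ℝ K) {z p q w w' : ℝ × ℝ}
    (hz : z ∈ interior K) (hp : p ∈ interior K) (hq : q ∈ interior K) (hwK : w ∈ K) (hwK' : w' ∈ K)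
    (hw : w ∉ interior K) (hw' : w' ∉ interior K)
    (hxz : sideValue c₀ x z = 0) (hyz : sideValue c₀ y z = 0) (hxp : sideValue c₀ x p = 0)
    (hyp : sideValue c₀ y p < 0) (hyq : sideValue c₀ y q = 0) (hxq : sideValue c₀ x q < 0)
    (hxw : sideValue c₀ x w < 0) (hyw : sideValue c₀ y w < 0)
    (hxw' : sideValue c₀ x w' < 0) (hyw' : sideValue c₀ y w' < 0)
    (ht : 0 < turn c₀ x y) (ho : 0 < orient w w' z) {j : PlaneLine} (h1 : 0 < j.height w * j.height p)
    (h2 : 0 < j.height w' * j.height q) : 0 < j.height w * j.height w' := by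
  have hxyw : 0 < sideValue c₀ x w * sideValue c₀ y w' - sideValue c₀ x w' * sideValue c₀ y w := by
    have := mul_pos ho ht
    rw [orient_mul_turn, hxz, hyz] at this
    linarith
  have nyp := hyp.ne
  have nxq := hxq.ne
  have nxw := hxw.ne
  have nyw' := hyw'.ne
  have pos : ∀ {a c : ℝ}, 0 < a * c → 0 < c → 0 < a := fun h hc => (pos_iff_pos_of_mul_pos h).2 hc
  -- the four orientations
  have o1 : 0 < orient w p q := pos (orient_mul_turn_pos (c₀ := c₀) hK ht.ne' hz hp
    (interior_subset hq) hw hxz hyz hxp hyp hyq hxq hxw hyw) ht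
  have o2 : 0 < orient w' p q := pos (orient_mul_turn_pos (c₀ := c₀) hK ht.ne' hz hp
    (interior_subset hq) hw' hxz hyz hxp hyp hyq hxq hxw' hyw') ht
  have o3 : orient w p w' < 0 := by
    have := one_lt_add_of_notMem hK ht.ne' hz hp hwK hw' hxz hyz
      (β := (sideValue c₀ x w * sideValue c₀ y w' - sideValue c₀ x w' * sideValue c₀ y w) /
        (sideValue c₀ x w * sideValue c₀ y p))
      (δ := sideValue c₀ x w' / sideValue c₀ x w)
      (div_pos hxyw (mul_pos_of_neg_of_neg hxw hyp))
      (div_pos_of_neg_of_neg hxw' hxw).le (by rw [hxp]; field_simp; ring) (by field_simp; ring)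
    have h3 := mul_lt_mul_of_pos_left this (mul_pos_of_neg_of_neg hxw hyp)
    have h4 : sideValue c₀ x w * sideValue c₀ y p *
      ((sideValue c₀ x w * sideValue c₀ y w' - sideValue c₀ x w' * sideValue c₀ y w) /
        (sideValue c₀ x w * sideValue c₀ y p) + sideValue c₀ x w' / sideValue c₀ x w) =
        sideValue c₀ x w * sideValue c₀ y w' - sideValue c₀ x w' * sideValue c₀ y w +
        sideValue c₀ y p * sideValue c₀ x w' := by field_simp
    have h5 := orient_mul_turn c₀ x y w p w'
    rw [hxp] at h5
    by_contra! h6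
    have := mul_nonneg h6 ht.le
    linarith
  have o4 : 0 < orient w' q w := by
    have := one_lt_add_of_notMem hK ht.ne' hz hq hwK' hw hxz hyz
      (β := (sideValue c₀ x w * sideValue c₀ y w' - sideValue c₀ x w' * sideValue c₀ y w) /
        (sideValue c₀ y w' * sideValue c₀ x q))
      (δ := sideValue c₀ y w / sideValue c₀ y w')
      (div_pos hxyw (mul_pos_of_neg_of_neg hyw' hxq))
      (div_pos_of_neg_of_neg hyw hyw').le (by field_simp; ring) (by rw [hyq]; field_simp; ring)
    have h3 := mul_lt_mul_of_pos_left this (mul_pos_of_neg_of_neg hyw' hxq)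
    have h4 : sideValue c₀ y w' * sideValue c₀ x q *
      ((sideValue c₀ x w * sideValue c₀ y w' - sideValue c₀ x w' * sideValue c₀ y w) /
        (sideValue c₀ y w' * sideValue c₀ x q) + sideValue c₀ y w / sideValue c₀ y w') =
        sideValue c₀ x w * sideValue c₀ y w' - sideValue c₀ x w' * sideValue c₀ y w +
        sideValue c₀ x q * sideValue c₀ y w := by field_simp
    have h5 := orient_mul_turn c₀ x y w' q w
    rw [hyq] at h5
    refine pos (c := turn c₀ x y) ?_ ht
    rw [h5]
    linarith
  -- The signs of the four orientations say that the segments `w p` and `w' q` cross. If `j`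
  -- separated them, all terms of this affine relation would have the same sign, and not all would
  -- vanish.
  have e := j.height_orient w p w' q
  have r1 : orient p w' q = -orient w' p q := by simp only [orient_eq]; ring
  have r2 : orient w w' q = orient w' q w := by simp only [orient_eq]; ring
  rw [r1, r2] at e
  by_contra! hcon
  rcases lt_trichotomy (j.height w) 0 with hj | hj | hj
  · have hjp : j.height p < 0 := by by_contra! h; nlinarith
    have hjw' : 0 ≤ j.height w' := by by_contra! h; nlinarith
    have hjq : 0 < j.height q := by by_contra! h; nlinarith
    nlinarith [mul_pos (neg_pos.2 hj) o2, mul_pos (neg_pos.2 hjp) o4, mul_nonneg hjw' o1.le,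
      mul_pos hjq (neg_pos.2 o3)]
  · simp [hj] at h1
  · have hjp : 0 < j.height p := by by_contra! h; nlinarith
    have hjw' : j.height w' ≤ 0 := by by_contra! h; nlinarith
    have hjq : j.height q < 0 := by by_contra! h; nlinarith
    nlinarith [mul_pos hj o2, mul_pos hjp o4, mul_nonneg (neg_nonneg.2 hjw') o1.le,
      mul_pos (neg_pos.2 hjq) (neg_pos.2 o3)]

end Position


/-! ## The order of the visits -/

theorem height_mul_pos_of_sideValue_neg {c₀ : Option (ℝ × ℝ)} {a : PlaneLine} {p q : ℝ × ℝ}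
    (hp : sideValue c₀ a p < 0) (hq : sideValue c₀ a q < 0) : 0 < a.height p * a.height q := by
  rw [sideValue_eq] at hp hq
  have h := mul_pos_of_neg_of_neg hp hq
  have h0 : sideSign c₀ a ≠ 0 := by rintro h0; rw [h0, zero_mul] at hp; exact lt_irrefl _ hp
  have h1 : 0 < sideSign c₀ a ^ 2 := by positivity
  have h2 : 0 < sideSign c₀ a ^ 2 * (a.height p * a.height q) := by linarith
  exact (pos_iff_pos_of_mul_pos h2).1 h1

theorem sideValue_neg_of_height_mul_pos {c₀ : Option (ℝ × ℝ)} {a : PlaneLine} {p q : ℝ × ℝ}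
    (h : 0 < a.height p * a.height q) (hq : sideValue c₀ a q < 0) : sideValue c₀ a p < 0 := by
  rw [sideValue_eq] at hq ⊢
  by_contra! hp
  have h1 : (sideSign c₀ a * a.height p) * (sideSign c₀ a * a.height q) ≤ 0 :=
    mul_nonpos_of_nonneg_of_nonpos hp hq.le
  have h0 : sideSign c₀ a ≠ 0 := by rintro h0; rw [h0, zero_mul] at hq; exact lt_irrefl _ hq
  have h2 : 0 < sideSign c₀ a ^ 2 * (a.height p * a.height q) := by positivity
  linarith

theorem exists_smul_mem_frontier {K : Set (ℝ × ℝ)} (hK : Bornology.IsBounded K) {z d : ℝ × ℝ}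
    (hz : z ∈ interior K) (hd : d ≠ 0) : ∃ t : ℝ, 0 < t ∧ z + t • d ∈ frontier K := by
  obtain ⟨R, hR⟩ := hK.subset_closedBall z
  have hd' : 0 < ‖d‖ := norm_pos_iff.2 hd
  have hcont : Continuous fun t : ℝ => z + t • d := by fun_prop
  have hz' := interior_subset hz
  have hR0 : 0 ≤ R := by have := hR hz'; simpa using this
  obtain ⟨_, ⟨t, ht, rfl⟩, hf⟩ := ((isPreconnected_Ici (a := (0 : ℝ))).image _
    hcont.continuousOn).exists_mem_frontier (s := K) (x := z) (y := z + ((R + 1) / ‖d‖) • d)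
    ⟨0, Set.self_mem_Ici, by simp⟩ hz' ⟨(R + 1) / ‖d‖, by simp; positivity, rfl⟩ (by
      intro h
      have h1 := hR h
      rw [Metric.mem_closedBall, dist_eq_norm, add_sub_cancel_left, norm_smul, Real.norm_eq_abs,
        abs_of_nonneg (by positivity), div_mul_cancel₀ _ hd'.ne'] at h1
      linarith)
  refine ⟨t, lt_of_le_of_ne ht ?_, hf⟩
  rintro rfl
  simp only [zero_smul, add_zero] at hf
  exact hf.2 hz

namespace IsConvexCurve

variable {C : Set (ℝ × ℝ)} {c₀ : Option (ℝ × ℝ)} {γ : ℝ → ℝ × ℝ}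

theorem mem_range_of_mem (hC : IsConvexCurve C c₀ γ) {p : ℝ × ℝ} (hp : p ∈ C)
    (hpc : ∀ c, c₀ = some c → p ≠ c) : ∃ t, γ t = p := by
  cases hc : c₀ with
  | none => exact ((hC.unbounded_case hc).1.symm ▸ hp : p ∈ Set.range γ)
  | some c =>
    exact ((hC.closed_case c hc).1.symm ▸ ⟨hp, hpc c hc⟩ : p ∈ Set.range γ)

theorem orient_nonneg_of_notMem (hC : IsConvexCurve C c₀ γ) {u u' t : ℝ} (huu : u < u')
    (ht : ¬ (u < t ∧ t < u')) : 0 ≤ orient (γ u) (γ u') (γ t) := by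
  rcases lt_trichotomy t u with h | rfl | h
  · rw [orient_rotate]; exact hC.orient_nonneg h huu
  · simp [orient_eq]
  · rcases (not_lt.1 fun h' => ht ⟨h, h'⟩).eq_or_lt with rfl | h'
    · rw [orient_eq]; linarith
    · exact hC.orient_nonneg huu h'

theorem orient_nonpos_of_mem (hC : IsConvexCurve C c₀ γ) {u u' t : ℝ} (h : u < t) (h' : t < u') :
    orient (γ u) (γ u') (γ t) ≤ 0 := by
  have := hC.orient_nonneg h h'
  rw [orient_eq] at this ⊢
  linarith

theorem sideValue_neg_of_mem_line (hC : IsConvexCurve C c₀ γ) {a : PlaneLine} {u u' : ℝ}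
    {w : ℝ × ℝ} (huu : u < u') (hw : w ∈ interior (convexHull ℝ C))
    (ho : orient (γ u) (γ u') w = 0) (h1 : sideValue c₀ a (γ u) < 0)
    (h2 : sideValue c₀ a (γ u') < 0) : sideValue c₀ a w < 0 := by
  obtain ⟨s, hs0, hs1, hs⟩ := hC.mem_openSegment (hC.mem_curve u) (hC.mem_curve u')
    (hC.injective_param.ne huu.ne) hw ho
  rw [hs, sideValue_combo _ _ _ _ _ _ (by ring)]
  have := mul_neg_of_pos_of_neg (sub_pos.2 hs1) h1
  have := mul_neg_of_pos_of_neg hs0 h2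
  linarith

/-- A chord passes above the points of its negative side. -/
theorem orient_pos (hC : IsConvexCurve C c₀ γ) {a : PlaneLine}
    (ha : ∀ c, c₀ = some c → ¬ a.Has c) {u u' : ℝ} {z : ℝ × ℝ} (huu : u < u')
    (hz : z ∈ interior (convexHull ℝ C)) (haz : sideValue c₀ a z = 0)
    (h1 : sideValue c₀ a (γ u) < 0) (h2 : sideValue c₀ a (γ u') < 0) :
    0 < orient (γ u) (γ u') z := by
  have hne : orient (γ u) (γ u') z ≠ 0 := fun h0 =>
    (hC.sideValue_neg_of_mem_line huu hz h0 h1 h2).ne haz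
  refine lt_of_le_of_ne ?_ hne.symm
  cases hc : c₀ with
  | none =>
    subst hc
    obtain ⟨-, hx, hup⟩ := hC.unbounded_case rfl
    have hx := sub_pos.2 (hx huu)
    simp only at hx
    by_contra! hneg
    -- If the chord passed above `z`, its point on the vertical line through `z` would be interior
    -- and not below `a`, although the chord runs on the negative side of `a`.
    obtain ⟨y, hy⟩ : ∃ y, y = (γ u).2 + ((γ u').2 - (γ u).2) * (z.1 - (γ u).1) /
      ((γ u').1 - (γ u).1) := ⟨_, rfl⟩
    have hy0 : orient (γ u) (γ u') (z.1, y) = 0 := by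
      rw [orient_eq, hy]; field_simp; ring
    have hyz : z.2 ≤ y := by
      rw [orient_eq] at hneg hy0
      simp only at hy0
      nlinarith
    have hyint : (z.1, y) ∈ interior (convexHull ℝ C) := by
      have key := (convex_convexHull ℝ C).combo_interior_self_mem_interior hz
        (hup z (interior_subset hz) (2 * y - z.2) (by linarith)) (a := 1 / 2) (b := 1 / 2)
        (by norm_num) (by norm_num) (by norm_num)
      convert key using 1
      refine Prod.ext ?_ ?_ <;>
      simp only [Prod.fst_add, Prod.snd_add, Prod.smul_fst, Prod.smul_snd, smul_eq_mul] <;> ring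
    have := hC.sideValue_neg_of_mem_line huu hyint hy0 h1 h2
    simp only [sideValue, PlaneLine.height] at this haz
    linarith
  | some c =>
    have hcpt := (hC.closed_case c hc).2.1
    have hbdd : Bornology.IsBounded (convexHull ℝ C) := isBounded_convexHull.2 hcpt.isBounded
    have hd : ((1, a.slope) : ℝ × ℝ) ≠ 0 := fun h => by simpa using congrArg Prod.fst h
    -- In both directions from `z` the line `a` reaches points of `C`. They are not on the arc
    -- between `u` and `u'`, which is negative for `a`, so they lie weakly on the required side of
    -- the chord; hence so does `z`.
    obtain ⟨s, hs0, hs⟩ := exists_smul_mem_frontier hbdd hz hd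
    obtain ⟨t, ht0, ht⟩ := exists_smul_mem_frontier hbdd hz (neg_ne_zero.2 hd)
    rw [hC.frontier_hull] at hs ht
    have haz' : a.Has z := (sideValue_eq_zero ha).1 haz
    have hline : ∀ r : ℝ, a.Has (z + r • (1, a.slope)) := fun r => by
      simp only [PlaneLine.Has, PlaneLine.height] at haz' ⊢
      simp
      linarith
    have hpos : ∀ r : ℝ, z + r • (1, a.slope) ∈ C → 0 ≤ orient (γ u) (γ u') (z + r • (1, a.slope)) := by
      intro r hr
      obtain ⟨τ, hτ⟩ := hC.mem_range_of_mem hr (fun c' hc' h => ha c' hc' (h ▸ hline r))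
      rw [← hτ]
      refine hC.orient_nonneg_of_notMem huu fun hτu => ?_
      have h3 := hC.sideValue_neg_of_between ha hτu.1 hτu.2 h1 h2
      rw [hτ] at h3
      exact h3.ne ((sideValue_eq_zero ha).2 (hline r))
    rw [smul_neg, ← neg_smul] at ht
    have e1 := hpos s hs
    have e2 := hpos (-t) ht
    have e3 : (s + t) * orient (γ u) (γ u') z = t * orient (γ u) (γ u') (z + s • (1, a.slope)) +
        s * orient (γ u) (γ u') (z + (-t) • (1, a.slope)) := by
      simp only [orient_eq, Prod.fst_add, Prod.snd_add, Prod.smul_fst, Prod.smul_snd, smul_eq_mul]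
      ring
    have e4 : 0 ≤ (s + t) * orient (γ u) (γ u') z := by rw [e3]; positivity
    exact nonneg_of_mul_nonneg_right e4 (by linarith)

theorem exists_apex (hC : IsConvexCurve C c₀ γ) {a b : PlaneLine}
    (ha : ∀ c, c₀ = some c → ¬ a.Has c) (hb : ∀ c, c₀ = some c → ¬ b.Has c) :
    ∃ c ∈ convexHull ℝ C, 0 < sideValue c₀ a c ∧ 0 < sideValue c₀ b c := by
  cases hc : c₀ with
  | none =>
    obtain ⟨-, -, hup⟩ := hC.unbounded_case hc
    obtain ⟨Y, hY⟩ := exists_gt (max (max (a.slope * (γ 0).1 + a.icept) (b.slope * (γ 0).1 + b.icept))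
      (γ 0).2)
    rw [max_lt_iff, max_lt_iff] at hY
    refine ⟨((γ 0).1, Y), hup _ (hC.mem_hull 0) Y hY.2.le, ?_, ?_⟩
    · simp only [sideValue, PlaneLine.height]; linarith [hY.1.1]
    · simp only [sideValue, PlaneLine.height]; linarith [hY.1.2]
  | some c =>
    exact ⟨c, subset_convexHull ℝ C (hC.closed_case c hc).2.2.1, sideValue_top_pos (ha c hc),
      sideValue_top_pos (hb c hc)⟩

variable {ι : Type} {ℓ : ι → PlaneLine}

/-- Some line separates two arcs that are separated by an endpoint. -/
theorem exists_height_mul_nonpos (hC : IsConvexCurve C c₀ γ) (hA : IsGeneralArrangement C c₀ ℓ)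
    {u u' t₀ : ℝ} {i j₀ : ι} (hi : ∀ t, u < t → t < u' → ¬ (ℓ i).Has (γ t)) (h1 : u < t₀)
    (h2 : t₀ < u') (hj : (ℓ j₀).Has (γ t₀)) {z : ℝ × ℝ} (hz : z ∈ interior (convexHull ℝ C))
    (hoz : 0 < orient (γ u) (γ u') z) :
    ∃ j, (ℓ j).height (γ u) * (ℓ j).height (γ u') ≤ 0 := by
  by_contra! hcon
  have huu := h1.trans h2
  have hne := hC.injective_param.ne huu.ne
  by_cases hline : ∃ o ∈ interior (convexHull ℝ C), orient (γ u) (γ u') o = 0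
  · obtain ⟨o, ho, hoo⟩ := hline
    -- If no line separates `γ u` from `γ u'`, then no line meets the chord between them inside the
    -- hull, and each segment stays on one side of this chord.
    have off : ∀ j, ∀ w ∈ convexHull ℝ C, (ℓ j).Has w → orient (γ u) (γ u') w ≠ 0 := by
      intro j w hw hjw h0
      obtain ⟨s, hs0, hs1, hs⟩ := hC.mem_segment (hC.mem_curve u) (hC.mem_curve u') hne ho hoo hw h0
      have e1 : (ℓ j).height w = 0 := hjw
      rw [hs, PlaneLine.height_combo _ _ _ _ _ (by ring)] at e1
      have e2 := hcon j
      have e3 : (1 - s) * (ℓ j).height (γ u) ^ 2 + s * ((ℓ j).height (γ u) * (ℓ j).height (γ u')) = 0 := by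
        linear_combination (ℓ j).height (γ u) * e1
      have e4 : 0 < (ℓ j).height (γ u) ^ 2 := by
        have : (ℓ j).height (γ u) ≠ 0 := by rintro h; rw [h, zero_mul] at e2; exact lt_irrefl _ e2
        positivity
      rcases hs0.eq_or_lt with rfl | hs0
      · linarith
      · have := mul_pos hs0 e2
        have := mul_nonneg (sub_nonneg.2 hs1) e4.le
        linarith
    have same : ∀ j, ∀ w ∈ convexHull ℝ C, (ℓ j).Has w → ∀ w' ∈ convexHull ℝ C, (ℓ j).Has w' →
        orient (γ u) (γ u') w < 0 → orient (γ u) (γ u') w' < 0 := by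
      intro j w hw hjw w' hw' hjw' hneg
      by_contra! hpos
      have hd : 0 < orient (γ u) (γ u') w' - orient (γ u) (γ u') w := by linarith
      refine off j ((orient (γ u) (γ u') w' / (orient (γ u) (γ u') w' - orient (γ u) (γ u') w)) • w +
        (-orient (γ u) (γ u') w / (orient (γ u) (γ u') w' - orient (γ u) (γ u') w)) • w') ?_ ?_ ?_
      · exact convex_convexHull ℝ C hw hw' (div_nonneg hpos hd.le) (div_nonneg (by linarith) hd.le)
          (by field_simp; ring)
      · rw [PlaneLine.Has, PlaneLine.height_combo _ _ _ _ _ (by field_simp; ring),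
          show (ℓ j).height w = 0 from hjw, show (ℓ j).height w' = 0 from hjw']
        ring
      · rw [orient_combo _ _ _ _ _ _ (by field_simp; ring)]
        field_simp
        ring
    -- The lines with an endpoint between `u` and `u'` lie beyond the chord. As `j₀` is one of them
    -- and `i` is not, connectedness provides two crossing segments, one of each kind, and so a
    -- segment on both sides of the chord.
    let N : Set ι := {j | ∃ t, u < t ∧ t < u' ∧ (ℓ j).Has (γ t)}
    obtain ⟨⟨⟨j, k⟩, hjk⟩, -, hjN, hkN⟩ := (hA.connected j₀ i).some.exists_boundary_dart N
      ⟨t₀, h1, h2, hj⟩ (fun ⟨t, ht1, ht2, ht⟩ => hi t ht1 ht2 ht)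
    simp only at hjN hkN
    obtain ⟨t, ht1, ht2, ht⟩ := hjN
    obtain ⟨-, w, ⟨hwK, hjw⟩, -, hkw⟩ := hjk
    have hneg : orient (γ u) (γ u') w < 0 := same j _ (hC.mem_hull t) ht w hwK hjw
      (lt_of_le_of_ne (hC.orient_nonpos_of_mem ht1 ht2) (off j _ (hC.mem_hull t) ht))
    obtain ⟨p, hp, hkp⟩ := hA.meets_curve k
    obtain ⟨τ, rfl⟩ := hC.mem_range_of_mem hp (fun c hc h => hA.avoids_top c hc k (h ▸ hkp))
    have := same k w hwK hkw _ (hC.mem_hull τ) hkp hneg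
    exact absurd this (not_lt.2 (hC.orient_nonneg_of_notMem huu fun hτ => hkN ⟨τ, hτ.1, hτ.2, hkp⟩))
  -- In the degenerate case the chord runs along the boundary of the hull. Then the whole arc is on
  -- a line, and `not_dip` shows that the line `j₀` has to separate its ends.
  · push Not at hline
    have hK : ∀ p ∈ convexHull ℝ C, 0 ≤ orient (γ u) (γ u') p := by
      intro p hp
      by_contra! hneg
      have hd : 0 < orient (γ u) (γ u') z - orient (γ u) (γ u') p := by linarith
      refine hline ((-orient (γ u) (γ u') p / (orient (γ u) (γ u') z - orient (γ u) (γ u') p)) • z +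
        (orient (γ u) (γ u') z / (orient (γ u) (γ u') z - orient (γ u) (γ u') p)) • p) ?_ ?_
      · exact (convex_convexHull ℝ C).combo_interior_self_mem_interior hz hp
          (div_pos (by linarith) hd) (div_nonneg hoz.le hd.le) (by field_simp; ring)
      · rw [orient_combo _ _ _ _ _ _ (by field_simp; ring)]
        field_simp
        ring
    have hall : ∀ t ∈ Set.Icc u u', orient (γ u) (γ u') (γ t) = 0 := by
      intro t ht
      by_cases h : u < t ∧ t < u'
      · exact le_antisymm (hC.orient_nonpos_of_mem h.1 h.2) (hK _ (hC.mem_hull t))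
      · rw [not_and_or, not_lt, not_lt] at h
        rcases h with h | h
        · obtain rfl : t = u := le_antisymm h ht.1
          simp [orient_eq]
        · obtain rfl : t = u' := le_antisymm ht.2 h
          rw [orient_eq]; ring
    have hj' : (ℓ j₀).height (γ t₀) = 0 := hj
    have e2 := hcon j₀
    have e4 : 0 < (ℓ j₀).height (γ u) ^ 2 := by
      have : (ℓ j₀).height (γ u) ≠ 0 := by rintro h; rw [h, zero_mul] at e2; exact lt_irrefl _ e2
      positivity
    obtain ⟨v, hv1, hv2⟩ := exists_between (max_lt (neg_lt_zero.2 e4) (neg_lt_zero.2 e2))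
    refine hC.not_dip (a := ℓ j₀) (κ := -(ℓ j₀).height (γ u)) (v := v) hne h1 h2
      (fun t ht _ => hall t ht) ?_ ?_ ?_ ?_
    · have := (le_max_left _ _).trans_lt hv1; linarith
    · rw [hj', mul_zero]; exact hv2
    · have := (le_max_right _ _).trans_lt hv1; linarith
    · intro heq
      obtain ⟨s, hs⟩ := exists_combo_of_orient_eq_zero hne (hall t₀ ⟨h1.le, h2.le⟩)
      rw [hs, PlaneLine.height_combo _ _ _ _ _ (by ring)] at hj'
      have : (ℓ j₀).height (γ u) ^ 2 = 0 := by
        linear_combination (ℓ j₀).height (γ u) * hj' - s * heq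
      exact e4.ne' this

/-- Suppose that `turn` were positive. If both visits belong to the same cell, the clockwise order
of its edges contradicts `orient_mul_turn_pos`. If they belong to different cells, the segments from
`γ u` and `γ u'` to the visited edges would cross, so no line separates the two arcs
(`not_separated`); but some line does, by `exists_height_mul_nonpos`. -/
theorem turn_neg_of_visitedBefore (hC : IsConvexCurve C c₀ γ) (hA : IsGeneralArrangement C c₀ ℓ)
    {v w : ℝ × ι} (hv : IsVisited C c₀ γ ℓ v) (hw : IsVisited C c₀ γ ℓ w)
    (hvw : VisitedBefore C γ ℓ v w) (hne : v.2 ≠ w.2) {u u' : ℝ} (hu : u ∈ arcAfter γ ℓ v.1)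
    (hu' : u' ∈ arcAfter γ ℓ w.1) (h1 : sideValue c₀ (ℓ w.2) (γ u) < 0)
    (h2 : sideValue c₀ (ℓ v.2) (γ u') < 0) :
    turn c₀ (ℓ v.2) (ℓ w.2) < 0 ∧ (ℓ v.2).meet (ℓ w.2) ∈ interior (convexHull ℝ C) := by
  have hav : ∀ c, c₀ = some c → ¬ (ℓ v.2).Has c := fun c hc => hA.avoids_top c hc _
  have haw : ∀ c, c₀ = some c → ¬ (ℓ w.2).Has c := fun c hc => hA.avoids_top c hc _
  obtain ⟨-, -, hvneg, p, hp, hxp, hpj⟩ := hv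
  obtain ⟨hwend, -, hwneg, q, hq, hyq, hqj⟩ := hw
  have hslope := hA.not_parallel _ _ hne
  have ht0 : turn c₀ (ℓ v.2) (ℓ w.2) ≠ 0 := mul_ne_zero (mul_ne_zero (sideSign_ne_zero hav)
    (sideSign_ne_zero haw)) (sub_ne_zero.2 hslope.symm)
  have hyp : sideValue c₀ (ℓ w.2) p < 0 :=
    sideValue_neg_of_height_mul_pos (hpj w.2 hne.symm u hu) h1
  have hxq : sideValue c₀ (ℓ v.2) q < 0 :=
    sideValue_neg_of_height_mul_pos (hqj v.2 hne u' hu') h2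
  have hxp' := (sideValue_eq_zero hav).2 hxp
  have hyq' := (sideValue_eq_zero haw).2 hyq
  obtain ⟨c, hc, hcx, hcy⟩ := hC.exists_apex hav haw
  have hK := convex_convexHull ℝ C
  have hz := meet_mem_interior hK hslope ht0 hp hq hc hxp' hyp hyq' hxq hcx hcy
  have hxz := (sideValue_eq_zero hav).2 ((ℓ v.2).has_meet_left (ℓ w.2))
  have hyz := (sideValue_eq_zero haw).2 (PlaneLine.has_meet_right hslope)
  have hnI : ∀ t, γ t ∉ interior (convexHull ℝ C) := fun t => hC.notMem_interior (hC.mem_curve t)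
  refine ⟨lt_of_le_of_ne (not_lt.1 fun ht => ?_) ht0, hz⟩
  rcases hvw with hlt | ⟨heq, hord⟩
  · have huw : u < w.1 := hu.2 w.1 hwend hlt
    have hwu : w.1 < u' := hu'.1
    have hoz := hC.orient_pos hav (huw.trans hwu) hz hxz (hvneg u hu) h2
    obtain ⟨j₀, hj₀⟩ := hwend
    obtain ⟨j, hj⟩ := hC.exists_height_mul_nonpos hA (i := v.2) (fun t ht1 ht2 ht => by
      have := hC.sideValue_neg_of_between hav ht1 ht2 (hvneg u hu) h2
      exact this.ne ((sideValue_eq_zero hav).2 ht)) huw hwu hj₀ hz hoz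
    refine absurd hj (not_le.2 ?_)
    by_cases hjv : j = v.2
    · subst hjv
      exact height_mul_pos_of_sideValue_neg (hvneg u hu) h2
    by_cases hjw : j = w.2
    · subst hjw
      exact height_mul_pos_of_sideValue_neg h1 (hwneg u' hu')
    refine not_separated (c₀ := c₀) hK hz hp hq (hC.mem_hull u) (hC.mem_hull u') (hnI u) (hnI u') hxz
      hyz hxp' hyp hyq' hxq (hvneg u hu) h1 h2 (hwneg u' hu') ht hoz ?_ ?_
    · rw [mul_comm]; exact hpj j hjv u hu
    · rw [mul_comm]; exact hqj j hjw u' hu'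
  · have h3 := orient_mul_turn_pos (c₀ := c₀) hK ht0 hz hp (interior_subset hq) (hnI u) hxz hyz hxp'
      hyp hyq' hxq (hvneg u hu) h1
    have h4 : orient (γ u) p q < 0 := hord u hu p ⟨hp, hxp, hpj⟩ q ⟨hq, hyq, hqj⟩
    have := mul_neg_of_neg_of_pos h4 ht
    linarith

end IsConvexCurve


/-! ## The tour of the inner zone as a timed word -/

theorem TimedWord.exists_shape_entries : ∀ (A : List (Piece Symb)) (Q : List (Symb × ℝ)),
    Q.map Prod.fst = word A → ∃ W : TimedWord, shape W = A ∧ entries W = Q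
  | [], Q, h => ⟨[], rfl, (List.map_eq_nil_iff.1 h).symm⟩
  | Piece.plain b :: A, Q, h => by
      obtain ⟨x, Q', rfl, hx, hQ⟩ := List.map_eq_cons_iff.1 h
      obtain ⟨W, rfl, rfl⟩ := TimedWord.exists_shape_entries A Q' hQ
      exact ⟨Sum.inr x :: W, by simp [shape, hx], by simp [entries]⟩
  | Piece.block l :: A, Q, h => by
      obtain ⟨Q₁, Q₂, rfl, h1, h2⟩ := List.map_eq_append_iff.1 h
      obtain ⟨W, rfl, rfl⟩ := TimedWord.exists_shape_entries A Q₂ h2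
      exact ⟨Sum.inl Q₁ :: W, by simp [shape, h1], by simp [entries]⟩

section Tour

variable {C : Set (ℝ × ℝ)} {c₀ : Option (ℝ × ℝ)} {γ : ℝ → ℝ × ℝ} {ι : Type} {ℓ : ι → PlaneLine}

theorem IsConvexCurve.eq_or_eq_of_has_param (hC : IsConvexCurve C c₀ γ)
    (hA : IsGeneralArrangement C c₀ ℓ) {i : ι} {s t u : ℝ} (hs : (ℓ i).Has (γ s))
    (ht : (ℓ i).Has (γ t)) (hu : (ℓ i).Has (γ u)) (hst : s ≠ t) : u = s ∨ u = t := by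
  obtain ⟨o, ho, hio⟩ := hA.not_tangent i
  exact (hC.eq_or_eq_of_has ho hio (hC.mem_curve s) hs (hC.mem_curve t) ht (hC.mem_curve u) hu
    (hC.injective_param.ne hst)).imp (fun h => hC.injective_param h) fun h => hC.injective_param h

theorem IsConvexCurve.finite_endTimes [Finite ι] (hC : IsConvexCurve C c₀ γ)
    (hA : IsGeneralArrangement C c₀ ℓ) : (endTimes γ ℓ).Finite := by
  have : endTimes γ ℓ = ⋃ i, {t | (ℓ i).Has (γ t)} := by ext; simp [endTimes]
  rw [this]
  refine Set.finite_iUnion fun i => ?_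
  by_cases h : ∃ s t, (ℓ i).Has (γ s) ∧ (ℓ i).Has (γ t) ∧ s ≠ t
  · obtain ⟨s, t, hs, ht, hst⟩ := h
    exact (Set.toFinite {s, t}).subset fun u hu => hC.eq_or_eq_of_has_param hA hs ht hu hst
  · push Not at h
    exact Set.Subsingleton.finite fun s hs t ht => h s t hs ht

theorem exists_arcAfter_eq_Ioo (hf : (endTimes γ ℓ).Finite) {s : ℝ} (hs : ∃ t ∈ endTimes γ ℓ, s < t) :
    ∃ n, s < n ∧ arcAfter γ ℓ s = Set.Ioo s n := by
  obtain ⟨n, ⟨hn, hsn⟩, hmin⟩ := (hf.inter_of_left {t | s < t}).exists_minimal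
    (show (endTimes γ ℓ ∩ {t | s < t}).Nonempty from hs.imp fun t ht => ht)
  refine ⟨n, hsn, Set.ext fun u => ⟨fun hu => ⟨hu.1, hu.2 n hn hsn⟩, fun hu => ⟨hu.1, fun t ht hst =>
    hu.2.trans_le ?_⟩⟩⟩
  by_contra! h
  exact absurd (hmin ⟨ht, hst⟩ h.le) (not_le.2 h)

theorem notMem_endTimes_of_mem_arcAfter {s u : ℝ} (hu : u ∈ arcAfter γ ℓ s) : u ∉ endTimes γ ℓ :=
  fun h => lt_irrefl _ (hu.2 u h hu.1)

/-- Times are chosen from the last visit backwards: each arc is an open interval, so a time before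
all those already chosen is available near its start. -/
theorem exists_visit_times (hf : (endTimes γ ℓ).Finite) : ∀ V : List (ℝ × ι),
    V.Pairwise (VisitedBefore C γ ℓ) → (∀ v ∈ V, IsVisited C c₀ γ ℓ v) →
    ∃ E : List ((ℝ × ι) × ℝ), E.map Prod.fst = V ∧
      E.Pairwise (fun e e' => VisitedBefore C γ ℓ e.1 e'.1 ∧ e.2 < e'.2) ∧
      ∀ e ∈ E, e.2 ∈ arcAfter γ ℓ e.1.1
  | [], _, _ => ⟨[], rfl, List.Pairwise.nil, by simp⟩
  | v :: V, hV, hv => by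
      rw [List.pairwise_cons] at hV
      obtain ⟨E, rfl, hE, harc⟩ := exists_visit_times hf V hV.2 fun w hw => hv w (by simp [hw])
      obtain ⟨n, hn, hIoo⟩ := exists_arcAfter_eq_Ioo hf (hv v (by simp)).2.1
      have hgt : ∀ e ∈ E, v.1 < e.2 := fun e he => by
        refine lt_of_le_of_lt ?_ (harc e he).1
        rcases hV.1 _ (List.mem_map_of_mem he) with h | h
        exacts [h.le, h.1.le]
      obtain ⟨t, ht, ht', hlt⟩ : ∃ t, v.1 < t ∧ t < n ∧ ∀ e ∈ E, t < e.2 := by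
        rcases E with _ | ⟨e, E⟩
        · obtain ⟨t, h1, h2⟩ := exists_between hn
          exact ⟨t, h1, h2, by simp⟩
        · obtain ⟨t, h1, h2⟩ := exists_between (lt_min hn (hgt e (by simp)))
          refine ⟨t, h1, h2.trans_le (min_le_left _ _), ?_⟩
          have h3 := h2.trans_le (min_le_right _ _)
          rw [List.pairwise_cons] at hE
          simp only [List.mem_cons, forall_eq_or_imp]
          exact ⟨h3, fun e' he' => h3.trans (hE.1 e' he').2⟩
      refine ⟨(v, t) :: E, rfl, List.pairwise_cons.2 ⟨fun e he =>
        ⟨hV.1 _ (List.mem_map_of_mem he), hlt e he⟩, hE⟩, ?_⟩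
      simp only [List.mem_cons, forall_eq_or_imp]
      exact ⟨by rw [hIoo]; exact ⟨ht, ht'⟩, harc⟩

/-- The line `i` is visited on the arc of `t` before the line `i'` is visited on the arc of `t'`. -/
def VisitedInOrder (C : Set (ℝ × ℝ)) (c₀ : Option (ℝ × ℝ)) (γ : ℝ → ℝ × ℝ) (ℓ : ι → PlaneLine)
    (i : ι) (t : ℝ) (i' : ι) (t' : ℝ) : Prop :=
  ∃ s s', IsVisited C c₀ γ ℓ (s, i) ∧ IsVisited C c₀ γ ℓ (s', i') ∧
    t ∈ arcAfter γ ℓ s ∧ t' ∈ arcAfter γ ℓ s' ∧ VisitedBefore C γ ℓ (s, i) (s', i')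

theorem exists_events (hf : (endTimes γ ℓ).Finite) {S : List ι}
    (hS : IsLowerInnerZoneSeq C c₀ γ ℓ S) {β : Type} {u : List β} {f : β → ι}
    (hu : (u.map f).Sublist S) :
    ∃ Q : List (β × ℝ), Q.map Prod.fst = u ∧ Q.Pairwise (fun x y => x.2 < y.2) ∧
      (∀ x ∈ Q, ∃ s, IsVisited C c₀ γ ℓ (s, f x.1) ∧ x.2 ∈ arcAfter γ ℓ s) ∧
      ∀ x ∈ Q, ∀ y ∈ Q, x.2 < y.2 → VisitedInOrder C c₀ γ ℓ (f x.1) x.2 (f y.1) y.2 := by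
  obtain ⟨V, hV, hVis, rfl⟩ := hS
  obtain ⟨E, rfl, hE, harc⟩ := exists_visit_times hf V hV fun v hv => (hVis v).1 hv
  rw [List.map_map] at hu
  obtain ⟨E', hE', hmap⟩ := List.sublist_map_iff.1 hu
  have h2 : List.Forall₂ (fun a (e : (ℝ × ι) × ℝ) => f a = e.1.2) u E' := by
    rw [← List.forall₂_map_left_iff (R := fun i (e : (ℝ × ι) × ℝ) => i = e.1.2)]
    rw [hmap, List.forall₂_map_left_iff]
    exact List.forall₂_same.2 fun _ _ => rfl
  rw [List.forall₂_iff_zip] at h2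
  obtain ⟨hlen, hzip⟩ := h2
  have hmem : ∀ z ∈ u.zip E', f z.1 = z.2.1.2 ∧ z.2 ∈ E := fun z hz =>
    ⟨hzip hz, hE'.subset (List.of_mem_zip hz).2⟩
  have hpw : (u.zip E').Pairwise fun z z' =>
      VisitedBefore C γ ℓ z.2.1 z'.2.1 ∧ z.2.2 < z'.2.2 := by
    have h := hE.sublist hE'
    rw [← List.map_snd_zip (l₁ := u) hlen.ge, List.pairwise_map] at h
    exact h
  have hvis : ∀ z ∈ u.zip E', IsVisited C c₀ γ ℓ (z.2.1.1, f z.1) ∧ z.2.2 ∈ arcAfter γ ℓ z.2.1.1 :=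
    fun z hz => by
      obtain ⟨h1, h2⟩ := hmem z hz
      exact ⟨h1 ▸ (hVis _).1 (List.mem_map_of_mem h2), harc _ h2⟩
  refine ⟨(u.zip E').map fun z => (z.1, z.2.2), ?_, ?_, ?_, ?_⟩
  · rw [List.map_map]
    exact List.map_fst_zip hlen.le
  · exact List.pairwise_map.2 (hpw.imp fun h => h.2)
  · rintro x hx
    obtain ⟨z, hz, rfl⟩ := List.mem_map.1 hx
    exact ⟨_, hvis z hz⟩
  · have key : ∀ z ∈ u.zip E', ∀ z' ∈ u.zip E',
        (z.2.2 < z'.2.2 → VisitedBefore C γ ℓ z.2.1 z'.2.1) ∧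
        (z'.2.2 < z.2.2 → VisitedBefore C γ ℓ z'.2.1 z.2.1) := by
      intro z hz z' hz'
      have : Std.Symm fun z z' : β × ((ℝ × ι) × ℝ) =>
        (z.2.2 < z'.2.2 → VisitedBefore C γ ℓ z.2.1 z'.2.1) ∧
        (z'.2.2 < z.2.2 → VisitedBefore C γ ℓ z'.2.1 z.2.1) := ⟨fun _ _ h => ⟨h.2, h.1⟩⟩
      refine List.Pairwise.forall_of_forall (R := fun z z' : β × ((ℝ × ι) × ℝ) =>
        (z.2.2 < z'.2.2 → VisitedBefore C γ ℓ z.2.1 z'.2.1) ∧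
        (z'.2.2 < z.2.2 → VisitedBefore C γ ℓ z'.2.1 z.2.1))
        (fun z _ => ⟨fun h => absurd h (lt_irrefl _), fun h => absurd h (lt_irrefl _)⟩)
        (hpw.imp fun h => ⟨fun _ => h.1, fun h' => absurd h' (not_lt.2 h.2.le)⟩) hz hz'
    rintro x hx y hy hlt
    obtain ⟨z, hz, rfl⟩ := List.mem_map.1 hx
    obtain ⟨z', hz', rfl⟩ := List.mem_map.1 hy
    refine ⟨_, _, (hvis z hz).1, (hvis z' hz').1, (hvis z hz).2, (hvis z' hz').2, ?_⟩
    have h := (key z hz z' hz').1 hlt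
    rw [(hmem z hz).1, (hmem z' hz').1]
    exact h

theorem IsConvexCurve.turn_neg_of_visitedInOrder (hC : IsConvexCurve C c₀ γ)
    (hA : IsGeneralArrangement C c₀ ℓ) {i j : ι} {t t' : ℝ} (h : VisitedInOrder C c₀ γ ℓ i t j t')
    (hij : i ≠ j) (h1 : sideValue c₀ (ℓ j) (γ t) < 0) (h2 : sideValue c₀ (ℓ i) (γ t') < 0) :
    turn c₀ (ℓ i) (ℓ j) < 0 ∧ (ℓ i).meet (ℓ j) ∈ interior (convexHull ℝ C) := by
  obtain ⟨s, s', hv, hw, ht, ht', hb⟩ := h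
  exact hC.turn_neg_of_visitedBefore hA hv hw hb hij ht ht' h1 h2

/-! ## Negative parameter intervals -/

/-- The parameters in `(A, B)` of the points on the negative side of the line `a`. -/
def negTimes (c₀ : Option (ℝ × ℝ)) (γ : ℝ → ℝ × ℝ) (A B : ℝ) (a : PlaneLine) : Set ℝ :=
  {t | t ∈ Set.Ioo A B ∧ sideValue c₀ a (γ t) < 0}

open Classical in
/-- The left end of `negTimes`. -/
noncomputable def leftTime (c₀ : Option (ℝ × ℝ)) (γ : ℝ → ℝ × ℝ) (A B : ℝ) (a : PlaneLine) : ℝ :=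
  if (negTimes c₀ γ A B a).Nonempty then sInf (negTimes c₀ γ A B a) else A

open Classical in
/-- The right end of `negTimes`. -/
noncomputable def rightTime (c₀ : Option (ℝ × ℝ)) (γ : ℝ → ℝ × ℝ) (A B : ℝ) (a : PlaneLine) : ℝ :=
  if (negTimes c₀ γ A B a).Nonempty then sSup (negTimes c₀ γ A B a) else B

namespace IsConvexCurve

variable {A B : ℝ} {a : PlaneLine}

theorem isOpen_negTimes (hC : IsConvexCurve C c₀ γ) : IsOpen (negTimes c₀ γ A B a) :=
  isOpen_Ioo.inter (isOpen_lt ((continuous_sideValue c₀ a).comp hC.continuous_param)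
    continuous_const)

theorem mem_negTimes_of_between (hC : IsConvexCurve C c₀ γ) (ha : ∀ c, c₀ = some c → ¬ a.Has c)
    {t₁ t₂ t₃ : ℝ} (h1 : t₁ ∈ negTimes c₀ γ A B a) (h3 : t₃ ∈ negTimes c₀ γ A B a) (h12 : t₁ < t₂)
    (h23 : t₂ < t₃) : t₂ ∈ negTimes c₀ γ A B a :=
  ⟨⟨h1.1.1.trans h12, h23.trans h3.1.2⟩, hC.sideValue_neg_of_between ha h12 h23 h1.2 h3.2⟩

theorem bddBelow_negTimes : BddBelow (negTimes c₀ γ A B a) := ⟨A, fun _ h => h.1.1.le⟩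

theorem bddAbove_negTimes : BddAbove (negTimes c₀ γ A B a) := ⟨B, fun _ h => h.1.2.le⟩

theorem lt_of_mem_negTimes (hC : IsConvexCurve C c₀ γ) {t : ℝ} (ht : t ∈ negTimes c₀ γ A B a) :
    leftTime c₀ γ A B a < t ∧ t < rightTime c₀ γ A B a := by
  have hne : (negTimes c₀ γ A B a).Nonempty := ⟨t, ht⟩
  obtain ⟨ε, hε, h⟩ := Metric.isOpen_iff.1 (hC.isOpen_negTimes (A := A) (B := B) (a := a)) t ht
  rw [Real.ball_eq_Ioo] at h
  rw [leftTime, rightTime, if_pos hne, if_pos hne]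
  constructor
  · exact (csInf_le bddBelow_negTimes (h ⟨by linarith, by linarith⟩ : t - ε / 2 ∈ _)).trans_lt
      (by linarith)
  · exact lt_of_lt_of_le (by linarith)
      (le_csSup bddAbove_negTimes (h ⟨by linarith, by linarith⟩ : t + ε / 2 ∈ _))

theorem mem_negTimes_of_lt (hC : IsConvexCurve C c₀ γ) (ha : ∀ c, c₀ = some c → ¬ a.Has c) {t : ℝ}
    (hne : (negTimes c₀ γ A B a).Nonempty) (h1 : leftTime c₀ γ A B a < t)
    (h2 : t < rightTime c₀ γ A B a) : t ∈ negTimes c₀ γ A B a := by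
  rw [leftTime, if_pos hne] at h1
  rw [rightTime, if_pos hne] at h2
  obtain ⟨s, hs, hst⟩ := exists_lt_of_csInf_lt hne h1
  obtain ⟨u, hu, htu⟩ := exists_lt_of_lt_csSup hne h2
  exact hC.mem_negTimes_of_between ha hs hu hst htu

theorem has_of_mem_closure_negTimes (hC : IsConvexCurve C c₀ γ) (ha : ∀ c, c₀ = some c → ¬ a.Has c)
    {t : ℝ} (ht : t ∈ closure (negTimes c₀ γ A B a)) (ht' : t ∉ negTimes c₀ γ A B a)
    (hA : A < t) (hB : t < B) : a.Has (γ t) := by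
  have hcont := (continuous_sideValue c₀ a).comp hC.continuous_param
  have h1 : sideValue c₀ a (γ t) ≤ 0 := closure_minimal
    (show negTimes c₀ γ A B a ⊆ {t | sideValue c₀ a (γ t) ≤ 0} from fun s hs => hs.2.le)
    (isClosed_le hcont continuous_const) ht
  exact (sideValue_eq_zero ha).1 (le_antisymm h1 (not_lt.1 fun h => ht' ⟨⟨hA, hB⟩, h⟩))

theorem has_leftTime (hC : IsConvexCurve C c₀ γ) (ha : ∀ c, c₀ = some c → ¬ a.Has c)
    (hne : (negTimes c₀ γ A B a).Nonempty) (h : A < leftTime c₀ γ A B a) :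
    a.Has (γ (leftTime c₀ γ A B a)) := by
  obtain ⟨t, ht⟩ := hne
  have hne : (negTimes c₀ γ A B a).Nonempty := ⟨t, ht⟩
  refine hC.has_of_mem_closure_negTimes ha ?_ (fun h' => lt_irrefl _ (hC.lt_of_mem_negTimes h').1) h
    ((hC.lt_of_mem_negTimes ht).1.trans ht.1.2)
  rw [leftTime, if_pos hne]
  exact csInf_mem_closure hne bddBelow_negTimes

theorem has_rightTime (hC : IsConvexCurve C c₀ γ) (ha : ∀ c, c₀ = some c → ¬ a.Has c)
    (hne : (negTimes c₀ γ A B a).Nonempty) (h : rightTime c₀ γ A B a < B) :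
    a.Has (γ (rightTime c₀ γ A B a)) := by
  obtain ⟨t, ht⟩ := hne
  have hne : (negTimes c₀ γ A B a).Nonempty := ⟨t, ht⟩
  refine hC.has_of_mem_closure_negTimes ha ?_ (fun h' => lt_irrefl _ (hC.lt_of_mem_negTimes h').2)
    (ht.1.1.trans (hC.lt_of_mem_negTimes ht).2) h
  rw [rightTime, if_pos hne]
  exact csSup_mem_closure hne bddAbove_negTimes

/-- By the default value in `leftTime`, a left end strictly after `A` shows that the line has
negative times at all. The ends strictly inside the window are then true zeros, and a line that
meets the interior has no third one. -/
theorem hasEndTimes (hC : IsConvexCurve C c₀ γ) (hA : IsGeneralArrangement C c₀ ℓ) {i : ι}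
    (h1 : A < leftTime c₀ γ A B (ℓ i)) (h2 : rightTime c₀ γ A B (ℓ i) < B) :
    (negTimes c₀ γ A B (ℓ i)).Nonempty ∧
      HasEndTimes γ (ℓ i) (leftTime c₀ γ A B (ℓ i)) (rightTime c₀ γ A B (ℓ i)) := by
  have ha : ∀ c, c₀ = some c → ¬ (ℓ i).Has c := fun c hc => hA.avoids_top c hc i
  have hne : (negTimes c₀ γ A B (ℓ i)).Nonempty := by
    by_contra h
    rw [leftTime, if_neg h] at h1
    exact lt_irrefl _ h1
  have hl := hC.has_leftTime ha hne h1
  have hr := hC.has_rightTime ha hne h2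
  obtain ⟨t, ht⟩ := id hne
  have hlr := (hC.lt_of_mem_negTimes ht).1.trans (hC.lt_of_mem_negTimes ht).2
  refine ⟨hne, hlr, fun t => ⟨fun h => hC.eq_or_eq_of_has_param hA hl hr h hlr.ne, ?_⟩⟩
  rintro (rfl | rfl)
  exacts [hl, hr]

/-- The counterclockwise triple `γ l, γ t, γ r` together with the side of `γ t` determines the
direction from the left to the right endpoint: `sideSign` tells whether it is the direction of
increasing abscissa. -/
theorem sideSign_mul_pos (hC : IsConvexCurve C c₀ γ) {l t r : ℝ} (hlt : l < t) (htr : t < r)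
    (hl : a.Has (γ l)) (hr : a.Has (γ r)) (ht : sideValue c₀ a (γ t) < 0) :
    0 < sideSign c₀ a * ((γ r).1 - (γ l).1) := by
  have h := hC.orient_nonneg hlt htr
  have hne : γ l ≠ γ r := hC.injective_param.ne (hlt.trans htr).ne
  simp only [PlaneLine.Has, PlaneLine.height] at hl hr
  rw [sideValue_eq] at ht
  have h1 : (γ r).1 - (γ l).1 ≠ 0 := fun h0 => hne (Prod.ext (by linarith) (by
    have : (γ r).1 = (γ l).1 := by linarith
    rw [this] at hr; linarith))
  have h2 : orient (γ l) (γ t) (γ r) = -((γ r).1 - (γ l).1) * a.height (γ t) := by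
    rw [orient_eq, PlaneLine.height]
    linear_combination ((γ t).1 - (γ l).1) * (hr - hl) + ((γ r).1 - (γ l).1) * hl
  rw [h2] at h
  have h3 : sideSign c₀ a * ((γ r).1 - (γ l).1) * (-(sideSign c₀ a * a.height (γ t))) =
      sideSign c₀ a ^ 2 * (-((γ r).1 - (γ l).1) * a.height (γ t)) := by ring
  have h4 : 0 ≤ sideSign c₀ a * ((γ r).1 - (γ l).1) := by
    by_contra! h5
    have := mul_neg_of_neg_of_pos h5 (neg_pos.2 ht)
    rw [h3] at this
    exact absurd this (not_lt.2 (mul_nonneg (sq_nonneg _) h))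
  refine lt_of_le_of_ne h4 fun h5 => ?_
  rcases mul_eq_zero.1 h5.symm with h6 | h6
  · rw [h6, zero_mul] at ht; exact lt_irrefl _ ht
  · exact h1 h6

end IsConvexCurve

/-- Along `b`, the side value of `a` is linear in the abscissa and vanishes at the crossing, so its
sign tells on which side of the crossing a point lies. -/
theorem sideSign_mul_pos_of_turn_neg {a b : PlaneLine} (hab : a.slope ≠ b.slope)
    (ht : turn c₀ a b < 0) {p : ℝ × ℝ} (hb : b.Has p) (hp : sideValue c₀ a p < 0) :
    0 < sideSign c₀ b * (p.1 - (a.meet b).1) := by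
  have h1 := a.has_meet_left b
  have h2 := PlaneLine.has_meet_right hab
  simp only [PlaneLine.Has, PlaneLine.height] at hb h1 h2
  have h3 : sideValue c₀ a p = sideSign c₀ a * (b.slope - a.slope) * (p.1 - (a.meet b).1) := by
    rw [sideValue_eq, PlaneLine.height]
    linear_combination sideSign c₀ a * (hb - h2 + h1)
  have h4 : 0 < sideValue c₀ a p * turn c₀ a b := mul_pos_of_neg_of_neg hp ht
  have h5 : sideValue c₀ a p * turn c₀ a b = (sideSign c₀ a * (b.slope - a.slope)) ^ 2 *
      (sideSign c₀ b * (p.1 - (a.meet b).1)) := by rw [h3, turn]; ring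
  rw [h5] at h4
  exact pos_of_mul_pos_right h4 (sq_nonneg _)

theorem sideSign_mul_neg_of_turn_neg {a b : PlaneLine} (hab : a.slope ≠ b.slope)
    (ht : turn c₀ b a < 0) {p : ℝ × ℝ} (hb : b.Has p) (hp : sideValue c₀ a p < 0) :
    sideSign c₀ b * (p.1 - (b.meet a).1) < 0 := by
  have h1 := b.has_meet_left a
  have h2 := PlaneLine.has_meet_right hab.symm
  simp only [PlaneLine.Has, PlaneLine.height] at hb h1 h2
  have h3 : sideValue c₀ a p = sideSign c₀ a * (b.slope - a.slope) * (p.1 - (b.meet a).1) := by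
    rw [sideValue_eq, PlaneLine.height]
    linear_combination sideSign c₀ a * (hb - h1 + h2)
  have h4 : 0 < sideValue c₀ a p * turn c₀ b a := mul_pos_of_neg_of_neg hp ht
  have h5 : sideValue c₀ a p * turn c₀ b a = (sideSign c₀ a * (b.slope - a.slope)) ^ 2 *
      -(sideSign c₀ b * (p.1 - (b.meet a).1)) := by rw [h3, turn]; ring
  rw [h5] at h4
  exact neg_pos.1 (pos_of_mul_pos_right h4 (sq_nonneg _))

end Tour



/-! ## Forcing -/

/-- `Q` records visits, at times in `(A, B)`, of the lines named by `f`. -/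
structure IsVisitRecord {ι : Type} (C : Set (ℝ × ℝ)) (c₀ : Option (ℝ × ℝ)) (γ : ℝ → ℝ × ℝ)
    (ℓ : ι → PlaneLine) (f : Symb → ι) (A B : ℝ) (Q : List (Symb × ℝ)) : Prop where
  bounds : ∀ x ∈ Q, A < x.2 ∧ x.2 < B
  visited : ∀ x ∈ Q, ∃ s, IsVisited C c₀ γ ℓ (s, f x.1) ∧ x.2 ∈ arcAfter γ ℓ s
  inOrder : ∀ x ∈ Q, ∀ y ∈ Q, x.2 < y.2 → VisitedInOrder C c₀ γ ℓ (f x.1) x.2 (f y.1) y.2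

namespace IsVisitRecord

variable {C : Set (ℝ × ℝ)} {c₀ : Option (ℝ × ℝ)} {γ : ℝ → ℝ × ℝ} {ι : Type} {ℓ : ι → PlaneLine}
  {f : Symb → ι} {A B : ℝ} {Q : List (Symb × ℝ)}

theorem mem_negTimes (hQ : IsVisitRecord C c₀ γ ℓ f A B Q) {a : Symb} {t : ℝ} (h : (a, t) ∈ Q) :
    t ∈ negTimes c₀ γ A B (ℓ (f a)) := by
  obtain ⟨s, hs, ht⟩ := hQ.visited _ h
  exact ⟨hQ.bounds _ h, hs.2.2.1 t ht⟩

theorem not_has (hQ : IsVisitRecord C c₀ γ ℓ f A B Q) {a : Symb} {t : ℝ} (h : (a, t) ∈ Q) (i : ι) :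
    ¬ (ℓ i).Has (γ t) := by
  obtain ⟨s, -, ht⟩ := hQ.visited _ h
  exact fun hi => notMem_endTimes_of_mem_arcAfter ht ⟨i, hi⟩

/-- At `t₂` and `t₃` both lines are negative, so the order `b a` fixes the sign of `turn`. If `b`
were already negative at `t₁`, or `a` still negative at `t₄`, the order `a b` would give the
opposite sign. -/
theorem goodTimes (hQ : IsVisitRecord C c₀ γ ℓ f A B Q) (hC : IsConvexCurve C c₀ γ)
    (hA : IsGeneralArrangement C c₀ ℓ)
    (hf : ∀ x ∈ Q, ∀ y ∈ Q, x.1 ≠ y.1 → f x.1 ≠ f y.1) :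
    GoodTimes (fun a => leftTime c₀ γ A B (ℓ (f a))) (fun a => rightTime c₀ γ A B (ℓ (f a)))
      {e | e ∈ Q} where
  mem _ _ h := hC.lt_of_mem_negTimes (hQ.mem_negTimes h)
  alt a b t₁ t₂ t₃ t₄ hab h1 h2 h3 h4 h12 h23 h34 := by
    have ha : ∀ i c, c₀ = some c → ¬ (ℓ i).Has c := fun i c hc => hA.avoids_top c hc i
    have m1 := hQ.mem_negTimes h1
    have m2 := hQ.mem_negTimes h2
    have m3 := hQ.mem_negTimes h3
    have m4 := hQ.mem_negTimes h4
    have hne := hf _ h1 _ h2 hab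
    have n2 := hC.mem_negTimes_of_between (ha _) m1 m3 h12 h23
    have n3 := hC.mem_negTimes_of_between (ha _) m2 m4 h23 h34
    have k23 := (hC.turn_neg_of_visitedInOrder hA (hQ.inOrder _ h2 _ h3 h23) hne.symm n2.2 n3.2).1
    constructor
    · by_contra! hle
      have n1 : t₁ ∈ negTimes c₀ γ A B (ℓ (f b)) := by
        refine hC.mem_negTimes_of_lt (ha _) ⟨_, m2⟩ (lt_of_le_of_ne hle fun h => ?_)
          (h12.trans (hC.lt_of_mem_negTimes m2).2)
        refine hQ.not_has h1 (f b) ?_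
        rw [← h]
        exact hC.has_leftTime (ha _) ⟨_, m2⟩ (h.symm ▸ m1.1.1)
      have k12 := (hC.turn_neg_of_visitedInOrder hA (hQ.inOrder _ h1 _ h2 h12) hne n1.2 n2.2).1
      rw [turn_neg] at k23
      linarith
    · by_contra! hle
      have n4 : t₄ ∈ negTimes c₀ γ A B (ℓ (f a)) := by
        refine hC.mem_negTimes_of_lt (ha _) ⟨_, m3⟩ ((hC.lt_of_mem_negTimes m3).1.trans h34)
          (lt_of_le_of_ne hle fun h => ?_)
        refine hQ.not_has h4 (f a) ?_
        rw [h]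
        exact hC.has_rightTime (ha _) ⟨_, m3⟩ (h ▸ m4.1.2)
      have k34 := (hC.turn_neg_of_visitedInOrder hA (hQ.inOrder _ h3 _ h4 h34) hne n3.2 n4.2).1
      rw [turn_neg] at k23
      linarith

/-- The consecutive visits `c b` and `b a` in the middle of the pattern fix both signs of `turn`. A
point of the edge of `b` visited between them is negative for `a` and for `c`; the signs place the
crossing with `c` before it and the crossing with `a` after it. -/
theorem exists_meets (hQ : IsVisitRecord C c₀ γ ℓ f A B Q) (hC : IsConvexCurve C c₀ γ)
    (hA : IsGeneralArrangement C c₀ ℓ) {a b c : Symb} (hab : f a ≠ f b) (hbc : f b ≠ f c)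
    (hz : ZigZag {e | e ∈ Q} a b c)
    (hb1 : A < leftTime c₀ γ A B (ℓ (f b))) (hb2 : rightTime c₀ γ A B (ℓ (f b)) < B) :
    ∃ p ∈ chord C (ℓ (f c)) ∩ chord C (ℓ (f b)), ∃ q ∈ chord C (ℓ (f b)) ∩ chord C (ℓ (f a)),
      0 < (q.1 - p.1) * ((γ (rightTime c₀ γ A B (ℓ (f b)))).1 -
        (γ (leftTime c₀ γ A B (ℓ (f b)))).1) := by
  have ha : ∀ i c, c₀ = some c → ¬ (ℓ i).Has c := fun i c hc => hA.avoids_top c hc i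
  obtain ⟨R, hR, hmap, hlt⟩ := hz
  obtain ⟨⟨_, t₁⟩, R, rfl, rfl, hmap⟩ := List.map_eq_cons_iff.1 hmap
  obtain ⟨⟨_, t₂⟩, R, rfl, rfl, hmap⟩ := List.map_eq_cons_iff.1 hmap
  obtain ⟨⟨_, t₃⟩, R, rfl, rfl, hmap⟩ := List.map_eq_cons_iff.1 hmap
  obtain ⟨⟨b', t₄⟩, R, rfl, hb', hmap⟩ := List.map_eq_cons_iff.1 hmap
  obtain ⟨⟨a', t₅⟩, R, rfl, ha', hmap⟩ := List.map_eq_cons_iff.1 hmap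
  obtain ⟨⟨b'', t₆⟩, R, rfl, hb'', hmap⟩ := List.map_eq_cons_iff.1 hmap
  obtain ⟨⟨c', t₇⟩, R, rfl, hc', -⟩ := List.map_eq_cons_iff.1 hmap
  dsimp only at hb' ha' hb'' hc' hab hbc hb1 hb2 ⊢
  subst hb' ha' hb'' hc'
  simp only [Set.mem_ofPred_eq, List.mem_cons, forall_eq_or_imp] at hR
  obtain ⟨h1, h2, h3, h4, h5, h6, h7, -⟩ := hR
  simp only [List.pairwise_cons, List.mem_cons, forall_eq_or_imp] at hlt
  obtain ⟨⟨h12, -, h14, h15, -⟩, ⟨h23, h24, -⟩, ⟨h34, -, -, h37, -⟩, ⟨h45, h46, h47, -⟩,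
    ⟨h56, -⟩, -⟩ := hlt
  have m1 := hQ.mem_negTimes h1
  have m2 := hQ.mem_negTimes h2
  have m3 := hQ.mem_negTimes h3
  have m4 := hQ.mem_negTimes h4
  have m5 := hQ.mem_negTimes h5
  have m6 := hQ.mem_negTimes h6
  have m7 := hQ.mem_negTimes h7
  have a4 := hC.mem_negTimes_of_between (ha _) m1 m5 h14 h45
  have b3 := hC.mem_negTimes_of_between (ha _) m2 m4 h23 h34
  have b5 := hC.mem_negTimes_of_between (ha _) m4 m6 h45 h56
  have c4 := hC.mem_negTimes_of_between (ha _) m3 m7 h34 h47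
  obtain ⟨k1, z1⟩ := hC.turn_neg_of_visitedInOrder hA (hQ.inOrder _ h3 _ h4 h34) hbc.symm b3.2 c4.2
  obtain ⟨k2, z2⟩ := hC.turn_neg_of_visitedInOrder hA (hQ.inOrder _ h4 _ h5 h45) hab.symm a4.2 b5.2
  dsimp only at k1 z1 k2 z2
  obtain ⟨s, ⟨-, -, -, p, -, hbp, hp⟩, hs⟩ := hQ.visited _ h4
  have ap := sideValue_neg_of_height_mul_pos (hp _ hab _ hs) a4.2
  have cp := sideValue_neg_of_height_mul_pos (hp _ hbc.symm _ hs) c4.2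
  have e1 := sideSign_mul_pos_of_turn_neg (hA.not_parallel _ _ hbc.symm) k1 hbp cp
  have e2 := sideSign_mul_neg_of_turn_neg (hA.not_parallel _ _ hab) k2 hbp ap
  have hl := hC.lt_of_mem_negTimes m4
  obtain ⟨hne, hlr, hzero⟩ := hC.hasEndTimes hA hb1 hb2
  have e3 := hC.sideSign_mul_pos hl.1 hl.2 ((hzero _).2 (Or.inl rfl)) ((hzero _).2 (Or.inr rfl)) m4.2
  refine ⟨_, ⟨⟨interior_subset z1, (ℓ _).has_meet_left _⟩, interior_subset z1,
    PlaneLine.has_meet_right (hA.not_parallel _ _ hbc.symm)⟩, _, ⟨⟨interior_subset z2,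
    (ℓ _).has_meet_left _⟩, interior_subset z2, PlaneLine.has_meet_right
    (hA.not_parallel _ _ hab.symm)⟩, ?_⟩
  refine pos_of_mul_pos_right (a := sideSign c₀ (ℓ (f b'')) ^ 2) ?_ (sq_nonneg _)
  have e4 := mul_pos (show 0 < sideSign c₀ (ℓ (f b'')) * (((ℓ (f b'')).meet (ℓ (f a'))).1 -
    ((ℓ (f c')).meet (ℓ (f b''))).1) by linarith) e3
  linarith

end IsVisitRecord

/-- All visits lie in a window `(A - 1, B + 1)`, and the interval ends of negative times in this
window serve as endpoints. As those of `T` lie strictly between two visit times, they are actual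
endpoints and not ends of the window. -/
theorem forces_of_timed {k m : ℕ} {T : SegConfig} {φ : Symb → Symb}
    (hT : ∀ a, Endpt.left a ∈ endpointWord T.pieces → Endpt.right a ∈ endpointWord T.pieces)
    (hg : ∀ g ∈ T.concave, ∀ a ∈ g, Endpt.left a ∈ endpointWord T.pieces)
    (h : ∀ (l r : Symb → ℝ) (W : TimedWord), IsTimed k m l r W →
      ((endpointWord T.pieces).map (Endpt.time (l ∘ φ) (r ∘ φ))).Pairwise (· < ·) ∧
      (∃ e ∈ entries W, ∃ e' ∈ entries W, ∀ a ∈ endpointWord T.pieces,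
        e.2 < a.time (l ∘ φ) (r ∘ φ) ∧ a.time (l ∘ φ) (r ∘ φ) < e'.2) ∧
      ∀ g ∈ T.concave, ConcaveTimes l r {e | e ∈ entries W} φ g) :
    Forces (word (hartSharir k m)) T := by
  refine ⟨(hartSharir_firstOcc_ababaFree k m).2, ?_⟩
  rintro C c₀ γ hC n ℓ hA S hS ⟨f, hf, hsub⟩
  obtain ⟨Q, hQu, hQlt, hQv, hQo⟩ := exists_events (hC.finite_endTimes hA) hS hsub
  obtain ⟨A, hAQ⟩ : BddBelow {t | t ∈ Q.map Prod.snd} := (List.finite_toSet _).bddBelow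
  obtain ⟨B, hBQ⟩ : BddAbove {t | t ∈ Q.map Prod.snd} := (List.finite_toSet _).bddAbove
  have hR : IsVisitRecord C c₀ γ ℓ f (A - 1) (B + 1) Q := by
    refine ⟨fun x hx => ?_, hQv, hQo⟩
    have h1 := hAQ (List.mem_map_of_mem hx)
    have h2 := hBQ (List.mem_map_of_mem hx)
    constructor <;> linarith
  have hmem : ∀ x ∈ Q, x.1 ∈ word (hartSharir k m) := fun x hx => hQu ▸ List.mem_map_of_mem hx
  have hgood := hR.goodTimes hC hA fun x hx y hy hne hxy => hne (hf (hmem x hx) (hmem y hy) hxy)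
  obtain ⟨W, hW, hWQ⟩ := TimedWord.exists_shape_entries _ Q hQu
  have hsorted : Sorted W := by rw [Sorted, hWQ]; exact hQlt
  obtain ⟨h1, ⟨e, he, e', he', h2⟩, h3⟩ := h _ _ W ⟨hW, hsorted, by rw [hWQ]; exact hgood⟩
  rw [hWQ] at he he' h3
  have hin : ∀ a, Endpt.left a ∈ endpointWord T.pieces →
      A - 1 < leftTime c₀ γ (A - 1) (B + 1) (ℓ (f (φ a))) ∧
      rightTime c₀ γ (A - 1) (B + 1) (ℓ (f (φ a))) < B + 1 := fun a ha =>
    ⟨(hR.bounds e he).1.trans (h2 _ ha).1, (h2 _ (hT a ha)).2.trans (hR.bounds e' he').2⟩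
  refine ⟨f ∘ φ, fun a => leftTime c₀ γ (A - 1) (B + 1) (ℓ (f (φ a))),
    fun a => rightTime c₀ γ (A - 1) (B + 1) (ℓ (f (φ a))),
    fun a ha => (hC.hasEndTimes hA (hin a ha).1 (hin a ha).2).2, h1, fun g hgT => ?_⟩
  obtain ⟨h4, h5⟩ := h3 g hgT
  refine ⟨h4, fun a b c habc => ?_⟩
  have h6 := (List.pairwise_append.1 h4).1
  rw [List.pairwise_map] at h6
  have h7 := h6.sublist habc.sublist
  simp only [List.pairwise_cons, List.mem_cons, forall_eq_or_imp, Function.comp_apply] at h7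
  have hb := hin b (hg g hgT b (habc.subset (by simp)))
  exact hR.exists_meets hC hA (fun h => h7.1.1.ne (by rw [h])) (fun h => h7.2.1.1.ne (by rw [h]))
    (h5 a b c habc) hb.1 hb.2


/-! ## The segments of the configuration -/

theorem endpointWord_renamePieces (f : Symb → Symb) : ∀ T : List (Piece Endpt),
    endpointWord (renamePieces f (Endpt.rename f) T) = (endpointWord T).map (Endpt.rename f)
  | [] => rfl
  | Piece.plain e :: T => by simp [renamePieces, endpointWord, endpointWord_renamePieces f T]
  | Piece.block l :: T => by
      simp [renamePieces, endpointWord, endpointWord_renamePieces f T, Endpt.rename]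

theorem endpointWord_append : ∀ T T' : List (Piece Endpt),
    endpointWord (T ++ T') = endpointWord T ++ endpointWord T'
  | [], _ => rfl
  | Piece.plain e :: T, T' => by simp [endpointWord, endpointWord_append T T']
  | Piece.block l :: T, T' => by simp [endpointWord, endpointWord_append T T']

theorem endpointWord_map_plain {α : Type} (f : α → Endpt) (u : List α) :
    endpointWord (u.map fun j => Piece.plain (f j)) = u.map f := by
  induction u with
  | nil => rfl
  | cons j u ih => simp [endpointWord, ih]

theorem left_mem_of_mem_specialBlocks {l : List Symb} {a : Symb} (ha : a ∈ l) :
    ∀ {T : List (Piece Endpt)}, l ∈ specialBlocks T → Endpt.left a ∈ endpointWord T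
  | Piece.plain e :: T, h => by
      simp only [specialBlocks] at h
      simp [endpointWord, left_mem_of_mem_specialBlocks ha h]
  | Piece.block l' :: T, h => by
      simp only [specialBlocks, List.mem_cons] at h
      rcases h with rfl | h
      · simp [endpointWord, ha]
      · simp [endpointWord, left_mem_of_mem_specialBlocks ha h]

theorem endpointWord_sublist_insertLefts : ∀ (T : List (Piece Endpt)) (gs : List Symb),
    (endpointWord T).Sublist (endpointWord (insertLefts T gs))
  | [], gs => by simp [endpointWord]
  | Piece.plain e :: T, gs => by
      simpa [insertLefts, endpointWord] using endpointWord_sublist_insertLefts T gs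
  | Piece.block l :: T, [] => by
      simpa [insertLefts, endpointWord] using endpointWord_sublist_insertLefts T []
  | Piece.block l :: T, g :: gs => by
      simpa [insertLefts, endpointWord] using
        (endpointWord_sublist_insertLefts T gs).cons (Endpt.left g)

theorem mem_of_mem_insertLefts {e : Endpt} : ∀ {T : List (Piece Endpt)} {gs : List Symb},
    e ∈ endpointWord (insertLefts T gs) → e ∈ endpointWord T ∨ ∃ g ∈ gs, e = Endpt.left g
  | [], gs, h => by simp [insertLefts, endpointWord] at h
  | Piece.plain e' :: T, gs, h => by
      simp only [insertLefts, endpointWord, List.mem_cons] at h ⊢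
      exact h.elim (fun h => Or.inl (Or.inl h)) fun h => (mem_of_mem_insertLefts h).imp_left Or.inr
  | Piece.block l :: T, [], h => by
      simp only [insertLefts, endpointWord, List.mem_append] at h ⊢
      exact h.elim (fun h => Or.inl (Or.inl h)) fun h => (mem_of_mem_insertLefts h).imp_left Or.inr
  | Piece.block l :: T, g :: gs, h => by
      simp only [insertLefts, endpointWord, List.mem_append, List.map_append, List.map_cons,
        List.map_nil, List.mem_singleton] at h ⊢
      rcases h with (h | h) | h
      · exact Or.inl (Or.inl h)
      · exact Or.inr ⟨g, by simp, h⟩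
      · exact (mem_of_mem_insertLefts h).imp Or.inr fun ⟨g, hg, h⟩ => ⟨g, by simp [hg], h⟩

theorem left_mem_insertLefts {g : Symb} : ∀ {T : List (Piece Endpt)} {gs : List Symb}, g ∈ gs →
    gs.length ≤ (specialBlocks T).length → Endpt.left g ∈ endpointWord (insertLefts T gs)
  | [], gs, hg, h => by
      obtain rfl : gs = [] := by simpa [specialBlocks] using h
      simp at hg
  | Piece.plain e :: T, gs, hg, h => by
      simp only [insertLefts, endpointWord, List.mem_cons]
      exact Or.inr (left_mem_insertLefts hg h)
  | Piece.block l :: T, [], hg, h => by simp at hg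
  | Piece.block l :: T, g' :: gs, hg, h => by
      simp only [insertLefts, endpointWord, List.mem_append, List.map_append, List.map_cons,
        List.map_nil, List.mem_singleton]
      rcases List.mem_cons.1 hg with rfl | hg
      · exact Or.inl (Or.inr rfl)
      · exact Or.inr (left_mem_insertLefts hg (by simpa [specialBlocks] using h))

theorem mem_of_mem_endpointShuffleFrom {A : List (Piece Endpt)} {e : Endpt} :
    ∀ {B : List (Piece Endpt)} {i : ℕ}, e ∈ endpointWord (endpointShuffleFrom A i B) →
    (∃ j, i ≤ j ∧ j < i + (specialBlocks B).length ∧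
      ∃ e' ∈ endpointWord A, e = e'.rename (Symb.loc j)) ∨
    ∃ e' ∈ endpointWord B, e = e'.rename Symb.glob
  | [], i, h => by simp [endpointShuffleFrom, endpointWord] at h
  | Piece.plain b :: B, i, h => by
      simp only [endpointShuffleFrom, endpointWord, List.mem_cons] at h
      rcases h with rfl | h
      · exact Or.inr ⟨b, by simp [endpointWord], rfl⟩
      · exact (mem_of_mem_endpointShuffleFrom h).imp id fun ⟨e', h1, h2⟩ =>
          ⟨e', by simp [endpointWord, h1], h2⟩
  | Piece.block l :: B, i, h => by
      simp only [endpointShuffleFrom, endpointWord_append, List.mem_append] at h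
      rcases h with h | h
      · rcases mem_of_mem_insertLefts h with h | ⟨g, hg, rfl⟩
        · rw [endpointWord_renamePieces, List.mem_map] at h
          obtain ⟨e', he', rfl⟩ := h
          exact Or.inl ⟨i, le_rfl, by simp [specialBlocks], e', he', rfl⟩
        · obtain ⟨a, ha, rfl⟩ := List.mem_map.1 hg
          exact Or.inr ⟨Endpt.left a, by simp [endpointWord, ha], rfl⟩
      · rcases mem_of_mem_endpointShuffleFrom h with ⟨j, h1, h2, h3⟩ | ⟨e', h1, h2⟩
        · exact Or.inl ⟨j, by omega, by simp only [specialBlocks, List.length_cons]; omega, h3⟩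
        · exact Or.inr ⟨e', by simp [endpointWord, h1], h2⟩

theorem rename_loc_mem_endpointShuffleFrom {A : List (Piece Endpt)} {e : Endpt}
    (he : e ∈ endpointWord A) : ∀ {B : List (Piece Endpt)} {i j : ℕ}, i ≤ j →
    j < i + (specialBlocks B).length →
    e.rename (Symb.loc j) ∈ endpointWord (endpointShuffleFrom A i B)
  | [], i, j, h, h' => by simp [specialBlocks] at h'; omega
  | Piece.plain b :: B, i, j, h, h' => by
      simp only [endpointShuffleFrom, endpointWord, List.mem_cons]
      exact Or.inr (rename_loc_mem_endpointShuffleFrom he h h')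
  | Piece.block l :: B, i, j, h, h' => by
      simp only [endpointShuffleFrom, endpointWord_append, List.mem_append]
      rcases h.eq_or_lt with rfl | h
      · refine Or.inl ((endpointWord_sublist_insertLefts _ _).subset ?_)
        rw [endpointWord_renamePieces]
        exact List.mem_map_of_mem he
      · exact Or.inr (rename_loc_mem_endpointShuffleFrom he h
          (by simp only [specialBlocks, List.length_cons] at h'; omega))

theorem right_glob_mem_endpointShuffleFrom {A : List (Piece Endpt)} {b : Symb} :
    ∀ {B : List (Piece Endpt)} {i : ℕ}, Endpt.right b ∈ endpointWord B →
    Endpt.right (Symb.glob b) ∈ endpointWord (endpointShuffleFrom A i B)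
  | Piece.plain e :: B, i, h => by
      simp only [endpointShuffleFrom, endpointWord, List.mem_cons] at h ⊢
      rcases h with rfl | h
      · exact Or.inl rfl
      · exact Or.inr (right_glob_mem_endpointShuffleFrom h)
  | Piece.block l :: B, i, h => by
      simp only [endpointShuffleFrom, endpointWord_append, endpointWord, List.mem_append] at h ⊢
      rcases h with h | h
      · simp at h
      · exact Or.inr (right_glob_mem_endpointShuffleFrom h)

/-- The length condition matters because `insertLefts` drops surplus symbols. -/
theorem left_glob_mem_endpointShuffleFrom {A : List (Piece Endpt)} {b : Symb} :
    ∀ {B : List (Piece Endpt)} {i : ℕ},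
    (∀ l ∈ specialBlocks B, l.length ≤ (specialBlocks A).length) → Endpt.left b ∈ endpointWord B →
    Endpt.left (Symb.glob b) ∈ endpointWord (endpointShuffleFrom A i B)
  | Piece.plain e :: B, i, hB, h => by
      simp only [endpointShuffleFrom, endpointWord, List.mem_cons] at h ⊢
      rcases h with rfl | h
      · exact Or.inl rfl
      · exact Or.inr (left_glob_mem_endpointShuffleFrom hB h)
  | Piece.block l :: B, i, hB, h => by
      simp only [specialBlocks, List.mem_cons, forall_eq_or_imp] at hB
      simp only [endpointShuffleFrom, endpointWord_append, endpointWord, List.mem_append] at h ⊢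
      rcases h with h | h
      · simp only [List.mem_map, Endpt.left.injEq, exists_eq_right] at h
        exact Or.inl (left_mem_insertLefts (List.mem_map_of_mem h)
          (by simpa [specialBlocks_renamePieces] using hB.1))
      · exact Or.inr (left_glob_mem_endpointShuffleFrom hB.2 h)

/-- Every segment that is listed has both its endpoints in the endpoint sequence. -/
structure SegConfig.Complete (T : SegConfig) : Prop where
  right_mem : ∀ a, Endpt.left a ∈ endpointWord T.pieces → Endpt.right a ∈ endpointWord T.pieces
  left_mem : ∀ g ∈ T.concave, ∀ a ∈ g, Endpt.left a ∈ endpointWord T.pieces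

theorem SegConfig.Complete.shuffle {A B : SegConfig} (hA : A.Complete) (hB : B.Complete)
    (h : ∀ l ∈ specialBlocks B.pieces, l.length ≤ (specialBlocks A.pieces).length) :
    (A.shuffle B).Complete where
  right_mem a ha := by
    simp only [SegConfig.shuffle] at ha ⊢
    rcases mem_of_mem_endpointShuffleFrom ha with ⟨j, h1, h2, e, he, hae⟩ | ⟨e, he, hae⟩
    · cases e with
      | right b => simp [Endpt.rename] at hae
      | left b =>
        obtain rfl : a = Symb.loc j b := by simpa [Endpt.rename] using hae
        exact rename_loc_mem_endpointShuffleFrom (hA.right_mem b he) h1 h2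
    · cases e with
      | right b => simp [Endpt.rename] at hae
      | left b =>
        obtain rfl : a = Symb.glob b := by simpa [Endpt.rename] using hae
        exact right_glob_mem_endpointShuffleFrom (hB.right_mem b he)
  left_mem g hg a ha := by
    simp only [SegConfig.shuffle, List.mem_append, List.mem_flatMap, List.mem_range,
      List.mem_map] at hg ⊢
    rcases hg with ⟨j, hj, g, hg, rfl⟩ | ⟨g, hg, rfl⟩
    · obtain ⟨b, hb, rfl⟩ := List.mem_map.1 ha
      exact rename_loc_mem_endpointShuffleFrom (hA.left_mem g hg b hb) (Nat.zero_le j) (by simpa)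
    · obtain ⟨b, hb, rfl⟩ := List.mem_map.1 ha
      exact left_glob_mem_endpointShuffleFrom h (hB.left_mem g hg b hb)

theorem complete_configF (m : ℕ) : (configF m).Complete where
  right_mem a := by simp [configF, endpointWord, endpointWord_map_plain]
  left_mem := by simp [configF]

theorem complete_configZ (m : ℕ) : (configZ m).Complete where
  right_mem a := by
    simp only [configZ, endpointWord_append, endpointWord, endpointWord_map_plain]
    simp
    aesop
  left_mem := by simp [configZ, endpointWord_append, endpointWord]

theorem complete_configY : configY.Complete where
  right_mem a := by simp [configY, endpointWord]
  left_mem := by simp [configY, endpointWord]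

theorem complete_configX : configX.Complete := by
  have hT : configT4.Complete :=
    ((((complete_configZ 1).shuffle (complete_configZ 2) (by decide +kernel)).shuffle
      (complete_configZ 4) (by decide +kernel)).shuffle (complete_configZ 8)
        (by decide +kernel)).shuffle (complete_configF 16) (by decide +kernel)
  have hlen : ∀ l ∈ specialBlocks configT4.pieces,
      l.length ≤ (specialBlocks configY.pieces).length := by decide +kernel
  have hX := complete_configY.shuffle hT hlen
  refine ⟨hX.right_mem, fun g hg a ha => ?_⟩
  simp only [configX, List.mem_append] at hg
  rcases hg with hg | hg
  · exact hX.left_mem g hg a ha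
  · obtain ⟨l, hl, rfl⟩ := List.mem_map.1 hg
    obtain ⟨b, hb, rfl⟩ := List.mem_map.1 ha
    exact left_glob_mem_endpointShuffleFrom hlen (left_mem_of_mem_specialBlocks hb hl)


/-! ## Charts in which the curve becomes a parabola -/

/-- Homogeneous coordinates `M : N : U`, affine in the plane, in which the curve `γ` is the conic
`N ^ 2 = M * U`, traversed from left to right. -/
structure ConicChart (C : Set (ℝ × ℝ)) (γ : ℝ → ℝ × ℝ) (N M U : ℝ × ℝ → ℝ) : Prop where
  combo : ∀ f ∈ [N, M, U], ∀ p q : ℝ × ℝ, ∀ s : ℝ, f ((1 - s) • p + s • q) = (1 - s) * f p + s * f q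
  conic : ∀ t, N (γ t) ^ 2 = M (γ t) * U (γ t)
  pos : ∀ t, 0 < M (γ t)
  nonneg : ∀ p ∈ convexHull ℝ C, 0 ≤ M p
  strictMono : StrictMono fun t => N (γ t) / M (γ t)

theorem PlaneLine.Has.exists_combo {a : PlaneLine} {p q w : ℝ × ℝ} (hp : a.Has p) (hq : a.Has q)
    (hpq : p ≠ q) (hw : a.Has w) :
    ∃ s : ℝ, w = (1 - s) • p + s • q ∧ w.1 - p.1 = s * (q.1 - p.1) := by
  simp only [PlaneLine.Has, PlaneLine.height] at hp hq hw
  obtain ⟨s, hs⟩ := exists_combo_of_orient_eq_zero (w := w) hpq (by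
    rw [orient_eq]
    linear_combination (q.1 - p.1) * (hw - hp) - (w.1 - p.1) * (hq - hp))
  refine ⟨s, hs, ?_⟩
  rw [hs]
  simp only [Prod.fst_add, Prod.smul_fst, smul_eq_mul]
  ring

/-- In coordinates on a parabola, concavity is an inequality of cross ratios. -/
def ConcaveRatio (L R : Symb → ℝ) (a b c : Symb) : Prop :=
  (L c - L b) * (R c - L b) * ((R b - L a) * (R b - R a)) <
    (L b - L a) * (R a - L b) * ((R b - L c) * (R c - R b))

namespace ConicChart

variable {C : Set (ℝ × ℝ)} {γ : ℝ → ℝ × ℝ} {N M U : ℝ × ℝ → ℝ}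

/-- The equation of the chord of the conic with parameters `N / M` at its ends: at a curve point
with parameter `x` the left side is `M` times the product of the differences of `x` from them. -/
theorem line_eq (h : ConicChart C γ N M U) {a : PlaneLine} {l r : ℝ} (hγ : γ l ≠ γ r)
    (hl : a.Has (γ l)) (hr : a.Has (γ r)) {p : ℝ × ℝ} (hp : a.Has p) :
    U p - (N (γ l) / M (γ l) + N (γ r) / M (γ r)) * N p
      + N (γ l) / M (γ l) * (N (γ r) / M (γ r)) * M p = 0 := by
  obtain ⟨s, rfl, -⟩ := hl.exists_combo hr hγ hp
  rw [h.combo N (by simp), h.combo M (by simp), h.combo U (by simp)]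
  have hl0 := (h.pos l).ne'
  have hr0 := (h.pos r).ne'
  have e1 : U (γ l) = N (γ l) ^ 2 / M (γ l) := by rw [h.conic]; field_simp
  have e2 : U (γ r) = N (γ r) ^ 2 / M (γ r) := by rw [h.conic]; field_simp
  rw [e1, e2]
  field_simp
  ring

theorem concaveRatio (h : ConicChart C γ N M U) (hγ : Function.Injective γ) {seg : Symb → PlaneLine}
    {l r : Symb → ℝ} {a b c : Symb} (ha : HasEndTimes γ (seg a) (l a) (r a))
    (hb : HasEndTimes γ (seg b) (l b) (r b)) (hc : HasEndTimes γ (seg c) (l c) (r c))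
    (hlt : [l a, l b, l c, r a, r b, r c].Pairwise (· < ·)) {p q : ℝ × ℝ}
    (hp : p ∈ chord C (seg c) ∩ chord C (seg b)) (hq : q ∈ chord C (seg b) ∩ chord C (seg a))
    (hpq : 0 < (q.1 - p.1) * ((γ (r b)).1 - (γ (l b)).1)) :
    ConcaveRatio (fun x => N (γ (l x)) / M (γ (l x))) (fun x => N (γ (r x)) / M (γ (r x))) a b c := by
  have hends : ∀ {x}, HasEndTimes γ (seg x) (l x) (r x) →
      γ (l x) ≠ γ (r x) ∧ (seg x).Has (γ (l x)) ∧ (seg x).Has (γ (r x)) := fun hx =>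
    ⟨hγ.ne hx.1.ne, (hx.2 _).2 (Or.inl rfl), (hx.2 _).2 (Or.inr rfl)⟩
  obtain ⟨na, la, ra⟩ := hends ha
  obtain ⟨nb, lb, rb⟩ := hends hb
  obtain ⟨nc, lc, rc⟩ := hends hc
  have hcp := h.line_eq nc lc rc hp.1.2
  have haq := h.line_eq na la ra hq.2.2
  obtain ⟨s, hps, hs⟩ := lb.exists_combo rb nb hp.2.2
  obtain ⟨t, hqt, ht⟩ := lb.exists_combo rb nb hq.1.2
  have hst : 0 < t - s := by
    refine pos_of_mul_pos_right (a := ((γ (r b)).1 - (γ (l b)).1) ^ 2) ?_ (sq_nonneg _)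
    have : q.1 - p.1 = (t - s) * ((γ (r b)).1 - (γ (l b)).1) := by linarith
    rw [this] at hpq
    linarith
  have Mp := h.nonneg p hp.1.1
  have Mq := h.nonneg q hq.1.1
  have hm := h.strictMono
  have Ml := h.pos (l b)
  have Mr := h.pos (r b)
  have eNl : N (γ (l b)) = N (γ (l b)) / M (γ (l b)) * M (γ (l b)) := by field_simp
  have eNr : N (γ (r b)) = N (γ (r b)) / M (γ (r b)) * M (γ (r b)) := by field_simp
  have eUl : U (γ (l b)) = (N (γ (l b)) / M (γ (l b))) ^ 2 * M (γ (l b)) := by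
    rw [div_pow, h.conic]; field_simp
  have eUr : U (γ (r b)) = (N (γ (r b)) / M (γ (r b))) ^ 2 * M (γ (r b)) := by
    rw [div_pow, h.conic]; field_simp
  rw [hps] at hcp Mp
  rw [hqt] at haq Mq
  rw [h.combo M (by simp)] at hcp haq Mp Mq
  rw [h.combo N (by simp), h.combo U (by simp), eUl, eUr] at hcp haq
  simp only [List.pairwise_cons, List.mem_cons, List.not_mem_nil, or_false, forall_eq_or_imp,
    forall_eq, List.Pairwise.nil, and_true, IsEmpty.forall_iff, implies_true] at hlt
  obtain ⟨⟨h1, -⟩, ⟨h2, h3, -⟩, ⟨h4, h5, -⟩, ⟨h6, -⟩, h7⟩ := hlt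
  replace h1 := hm h1
  replace h2 := hm h2
  replace h3 := hm h3
  replace h4 := hm h4
  replace h5 := hm h5
  replace h6 := hm h6
  replace h7 := hm h7
  simp only [ConcaveRatio] at h1 h2 h3 h4 h5 h6 h7 ⊢
  generalize N (γ (l a)) / M (γ (l a)) = a1 at *
  generalize N (γ (r a)) / M (γ (r a)) = a2 at *
  generalize hb1 : N (γ (l b)) / M (γ (l b)) = b1 at *
  generalize hb2 : N (γ (r b)) / M (γ (r b)) = b2 at *
  generalize N (γ (l c)) / M (γ (l c)) = c1 at *
  generalize N (γ (r c)) / M (γ (r c)) = c2 at *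
  generalize M (γ (l b)) = m1 at *
  generalize M (γ (r b)) = m2 at *
  rw [eNl, eNr] at hcp haq
  -- The crossings with `c` and `a` divide the chord `b` at `s` and `t`. The equations determine
  -- both ratios, and multiplying by `s < t` turns concavity into the asserted inequality; the
  -- unknown weights `m1`, `m2` cancel.
  have k1 : (1 - s) * m1 * ((c1 - b1) * (c2 - b1)) = s * m2 * ((b2 - c1) * (c2 - b2)) := by
    linear_combination hcp
  have k2 : (1 - t) * m1 * ((b1 - a1) * (a2 - b1)) = t * m2 * ((b2 - a1) * (b2 - a2)) := by
    linear_combination -haq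
  have p1 : 0 < (c1 - b1) * (c2 - b1) := mul_pos (by linarith) (by linarith)
  have p2 : 0 < (b2 - c1) * (c2 - b2) := mul_pos (by linarith) (by linarith)
  have p3 : 0 < (b1 - a1) * (a2 - b1) := mul_pos (by linarith) (by linarith)
  have p4 : 0 < (b2 - a1) * (b2 - a2) := mul_pos (by linarith) (by linarith)
  have hs1 : s < 1 := by
    by_contra! hs1
    have h8 : (1 - s) * m1 * ((c1 - b1) * (c2 - b1)) ≤ 0 :=
      mul_nonpos_of_nonpos_of_nonneg (mul_nonpos_of_nonpos_of_nonneg (by linarith) Ml.le) p1.le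
    have h9 : 0 < s * m2 * ((b2 - c1) * (c2 - b2)) := mul_pos (mul_pos (by linarith) Mr) p2
    linarith
  have ht0 : 0 < t := by
    by_contra! ht0
    have h8 : t * m2 * ((b2 - a1) * (b2 - a2)) ≤ 0 :=
      mul_nonpos_of_nonpos_of_nonneg (mul_nonpos_of_nonpos_of_nonneg ht0 Mr.le) p4.le
    have h9 : 0 < (1 - t) * m1 * ((b1 - a1) * (a2 - b1)) := mul_pos (mul_pos (by linarith) Ml) p3
    linarith
  have h8 : 0 < (1 - s) * t := mul_pos (by linarith) ht0
  have h9 : (1 - s) * m1 * (t * m2) * ((c1 - b1) * (c2 - b1) * ((b2 - a1) * (b2 - a2))) =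
      s * m2 * ((1 - t) * m1) * ((b1 - a1) * (a2 - b1) * ((b2 - c1) * (c2 - b2))) := by
    linear_combination t * m2 * ((b2 - a1) * (b2 - a2)) * k1 -
      s * m2 * ((b2 - c1) * (c2 - b2)) * k2
  have h10 : s * m2 * ((1 - t) * m1) * ((b1 - a1) * (a2 - b1) * ((b2 - c1) * (c2 - b2))) <
      (1 - s) * m1 * (t * m2) * ((b1 - a1) * (a2 - b1) * ((b2 - c1) * (c2 - b2))) := by
    refine mul_lt_mul_of_pos_right ?_ (mul_pos p3 p2)
    have := mul_pos (mul_pos Ml Mr) hst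
    linarith
  rw [← h9] at h10
  refine lt_of_mul_lt_mul_left h10 ?_
  have := mul_pos h8 (mul_pos Ml Mr)
  linarith

end ConicChart

/-! ## The configuration on a parabola -/

/-- If both alternatives failed, the two products in the hypothesis would compare factor by factor
in the opposite sense. -/
theorem whisker_gaps {a1 a2 b1 b2 c1 c2 : ℝ} (h1 : a1 < b1) (h3 : c1 < a2)
    (h4 : a2 < b2) (h5 : b2 < c2)
    (h : (c1 - b1) * (c2 - b1) * ((b2 - a1) * (b2 - a2)) <
      (b1 - a1) * (a2 - b1) * ((b2 - c1) * (c2 - b2))) :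
    c1 - b1 ≤ c2 - c1 ∨ b2 - a2 < c2 - b2 := by
  by_contra! hcon
  obtain ⟨h6, h7⟩ := hcon
  refine absurd h (not_lt.2 ?_)
  calc (b1 - a1) * (a2 - b1) * ((b2 - c1) * (c2 - b2))
      ≤ (b2 - a1) * (c2 - b1) * ((c1 - b1) * (b2 - a2)) := by
        refine mul_le_mul (mul_le_mul ?_ ?_ ?_ ?_) (mul_le_mul ?_ ?_ ?_ ?_) (mul_nonneg ?_ ?_)
          (mul_nonneg ?_ ?_) <;> linarith
    _ = _ := by ring

theorem gap_ratio {l l1 l2 l3 r1 r2 r3 : ℝ} (h0 : l ≤ l1) (h1 : l1 < l2) (h2 : l2 < l3) (h3 : l3 < r1)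
    (h4 : r1 < r2) (h5 : r2 < r3)
    (h : (l3 - l2) * (r3 - l2) * ((r2 - l1) * (r2 - r1)) <
      (l2 - l1) * (r1 - l2) * ((r2 - l3) * (r3 - r2))) :
    (l3 - l2) * (1 / (r1 - l) - 1 / (r2 - l)) < (l2 - l1) * (1 / (r2 - l) - 1 / (r3 - l)) := by
  have e1 : 0 < r1 - l := by linarith
  have e2 : 0 < r2 - l := by linarith
  have e3 : 0 < r3 - l := by linarith
  have e4 : 1 / (r1 - l) - 1 / (r2 - l) = (r2 - r1) / ((r1 - l) * (r2 - l)) := by field_simp; ring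
  have e5 : 1 / (r2 - l) - 1 / (r3 - l) = (r3 - r2) / ((r2 - l) * (r3 - l)) := by field_simp; ring
  rw [e4, e5, mul_div_assoc', mul_div_assoc', div_lt_div_iff₀ (by positivity) (by positivity)]
  suffices h6 : (l3 - l2) * (r2 - r1) * (r3 - l) < (l2 - l1) * (r3 - r2) * (r1 - l) by
    have := mul_lt_mul_of_pos_right h6 e2
    linarith
  have e6 : 0 < r2 - l1 := by linarith
  have e7 : 0 < r3 - l2 := by linarith
  refine lt_of_mul_lt_mul_right ?_ (mul_pos e6 e7).le
  calc (l3 - l2) * (r2 - r1) * (r3 - l) * ((r2 - l1) * (r3 - l2))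
      = (l3 - l2) * (r3 - l2) * ((r2 - l1) * (r2 - r1)) * (r3 - l) := by ring
    _ < (l2 - l1) * (r1 - l2) * ((r2 - l3) * (r3 - r2)) * (r3 - l) := mul_lt_mul_of_pos_right h e3
    _ = (l2 - l1) * (r3 - r2) * ((r2 - l3) * ((r1 - l2) * (r3 - l))) := by ring
    _ ≤ (l2 - l1) * (r3 - r2) * ((r2 - l1) * ((r1 - l) * (r3 - l2))) := by
        have e8 : (r1 - l2) * (r3 - l) ≤ (r1 - l) * (r3 - l2) := by
          have : (r1 - l) * (r3 - l2) - (r1 - l2) * (r3 - l) = (l2 - l) * (r3 - r1) := by ring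
          have := mul_nonneg (show 0 ≤ l2 - l by linarith) (show 0 ≤ r3 - r1 by linarith)
          linarith
        have e9 : 0 ≤ (r1 - l2) * (r3 - l) := mul_nonneg (by linarith) e3.le
        have e10 : 0 ≤ (l2 - l1) * (r3 - r2) := mul_nonneg (by linarith) (by linarith)
        refine mul_le_mul_of_nonneg_left ?_ e10
        exact mul_le_mul (by linarith) e8 e9 e6.le
    _ = _ := by ring


/-! ## The endpoints at a leaf of the configuration -/

def Symb.decEq : (a b : Symb) → Decidable (a = b)
  | Symb.atom n, Symb.atom m => decidable_of_iff (n = m) (by simp)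
  | Symb.loc i a, Symb.loc j b =>
      haveI := Symb.decEq a b
      decidable_of_iff (i = j ∧ a = b) (by simp)
  | Symb.glob a, Symb.glob b =>
      haveI := Symb.decEq a b
      decidable_of_iff (a = b) (by simp)
  | Symb.atom _, Symb.loc _ _ => isFalse (by simp)
  | Symb.atom _, Symb.glob _ => isFalse (by simp)
  | Symb.loc _ _, Symb.atom _ => isFalse (by simp)
  | Symb.loc _ _, Symb.glob _ => isFalse (by simp)
  | Symb.glob _, Symb.atom _ => isFalse (by simp)
  | Symb.glob _, Symb.loc _ _ => isFalse (by simp)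

instance : DecidableEq Symb := Symb.decEq

instance : DecidableEq Endpt
  | Endpt.left a, Endpt.left b => decidable_of_iff (a = b) (by simp)
  | Endpt.right a, Endpt.right b => decidable_of_iff (a = b) (by simp)
  | Endpt.left _, Endpt.right _ => isFalse (by simp)
  | Endpt.right _, Endpt.left _ => isFalse (by simp)
/-- The endpoints of the segments `a, b, c` of a whisker and of the numeric segment `n`, in the
order in which they surround the endpoints `u` in the first or in the second half. -/
def whiskerWrap (i : Bool) (f : Symb → Symb) (n : Symb) (u : List Endpt) : List Endpt :=
  if i then
    [Endpt.left (f (Symb.atom 0)), Endpt.left (f (Symb.atom 1)), Endpt.left (f (Symb.atom 2)),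
      Endpt.right (f (Symb.atom 0))] ++ u ++
    [Endpt.right n, Endpt.right (f (Symb.atom 1)), Endpt.right (f (Symb.atom 2))]
  else
    [Endpt.left (f (Symb.atom 0)), Endpt.left (f (Symb.atom 1))] ++ u ++
    [Endpt.right n, Endpt.left (f (Symb.atom 2)), Endpt.right (f (Symb.atom 0)),
      Endpt.right (f (Symb.atom 1)), Endpt.right (f (Symb.atom 2))]

/-- The whiskers on the four levels. -/
def levelSymb (i j k : Bool) : ℕ → Symb → Symb
  | 1, a => Symb.glob (Symb.loc 0 (Symb.loc i.toNat (Symb.loc j.toNat (Symb.loc k.toNat a))))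
  | 2, a => Symb.glob (Symb.loc 0 (Symb.loc i.toNat (Symb.loc j.toNat (Symb.glob a))))
  | 3, a => Symb.glob (Symb.loc 0 (Symb.loc i.toNat (Symb.glob a)))
  | 4, a => Symb.glob (Symb.loc 0 (Symb.glob a))
  | _, a => Symb.glob (Symb.glob a)

/-- The numeric segments at a leaf. -/
def numSymb (i j k h : Bool) : ℕ → Symb
  | 1 => levelSymb i j k 1 (Symb.atom (h.toNat + 3))
  | 2 => levelSymb i j k 2 (Symb.atom (2 * k.toNat + h.toNat + 3))
  | 3 => levelSymb i j k 3 (Symb.atom (4 * j.toNat + 2 * k.toNat + h.toNat + 3))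
  | 4 => levelSymb i j k 4 (Symb.atom (8 * i.toNat + 4 * j.toNat + 2 * k.toNat + h.toNat + 3))
  | _ => levelSymb i j k 5 (Symb.atom (8 * i.toNat + 4 * j.toNat + 2 * k.toNat + h.toNat + 1))

/-- The copy of `Y` at a leaf. -/
def leafSymb (i j k h : Bool) (n : ℕ) : Symb :=
  Symb.loc (8 * i.toNat + 4 * j.toNat + 2 * k.toNat + h.toNat) (Symb.atom n)

/-- The endpoints at a leaf, together with the whiskers above it. -/
def leafWord (i j k h : Bool) : List Endpt :=
  whiskerWrap i (levelSymb i j k 4) (numSymb i j k h 4)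
    (whiskerWrap j (levelSymb i j k 3) (numSymb i j k h 3)
      (whiskerWrap k (levelSymb i j k 2) (numSymb i j k h 2)
        (whiskerWrap h (levelSymb i j k 1) (numSymb i j k h 1)
          [Endpt.left (leafSymb i j k h 0), Endpt.left (leafSymb i j k h 1),
            Endpt.left (numSymb i j k h 1), Endpt.left (numSymb i j k h 2),
            Endpt.left (leafSymb i j k h 2), Endpt.right (leafSymb i j k h 0),
            Endpt.left (numSymb i j k h 3), Endpt.left (numSymb i j k h 4),
            Endpt.right (leafSymb i j k h 1), Endpt.right (leafSymb i j k h 2),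
            Endpt.left (numSymb i j k h 5)]))) ++ [Endpt.right (numSymb i j k h 5)]
theorem leafWord_sublist : ∀ i j k h, (leafWord i j k h).Sublist (endpointWord configX.pieces) := by
  have H : ∀ i j k h, (leafWord i j k h).isSublist (endpointWord configX.pieces) = true := by
    decide +kernel
  exact fun i j k h => List.isSublist_iff_sublist.1 (H i j k h)

theorem concave_mem_configX : ∀ i j k h,
    [numSymb i j k h 1, numSymb i j k h 2, numSymb i j k h 3, numSymb i j k h 4,
      numSymb i j k h 5] ∈ configX.concave ∧
    [leafSymb i j k h 0, leafSymb i j k h 1, leafSymb i j k h 2] ∈ configX.concave ∧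
    ∀ n ∈ [1, 2, 3, 4], [levelSymb i j k n (Symb.atom 0), levelSymb i j k n (Symb.atom 1),
      levelSymb i j k n (Symb.atom 2)] ∈ configX.concave := by
  decide +kernel

theorem mem_whiskerWrap {i : Bool} {f : Symb → Symb} {n : Symb} {u : List Endpt} {e : Endpt}
    (h : e ∈ u) : e ∈ whiskerWrap i f n u := by
  cases i <;> simp [whiskerWrap, h]

/-- The half of the whisker which is short compared with what follows. -/
def ShortHalf (L R : Symb → ℝ) (f : Symb → Symb) (i : Bool) : Prop :=
  if i then R (f (Symb.atom 1)) - R (f (Symb.atom 0)) < R (f (Symb.atom 2)) - R (f (Symb.atom 1))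
  else L (f (Symb.atom 2)) - L (f (Symb.atom 1)) ≤ R (f (Symb.atom 2)) - L (f (Symb.atom 2))

/-- From `e` to `R n` one stays inside the chosen half, which is shorter than the stretch from the
end of this half to `R_c`. -/
theorem whiskerWrap_gap {L R : Symb → ℝ} {f : Symb → Symb} {i : Bool} {n : Symb} {u : List Endpt}
    (h : ((whiskerWrap i f n u).map (Endpt.time L R)).Pairwise (· < ·)) (hi : ShortHalf L R f i) :
    (u.map (Endpt.time L R)).Pairwise (· < ·) ∧ (∀ e ∈ u, e.time L R < R n) ∧
      (∀ e ∈ u, 2 * (R n - e.time L R) < R (f (Symb.atom 2)) - e.time L R) := by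
  cases i
  · simp only [whiskerWrap, ShortHalf, Bool.false_eq_true, if_false, List.map_append] at h hi
    obtain ⟨h1, h2, h3⟩ := List.pairwise_append.1 h
    obtain ⟨h4, h5, h6⟩ := List.pairwise_append.1 h1
    simp only [List.map_cons, List.map_nil, Endpt.time, List.pairwise_cons, List.mem_cons,
      List.mem_append, List.mem_map, List.not_mem_nil, or_false, forall_eq_or_imp,
      forall_eq, forall_exists_index, and_imp, forall_apply_eq_imp_iff₂] at h2 h3 h6
    have hn : ∀ e ∈ u, e.time L R < R n := fun e he => (h3 _ (Or.inr ⟨e, he, rfl⟩)).1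
    refine ⟨h5, hn, fun e he => ?_⟩
    have := hn e he
    have : L (f (Symb.atom 1)) < e.time L R := h6.2 e he
    have := h2.1.1
    linarith
  · simp only [whiskerWrap, ShortHalf, if_true, List.map_append] at h hi
    obtain ⟨h1, h2, h3⟩ := List.pairwise_append.1 h
    obtain ⟨h4, h5, h6⟩ := List.pairwise_append.1 h1
    simp only [List.map_cons, List.map_nil, Endpt.time, List.pairwise_cons, List.mem_cons,
      List.mem_append, List.mem_map, List.not_mem_nil, or_false, forall_eq_or_imp,
      forall_eq, forall_exists_index, and_imp, forall_apply_eq_imp_iff₂] at h2 h3 h6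
    have hn : ∀ e ∈ u, e.time L R < R n := fun e he => (h3 _ (Or.inr ⟨e, he, rfl⟩)).1
    refine ⟨h5, hn, fun e he => ?_⟩
    have := hn e he
    have : R (f (Symb.atom 0)) < e.time L R := h6.2.2.2 e he
    have := h2.1.1
    linarith

theorem exists_shortHalf {L R : Symb → ℝ} {f : Symb → Symb}
    (h : [L (f (Symb.atom 0)), L (f (Symb.atom 1)), L (f (Symb.atom 2)), R (f (Symb.atom 0)),
      R (f (Symb.atom 1)), R (f (Symb.atom 2))].Pairwise (· < ·))
    (hf : ConcaveRatio L R (f (Symb.atom 0)) (f (Symb.atom 1)) (f (Symb.atom 2))) :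
    ∃ i, ShortHalf L R f i := by
  simp only [List.pairwise_cons, List.mem_cons, List.not_mem_nil, or_false, forall_eq_or_imp,
    forall_eq, List.Pairwise.nil, and_true, IsEmpty.forall_iff, implies_true] at h
  obtain ⟨⟨h1, -⟩, -, ⟨h3, -⟩, ⟨h4, -⟩, h5⟩ := h
  rcases whisker_gaps h1 h3 h4 h5 hf with h6 | h6
  · exact ⟨false, by simpa [ShortHalf] using h6⟩
  · exact ⟨true, by simpa [ShortHalf] using h6⟩

/-- With `H_n = 1 / (r_n - l1)`, each `H_{n+1}` is less than half of `H_n`. By `gap_ratio`, the gaps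
after `l2` sum to less than `l2 - l1`, and `l5 - l4 < l4 - l3`. Since `e1 < l1 < l2 < f1`, `d2 < l3
< l4 < e2` and `f2 < l5`, both alternatives of `whisker_gaps` for `d, e, f` fail. -/
theorem leaf_contradiction {d1 d2 e1 e2 f1 f2 l1 l2 l3 l4 l5 r1 r2 r3 r4 r5 : ℝ}
    (hY : [d1, e1, l1, l2, f1, d2, l3, l4, e2, f2, l5].Pairwise (· < ·)) (hlr : l5 < r1)
    (h1 : 2 * (r1 - l1) < r2 - l1) (h2 : 2 * (r2 - l1) < r3 - l1) (h3 : 2 * (r3 - l1) < r4 - l1)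
    (h4 : 2 * (r4 - l1) < r5 - l1)
    (h123 : (l3 - l2) * (r3 - l2) * ((r2 - l1) * (r2 - r1)) <
      (l2 - l1) * (r1 - l2) * ((r2 - l3) * (r3 - r2)))
    (h234 : (l4 - l3) * (r4 - l3) * ((r3 - l2) * (r3 - r2)) <
      (l3 - l2) * (r2 - l3) * ((r3 - l4) * (r4 - r3)))
    (h345 : (l5 - l4) * (r5 - l4) * ((r4 - l3) * (r4 - r3)) <
      (l4 - l3) * (r3 - l4) * ((r4 - l5) * (r5 - r4)))
    (hdef : (f1 - e1) * (f2 - e1) * ((e2 - d1) * (e2 - d2)) <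
      (e1 - d1) * (d2 - e1) * ((e2 - f1) * (f2 - e2))) : False := by
  have hch : [d1, e1, l1, l2, f1, d2, l3, l4, e2, f2, l5].IsChain (· < ·) :=
    List.isChain_iff_pairwise.2 hY
  simp only [List.isChain_cons_cons, List.isChain_singleton, and_true] at hch
  obtain ⟨t1, t2, t3, t4, t5, t6, t7, t8, t9, t10⟩ := hch
  have half : ∀ {x y : ℝ}, 0 < x → 2 * x < y → 0 < 1 / y ∧ 2 * (1 / y) < 1 / x := fun {x y} hx hxy => by
    have hy : 0 < y := by linarith
    refine ⟨by positivity, ?_⟩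
    rw [mul_one_div, div_lt_div_iff₀ hy hx]
    linarith
  have k1 := half (by linarith) h1
  have k2 := half (by linarith) h2
  have k3 := half (by linarith) h3
  have k4 := half (by linarith) h4
  have g1 := gap_ratio le_rfl (by linarith) (by linarith) (by linarith) (by linarith) (by linarith)
    h123
  have g2 := gap_ratio (l := l1) (by linarith) (by linarith) (by linarith) (by linarith)
    (by linarith) (by linarith) h234
  have g3 := gap_ratio (l := l1) (by linarith) (by linarith) (by linarith) (by linarith)
    (by linarith) (by linarith) h345
  generalize 1 / (r1 - l1) = H1 at *
  generalize 1 / (r2 - l1) = H2 at *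
  generalize 1 / (r3 - l1) = H3 at *
  generalize 1 / (r4 - l1) = H4 at *
  generalize 1 / (r5 - l1) = H5 at *
  have D1 : 0 < H1 - H2 := by linarith
  have D2 : 0 < H2 - H3 := by linarith
  have D3 : 0 < H3 - H4 := by linarith
  have chain : ∀ {x y z u v w : ℝ}, 0 < u → 0 < v → 0 < w → y * u < x * v → z * v < y * w →
      z * u < x * w := fun {x y z u v w} hu hv hw h h' => by
    refine lt_of_mul_lt_mul_right ?_ hv.le
    have e1 := mul_lt_mul_of_pos_right h hw
    have e2 := mul_lt_mul_of_pos_right h' hu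
    linarith
  have g4 := chain D1 D2 D3 g1 g2
  have g5 := chain D1 D3 (by linarith) g4 g3
  have s1 : l5 - l4 < l4 - l3 := by
    refine lt_of_mul_lt_mul_right (g3.trans ?_) D3.le
    exact mul_lt_mul_of_pos_left (by linarith) (by linarith)
  -- The three bounds `g1`, `g4`, `g5` add up to a telescoping sum, `(l5 - l2) (H1 - H2) < (l2 - l1)
  -- (H2 - H5)`.
  have s2 : l5 - l2 < l2 - l1 := by
    refine lt_of_mul_lt_mul_right (a := H1 - H2) ?_ D1.le
    have := mul_lt_mul_of_pos_left (show H2 - H5 < H1 - H2 by linarith)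
      (show 0 < l2 - l1 by linarith)
    linarith
  rcases whisker_gaps (by linarith) (by linarith) (by linarith) (by linarith) hdef with h | h <;>
    linarith

theorem configX_not_concave {L R : Symb → ℝ}
    (hlt : ((endpointWord configX.pieces).map (Endpt.time L R)).Pairwise (· < ·))
    (hc : ∀ g ∈ configX.concave, ∀ a b c, List.IsInfix [a, b, c] g → ConcaveRatio L R a b c) :
    False := by
  have hsub : ∀ i j k h, ((leafWord i j k h).map (Endpt.time L R)).Pairwise (· < ·) :=
    fun i j k h => hlt.sublist ((leafWord_sublist i j k h).map _)
  have hlev : ∀ i j k, ∀ n ∈ [1, 2, 3, 4], ∃ i', ShortHalf L R (levelSymb i j k n) i' := by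
    intro i j k n hn
    refine exists_shortHalf ?_ (hc _ ((concave_mem_configX i j k false).2.2 n hn) _ _ _
      (List.infix_refl _))
    have hs : ([Endpt.left (levelSymb i j k n (Symb.atom 0)),
        Endpt.left (levelSymb i j k n (Symb.atom 1)), Endpt.left (levelSymb i j k n (Symb.atom 2)),
        Endpt.right (levelSymb i j k n (Symb.atom 0)), Endpt.right (levelSymb i j k n (Symb.atom 1)),
        Endpt.right (levelSymb i j k n (Symb.atom 2))]).Sublist (leafWord i j k false) := by
      revert i j k n
      decide +kernel
    exact (hsub i j k false).sublist (hs.map (Endpt.time L R))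
  -- The choices go from the outermost whisker inwards: the whisker of level 4 is the same for all
  -- leaves, and each choice determines which whisker of the next level is relevant. The `false`
  -- arguments are placeholders.
  obtain ⟨i, hi⟩ := hlev false false false 4 (by simp)
  obtain ⟨j, hj⟩ := hlev i false false 3 (by simp)
  obtain ⟨k, hk⟩ := hlev i j false 2 (by simp)
  obtain ⟨h, hh⟩ := hlev i j k 1 (by simp)
  have hs := hsub i j k h
  obtain ⟨hn, hd, hw⟩ := concave_mem_configX i j k h
  rw [leafWord, List.map_append] at hs
  obtain ⟨s4, -, t5⟩ := List.pairwise_append.1 hs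
  obtain ⟨s3, t4, u4⟩ := whiskerWrap_gap s4 hi
  obtain ⟨s2, t3, u3⟩ := whiskerWrap_gap s3 hj
  obtain ⟨s1, t2, u2⟩ := whiskerWrap_gap s2 hk
  obtain ⟨s0, t1, u1⟩ := whiskerWrap_gap s1 hh
  have hlast : ∀ (i : Bool) (f : Symb → Symb) (n : Symb) (u : List Endpt),
      Endpt.right (f (Symb.atom 2)) ∈ whiskerWrap i f n u := fun i f n u => by
    cases i <;> simp [whiskerWrap]
  have v1 := u1 (Endpt.left (numSymb i j k h 1)) (by simp)
  have v2 := u2 (Endpt.left (numSymb i j k h 1)) (mem_whiskerWrap (by simp))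
  have v3 := u3 (Endpt.left (numSymb i j k h 1)) (mem_whiskerWrap (mem_whiskerWrap (by simp)))
  have v4 := u4 (Endpt.left (numSymb i j k h 1))
    (mem_whiskerWrap (mem_whiskerWrap (mem_whiskerWrap (by simp))))
  have w1 := t2 _ (hlast h _ _ _)
  have w2 := t3 _ (hlast k _ _ _)
  have w3 := t4 _ (hlast j _ _ _)
  have w4 := t5 _ (List.mem_map_of_mem (hlast i _ _ _)) (R (numSymb i j k h 5)) (by simp [Endpt.time])
  have x5 := t1 (Endpt.left (numSymb i j k h 5)) (by simp)
  exact leaf_contradiction s0 x5 (v1.trans (sub_lt_sub_right w1 _))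
    (v2.trans (sub_lt_sub_right w2 _)) (v3.trans (sub_lt_sub_right w3 _))
    (v4.trans (sub_lt_sub_right w4 _)) (hc _ hn _ _ _ ⟨[], _, rfl⟩) (hc _ hn _ _ _ ⟨[_], _, rfl⟩)
    (hc _ hn _ _ _ ⟨[_, _], [], rfl⟩) (hc _ hd _ _ _ (List.infix_refl _))


/-! ## Parabolas and circles -/

theorem not_realizes_configX {C : Set (ℝ × ℝ)} {c₀ : Option (ℝ × ℝ)} {γ : ℝ → ℝ × ℝ}
    (hC : IsConvexCurve C c₀ γ) {N M U : ℝ × ℝ → ℝ} (h : ConicChart C γ N M U)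
    (seg : Symb → PlaneLine) : ¬ Realizes C γ seg configX := by
  rintro ⟨l, r, hends, hlt, hconc⟩
  refine configX_not_concave (L := fun x => N (γ (l x)) / M (γ (l x)))
    (R := fun x => N (γ (r x)) / M (γ (r x))) ?_ fun g hg a b c habc => ?_
  · have : (endpointWord configX.pieces).map (Endpt.time (fun x => N (γ (l x)) / M (γ (l x)))
        (fun x => N (γ (r x)) / M (γ (r x)))) =
        ((endpointWord configX.pieces).map (Endpt.time l r)).map fun t => N (γ t) / M (γ t) := by
      rw [List.map_map]
      refine List.map_congr_left fun e _ => ?_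
      cases e <;> rfl
    rw [this]
    exact List.pairwise_map.2 (hlt.imp fun hst => h.strictMono hst)
  · obtain ⟨h1, h2⟩ := hconc g hg
    obtain ⟨p, hp, q, hq, hpq⟩ := h2 a b c habc
    have hseg : ∀ x ∈ [a, b, c], HasEndTimes γ (seg x) (l x) (r x) := fun x hx =>
      hends x (complete_configX.left_mem g hg x (habc.subset hx))
    have hsub : ([a, b, c].map l ++ [a, b, c].map r).Sublist (g.map l ++ g.map r) :=
      (habc.sublist.map l).append (habc.sublist.map r)
    exact h.concaveRatio hC.injective_param (hseg a (by simp)) (hseg b (by simp))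
      (hseg c (by simp)) (h1.sublist hsub) hp hq hpq

theorem neverContains_of_forces {C : Set (ℝ × ℝ)} {u : List Symb} (hu : Forces u configX)
    (hC : ∀ c₀ γ, IsConvexCurve C c₀ γ → ∃ N M U, ConicChart C γ N M U) : NeverContains C u := by
  intro c₀ γ hcurve n ℓ hA S hS hcon
  obtain ⟨N, M, U, h⟩ := hC c₀ γ hcurve
  obtain ⟨φ, hφ⟩ := hu.2 C c₀ γ hcurve n ℓ hA S hS hcon
  exact not_realizes_configX hcurve h _ hφ

theorem not_isCompact_parabola : ¬ IsCompact parabola := by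
  intro h
  obtain ⟨B, hB⟩ := (h.image continuous_fst).bddAbove
  have h1 : B + 1 ∈ Prod.fst '' parabola := ⟨(B + 1, (B + 1) ^ 2), rfl, rfl⟩
  have := hB h1
  linarith

theorem exists_conicChart_parabola (c₀ : Option (ℝ × ℝ)) (γ : ℝ → ℝ × ℝ)
    (hC : IsConvexCurve parabola c₀ γ) : ∃ N M U, ConicChart parabola γ N M U := by
  have hnone : c₀ = none := by
    cases hc : c₀ with
    | none => rfl
    | some c => exact absurd (hC.closed_case c hc).2.1 not_isCompact_parabola
  refine ⟨Prod.fst, fun _ => 1, Prod.snd, ⟨?_, fun t => ?_, fun t => one_pos,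
    fun p _ => zero_le_one, ?_⟩⟩
  · simp
  · have : (γ t).2 = (γ t).1 ^ 2 := hC.mem_curve t
    rw [this, one_mul]
  · simpa using (hC.unbounded_case hnone).2.1

/-- Projection from the top point sends the circle to a parabola: `M` is the distance below the
tangent at the top, and `N / M` is the stereographic coordinate, which increases counterclockwise.
-/
theorem exists_conicChart_planeCircle {z : ℝ × ℝ} {ρ : ℝ} (hρ : 0 < ρ) (c₀ : Option (ℝ × ℝ))
    (γ : ℝ → ℝ × ℝ) (hC : IsConvexCurve (planeCircle z ρ) c₀ γ) :
    ∃ N M U, ConicChart (planeCircle z ρ) γ N M U := by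
  have hle : ∀ p ∈ planeCircle z ρ, p.2 ≤ z.2 + ρ := by
    intro p hp
    have hp' : (p.1 - z.1) ^ 2 + (p.2 - z.2) ^ 2 = ρ ^ 2 := hp
    have := abs_le_of_sq_le_sq' (show (p.2 - z.2) ^ 2 ≤ ρ ^ 2 by linarith [sq_nonneg (p.1 - z.1)])
      hρ.le
    linarith [this.2]
  have hleK : ∀ p ∈ convexHull ℝ (planeCircle z ρ), p.2 ≤ z.2 + ρ := by
    have hconv : Convex ℝ {p : ℝ × ℝ | p.2 ≤ z.2 + ρ} :=
      (convex_Iic (z.2 + ρ)).linear_preimage (LinearMap.snd ℝ ℝ ℝ)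
    exact convexHull_min hle hconv
  cases hc : c₀ with
  | none =>
    have hup := (hC.unbounded_case hc).2.2 _ (hC.mem_hull 0) (max (γ 0).2 (z.2 + ρ + 1))
      (le_max_left _ _)
    have h1 := hleK _ hup
    have := le_max_right (γ 0).2 (z.2 + ρ + 1)
    dsimp only at h1
    linarith
  | some c =>
    obtain ⟨hrange, -, hcC, htop⟩ := hC.closed_case c hc
    have hcC' : (c.1 - z.1) ^ 2 + (c.2 - z.2) ^ 2 = ρ ^ 2 := hcC
    have hc2 : c.2 = z.2 + ρ := le_antisymm (hle c hcC)
      (htop (z.1, z.2 + ρ) (by simp [planeCircle]))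
    have hc1 : c.1 = z.1 := by
      rw [hc2] at hcC'
      have : (c.1 - z.1) ^ 2 = 0 := by linarith
      linarith [pow_eq_zero_iff (two_ne_zero) |>.1 this]
    have hcirc : ∀ t, ((γ t).1 - z.1) ^ 2 + ((γ t).2 - z.2) ^ 2 = ρ ^ 2 := hC.mem_curve
    have hpos : ∀ t, 0 < z.2 + ρ - (γ t).2 := by
      intro t
      refine lt_of_le_of_ne (by linarith [hle _ (hC.mem_curve t)]) fun h0 => ?_
      have h2 : (γ t).2 = z.2 + ρ := by linarith
      have h1 := hcirc t
      rw [h2] at h1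
      have h3 : ((γ t).1 - z.1) ^ 2 = 0 := by linarith
      have h4 := pow_eq_zero_iff (two_ne_zero) |>.1 h3
      have hγc : γ t = c := Prod.ext (by linarith) (by linarith)
      have : γ t ∈ planeCircle z ρ \ {c} := hrange ▸ Set.mem_range_self t
      exact this.2 hγc
    refine ⟨fun p => p.1 - z.1, fun p => z.2 + ρ - p.2, fun p => 2 * ρ - (z.2 + ρ - p.2),
      ⟨?_, fun t => ?_, hpos, fun p hp => by linarith [hleK p hp], ?_⟩⟩
    · simp only [List.mem_cons, List.not_mem_nil, or_false, forall_eq_or_imp, forall_eq,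
        Prod.fst_add, Prod.snd_add, Prod.smul_fst, Prod.smul_snd, smul_eq_mul]
      refine ⟨?_, ?_, ?_⟩ <;> intros <;> ring
    · linear_combination hcirc t
    · intro s t hst
      have hs := hpos s
      have ht := hpos t
      have ho := hC.orient_top_nonneg hc hst
      rw [orient_eq, hc1, hc2] at ho
      dsimp only
      rw [div_lt_div_iff₀ hs ht]
      -- The orientation with the top point gives only the weak inequality. In case of equality both
      -- points are on one line through the top, which meets the circle in just one other point.
      refine lt_of_le_of_ne (by linarith) fun heq => hC.injective_param.ne hst.ne ?_
      have es := hcirc s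
      have et := hcirc t
      set a := (γ s).1 - z.1 with ha
      set b := (γ t).1 - z.1 with hb
      set m := z.2 + ρ - (γ s).2 with hm
      set n := z.2 + ρ - (γ t).2 with hn
      have e1 : a ^ 2 + m ^ 2 = 2 * ρ * m := by rw [hm]; linear_combination es
      have e2 : b ^ 2 + n ^ 2 = 2 * ρ * n := by rw [hn]; linear_combination et
      have e3 : 2 * ρ * m * n * (n - m) = 0 := by
        linear_combination (-n ^ 2) * e1 + m ^ 2 * e2 + (a * n + b * m) * heq
      have e4 : n = m := by
        rcases mul_eq_zero.1 e3 with h0 | h0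
        · exact absurd h0 (by positivity)
        · linarith
      have e5 : a = b := by
        rw [e4] at heq
        exact mul_right_cancel₀ hs.ne' heq
      exact Prod.ext (by linarith) (by linarith)

/-! ### Conclusion -/

theorem mainTheorem4 :
    ∃ m : ℕ, 1 ≤ m ∧
      Forces (word (hartSharir 7 m)) configX ∧
      NeverContains parabola (word (hartSharir 7 m)) ∧
      ∀ (z : ℝ × ℝ) (ρ : ℝ), 0 < ρ →
        NeverContains (planeCircle z ρ) (word (hartSharir 7 m)) := by
  obtain ⟨m, φ, hm, h⟩ := exists_configX
  have hF : Forces (word (hartSharir 7 m)) configX :=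
    forces_of_timed complete_configX.right_mem complete_configX.left_mem h
  exact ⟨m, hm, hF, neverContains_of_forces hF exists_conicChart_parabola,
    fun z ρ hρ => neverContains_of_forces hF (exists_conicChart_planeCircle hρ)⟩
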